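/- Let $d\ge 2$, $k\ge 1$, $n$ be integers and let $\rho_v,\rho_e,\kappa,\delta,\lambda_1,\lambda_2>0$. There is a constant $C>0$, depending only on these data, with the following property. Let $\Omega\subset\mathbb R^d$ be a bounded open polytopal set with a finite face-to-face partition $\mathcal T_h$ into open convex polytopes: the elements are pairwise disjoint, $\Omega$ is the interior of the union of their closures, and every (flat, $(d-1)$-dimensional) face of an element either lies on $\partial\Omega$ or is also a face of another element. Let $h_T=\operatorname{diam}T$, $h_e=\operatorname{diam}e$, $h=\max_T h_T$, and assume that $\mathcal T_h$ is shape regular: every element $T$ has at most $n$ faces, $|T|\ge\rho_v h_T^d$, every face $e$ of $T$ satisfies $|e|\ge\rho_e h_e^{d-1}$ and $h_e\ge\kappa h_T$, and the unit outward normals of any two different faces $e\neq e'$ of $T$ satisfy $\mathbf n_e\cdot\mathbf n_{e'}\le 1-\delta$. Let $a$ be a symmetric $d\times d$ matrix-valued function on $\Omega$, constant on each $T\in\mathcal T_h$, with $\lambda_1\xi^t\xi\le\xi^ta\xi\le\lambda_2\xi^t\xi$ for all $\xi\in\mathbb R^d$. Let $f\in L^2(\Omega)$ and let $u\in H^1(\Omega)$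 be a weak solution of $-\nabla\cdot(a\nabla u)=f$ in $\Omega$, $u=g$ on $\partial\Omega$ (in the sense of traces). Put $j=n+k-1$. Let $V_h$ be the space of all $v=\{v_0,v_b\}$ with $v_0|_T\in P_k(T)$ for each $T\in\mathcal T_h$ and $v_b|_e\in P_{k-1}(e)$ (single valued) for each face $e$, and let $V_h^0=\{v\in V_h: v_b=0 \text{ on }\partial\Omega\}$. Let $Q_0$ and $Q_b$ be the $L^2$ projections onto $P_k(T)$ on each element and onto $P_{k-1}(e)$ on each face, and $Q_hu=\{Q_0u,Q_bu\}\in V_h$. For a weak function $v=\{v_0,v_b\}$ (a member of $V_h$; a function $v\in H^1(\Omega)$, for which $v_0=v$ and $v_b=v$; or a difference of such) the weak gradient $\nabla_wv$ is defined on each $T$ by $\nabla_wv|_T\in[P_j(T)]^d$ and $$(\nabla_wv,\mathbf q)_T=(\nabla v_0,\mathbf q)_T+\langle Q_b(v_b-v_0),\mathbf q\cdot\mathbf n\rangle_{\partial T}\qquad\forall\,\mathbf q\in[P_j(T)]^d ,$$ and $|||v|||^2=\sum_{T\in\mathcal T_h}(a\nabla_wv,\nabla_wv)_T$. Let $u_h=\{u_0,u_b\}\in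 V_h$ be the weak Galerkin solution, that is, $u_b=Q_bg$ on $\partial\Omega$ and $$\sum_{T\in\mathcal T_h}(a\nabla_wu_h,\nabla_wv)_T=(f,v_0)\qquad\forall\,v=\{v_0,v_b\}\in V_h^0 .$$ If $u\in H^{k+1}(\Omega)$, then $$|||u-u_h|||\le C\,h^k\,|u|_{k+1}\qquad\text{and}\qquad |||Q_hu-u_h|||\le C\,h^k\,|u|_{k+1},$$ where $|u|_{k+1}^2=\sum_{i_1,\dots,i_{k+1}=1}^d\|\partial_{i_1}\cdots\partial_{i_{k+1}}u\|_{L^2(\Omega)}^2$. -/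

import Mathlib

open MeasureTheory
open scoped ContDiff Topology

noncomputable section

namespace WG

/-- Euclidean space `ℝ^d`. -/
abbrev E (d : ℕ) : Type := EuclideanSpace ℝ (Fin d)

/-- The `l`-th coordinate vector of `ℝ^d`. -/
def unitVec {d : ℕ} (l : Fin d) : E d := EuclideanSpace.single l 1

/-- Surface measure (`(d-1)`-dimensional, normalized to agree with Lebesgue measure
on hyperplanes) restricted to the set `e`. -/
def surf {d : ℕ} (e : Set (E d)) : Measure (E d) := (μHE[d - 1] : Measure (E d)).restrict e

/-! ### Sobolev spaces through weak derivatives -/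

/-- `φ ∈ C_c^∞(Ω)`. -/
def IsTest {d : ℕ} (Ω : Set (E d)) (φ : E d → ℝ) : Prop :=
  ContDiff ℝ ∞ φ ∧ HasCompactSupport φ ∧ tsupport φ ⊆ Ω

/-- `w` is the weak derivative `∂_{s 0} ⋯ ∂_{s (m-1)} u` in `Ω`. -/
def IsWeakDeriv {d : ℕ} (Ω : Set (E d)) {m : ℕ} (s : Fin m → Fin d) (u w : E d → ℝ) : Prop :=
  ∀ φ : E d → ℝ, IsTest Ω φ →
    ∫ x in Ω, u x * iteratedFDeriv ℝ m φ x (fun r => unitVec (s r))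
      = (-1) ^ m * ∫ x in Ω, w x * φ x

/-- `u ∈ H^m(Ω)`: `u` and all its weak derivatives of order at most `m` are in `L²(Ω)`. -/
def MemSobolev {d : ℕ} (Ω : Set (E d)) (m : ℕ) (u : E d → ℝ) : Prop :=
  MemLp u 2 (volume.restrict Ω) ∧
    ∀ r : ℕ, r ≤ m → ∀ s : Fin r → Fin d,
      ∃ w : E d → ℝ, MemLp w 2 (volume.restrict Ω) ∧ IsWeakDeriv Ω s u w

/-- The square integrable weak derivative `∂_{s 0} ⋯ ∂_{s (m-1)} u` (unique almost everywhere). -/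
def weakDeriv {d : ℕ} (Ω : Set (E d)) {m : ℕ} (s : Fin m → Fin d) (u : E d → ℝ) : E d → ℝ :=
  Classical.epsilon fun w => MemLp w 2 (volume.restrict Ω) ∧ IsWeakDeriv Ω s u w

/-- The distributional gradient `∇u` of `u ∈ H¹(Ω)`. -/
def grad {d : ℕ} (Ω : Set (E d)) (u : E d → ℝ) (x : E d) : Fin d → ℝ :=
  fun l => weakDeriv Ω ![l] u x

/-- The seminorm `|u|_m` of `H^m(Ω)`: the square root of the sum of the squared `L²(Ω)` norms of
all derivatives of order exactly `m`. -/
def sobolevSeminorm {d : ℕ} (Ω : Set (E d)) (m : ℕ) (u : E d → ℝ) : ℝ :=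
  Real.sqrt (∑ s : Fin m → Fin d, ∫ x in Ω, (weakDeriv Ω s u x) ^ 2)

/-- `w` is the trace on `e ⊆ ∂T` of the restriction to `T` of `u ∈ H¹(Ω)`, `T ⊆ Ω`:
there are smooth functions converging to `u` in `H¹(T)` and to `w` in `L²(e)`. -/
def IsTrace {d : ℕ} (Ω T e : Set (E d)) (u w : E d → ℝ) : Prop :=
  MemLp w 2 (surf e) ∧
    ∃ φ : ℕ → E d → ℝ, (∀ m, ContDiff ℝ ∞ (φ m)) ∧
      Filter.Tendsto (fun m => eLpNorm (fun x => φ m x - u x) 2 (volume.restrict T))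
        Filter.atTop (𝓝 0) ∧
      (∀ l : Fin d, Filter.Tendsto
        (fun m => eLpNorm (fun x => fderiv ℝ (φ m) x (unitVec l) - grad Ω u x l) 2
          (volume.restrict T)) Filter.atTop (𝓝 0)) ∧
      Filter.Tendsto (fun m => eLpNorm (fun x => φ m x - w x) 2 (surf e)) Filter.atTop (𝓝 0)

/-! ### Polytopes and partitions -/

/-- A convex polytope with nonempty interior, given as a bounded intersection of half-spaces
`⟨ν_i, x⟩ < c_i` with unit outward normals `ν_i`, one for each of its faces
(edges if `d = 2`). -/
structure ConvexPolytope (d : ℕ) where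
  numFaces : ℕ
  normal : Fin numFaces → E d
  offset : Fin numFaces → ℝ
  norm_normal : ∀ i, ‖normal i‖ = 1
  normal_injective : Function.Injective normal
  nonempty : {x : E d | ∀ i, inner ℝ (normal i) x < offset i}.Nonempty
  bounded : Bornology.IsBounded {x : E d | ∀ i, inner ℝ (normal i) x < offset i}
  /-- No half-space is redundant: each one contributes a `(d-1)`-dimensional face. -/
  face_pos : ∀ i, 0 < (μHE[d - 1] : Measure (E d))
    {x : E d | inner ℝ (normal i) x = offset i ∧ ∀ l, inner ℝ (normal l) x ≤ offset l}

namespace ConvexPolytope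

variable {d : ℕ} (T : ConvexPolytope d)

/-- The open polytope. -/
def carrier : Set (E d) := {x | ∀ i, inner ℝ (T.normal i) x < T.offset i}

/-- The (closed, flat) faces. -/
def face (i : Fin T.numFaces) : Set (E d) :=
  {x | inner ℝ (T.normal i) x = T.offset i ∧ ∀ l, inner ℝ (T.normal l) x ≤ T.offset l}

/-- The size `h_T`. -/
def size : ℝ := Metric.diam T.carrier

end ConvexPolytope

/-- A finite face-to-face partition of `Ω` into convex polytopes. In particular `Ω` is a bounded
open polytopal set. -/
structure Mesh (d : ℕ) (Ω : Set (E d)) where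
  numElem : ℕ
  elem : Fin numElem → ConvexPolytope d
  disjoint : ∀ t t', t ≠ t' → Disjoint (elem t).carrier (elem t').carrier
  domain_eq : Ω = interior (⋃ t, closure (elem t).carrier)
  /-- Every face which is not on `∂Ω` is also a face of a neighbouring element. -/
  conforming : ∀ t i, ¬ (elem t).face i ⊆ frontier Ω →
    ∃ t', t' ≠ t ∧ ∃ i', (elem t').face i' = (elem t).face i

/-- Shape regularity of a partition, in which every element has at most `n` faces. -/
structure ShapeRegular {d : ℕ} {Ω : Set (E d)} (M : Mesh d Ω) (n : ℕ) (ρv ρe κ δ : ℝ) : Prop where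
  numFaces_le : ∀ t, (M.elem t).numFaces ≤ n
  volume_ge : ∀ t, ρv * (M.elem t).size ^ d ≤ (volume (M.elem t).carrier).toReal
  face_ge : ∀ t i, ρe * Metric.diam ((M.elem t).face i) ^ (d - 1)
    ≤ ((μHE[d - 1] : Measure (E d)) ((M.elem t).face i)).toReal
  diam_face_ge : ∀ t i, κ * (M.elem t).size ≤ Metric.diam ((M.elem t).face i)
  /-- Interior angles between faces stay away from `π`: different faces of an element do not
  become coplanar. -/
  angle : ∀ t i i', i ≠ i' →
    inner ℝ ((M.elem t).normal i) ((M.elem t).normal i') ≤ 1 - δ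

/-! ### The weak Galerkin method -/

/-- Polynomials in `d` variables, and their values at points of `ℝ^d`. -/
abbrev Poly (d : ℕ) : Type := MvPolynomial (Fin d) ℝ

/-- The value of a polynomial at a point. -/
def ev {d : ℕ} (p : Poly d) (x : E d) : ℝ := MvPolynomial.eval (fun l => x l) p

/-- The value of a vector valued polynomial at a point. -/
def evVec {d : ℕ} (q : Fin d → Poly d) (x : E d) : Fin d → ℝ := fun l => ev (q l) x

/-- The `L²(μ)` projection of `f` onto the polynomials of degree at most `m`, where `μ` is the
volume measure of an element or the surface measure of a face
(in the latter case only the values on the face are unique). -/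
def l2Proj {d : ℕ} (μ : Measure (E d)) (m : ℕ) (f : E d → ℝ) :
    {p : Poly d // p.totalDegree ≤ m} :=
  haveI : Nonempty {p : Poly d // p.totalDegree ≤ m} := ⟨⟨0, by simp⟩⟩
  Classical.epsilon fun p : {p : Poly d // p.totalDegree ≤ m} =>
    ∀ q : Poly d, q.totalDegree ≤ m → ∫ x, ev p.1 x * ev q x ∂μ = ∫ x, f x * ev q x ∂μ

namespace Mesh

variable {d : ℕ} {Ω : Set (E d)} (M : Mesh d Ω)

/-- The mesh size `h = max_T h_T`. -/
def meshSize : ℝ := ⨆ t, (M.elem t).size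

/-- The set `𝓔_h` of all faces. -/
def Face : Type := {e : Set (E d) // ∃ t i, (M.elem t).face i = e}

/-- The `i`-th face of the element `t`, as a member of `𝓔_h`. -/
def faceOf (t : Fin M.numElem) (i : Fin (M.elem t).numFaces) : M.Face :=
  ⟨(M.elem t).face i, t, i, rfl⟩

/-- The face is part of `∂Ω`. -/
def IsBoundaryFace (e : M.Face) : Prop := e.1 ⊆ frontier Ω

/-- The trace of `u ∈ H¹(Ω)` on a face, which is the same from all elements with that face. -/
def faceTrace (u : E d → ℝ) (e : M.Face) : E d → ℝ :=
  Classical.epsilon fun w => ∀ t i, (M.elem t).face i = e.1 →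
    IsTrace Ω (M.elem t).carrier e.1 u w

/-- Weak functions `v = {v_0, v_b}` with `v_0` in `H¹(T)` on each element `T`, recorded through what
enters the weak gradient: `∇v_0` on each element, the boundary values of `v_0` seen from each
element, and the function `v_b`, which is single valued on each face. -/
structure WeakFn where
  gradInt : Fin M.numElem → E d → Fin d → ℝ
  traceInt : (t : Fin M.numElem) → Fin (M.elem t).numFaces → E d → ℝ
  bdry : M.Face → E d → ℝ

instance : Sub M.WeakFn where
  sub v w :=
    { gradInt := fun t x => v.gradInt t x - w.gradInt t x
      traceInt := fun t i x => v.traceInt t i x - w.traceInt t i x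
      bdry := fun e x => v.bdry e x - w.bdry e x }

/-- The finite element space `V_h`: `v_0 ∈ P_k(T)` on each element, `v_b ∈ P_{k-1}(e)` on
each face. -/
structure Vh (k : ℕ) where
  int : Fin M.numElem → Poly d
  bdry : M.Face → Poly d
  int_degree : ∀ t, (int t).totalDegree ≤ k
  bdry_degree : ∀ e, (bdry e).totalDegree ≤ k - 1

/-- The subspace `V_h^0`: `v_b = 0` on `∂Ω`. -/
def MemVh0 {k : ℕ} (v : M.Vh k) : Prop :=
  ∀ e, M.IsBoundaryFace e → ∀ x ∈ e.1, ev (v.bdry e) x = 0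

/-- A member of `V_h` as a weak function. -/
def Vh.toWeakFn {M : Mesh d Ω} {k : ℕ} (v : M.Vh k) : M.WeakFn where
  gradInt t x := fun l => ev (MvPolynomial.pderiv l (v.int t)) x
  traceInt t _ x := ev (v.int t) x
  bdry e x := ev (v.bdry e) x

/-- A function `u ∈ H¹(Ω)` as a weak function: `v_0 = u` and `v_b = u`. -/
def ofSobolev (u : E d → ℝ) : M.WeakFn where
  gradInt _ x := grad Ω u x
  traceInt t i x := M.faceTrace u (M.faceOf t i) x
  bdry e x := M.faceTrace u e x

/-- `G ∈ [P_j(T)]^d` is the weak gradient of `v` on the element `T = t`: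
`(G, q)_T = (∇v_0, q)_T + ⟨Q_b (v_b - v_0), q · n⟩_{∂T}` for all `q ∈ [P_j(T)]^d`,
where `Q_b` projects onto `P_{k-1}(e)` on each face `e`. -/
def IsWeakGradient (k j : ℕ) (v : M.WeakFn) (t : Fin M.numElem) (G : Fin d → Poly d) : Prop :=
  (∀ l, (G l).totalDegree ≤ j) ∧
    ∀ q : Fin d → Poly d, (∀ l, (q l).totalDegree ≤ j) →
      ∫ x in (M.elem t).carrier, evVec G x ⬝ᵥ evVec q x
        = (∫ x in (M.elem t).carrier, v.gradInt t x ⬝ᵥ evVec q x)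
          + ∑ i, ∫ x, ev (l2Proj (surf ((M.elem t).face i)) (k - 1)
                (fun y => v.bdry (M.faceOf t i) y - v.traceInt t i y)).1 x
              * (evVec q x ⬝ᵥ fun l => (M.elem t).normal i l) ∂(surf ((M.elem t).face i))

/-- The weak gradient `∇_w v` on each element. -/
def weakGradient (k j : ℕ) (v : M.WeakFn) (t : Fin M.numElem) : Fin d → Poly d :=
  Classical.epsilon fun G => M.IsWeakGradient k j v t G

/-- The bilinear form `(a ∇_w v, ∇_w w)_{𝒯_h}`. -/
def form (a : E d → Matrix (Fin d) (Fin d) ℝ) (k j : ℕ) (v w : M.WeakFn) : ℝ :=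
  ∑ t, ∫ x in (M.elem t).carrier,
    (a x).mulVec (evVec (M.weakGradient k j v t) x) ⬝ᵥ evVec (M.weakGradient k j w t) x

/-- The energy norm `|||v||| = (a ∇_w v, ∇_w v)_{𝒯_h}^{1/2}`. -/
def energyNorm (a : E d → Matrix (Fin d) (Fin d) ℝ) (k j : ℕ) (v : M.WeakFn) : ℝ :=
  Real.sqrt (M.form a k j v v)

/-- `Q_h u = {Q_0 u, Q_b u} ∈ V_h`, the element by element and face by face `L²` projection of
`u ∈ H¹(Ω)`. -/
def Qh (k : ℕ) (u : E d → ℝ) : M.Vh k where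
  int t := (l2Proj (volume.restrict (M.elem t).carrier) k u).1
  bdry e := (l2Proj (surf e.1) (k - 1) (M.faceTrace u e)).1
  int_degree t := (l2Proj (volume.restrict (M.elem t).carrier) k u).2
  bdry_degree e := (l2Proj (surf e.1) (k - 1) (M.faceTrace u e)).2

/-- `u_h ∈ V_h` solves the weak Galerkin scheme: `u_b = Q_b g` on `∂Ω` and
`(a ∇_w u_h, ∇_w v)_{𝒯_h} = (f, v_0)` for all `v ∈ V_h^0`. -/
def IsWGSolution (a : E d → Matrix (Fin d) (Fin d) ℝ) (f g : E d → ℝ) {k : ℕ} (j : ℕ)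
    (uh : M.Vh k) : Prop :=
  (∀ e, M.IsBoundaryFace e → ∀ x ∈ e.1,
    ev (uh.bdry e) x = ev (l2Proj (surf e.1) (k - 1) g).1 x) ∧
  ∀ v : M.Vh k, M.MemVh0 v →
    M.form a k j uh.toWeakFn v.toWeakFn
      = ∑ t, ∫ x in (M.elem t).carrier, f x * ev (v.int t) x

/-- `u ∈ H¹(Ω)` is the weak solution of `-∇ · (a ∇u) = f` in `Ω`, `u = g` on `∂Ω`. -/
def IsExactSolution (a : E d → Matrix (Fin d) (Fin d) ℝ) (f g u : E d → ℝ) : Prop :=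
  MemSobolev Ω 1 u ∧
  (∀ φ : E d → ℝ, IsTest Ω φ →
    ∫ x in Ω, (a x).mulVec (grad Ω u x) ⬝ᵥ (fun l => fderiv ℝ φ x (unitVec l))
      = ∫ x in Ω, f x * φ x) ∧
  ∀ t i, (M.elem t).face i ⊆ frontier Ω →
    IsTrace Ω (M.elem t).carrier ((M.elem t).face i) u g

/-- The coefficient is constant on each element. -/
def IsPiecewiseConstant (a : E d → Matrix (Fin d) (Fin d) ℝ) : Prop :=
  ∀ t, ∃ A, ∀ x ∈ (M.elem t).carrier, a x = A

end Mesh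

/-- The coefficient is symmetric and satisfies `λ₁ ξᵗξ ≤ ξᵗ a ξ ≤ λ₂ ξᵗξ` in `Ω`. -/
def IsElliptic {d : ℕ} (Ω : Set (E d)) (lam₁ lam₂ : ℝ) (a : E d → Matrix (Fin d) (Fin d) ℝ) :
    Prop :=
  ∀ x ∈ Ω, (a x).IsSymm ∧ ∀ ξ : Fin d → ℝ,
    lam₁ * (ξ ⬝ᵥ ξ) ≤ ξ ⬝ᵥ (a x).mulVec ξ ∧ ξ ⬝ᵥ (a x).mulVec ξ ≤ lam₂ * (ξ ⬝ᵥ ξ)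

end WG

end

/-! Put `e = Q_h u - u_h`, a member of `V_h^0`. The proof rests on a stability property of the weak
gradient, a consistency identity, and the uniformity of all constants over shape regular elements.

Stability. No stabilizer is needed because weak gradients of degree `j = n + k - 1` see the jumps
`v_b - v_0`. For a face of `T` and a polynomial `φ` of degree at most `k - 1` there is a polynomial
`s` of degree at most `j` which vanishes on all other faces, is orthogonal on `T` to polynomials of
degree at most `k - 1`, and tests `φ` on the face with a nonnegative weight (`exists_face_test`). It
is built from the product of the scaled distances to the other faces. Testing the weak gradient with
`s` times the normal removes `∇v_0` and every other face, so `‖Q_b (v_b - v_0)‖` on the face is at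
most `C h^{1/2} ‖∇_w v‖` on `T`. Testing with `∇v_0` then bounds `∇v_0` (`exists_norm_equiv`), and
the Poincaré inequality bounds the unprojected jump (`exists_jump_le`).

Consistency. The weak gradient of `u` is the `L²` projection `P` of `∇u`. Green's formula, the
equation on each element, the continuity of `a∇u · n` across faces and `v_b = 0` on `∂Ω` show that
the form at `(e, v)` is a sum over elements of `(a(∇_w Q_h u - P), ∇_w v)` and of face terms
comparing `a P · n` against `Q_b (v_b - v_0)` with `a∇u · n` against `v_b - v_0` (`elemError_eq`,
`form_eq_sum_elemError`). Since `∇Q_0 u` has degree `k - 1`, the projection `Q_b` is invisible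
against it. The face terms therefore contain only the approximation errors of `P` and `∇u` by `∇Q_0
u`, of order `h^{k-1/2}`, times jumps of order `h^{1/2} ‖∇_w v‖` (`exists_elemError_le`). Taking `v
= e` and cancelling one factor of the energy norm proves the second estimate. The first one follows
because the weak gradients of `u - u_h` and `e` differ by `∇_w Q_h u - P`, which is already
estimated.

Uniformity. No reference element is available. Counting slabs shows that elements and their faces
contain balls of radius comparable to `h` (`exists_inball`, `exists_face_inball`); inverse
inequalities reduce to concentric balls, where scaling applies. The Poincaré constant of a convex
set depends only on `d` and the diameter, and it yields polynomial approximation by iteration. The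
divergence theorem comes from polar integration over cones, and traces come from mollification on
convex elements. Inside the proof `k` is replaced by `k + 1`. -/

namespace WG

/-! ### The `L²` norm as a real number -/

section L2

variable {X : Type*} [MeasurableSpace X] {μ : Measure X} {f g : X → ℝ}

/-- The `L²(μ)` norm of a square integrable function. -/
noncomputable def nrm (μ : Measure X) (f : X → ℝ) : ℝ := (eLpNorm f 2 μ).toReal

lemma nrm_nonneg (μ : Measure X) (f : X → ℝ) : 0 ≤ nrm μ f := ENNReal.toReal_nonneg

lemma integrable_mul_of_memLp (hf : MemLp f 2 μ) (hg : MemLp g 2 μ) :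
    Integrable (fun x => f x * g x) μ := hf.integrable_mul hg

lemma nrm_sq (hf : MemLp f 2 μ) : nrm μ f ^ 2 = ∫ x, f x ^ 2 ∂μ := by
  have h := hf.eLpNorm_eq_integral_rpow_norm (by norm_num) (by norm_num)
  have h0 : 0 ≤ ∫ x, f x ^ 2 ∂μ := integral_nonneg fun x => sq_nonneg _
  have h2 : ∀ x, ‖f x‖ ^ (ENNReal.toReal 2) = f x ^ 2 := by intro x; simp
  rw [nrm, h]
  simp only [h2]
  rw [ENNReal.toReal_ofReal (by positivity), ← Real.rpow_natCast, ← Real.rpow_mul h0]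
  norm_num

lemma nrm_eq_sqrt (hf : MemLp f 2 μ) : nrm μ f = Real.sqrt (∫ x, f x ^ 2 ∂μ) := by
  rw [← nrm_sq hf, Real.sqrt_sq (nrm_nonneg _ _)]

lemma nrm_add_le (hf : MemLp f 2 μ) (hg : MemLp g 2 μ) :
    nrm μ (fun x => f x + g x) ≤ nrm μ f + nrm μ g := by
  rw [nrm, nrm, nrm, ← ENNReal.toReal_add hf.2.ne hg.2.ne]
  exact ENNReal.toReal_mono (ENNReal.add_ne_top.2 ⟨hf.2.ne, hg.2.ne⟩)
    (eLpNorm_add_le hf.1 hg.1 (by norm_num))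

lemma nrm_sub_le (hf : MemLp f 2 μ) (hg : MemLp g 2 μ) :
    nrm μ (fun x => f x - g x) ≤ nrm μ f + nrm μ g := by
  rw [nrm, nrm, nrm, ← ENNReal.toReal_add hf.2.ne hg.2.ne]
  exact ENNReal.toReal_mono (ENNReal.add_ne_top.2 ⟨hf.2.ne, hg.2.ne⟩)
    (eLpNorm_sub_le hf.1 hg.1 (by norm_num))

lemma nrm_sub_comm (f g : X → ℝ) :
    nrm μ (fun x => f x - g x) = nrm μ (fun x => g x - f x) := by
  rw [nrm, nrm]
  exact congrArg _ (eLpNorm_sub_comm f g 2 μ)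

lemma nrm_const_mul (c : ℝ) (f : X → ℝ) : nrm μ (fun x => c * f x) = |c| * nrm μ f := by
  rw [nrm, nrm]
  have : (fun x => c * f x) = c • f := by ext; simp
  rw [this, eLpNorm_const_smul, ENNReal.toReal_mul]
  simp

lemma nrm_neg (f : X → ℝ) : nrm μ (fun x => - f x) = nrm μ f := by
  have := nrm_const_mul (μ := μ) (-1) f
  simpa using this

lemma nrm_zero : nrm μ (fun _ => (0 : ℝ)) = 0 := by simp [nrm]

lemma nrm_sum_le {ι : Type*} (s : Finset ι) {F : ι → X → ℝ} (hF : ∀ i ∈ s, MemLp (F i) 2 μ) :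
    nrm μ (fun x => ∑ i ∈ s, F i x) ≤ ∑ i ∈ s, nrm μ (F i) := by
  classical
  induction s using Finset.induction_on with
  | empty => simp [nrm_zero]
  | insert a s ha ih =>
    simp only [Finset.sum_insert ha]
    refine (nrm_add_le (hF a (by simp))
      (memLp_finsetSum s fun i hi => hF i (by simp [hi]))).trans ?_
    gcongr
    exact ih fun i hi => hF i (by simp [hi])

lemma nrm_congr_ae (h : f =ᵐ[μ] g) : nrm μ f = nrm μ g := by
  rw [nrm, nrm, eLpNorm_congr_ae h]

lemma nrm_mono_measure {ν : Measure X} (h : μ ≤ ν) (hf : MemLp f 2 ν) : nrm μ f ≤ nrm ν f :=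
  ENNReal.toReal_mono hf.2.ne (eLpNorm_mono_measure f h)

lemma nrm_mono (hg : MemLp g 2 μ) (h : ∀ᵐ x ∂μ, |f x| ≤ |g x|) : nrm μ f ≤ nrm μ g :=
  ENNReal.toReal_mono hg.2.ne (eLpNorm_mono_ae h)

lemma abs_integral_mul_le (hf : MemLp f 2 μ) (hg : MemLp g 2 μ) :
    |∫ x, f x * g x ∂μ| ≤ nrm μ f * nrm μ g := by
  have h1 := integral_mul_le_Lp_mul_Lq_of_nonneg (μ := μ) (f := fun x => |f x|)
    (g := fun x => |g x|) Real.HolderConjugate.two_two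
    (Filter.Eventually.of_forall fun x => abs_nonneg _)
    (Filter.Eventually.of_forall fun x => abs_nonneg _)
    (by simpa using hf.norm) (by simpa using hg.norm)
  have h2 : |∫ x, f x * g x ∂μ| ≤ ∫ x, |f x| * |g x| ∂μ := by
    refine (abs_integral_le_integral_abs).trans (le_of_eq ?_)
    simp [abs_mul]
  refine h2.trans (h1.trans (le_of_eq ?_))
  rw [nrm_eq_sqrt hf, nrm_eq_sqrt hg, Real.sqrt_eq_rpow, Real.sqrt_eq_rpow]
  simp

lemma nrm_le_of_sq_le {c : ℝ} (hc : 0 ≤ c) (hf : MemLp f 2 μ) (h : ∫ x, f x ^ 2 ∂μ ≤ c ^ 2) :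
    nrm μ f ≤ c := by
  rw [← nrm_sq hf] at h
  exact (sq_le_sq₀ (nrm_nonneg _ _) hc).1 h

lemma tendsto_nrm_zero {F : ℕ → X → ℝ}
    (h : Filter.Tendsto (fun m => eLpNorm (F m) 2 μ) Filter.atTop (𝓝 0)) :
    Filter.Tendsto (fun m => nrm μ (F m)) Filter.atTop (𝓝 0) :=
  (ENNReal.tendsto_toReal ENNReal.zero_ne_top).comp h

lemma nrm_le_add_sub (hf : MemLp f 2 μ) (hg : MemLp g 2 μ) :
    nrm μ f ≤ nrm μ (fun x => f x - g x) + nrm μ g := by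
  have h := nrm_add_le (f := fun x => f x - g x) (hf.sub hg) hg
  simpa only [sub_add_cancel] using h

lemma tendsto_nrm {F : ℕ → X → ℝ} (hF : ∀ m, MemLp (F m) 2 μ) (hf : MemLp f 2 μ)
    (h : Filter.Tendsto (fun m => eLpNorm (fun x => F m x - f x) 2 μ) Filter.atTop (𝓝 0)) :
    Filter.Tendsto (fun m => nrm μ (F m)) Filter.atTop (𝓝 (nrm μ f)) := by
  have h' := tendsto_nrm_zero h
  rw [tendsto_iff_dist_tendsto_zero]
  refine squeeze_zero (fun _ => dist_nonneg) (fun m => ?_) h'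
  rw [Real.dist_eq, abs_le]
  have h1 := nrm_le_add_sub (hF m) hf
  have h2 := nrm_le_add_sub hf (hF m)
  rw [nrm_sub_comm] at h2
  constructor <;> linarith

lemma tendsto_integral_mul {F : ℕ → X → ℝ} (hF : ∀ m, MemLp (F m) 2 μ) (hf : MemLp f 2 μ)
    (hg : MemLp g 2 μ)
    (h : Filter.Tendsto (fun m => eLpNorm (fun x => F m x - f x) 2 μ) Filter.atTop (𝓝 0)) :
    Filter.Tendsto (fun m => ∫ x, F m x * g x ∂μ) Filter.atTop (𝓝 (∫ x, f x * g x ∂μ)) := by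
  have h' : Filter.Tendsto (fun m => nrm μ (fun x => F m x - f x) * nrm μ g) Filter.atTop
      (𝓝 0) := by
    simpa using (tendsto_nrm_zero h).mul_const (nrm μ g)
  rw [tendsto_iff_dist_tendsto_zero]
  refine squeeze_zero (fun _ => dist_nonneg) (fun m => ?_) h'
  rw [Real.dist_eq, ← integral_sub (integrable_mul_of_memLp (hF m) hg)
    (integrable_mul_of_memLp hf hg)]
  simp only [← sub_mul]
  exact abs_integral_mul_le ((hF m).sub hf) hg

end L2

/-! ### Polynomials as functions -/

section Poly

variable {d : ℕ}

@[simp] lemma ev_add (p q : Poly d) (x : E d) : ev (p + q) x = ev p x + ev q x := by simp [ev]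
@[simp] lemma ev_sub (p q : Poly d) (x : E d) : ev (p - q) x = ev p x - ev q x := by simp [ev]
@[simp] lemma ev_mul (p q : Poly d) (x : E d) : ev (p * q) x = ev p x * ev q x := by simp [ev]
@[simp] lemma ev_zero (x : E d) : ev (0 : Poly d) x = 0 := by simp [ev]
@[simp] lemma ev_C (c : ℝ) (x : E d) : ev (MvPolynomial.C c : Poly d) x = c := by simp [ev]
@[simp] lemma ev_X (l : Fin d) (x : E d) : ev (MvPolynomial.X l : Poly d) x = x l := by simp [ev]
@[simp] lemma ev_smul (c : ℝ) (p : Poly d) (x : E d) : ev (c • p) x = c * ev p x := by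
  simp [ev]
@[simp] lemma ev_neg (p : Poly d) (x : E d) : ev (-p) x = - ev p x := by simp [ev]
lemma ev_sum {ι : Type*} (s : Finset ι) (p : ι → Poly d) (x : E d) :
    ev (∑ i ∈ s, p i) x = ∑ i ∈ s, ev (p i) x := by simp [ev]
lemma ev_prod {ι : Type*} (s : Finset ι) (p : ι → Poly d) (x : E d) :
    ev (∏ i ∈ s, p i) x = ∏ i ∈ s, ev (p i) x := by simp [ev]

lemma contDiff_ev (p : Poly d) : ContDiff ℝ ∞ (ev p) := by
  induction p using MvPolynomial.induction_on with
  | C a => simpa [funext (ev_C (d := d) a)] using contDiff_const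
  | add p q hp hq => simpa [funext (ev_add p q)] using hp.add hq
  | mul_X p l hp =>
    rw [funext (ev_mul p _)]
    refine hp.mul ?_
    rw [funext (ev_X l)]
    exact (EuclideanSpace.proj l : E d →L[ℝ] ℝ).contDiff

lemma continuous_ev (p : Poly d) : Continuous (ev p) := (contDiff_ev p).continuous

lemma fderiv_ev (p : Poly d) (l : Fin d) (x : E d) :
    fderiv ℝ (ev p) x (unitVec l) = ev (MvPolynomial.pderiv l p) x := by
  have hd : ∀ p : Poly d, DifferentiableAt ℝ (ev p) x := fun p =>
    (contDiff_ev p).differentiable (by simp) x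
  induction p using MvPolynomial.induction_on with
  | C a => simp [funext (ev_C (d := d) a)]
  | add p q hp hq =>
    rw [funext (ev_add p q), fderiv_fun_add (hd p) (hd q)]
    simp [hp, hq]
  | mul_X p m hp =>
    rw [funext (ev_mul p _), fderiv_fun_mul (hd p) (hd _)]
    have hX : fderiv ℝ (ev (MvPolynomial.X m : Poly d)) x (unitVec l)
        = ev (MvPolynomial.pderiv l (MvPolynomial.X m)) x := by
      rw [funext (ev_X m)]
      have : fderiv ℝ (fun x : E d => x m) x = (EuclideanSpace.proj m : E d →L[ℝ] ℝ) :=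
        (EuclideanSpace.proj m : E d →L[ℝ] ℝ).hasFDerivAt.fderiv
      rw [this]
      by_cases h : l = m
      · subst h; simp [unitVec, MvPolynomial.pderiv_X]; simp [ev]
      · simp [unitVec, MvPolynomial.pderiv_X_of_ne (Ne.symm h), Ne.symm h]
    simp only [add_apply, smul_apply, hX, hp,
      MvPolynomial.pderiv_mul, ev_add, ev_mul, smul_eq_mul, ev_X]
    ring

lemma totalDegree_pderiv_le (p : Poly d) (l : Fin d) :
    (MvPolynomial.pderiv l p).totalDegree ≤ p.totalDegree - 1 := by
  classical
  refine Finset.sup_le fun m hm => ?_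
  rw [MvPolynomial.mem_support_iff, MvPolynomial.coeff_pderiv] at hm
  have hm' : m + Finsupp.single l 1 ∈ p.support := by
    rw [MvPolynomial.mem_support_iff]
    intro h; simp [h] at hm
  have := MvPolynomial.le_totalDegree hm'
  rw [Finsupp.sum_add_index' (by simp) (by simp)] at this
  simp at this
  omega

/-- Substitution of polynomials into a polynomial. -/
noncomputable def subst (A : Fin d → Poly d) (p : Poly d) : Poly d := MvPolynomial.bind₁ A p

lemma totalDegree_subst_le {A : Fin d → Poly d} (hA : ∀ l, (A l).totalDegree ≤ 1) (p : Poly d) :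
    (subst A p).totalDegree ≤ p.totalDegree := by
  classical
  rw [subst, MvPolynomial.bind₁, MvPolynomial.aeval_def, MvPolynomial.eval₂_eq]
  refine (MvPolynomial.totalDegree_finsetSum _ _).trans (Finset.sup_le fun m hm => ?_)
  refine (MvPolynomial.totalDegree_mul _ _).trans ?_
  have h1 : (algebraMap ℝ (Poly d) (MvPolynomial.coeff m p)).totalDegree = 0 := by
    rw [MvPolynomial.algebraMap_eq]; exact MvPolynomial.totalDegree_C _
  rw [h1, zero_add]
  refine (MvPolynomial.totalDegree_finsetProd _ _).trans ?_
  refine le_trans (Finset.sum_le_sum fun i _ => (MvPolynomial.totalDegree_pow _ _).trans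
    (Nat.mul_le_mul_left _ (hA i))) ?_
  simpa [Finsupp.sum] using MvPolynomial.le_totalDegree hm

lemma ev_subst (A : Fin d → Poly d) (p : Poly d) (x y : E d) (h : ∀ l, ev (A l) x = y l) :
    ev (subst A p) x = ev p y := by
  induction p using MvPolynomial.induction_on with
  | C a => simp [subst, MvPolynomial.bind₁_C_right]
  | add p q hp hq =>
    rw [subst] at hp hq ⊢
    simp [hp, hq]
  | mul_X p l hp =>
    rw [subst] at hp ⊢
    simp [hp, h]

/-- The polynomial `x ↦ ⟨v, x⟩ + c`. -/
noncomputable def affPoly (v : E d) (c : ℝ) : Poly d :=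
  (∑ l, MvPolynomial.C (v l) * MvPolynomial.X l) + MvPolynomial.C c

@[simp] lemma ev_affPoly (v : E d) (c : ℝ) (x : E d) : ev (affPoly v c) x = inner ℝ v x + c := by
  simp [affPoly, ev_sum, PiLp.inner_apply, mul_comm]

lemma totalDegree_affPoly_le (v : E d) (c : ℝ) : (affPoly v c).totalDegree ≤ 1 := by
  refine (MvPolynomial.totalDegree_add _ _).trans (max_le ?_ (by simp))
  refine (MvPolynomial.totalDegree_finsetSum _ _).trans (Finset.sup_le fun l _ => ?_)
  refine (MvPolynomial.totalDegree_mul _ _).trans ?_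
  simp [MvPolynomial.totalDegree_X]

lemma totalDegree_add_le {p q : Poly d} {N : ℕ} (hp : p.totalDegree ≤ N) (hq : q.totalDegree ≤ N) :
    (p + q).totalDegree ≤ N := (MvPolynomial.totalDegree_add p q).trans (max_le hp hq)

lemma totalDegree_sub_le {p q : Poly d} {N : ℕ} (hp : p.totalDegree ≤ N) (hq : q.totalDegree ≤ N) :
    (p - q).totalDegree ≤ N := (MvPolynomial.totalDegree_sub p q).trans (max_le hp hq)

lemma totalDegree_sum_le {ι : Type*} (s : Finset ι) {p : ι → Poly d} {N : ℕ}
    (hp : ∀ i ∈ s, (p i).totalDegree ≤ N) : (∑ i ∈ s, p i).totalDegree ≤ N :=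
  (MvPolynomial.totalDegree_finsetSum s p).trans (Finset.sup_le hp)

lemma totalDegree_smul_le {p : Poly d} {N : ℕ} (c : ℝ) (hp : p.totalDegree ≤ N) :
    (c • p).totalDegree ≤ N := (MvPolynomial.totalDegree_smul_le c p).trans hp

/-- All polynomials are square integrable. -/
def PolyMem (μ : Measure (E d)) : Prop := ∀ p : Poly d, MemLp (ev p) 2 μ

lemma memLp_of_continuous {μ : Measure (E d)} [IsFiniteMeasure μ]
    {s : Set (E d)} (hs : Bornology.IsBounded s) (hμ : ∀ᵐ x ∂μ, x ∈ s)
    {f : E d → ℝ} (hf : Continuous f) : MemLp f 2 μ := by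
  have hc : IsCompact (closure s) :=
    Metric.isCompact_of_isClosed_isBounded isClosed_closure hs.closure
  obtain ⟨C, hC⟩ := hc.exists_bound_of_continuousOn hf.continuousOn
  exact MemLp.of_bound hf.aestronglyMeasurable C
    (hμ.mono fun x hx => hC x (subset_closure hx))

lemma memLp_volume_of_continuous {s : Set (E d)} (hs : Bornology.IsBounded s)
    (hm : MeasurableSet s) {f : E d → ℝ} (hf : Continuous f) :
    MemLp f 2 (volume.restrict s) := by
  haveI : IsFiniteMeasure (volume.restrict s) :=
    isFiniteMeasure_restrict.2 hs.measure_lt_top.ne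
  exact memLp_of_continuous hs (ae_restrict_mem hm) hf

lemma polyMem_volume {s : Set (E d)} (hs : Bornology.IsBounded s) (hm : MeasurableSet s) :
    PolyMem (volume.restrict s) := fun p => memLp_volume_of_continuous hs hm (continuous_ev p)

end Poly

end WG

namespace WG

/-! ### Finite dimensional variational problems -/

/-- By symmetry the range of `B` lies in the annihilator of its kernel, and the dimensions agree.
Degenerate forms have to be allowed: for a surface measure, polynomials in `d` variables that vanish
on the hyperplane lie in the kernel. -/
lemma exists_bilin_eq {V : Type*} [AddCommGroup V] [Module ℝ V] [FiniteDimensional ℝ V]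
    (B : V →ₗ[ℝ] V →ₗ[ℝ] ℝ) (hB : ∀ v w, B v w = B w v) (ℓ : V →ₗ[ℝ] ℝ)
    (hℓ : ∀ v, B v v = 0 → ℓ v = 0) : ∃ p, ∀ q, B p q = ℓ q := by
  have hle : LinearMap.range B ≤ (LinearMap.ker B).dualAnnihilator := by
    rintro _ ⟨w, rfl⟩
    rw [Submodule.mem_dualAnnihilator]
    intro v hv
    rw [hB, LinearMap.mem_ker.1 hv, LinearMap.zero_apply]
  have heq : LinearMap.range B = (LinearMap.ker B).dualAnnihilator := by
    refine Submodule.eq_of_le_of_finrank_eq hle ?_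
    have h1 := LinearMap.finrank_range_add_finrank_ker B
    have h2 := Subspace.finrank_add_finrank_dualAnnihilator_eq (LinearMap.ker B)
    exact Nat.add_right_cancel ((h1.trans h2.symm).trans (add_comm _ _))
  have hmem : ℓ ∈ LinearMap.range B := by
    rw [heq, Submodule.mem_dualAnnihilator]
    intro v hv
    exact hℓ v (by rw [LinearMap.mem_ker.1 hv, LinearMap.zero_apply])
  obtain ⟨p, hp⟩ := hmem
  exact ⟨p, fun q => by rw [hp]⟩

section Proj

variable {d : ℕ}

/-- Polynomials of total degree at most `N`. -/
noncomputable abbrev PN (d N : ℕ) : Submodule ℝ (Poly d) := MvPolynomial.restrictTotalDegree (Fin d) ℝ N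

lemma mem_PN {N : ℕ} {p : Poly d} : p ∈ PN d N ↔ p.totalDegree ≤ N :=
  MvPolynomial.mem_restrictTotalDegree _ _ _

lemma ae_eq_zero_of_integral_sq {μ : Measure (E d)} {f : E d → ℝ} (hf : MemLp f 2 μ)
    (h : ∫ x, f x * f x ∂μ = 0) : f =ᵐ[μ] 0 := by
  rw [integral_eq_zero_iff_of_nonneg (fun x => mul_self_nonneg _)
    (integrable_mul_of_memLp hf hf)] at h
  exact h.mono fun x hx => by simpa using hx

/-- A weighted projection problem in the space of polynomials. -/
lemma exists_weighted_proj {μ : Measure (E d)} (hμ : PolyMem μ) (m : ℕ) (b : Poly d)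
    (hb : ∀ᵐ x ∂μ, 0 ≤ ev b x) {f : E d → ℝ} (hf : MemLp f 2 μ)
    (hbf : ∀ᵐ x ∂μ, ev b x = 0 → f x = 0) :
    ∃ p : Poly d, p.totalDegree ≤ m ∧ ∀ q : Poly d, q.totalDegree ≤ m →
      ∫ x, ev b x * ev p x * ev q x ∂μ = ∫ x, f x * ev q x ∂μ := by
  have hint : ∀ p q : Poly d, Integrable (fun x => ev b x * ev p x * ev q x) μ := fun p q => by
    simpa using integrable_mul_of_memLp (hμ (b * p)) (hμ q)
  have hint' : ∀ q : Poly d, Integrable (fun x => f x * ev q x) μ := fun q =>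
    integrable_mul_of_memLp hf (hμ q)
  let B : PN d m →ₗ[ℝ] PN d m →ₗ[ℝ] ℝ := LinearMap.mk₂ ℝ
    (fun p q => ∫ x, ev b x * ev p.1 x * ev q.1 x ∂μ)
    (fun p p' q => by
      rw [← integral_add (hint _ _) (hint _ _)]
      congr 1; ext x; simp; ring)
    (fun c p q => by
      rw [smul_eq_mul, ← integral_const_mul]
      congr 1; ext x; simp; ring)
    (fun p q q' => by
      rw [← integral_add (hint _ _) (hint _ _)]
      congr 1; ext x; simp; ring)
    (fun c p q => by
      rw [smul_eq_mul, ← integral_const_mul]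
      congr 1; ext x; simp; ring)
  let ℓ : PN d m →ₗ[ℝ] ℝ :=
    { toFun := fun q => ∫ x, f x * ev q.1 x ∂μ
      map_add' := fun q q' => by
        rw [← integral_add (hint' _) (hint' _)]
        congr 1; ext x; simp; ring
      map_smul' := fun c q => by
        rw [RingHom.id_apply, smul_eq_mul, ← integral_const_mul]
        congr 1; ext x; simp; ring }
  obtain ⟨p, hp⟩ := exists_bilin_eq B
    (fun v w => by
      show ∫ x, _ ∂μ = ∫ x, _ ∂μ
      congr 1; ext x; ring) ℓ
    -- If the weighted square integral of `v` vanishes, then almost everywhere the weight or `v`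
    -- vanishes; where the weight vanishes, so does `f`.
    (fun v hv => by
      have hv' : ∫ x, ev b x * ev v.1 x * ev v.1 x ∂μ = 0 := hv
      rw [integral_eq_zero_iff_of_nonneg_ae
        (hb.mono fun x hx => by
          show 0 ≤ ev b x * ev v.1 x * ev v.1 x
          rw [mul_assoc]; exact mul_nonneg hx (mul_self_nonneg _)) (hint _ _)] at hv'
      show ∫ x, f x * ev v.1 x ∂μ = 0
      rw [integral_eq_zero_of_ae]
      filter_upwards [hv', hbf] with x hx hx'
      simp only [Pi.zero_apply, mul_eq_zero] at hx ⊢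
      tauto)
  exact ⟨p.1, mem_PN.1 p.2, fun q hq => hp ⟨q, mem_PN.2 hq⟩⟩

/-- The weighted problem with weight `1` is solvable, which makes the `Classical.epsilon` in the
definition meaningful, also when the projecting polynomial is not unique. -/
lemma l2Proj_spec {μ : Measure (E d)} (hμ : PolyMem μ) (m : ℕ) {f : E d → ℝ} (hf : MemLp f 2 μ)
    (q : Poly d) (hq : q.totalDegree ≤ m) :
    ∫ x, ev (l2Proj μ m f).1 x * ev q x ∂μ = ∫ x, f x * ev q x ∂μ := by
  obtain ⟨p, hp, hpq⟩ := exists_weighted_proj hμ m (MvPolynomial.C 1)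
    (Filter.Eventually.of_forall fun x => by rw [ev_C]; exact zero_le_one) hf
    (Filter.Eventually.of_forall fun x hx => by rw [ev_C] at hx; norm_num at hx)
  have : ∃ p : {p : Poly d // p.totalDegree ≤ m}, ∀ q : Poly d, q.totalDegree ≤ m →
      ∫ x, ev p.1 x * ev q x ∂μ = ∫ x, f x * ev q x ∂μ :=
    ⟨⟨p, hp⟩, fun q hq => by simpa only [ev_C, one_mul] using hpq q hq⟩
  exact Classical.epsilon_spec this q hq

/-- Both sides are choices from the same predicate, so the polynomials themselves coincide. The
boundary condition of `V_h^0`, which is required at every point, depends on this. -/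
lemma l2Proj_congr {μ : Measure (E d)} {m : ℕ} {f g : E d → ℝ}
    (h : ∀ q : Poly d, q.totalDegree ≤ m → ∫ x, f x * ev q x ∂μ = ∫ x, g x * ev q x ∂μ) :
    l2Proj μ m f = l2Proj μ m g := by
  have : (fun p : {p : Poly d // p.totalDegree ≤ m} => ∀ q : Poly d, q.totalDegree ≤ m →
        ∫ x, ev p.1 x * ev q x ∂μ = ∫ x, f x * ev q x ∂μ)
      = fun p => ∀ q : Poly d, q.totalDegree ≤ m →
        ∫ x, ev p.1 x * ev q x ∂μ = ∫ x, g x * ev q x ∂μ := by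
    ext p
    exact forall_congr' fun q => forall_congr' fun hq => by rw [h q hq]
  rw [l2Proj, l2Proj, this]

lemma nrm_l2Proj_le {μ : Measure (E d)} (hμ : PolyMem μ) (m : ℕ) {f : E d → ℝ}
    (hf : MemLp f 2 μ) : nrm μ (ev (l2Proj μ m f).1) ≤ nrm μ f := by
  set p := l2Proj μ m f
  have h1 := nrm_sq (hμ p.1)
  have h2 := l2Proj_spec hμ m hf p.1 p.2
  have h3 := abs_integral_mul_le hf (hμ p.1)
  rw [← h2] at h3
  have h4 : nrm μ (ev p.1) ^ 2 ≤ nrm μ f * nrm μ (ev p.1) := by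
    rw [h1]
    refine le_trans (le_of_eq ?_) ((le_abs_self _).trans h3)
    congr 1; ext x; rw [sq]
  by_contra hlt
  push Not at hlt
  have := nrm_nonneg μ f
  nlinarith

lemma nrm_sub_l2Proj_le {μ : Measure (E d)} (hμ : PolyMem μ) (m : ℕ) {f : E d → ℝ}
    (hf : MemLp f 2 μ) (q : Poly d) (hq : q.totalDegree ≤ m) :
    nrm μ (fun x => f x - ev (l2Proj μ m f).1 x) ≤ nrm μ (fun x => f x - ev q x) := by
  set p := l2Proj μ m f
  have hfp : MemLp (fun x => f x - ev p.1 x) 2 μ := hf.sub (hμ p.1)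
  have hfq : MemLp (fun x => f x - ev q x) 2 μ := hf.sub (hμ q)
  have horth : ∀ r : Poly d, r.totalDegree ≤ m → ∫ x, (f x - ev p.1 x) * ev r x ∂μ = 0 := by
    intro r hr
    simp only [sub_mul]
    rw [integral_sub (integrable_mul_of_memLp hf (hμ r))
      (integrable_mul_of_memLp (hμ p.1) (hμ r)), l2Proj_spec hμ m hf r hr, sub_self]
  have h1 := nrm_sq hfp
  have h3 := abs_integral_mul_le hfp hfq
  have h5 := horth (p.1 - q) (totalDegree_sub_le p.2 hq)
  have h4 : ∫ x, (f x - ev p.1 x) * (f x - ev q x) ∂μ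
      = ∫ x, (f x - ev p.1 x) ^ 2 ∂μ + ∫ x, (f x - ev p.1 x) * ev (p.1 - q) x ∂μ := by
    rw [← integral_add hfp.integrable_sq
      (integrable_mul_of_memLp hfp (hμ _))]
    congr 1; ext x; simp; ring
  have h6 : nrm μ (fun x => f x - ev p.1 x) ^ 2
      ≤ nrm μ (fun x => f x - ev p.1 x) * nrm μ (fun x => f x - ev q x) := by
    calc _ = ∫ x, (f x - ev p.1 x) * (f x - ev q x) ∂μ := by
          rw [h4, h5, add_zero]; exact h1
      _ ≤ _ := (le_abs_self _).trans h3
  by_contra hlt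
  push Not at hlt
  have := nrm_nonneg μ (fun x => f x - ev q x)
  nlinarith

end Proj

/-! ### Norm equivalence for polynomials on balls -/

section Balls

variable {d : ℕ}

lemma poly_eq_zero_of_open {U : Set (E d)} (hU : IsOpen U) (hne : U.Nonempty) {p : Poly d}
    (h : ∀ x ∈ U, ev p x = 0) : p = 0 := by
  obtain ⟨x, hx⟩ := hne
  have hU' : IsOpen ((WithLp.toLp 2 : (Fin d → ℝ) → E d) ⁻¹' U) :=
    hU.preimage (PiLp.continuous_toLp 2 _)
  obtain ⟨ε, hε, hball⟩ := Metric.isOpen_iff.1 hU' (WithLp.ofLp x) (by simpa using hx)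
  refine MvPolynomial.funext_set (fun l => Metric.ball (x l) ε) (fun l => ?_) fun y hy => ?_
  · rw [Real.ball_eq_Ioo]
    exact Set.Ioo_infinite (by linarith)
  · rw [ball_pi _ hε |>.symm] at hy
    simpa [ev] using h _ (hball hy)

lemma poly_eq_zero_of_ae {U : Set (E d)} (hU : IsOpen U) (hne : U.Nonempty) {p : Poly d}
    (h : ev p =ᵐ[volume.restrict U] 0) : p = 0 := by
  refine poly_eq_zero_of_open hU hne fun x hx => ?_
  have := Measure.eqOn_open_of_ae_eq (f := ev p) (g := fun _ => (0 : ℝ)) h hU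
    (continuous_ev p).continuousOn continuousOn_const
  exact this hx

/-- Linear maps out of a finite dimensional normed space are bounded; injectivity identifies
polynomials with their classes in `L²(μ₁)`. Taking `T` to be the identity compares norms, taking it
to be a derivative gives inverse inequalities. -/
lemma exists_nrm_le_of_polyMem {μ₁ μ₂ : Measure (E d)} (h₁ : PolyMem μ₁) (h₂ : PolyMem μ₂) (N : ℕ)
    (hinj : ∀ p : Poly d, ev p =ᵐ[μ₁] 0 → p = 0) (T : Poly d →ₗ[ℝ] Poly d) :
    ∃ C : ℝ, 0 < C ∧ ∀ p : Poly d, p.totalDegree ≤ N →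
      nrm μ₂ (ev (T p)) ≤ C * nrm μ₁ (ev p) := by
  let J₁ : PN d N →ₗ[ℝ] Lp ℝ 2 μ₁ :=
    { toFun := fun p => (h₁ p.1).toLp
      map_add' := fun p q => by
        rw [← MemLp.toLp_add]
        congr 1; ext x; simp
      map_smul' := fun c p => by
        rw [RingHom.id_apply, ← MemLp.toLp_const_smul]
        congr 1; ext x; simp }
  let J₂ : PN d N →ₗ[ℝ] Lp ℝ 2 μ₂ :=
    { toFun := fun p => (h₂ (T p.1)).toLp
      map_add' := fun p q => by
        rw [← MemLp.toLp_add]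
        congr 1; ext x; simp
      map_smul' := fun c p => by
        rw [RingHom.id_apply, ← MemLp.toLp_const_smul]
        congr 1; ext x; simp }
  have hJ : Function.Injective J₁ := by
    rw [← LinearMap.ker_eq_bot, LinearMap.ker_eq_bot']
    intro p hp
    have : (h₁ p.1).toLp = 0 := hp
    rw [← MemLp.toLp_zero MemLp.zero', MemLp.toLp_eq_toLp_iff] at this
    exact Subtype.ext (hinj p.1 this)
  let g : LinearMap.range J₁ →L[ℝ] Lp ℝ 2 μ₂ := LinearMap.toContinuousLinearMap
    (J₂ ∘ₗ (LinearEquiv.ofInjective J₁ hJ).symm.toLinearMap)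
  refine ⟨‖g‖ + 1, by positivity, fun p hp => ?_⟩
  let p' : PN d N := ⟨p, mem_PN.2 hp⟩
  have hg : g (LinearEquiv.ofInjective J₁ hJ p') = J₂ p' := by
    simp [g]
  have hJ₂ : ‖J₂ p'‖ = nrm μ₂ (ev (T p)) := Lp.norm_toLp _ (h₂ _)
  have h4 : ‖LinearEquiv.ofInjective J₁ hJ p'‖ = nrm μ₁ (ev p) := by
    have : ‖LinearEquiv.ofInjective J₁ hJ p'‖ = ‖J₁ p'‖ := rfl
    rw [this]; exact Lp.norm_toLp _ (h₁ _)
  rw [← hJ₂, ← h4, ← hg]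
  refine (g.le_opNorm _).trans ?_
  gcongr
  linarith

lemma setIntegral_ball_affine (f : E d → ℝ) (x₀ : E d) {R : ℝ} (hR : 0 < R) (c : ℝ) :
    ∫ x in Metric.ball x₀ (c * R), f x = R ^ d * ∫ y in Metric.ball 0 c, f (x₀ + R • y) := by
  have h1 := Measure.setIntegral_comp_smul_of_pos (μ := (volume : Measure (E d)))
    (fun y => f (x₀ + y)) (Metric.ball 0 c) hR
  rw [h1, finrank_euclideanSpace_fin, smul_eq_mul, ← mul_assoc,
    mul_inv_cancel₀ (by positivity), one_mul, smul_ball hR.ne']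
  have h2 := (measurePreserving_add_left (volume : Measure (E d)) x₀).setIntegral_preimage_emb
    (measurableEmbedding_addLeft x₀) f (Metric.ball x₀ (c * R))
  rw [← h2]
  congr 2
  ext y
  simp [abs_of_pos hR, mul_comm]

lemma nrm_ball_affine {f : E d → ℝ} (hf : Continuous f) (x₀ : E d) {R : ℝ} (hR : 0 < R) (c : ℝ) :
    nrm (volume.restrict (Metric.ball x₀ (c * R))) f
      = Real.sqrt (R ^ d) * nrm (volume.restrict (Metric.ball 0 c)) (fun y => f (x₀ + R • y)) := by
  rw [nrm_eq_sqrt (memLp_volume_of_continuous Metric.isBounded_ball measurableSet_ball hf),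
    nrm_eq_sqrt (memLp_volume_of_continuous Metric.isBounded_ball measurableSet_ball
      (by fun_prop)), setIntegral_ball_affine (fun x => f x ^ 2) x₀ hR,
    Real.sqrt_mul (by positivity)]

/-- The polynomial `y ↦ p (x₀ + R y)`. -/
noncomputable def dilate (x₀ : E d) (R : ℝ) (p : Poly d) : Poly d :=
  subst (fun l => affPoly (R • unitVec l) (x₀ l)) p

lemma ev_dilate (x₀ : E d) (R : ℝ) (p : Poly d) (y : E d) :
    ev (dilate x₀ R p) y = ev p (x₀ + R • y) := by
  refine ev_subst _ _ _ _ fun l => ?_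
  simp [unitVec, inner_smul_left, EuclideanSpace.inner_single_left, add_comm]

lemma totalDegree_dilate_le (x₀ : E d) (R : ℝ) (p : Poly d) :
    (dilate x₀ R p).totalDegree ≤ p.totalDegree :=
  totalDegree_subst_le (fun _ => totalDegree_affPoly_le _ _) p

lemma ev_pderiv_dilate (x₀ : E d) (R : ℝ) (p : Poly d) (l : Fin d) (y : E d) :
    ev (MvPolynomial.pderiv l (dilate x₀ R p)) y
      = R * ev (MvPolynomial.pderiv l p) (x₀ + R • y) := by
  rw [← fderiv_ev, ← fderiv_ev, funext (ev_dilate x₀ R p)]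
  have h1 : HasFDerivAt (fun y : E d => x₀ + R • y) (R • ContinuousLinearMap.id ℝ (E d)) y :=
    ((hasFDerivAt_id y).const_smul R).const_add x₀
  have h2 : HasFDerivAt (ev p) (fderiv ℝ (ev p) (x₀ + R • y)) (x₀ + R • y) :=
    ((contDiff_ev p).differentiable (by simp) _).hasFDerivAt
  have := (h2.comp y h1).fderiv
  rw [Function.comp_def] at this
  rw [this]
  simp

/-- Polynomials of bounded degree on concentric balls of comparable radii. -/
lemma exists_nrm_ball_le (d N : ℕ) {c C : ℝ} (hc : 0 < c) :
    ∃ K : ℝ, 0 < K ∧ ∀ (x₀ : E d) (R : ℝ), 0 < R → ∀ p : Poly d, p.totalDegree ≤ N →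
      nrm (volume.restrict (Metric.ball x₀ (C * R))) (ev p)
          ≤ K * nrm (volume.restrict (Metric.ball x₀ (c * R))) (ev p) ∧
      ∀ l, R * nrm (volume.restrict (Metric.ball x₀ (C * R))) (ev (MvPolynomial.pderiv l p))
          ≤ K * nrm (volume.restrict (Metric.ball x₀ (c * R))) (ev p) := by
  have hb : ∀ r : ℝ, PolyMem (volume.restrict (Metric.ball (0 : E d) r)) := fun r =>
    polyMem_volume Metric.isBounded_ball measurableSet_ball
  have hinj : ∀ p : Poly d, ev p =ᵐ[volume.restrict (Metric.ball (0 : E d) c)] 0 → p = 0 :=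
    fun p hp => poly_eq_zero_of_ae Metric.isOpen_ball (Metric.nonempty_ball.2 hc) hp
  -- The constants belong to the balls of radii `c` and `C` about the origin. `dilate` transports a
  -- polynomial there without raising its degree, and the chain rule produces the factor `R` in
  -- front of the derivative.
  obtain ⟨K₀, hK₀, h₀⟩ := exists_nrm_le_of_polyMem (hb c) (hb C) N hinj LinearMap.id
  choose K₁ hK₁ h₁ using fun l : Fin d => exists_nrm_le_of_polyMem (hb c) (hb C) N hinj
    (MvPolynomial.pderiv l).toLinearMap
  have hKle : ∀ l, K₁ l ≤ K₀ + ∑ l, K₁ l := fun l => by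
    have := Finset.single_le_sum (f := K₁) (fun i _ => (hK₁ i).le) (Finset.mem_univ l)
    linarith
  have hsum : 0 ≤ ∑ l, K₁ l := Finset.sum_nonneg fun i _ => (hK₁ i).le
  refine ⟨K₀ + ∑ l, K₁ l, by linarith, fun x₀ R hR p hp => ⟨?_, fun l => ?_⟩⟩
  · rw [nrm_ball_affine (continuous_ev p) x₀ hR, nrm_ball_affine (continuous_ev p) x₀ hR]
    have := h₀ (dilate x₀ R p) ((totalDegree_dilate_le x₀ R p).trans hp)
    rw [LinearMap.id_apply, funext (ev_dilate x₀ R p)] at this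
    rw [mul_left_comm]
    gcongr
    refine this.trans ?_
    gcongr
    · exact nrm_nonneg _ _
    · linarith
  · rw [nrm_ball_affine (continuous_ev _) x₀ hR, nrm_ball_affine (continuous_ev p) x₀ hR]
    have := h₁ l (dilate x₀ R p) ((totalDegree_dilate_le x₀ R p).trans hp)
    have h2 : ((MvPolynomial.pderiv l).toLinearMap : Poly d →ₗ[ℝ] Poly d) (dilate x₀ R p)
      = MvPolynomial.pderiv l (dilate x₀ R p) := rfl
    rw [h2, funext (ev_pderiv_dilate x₀ R p l), funext (ev_dilate x₀ R p), nrm_const_mul,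
      abs_of_pos hR] at this
    rw [mul_left_comm, mul_left_comm _ (Real.sqrt _)]
    refine mul_le_mul_of_nonneg_left (this.trans ?_) (Real.sqrt_nonneg _)
    exact mul_le_mul_of_nonneg_right (hKle l) (nrm_nonneg _ _)

end Balls

end WG

namespace WG

/-! ### Slicing along a unit vector -/

section Slice

variable {V : Type*} [NormedAddCommGroup V] [InnerProductSpace ℝ V] [FiniteDimensional ℝ V]
  [MeasurableSpace V] [BorelSpace V]

/-- The hyperplane of vectors orthogonal to `ν`. -/
noncomputable abbrev Perp (ν : V) : Submodule ℝ V := (Submodule.span ℝ {ν})ᗮ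

/-- Orthogonal coordinates along `ν` and its orthogonal complement, centred at `x₀`. -/
noncomputable def slice (ν x₀ : V) (p : ℝ × Perp ν) : V := x₀ + (p.1 • ν + (p.2 : V))

lemma inner_perp {ν : V} (z : Perp ν) : inner ℝ ν (z : V) = 0 :=
  (Submodule.mem_orthogonal_singleton_iff_inner_right (𝕜 := ℝ)).1 z.2

lemma inner_slice {ν : V} (hν : ‖ν‖ = 1) (x₀ : V) (p : ℝ × Perp ν) :
    inner ℝ ν (slice ν x₀ p) = inner ℝ ν x₀ + p.1 := by
  simp [slice, inner_add_right, inner_smul_right, inner_perp, hν]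

/-- Slicing as a measurable equivalence. -/
noncomputable def sliceEquiv {ν : V} (hν : ‖ν‖ = 1) (x₀ : V) : ℝ × Perp ν ≃ᵐ V :=
  ((LinearIsometryEquiv.toSpanUnitSingleton ν hν).toHomeomorph.toMeasurableEquiv.prodCongr
    (MeasurableEquiv.refl _)).trans ((Submodule.span ℝ {ν}).measurableEquivProd x₀).symm

lemma coe_sliceEquiv {ν : V} (hν : ‖ν‖ = 1) (x₀ : V) : ⇑(sliceEquiv hν x₀) = slice ν x₀ := by
  ext p
  simp [sliceEquiv, slice, MeasurableEquiv.prodCongr, add_comm]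

lemma measurePreserving_measurableEquivProd_symm (s : Submodule ℝ V) (x₀ : V) :
    MeasurePreserving (s.measurableEquivProd x₀).symm (volume.prod volume) volume := by
  have h := s.measurePreserving_measurableEquivProd x₀
  rw [InnerProductSpace.euclideanHausdorffMeasure_eq_volume] at h
  exact MeasurePreserving.symm _ h

lemma measurePreserving_add_of_isometry (s : Submodule ℝ V) (f : ℝ ≃ₗᵢ[ℝ] s) (x₀ : V) :
    MeasurePreserving (fun p : ℝ × sᗮ => x₀ + ((f p.1 : V) + (p.2 : V))) (volume.prod volume)
      volume := by
  have h2 : MeasurePreserving (Prod.map f (id : sᗮ → sᗮ))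
      (volume.prod volume) (volume.prod volume) :=
    f.measurePreserving.prod (MeasurePreserving.id _)
  have h3 : (fun p : ℝ × sᗮ => x₀ + ((f p.1 : V) + (p.2 : V)))
      = (s.measurableEquivProd x₀).symm ∘ (Prod.map f (id : sᗮ → sᗮ)) := by
    ext p
    simp [add_comm]
  rw [h3]
  exact (measurePreserving_measurableEquivProd_symm s x₀).comp h2

lemma measurePreserving_slice {ν : V} (hν : ‖ν‖ = 1) (x₀ : V) :
    MeasurePreserving (slice ν x₀) (volume.prod volume) volume :=
  measurePreserving_add_of_isometry (Submodule.span ℝ {ν})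
    (LinearIsometryEquiv.toSpanUnitSingleton ν hν) x₀

lemma measurableEmbedding_slice {ν : V} (hν : ‖ν‖ = 1) (x₀ : V) :
    MeasurableEmbedding (slice ν x₀) := by
  rw [← coe_sliceEquiv hν]; exact (sliceEquiv hν x₀).measurableEmbedding

lemma finrank_perp {ν : V} (hν : ‖ν‖ = 1) :
    Module.finrank ℝ (Perp ν) = Module.finrank ℝ V - 1 := by
  have h0 : ν ≠ 0 := by rintro rfl; simp at hν
  have h := (Submodule.span ℝ {ν}).finrank_add_finrank_orthogonal
  rw [finrank_span_singleton h0] at h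
  exact Nat.eq_sub_of_add_eq' h

lemma isometry_slice_const (ν x₀ : V) (t : ℝ) :
    Isometry (fun z : Perp ν => slice ν x₀ (t, z)) := by
  refine Isometry.of_dist_eq fun z z' => ?_
  simp [slice, dist_eq_norm]

lemma mem_range_slice {ν : V} (hν : ‖ν‖ = 1) (x₀ : V) (t : ℝ) (x : V) :
    x ∈ Set.range (fun z : Perp ν => slice ν x₀ (t, z)) ↔ inner ℝ ν x = inner ℝ ν x₀ + t := by
  constructor
  · rintro ⟨z, rfl⟩; exact inner_slice hν x₀ _
  · intro h
    refine ⟨⟨x - x₀ - t • ν, ?_⟩, ?_⟩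
    · rw [Submodule.mem_orthogonal_singleton_iff_inner_right]
      simp [inner_sub_right, inner_smul_right, hν, h]
    · simp [slice]

/-- An isometry carries Hausdorff measure to Hausdorff measure on its range, and on the hyperplane
`Perp ν` this measure is the volume. Surface integrals over flat faces thereby become Lebesgue
integrals. -/
lemma map_slice_const {ν : V} (hν : ‖ν‖ = 1) (x₀ : V) (t : ℝ) :
    (volume : Measure (Perp ν)).map (fun z => slice ν x₀ (t, z))
      = (μHE[Module.finrank ℝ V - 1] : Measure V).restrict
          {x | inner ℝ ν x = inner ℝ ν x₀ + t} := by
  rw [← InnerProductSpace.euclideanHausdorffMeasure_eq_volume, finrank_perp hν,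
    (isometry_slice_const ν x₀ t).map_euclideanHausdorffMeasure]
  congr 1
  ext x
  exact mem_range_slice hν x₀ t x

lemma volume_hyperplane {w : V} (hw : w ≠ 0) (c : ℝ) :
    volume {x : V | inner ℝ w x = c} = 0 := by
  have h := Measure.addHaar_affineSubspace (volume : Measure V)
    (AffineSubspace.mk' ((c / ‖w‖ ^ 2) • w) (Perp w)) ?_
  · convert h using 2
    ext x
    have h0 : ‖w‖ ^ 2 ≠ 0 := by positivity
    simp only [Set.mem_ofPred_eq, SetLike.mem_coe, AffineSubspace.mem_mk', vsub_eq_sub]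
    rw [Submodule.mem_orthogonal_singleton_iff_inner_right, inner_sub_right, inner_smul_right,
      real_inner_self_eq_norm_sq, div_mul_cancel₀ _ h0, sub_eq_zero]
  · intro h
    have h2 := congrArg AffineSubspace.direction h
    rw [AffineSubspace.direction_mk', AffineSubspace.direction_top,
      Submodule.orthogonal_eq_top_iff, Submodule.span_singleton_eq_bot] at h2
    exact hw h2

/-- The volume of the unit ball of dimension `m`. -/
noncomputable def ballVol (m : ℕ) : ENNReal := volume (Metric.ball (0 : EuclideanSpace ℝ (Fin m)) 1)

lemma ballVol_lt_top (m : ℕ) : ballVol m < ⊤ := measure_ball_lt_top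

lemma volume_closedBall_eq (x : V) {r : ℝ} (hr : 0 ≤ r) :
    volume (Metric.closedBall x r)
      = ENNReal.ofReal (r ^ Module.finrank ℝ V) * ballVol (Module.finrank ℝ V) := by
  rw [Measure.addHaar_closedBall _ _ hr, ballVol]
  congr 1
  have h := (stdOrthonormalBasis ℝ V).measurePreserving_repr.measure_preimage
    (s := Metric.ball 0 1) measurableSet_ball.nullMeasurableSet
  rw [← h]
  congr 1
  ext x
  simp

/-- In slice coordinates the set lies in an interval of length `b - a` times a ball of radius `R`,
since orthogonal projection does not increase norms. Both inscribed ball lemmas count slabs with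
this bound. -/
lemma volume_slab_le {ν : V} (hν : ‖ν‖ = 1) (x₀ : V) {R a b : ℝ} (hR : 0 ≤ R) (hab : a ≤ b) :
    volume {x | x ∈ Metric.closedBall x₀ R ∧ inner ℝ ν x ∈ Set.Icc a b}
      ≤ ENNReal.ofReal ((b - a) * R ^ (Module.finrank ℝ V - 1)
        * (ballVol (Module.finrank ℝ V - 1)).toReal) := by
  rw [ENNReal.ofReal_mul (mul_nonneg (sub_nonneg.2 hab) (pow_nonneg hR _)),
    ENNReal.ofReal_toReal (ballVol_lt_top _).ne]
  rw [← (measurePreserving_slice hν x₀).measure_preimage_emb (measurableEmbedding_slice hν x₀)]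
  refine (measure_mono (t := Set.Icc (a - inner ℝ ν x₀) (b - inner ℝ ν x₀)
    ×ˢ Metric.closedBall (0 : Perp ν) R) ?_).trans ?_
  · rintro ⟨t, z⟩ ⟨h1, h2⟩
    rw [inner_slice hν] at h2
    simp only [Set.mem_prod, Set.mem_Icc, Metric.mem_closedBall, dist_zero_right] at h2 ⊢
    refine ⟨⟨by linarith [h2.1], by linarith [h2.2]⟩, ?_⟩
    rw [Metric.mem_closedBall, dist_eq_norm, slice, add_sub_cancel_left] at h1
    have h3 : ‖(z : V)‖ ^ 2 ≤ ‖t • ν + (z : V)‖ ^ 2 := by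
      rw [norm_add_sq_real, inner_smul_left, inner_perp]
      simp
    have h4 := (sq_le_sq₀ (norm_nonneg _) (norm_nonneg _)).1 h3
    exact h4.trans h1
  · rw [Measure.prod_prod, Real.volume_Icc, volume_closedBall_eq _ hR, finrank_perp hν,
      ← mul_assoc, ← ENNReal.ofReal_mul (by linarith)]
    simp

end Slice

end WG

namespace WG

/-! ### Integration over flat pieces and over cones -/

section Cone

variable {d : ℕ}

lemma surf_eq_map {ν : E d} (hν : ‖ν‖ = 1) (x₀ : E d) (t : ℝ) {e : Set (E d)}
    (he : ∀ x ∈ e, inner ℝ ν x = inner ℝ ν x₀ + t) (hem : MeasurableSet e) :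
    surf e = ((volume : Measure (Perp ν)).restrict {z | slice ν x₀ (t, z) ∈ e}).map
      (fun z => slice ν x₀ (t, z)) := by
  have hm : Measurable (fun z : Perp ν => slice ν x₀ (t, z)) :=
    (isometry_slice_const ν x₀ t).continuous.measurable
  have h := map_slice_const hν x₀ t
  rw [finrank_euclideanSpace_fin] at h
  have h2 := Measure.restrict_map (μ := (volume : Measure (Perp ν))) hm hem
  rw [h, Measure.restrict_restrict hem] at h2
  rw [surf, Set.preimage] at *
  rw [← h2]
  congr 1
  ext x
  exact ⟨fun hx => ⟨hx, he x hx⟩, fun hx => hx.1⟩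

lemma integral_surf {ν : E d} (hν : ‖ν‖ = 1) (x₀ : E d) (t : ℝ) {e : Set (E d)}
    (he : ∀ x ∈ e, inner ℝ ν x = inner ℝ ν x₀ + t) (hem : MeasurableSet e) (g : E d → ℝ) :
    ∫ x, g x ∂(surf e) = ∫ z in {z : Perp ν | slice ν x₀ (t, z) ∈ e}, g (slice ν x₀ (t, z)) := by
  rw [surf_eq_map hν x₀ t he hem, MeasurableEmbedding.integral_map]
  exact (isometry_slice_const ν x₀ t).isClosedEmbedding.measurableEmbedding

lemma isBounded_slice_preimage {ν : E d} (x₀ : E d) (t : ℝ) {e : Set (E d)}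
    (hb : Bornology.IsBounded e) : Bornology.IsBounded {z : Perp ν | slice ν x₀ (t, z) ∈ e} :=
  (isometry_slice_const ν x₀ t).antilipschitz.isBounded_preimage hb

lemma measurableSet_slice_preimage {ν : E d} (x₀ : E d) (t : ℝ) {e : Set (E d)}
    (hem : MeasurableSet e) : MeasurableSet {z : Perp ν | slice ν x₀ (t, z) ∈ e} :=
  (isometry_slice_const ν x₀ t).continuous.measurable hem

/-- The open cone with apex `x₀` over a subset of the hyperplane at distance `lam`. -/
def cone (ν x₀ : E d) (lam : ℝ) (e : Set (E d)) : Set (E d) :=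
  {x | inner ℝ ν (x - x₀) ∈ Set.Ioo 0 lam ∧ x₀ + (lam / inner ℝ ν (x - x₀)) • (x - x₀) ∈ e}

lemma measurableSet_cone (ν x₀ : E d) (lam : ℝ) {e : Set (E d)} (hem : MeasurableSet e) :
    MeasurableSet (cone ν x₀ lam e) := by
  have h1 : Measurable fun x : E d => inner ℝ ν (x - x₀) := by fun_prop
  have h2 : Measurable fun x : E d => x₀ + (lam / inner ℝ ν (x - x₀)) • (x - x₀) := by fun_prop
  exact (h1 measurableSet_Ioo).inter (h2 hem)

lemma isBounded_cone (ν x₀ : E d) {lam : ℝ} {e : Set (E d)}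
    (hb : Bornology.IsBounded e) : Bornology.IsBounded (cone ν x₀ lam e) := by
  obtain ⟨R, hR⟩ := hb.subset_closedBall x₀
  refine (Metric.isBounded_closedBall (x := x₀) (r := R)).subset fun x hx => ?_
  obtain ⟨⟨h1, h2⟩, h3⟩ := hx
  have h4 := hR h3
  rw [Metric.mem_closedBall, dist_eq_norm, add_sub_cancel_left, norm_smul, Real.norm_eq_abs,
    abs_of_pos (div_pos (h1.trans h2) h1)] at h4
  rw [Metric.mem_closedBall, dist_eq_norm]
  refine le_trans ?_ h4
  have : 1 ≤ lam / inner ℝ ν (x - x₀) := (one_le_div h1).2 h2.le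
  nlinarith [norm_nonneg (x - x₀)]

/-- The section of the cone at height `t` is the base contracted by `t / lam`; rescaling it to the
base has the Jacobian `(t / lam) ^ (d - 1)`. -/
lemma integral_cone_slice {ν : E d} (hν : ‖ν‖ = 1) (x₀ : E d) {lam : ℝ}
    {e : Set (E d)} (hem : MeasurableSet e) (F : E d → ℝ) {t : ℝ} (ht : t ∈ Set.Ioo 0 lam) :
    ∫ z : Perp ν, (cone ν x₀ lam e).indicator F (slice ν x₀ (t, z))
      = ∫ z in {z : Perp ν | slice ν x₀ (lam, z) ∈ e},
          (t / lam) ^ (d - 1) * F (x₀ + (t / lam) • (lam • ν + (z : E d))) := by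
  classical
  have hl : 0 < lam := ht.1.trans ht.2
  set e' := {z : Perp ν | slice ν x₀ (lam, z) ∈ e} with he'
  have h1 : ∀ z : Perp ν, (cone ν x₀ lam e).indicator F (slice ν x₀ (t, z))
      = e'.indicator (fun z : Perp ν => F (x₀ + (t / lam) • (lam • ν + (z : E d))))
          ((lam / t) • z) := by
    intro z
    have ht0 := ht.1.ne'
    have e1 : x₀ + (lam / t) • (slice ν x₀ (t, z) - x₀) = slice ν x₀ (lam, (lam / t) • z) := by
      simp only [slice, add_sub_cancel_left, smul_add, smul_smul, Submodule.coe_smul]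
      congr 3
      field_simp
    have e2 : x₀ + (t / lam) • (lam • ν + (((lam / t) • z : Perp ν) : E d))
        = slice ν x₀ (t, z) := by
      simp only [slice, smul_add, smul_smul, Submodule.coe_smul]
      have : t / lam * (lam / t) = 1 := by field_simp
      rw [this, one_smul, div_mul_cancel₀ _ hl.ne']
    have e3 : inner ℝ ν (slice ν x₀ (t, z) - x₀) = t := by
      rw [inner_sub_right, inner_slice hν]; ring
    have hiff : slice ν x₀ (t, z) ∈ cone ν x₀ lam e ↔ (lam / t) • z ∈ e' := by
      simp only [cone, Set.mem_ofPred_eq, e3, e1, he']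
      exact ⟨fun h => h.2, fun h => ⟨ht, h⟩⟩
    by_cases hz : (lam / t) • z ∈ e'
    · rw [Set.indicator_of_mem (hiff.2 hz), Set.indicator_of_mem hz, e2]
    · rw [Set.indicator_of_notMem (fun h => hz (hiff.1 h)), Set.indicator_of_notMem hz]
  rw [integral_congr_ae (ae_of_all _ h1), Measure.integral_comp_smul, finrank_perp hν, finrank_euclideanSpace_fin, integral_const_mul,
    abs_of_pos (by have := ht.1; positivity), smul_eq_mul]
  congr 1
  · rw [← inv_pow, inv_div]
  · exact integral_indicator (measurableSet_slice_preimage x₀ lam hem)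

lemma integrableOn_of_continuous {X : Type*} [PseudoMetricSpace X] [ProperSpace X]
    [MeasurableSpace X] [OpensMeasurableSpace X] {μ : Measure X} [IsFiniteMeasureOnCompacts μ]
    {s : Set X} (hs : Bornology.IsBounded s) {f : X → ℝ} (hf : Continuous f) :
    IntegrableOn f s μ :=
  (hf.continuousOn.integrableOn_compact' (Metric.isCompact_of_isClosed_isBounded isClosed_closure
    hs.closure) isClosed_closure.measurableSet).mono_set subset_closure

/-- Integration in polar coordinates over a cone. -/
lemma integral_cone (hd : 1 ≤ d) {ν : E d} (hν : ‖ν‖ = 1) (x₀ : E d) {lam : ℝ} (hl : 0 < lam)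
    {e : Set (E d)} (he : ∀ x ∈ e, inner ℝ ν x = inner ℝ ν x₀ + lam) (hem : MeasurableSet e)
    (hb : Bornology.IsBounded e) {g : E d → ℝ} (hg : ContDiff ℝ 1 g) :
    ∫ x in cone ν x₀ lam e, (d * g x + fderiv ℝ g x (x - x₀)) = lam * ∫ x, g x ∂(surf e) := by
  set F : E d → ℝ := fun x => d * g x + fderiv ℝ g x (x - x₀) with hF
  have hgc := hg.continuous
  have hfc : Continuous F := by
    have := hg.continuous_fderiv one_ne_zero
    fun_prop
  have hcm := measurableSet_cone ν x₀ lam hem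
  have hint : Integrable ((cone ν x₀ lam e).indicator F) := by
    rw [integrable_indicator_iff hcm]
    exact integrableOn_of_continuous (isBounded_cone ν x₀ hb) hfc
  set e' := {z : Perp ν | slice ν x₀ (lam, z) ∈ e} with he'
  have h1 : ∫ x in cone ν x₀ lam e, F x
      = ∫ t, ∫ z : Perp ν, (cone ν x₀ lam e).indicator F (slice ν x₀ (t, z)) := by
    rw [← integral_indicator hcm,
      ← (measurePreserving_slice hν x₀).integral_comp (measurableEmbedding_slice hν x₀)]
    exact integral_prod _ (((measurePreserving_slice hν x₀).integrable_comp_emb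
      (measurableEmbedding_slice hν x₀)).2 hint)
  have h2 : ∀ t, ∫ z : Perp ν, (cone ν x₀ lam e).indicator F (slice ν x₀ (t, z))
      = (Set.Ioo 0 lam).indicator (fun t => ∫ z in e',
          (t / lam) ^ (d - 1) * F (x₀ + (t / lam) • (lam • ν + (z : E d)))) t := by
    intro t
    by_cases ht : t ∈ Set.Ioo 0 lam
    · rw [Set.indicator_of_mem ht]
      exact integral_cone_slice hν x₀ hem F ht
    · rw [Set.indicator_of_notMem ht]
      have : ∀ z : Perp ν, (cone ν x₀ lam e).indicator F (slice ν x₀ (t, z)) = 0 := by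
        intro z
        refine Set.indicator_of_notMem (fun h => ht ?_) _
        have h3 := h.1
        rw [inner_sub_right, inner_slice hν] at h3
        simpa using h3
      simp only [this, integral_zero]
  rw [h1, integral_congr_ae (ae_of_all _ h2), integral_indicator measurableSet_Ioo,
    integral_integral_swap]
  · rw [integral_surf hν x₀ lam he hem, ← integral_const_mul]
    refine integral_congr_ae (ae_of_all _ fun z => ?_)
    set w : E d := lam • ν + (z : E d) with hw
    -- The combination `d g + ∇g · (x - x₀)`, multiplied by the Jacobian, is an exact derivative
    -- along every ray from the apex. Only the endpoint on the base contributes.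
    have hder : ∀ t : ℝ, HasDerivAt (fun t : ℝ => lam * ((t / lam) ^ d * g (x₀ + (t / lam) • w)))
        ((t / lam) ^ (d - 1) * F (x₀ + (t / lam) • w)) t := by
      intro t
      have a1 : HasDerivAt (fun t : ℝ => t / lam) (1 / lam) t := (hasDerivAt_id t).div_const lam
      have a2 : HasDerivAt (fun t : ℝ => x₀ + (t / lam) • w) ((1 / lam) • w) t :=
        (a1.smul_const w).const_add x₀
      have a3 := ((hg.differentiable one_ne_zero (x₀ + (t / lam) • w)).hasFDerivAt).comp_hasDerivAt
        t a2
      have a4 := ((a1.pow d).mul a3).const_mul lam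
      refine HasDerivAt.congr_deriv
        (f := fun t : ℝ => lam * ((t / lam) ^ d * g (x₀ + (t / lam) • w))) a4 ?_
      have hpow : (t / lam) ^ d = (t / lam) ^ (d - 1) * (t / lam) := by
        rw [← pow_succ, Nat.sub_add_cancel hd]
      simp only [Function.comp, Pi.pow_apply, hpow, hF, add_sub_cancel_left, map_smul, smul_eq_mul]
      field_simp
    show ∫ t in Set.Ioo 0 lam, (t / lam) ^ (d - 1) * F (x₀ + (t / lam) • w) = _
    rw [← integral_Ioc_eq_integral_Ioo, ← intervalIntegral.integral_of_le hl.le,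
      intervalIntegral.integral_eq_sub_of_hasDerivAt (fun t _ => hder t)]
    · have hd0 : d ≠ 0 := by omega
      simp [hl.ne', hd0, hw, slice]
    · exact Continuous.intervalIntegrable (by fun_prop) _ _
  · rw [Measure.prod_restrict]
    refine integrableOn_of_continuous
      ((Metric.isBounded_Ioo 0 lam).prod (isBounded_slice_preimage x₀ lam hb)) ?_
    simp only [Function.uncurry_def]
    fun_prop

end Cone

end WG

namespace WG

/-! ### The divergence theorem on a convex polytope -/

namespace ConvexPolytope

variable {d : ℕ} (T : ConvexPolytope d)

/-- The distance to the hyperplane of the `i`-th face. -/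
noncomputable def lam (i : Fin T.numFaces) (x : E d) : ℝ := T.offset i - inner ℝ (T.normal i) x

variable {T}

lemma mem_carrier {x : E d} : x ∈ T.carrier ↔ ∀ i, 0 < T.lam i x := by
  simp [carrier, lam]

lemma mem_face {i : Fin T.numFaces} {x : E d} :
    x ∈ T.face i ↔ T.lam i x = 0 ∧ ∀ l, 0 ≤ T.lam l x := by
  simp only [face, lam, Set.mem_ofPred_eq, sub_nonneg, sub_eq_zero]
  exact and_congr_left fun _ => eq_comm

lemma lam_sub (i : Fin T.numFaces) (x y : E d) :
    T.lam i x - T.lam i y = inner ℝ (T.normal i) (y - x) := by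
  simp [lam, inner_sub_right]

lemma lam_sub_le (i : Fin T.numFaces) (x y : E d) : T.lam i x - T.lam i y ≤ ‖x - y‖ := by
  rw [lam_sub]
  refine (real_inner_le_norm _ _).trans ?_
  rw [T.norm_normal, one_mul, norm_sub_rev]

lemma lam_comb (i : Fin T.numFaces) (x y : E d) (s : ℝ) :
    T.lam i (x + s • (y - x)) = (1 - s) * T.lam i x + s * T.lam i y := by
  simp only [lam, inner_add_right, inner_smul_right, inner_sub_right]
  ring

lemma continuous_lam (i : Fin T.numFaces) : Continuous (T.lam i) := by
  unfold lam; fun_prop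

variable (T)

lemma isOpen_carrier : IsOpen T.carrier := by
  have : T.carrier = ⋂ i, {x | 0 < T.lam i x} := by
    ext x; simp [mem_carrier]
  rw [this]
  exact isOpen_iInter_of_finite fun i => isOpen_lt continuous_const (continuous_lam i)

lemma measurableSet_carrier : MeasurableSet T.carrier := T.isOpen_carrier.measurableSet

lemma isBounded_carrier : Bornology.IsBounded T.carrier := T.bounded

lemma carrier_nonempty : T.carrier.Nonempty := T.nonempty

lemma isClosed_face (i : Fin T.numFaces) : IsClosed (T.face i) := by
  have : T.face i = {x | T.lam i x = 0} ∩ ⋂ l, {x | 0 ≤ T.lam l x} := by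
    ext x; simp [mem_face]
  rw [this]
  exact (isClosed_eq (continuous_lam i) continuous_const).inter
    (isClosed_iInter fun l => isClosed_le continuous_const (continuous_lam l))

lemma measurableSet_face (i : Fin T.numFaces) : MeasurableSet (T.face i) :=
  (T.isClosed_face i).measurableSet

variable {T}

lemma comb_mem_carrier {x y : E d} (hx : x ∈ T.carrier) (hy : ∀ i, 0 ≤ T.lam i y) {s : ℝ}
    (hs : s ∈ Set.Ico (0 : ℝ) 1) : x + s • (y - x) ∈ T.carrier := by
  rw [mem_carrier] at hx ⊢
  intro i
  rw [lam_comb]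
  have := mul_pos (sub_pos.2 hs.2) (hx i)
  have := mul_nonneg hs.1 (hy i)
  linarith

lemma convex_carrier : Convex ℝ T.carrier := by
  have : T.carrier = ⋂ i, {x | inner ℝ (T.normal i) x < T.offset i} := by
    ext x; simp [carrier]
  rw [this]
  refine convex_iInter fun i => ?_
  exact convex_halfSpace_lt (innerSL ℝ (T.normal i)).toLinearMap.isLinear _

lemma mem_closure_carrier {y : E d} (hy : ∀ i, 0 ≤ T.lam i y) : y ∈ closure T.carrier := by
  obtain ⟨x, hx⟩ := T.carrier_nonempty
  have h1 : Filter.Tendsto (fun s : ℝ => x + s • (y - x)) (𝓝[<] 1) (𝓝 (x + (1 : ℝ) • (y - x))) :=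
    (Continuous.tendsto (by fun_prop) 1).mono_left nhdsWithin_le_nhds
  rw [one_smul, add_sub_cancel] at h1
  refine mem_closure_of_tendsto h1 ?_
  filter_upwards [Ico_mem_nhdsLT (zero_lt_one' ℝ)] with s hs
  exact comb_mem_carrier hx hy hs

lemma face_subset_closure (i : Fin T.numFaces) : T.face i ⊆ closure T.carrier :=
  fun _ hy => mem_closure_carrier (mem_face.1 hy).2

lemma isBounded_face (i : Fin T.numFaces) : Bornology.IsBounded (T.face i) :=
  T.isBounded_carrier.closure.subset (face_subset_closure i)

lemma inner_eq_of_mem_face {i : Fin T.numFaces} {x : E d} (hx : x ∈ T.face i) (x₀ : E d) :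
    inner ℝ (T.normal i) x = inner ℝ (T.normal i) x₀ + T.lam i x₀ := by
  have := (mem_face.1 hx).1
  simp only [lam] at *
  linarith

instance isFiniteMeasure_surf_face (i : Fin T.numFaces) : IsFiniteMeasure (surf (T.face i)) := by
  have h := surf_eq_map (T.norm_normal i) 0 (T.lam i 0)
    (fun x hx => inner_eq_of_mem_face hx 0) (T.measurableSet_face i)
  rw [h]
  have : IsFiniteMeasure ((volume : Measure (Perp (T.normal i))).restrict
      {z | slice (T.normal i) 0 (T.lam i 0, z) ∈ T.face i}) :=
    isFiniteMeasure_restrict.2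
      (isBounded_slice_preimage 0 (T.lam i 0) (isBounded_face i)).measure_lt_top.ne
  infer_instance

lemma ae_surf_mem (i : Fin T.numFaces) : ∀ᵐ x ∂(surf (T.face i)), x ∈ T.face i :=
  ae_restrict_mem (T.measurableSet_face i)

lemma memLp_surf {f : E d → ℝ} (hf : Continuous f) (i : Fin T.numFaces) :
    MemLp f 2 (surf (T.face i)) := memLp_of_continuous (isBounded_face i) (ae_surf_mem i) hf

lemma polyMem_surf (i : Fin T.numFaces) : PolyMem (surf (T.face i)) :=
  fun p => memLp_surf (continuous_ev p) i

lemma memLp_carrier {f : E d → ℝ} (hf : Continuous f) : MemLp f 2 (volume.restrict T.carrier) :=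
  memLp_volume_of_continuous T.isBounded_carrier T.measurableSet_carrier hf

lemma polyMem_carrier : PolyMem (volume.restrict T.carrier) :=
  polyMem_volume T.isBounded_carrier T.measurableSet_carrier

instance isFiniteMeasure_carrier : IsFiniteMeasure (volume.restrict T.carrier) :=
  isFiniteMeasure_restrict.2 T.isBounded_carrier.measure_lt_top.ne

/-- The cone over the `i`-th face. -/
noncomputable def faceCone (T : ConvexPolytope d) (x₀ : E d) (i : Fin T.numFaces) : Set (E d) :=
  cone (T.normal i) x₀ (T.lam i x₀) (T.face i)

lemma faceCone_subset {x₀ : E d} (hx₀ : x₀ ∈ T.carrier) (i : Fin T.numFaces) :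
    T.faceCone x₀ i ⊆ T.carrier := by
  intro x hx
  obtain ⟨⟨h1, h2⟩, h3⟩ := hx
  have hl := h1.trans h2
  have := comb_mem_carrier hx₀ (mem_face.1 h3).2
    (s := inner ℝ (T.normal i) (x - x₀) / T.lam i x₀)
    ⟨(div_pos h1 hl).le, (div_lt_one hl).2 h2⟩
  rw [add_sub_cancel_left, smul_smul, div_mul_div_cancel₀ hl.ne', div_self h1.ne', one_smul,
    add_sub_cancel] at this
  exact this

/-- Otherwise the whole ray from `x₀` through `x` would stay in the polytope, which is bounded. -/
lemma exists_inner_pos {x₀ x : E d} (hx₀ : x₀ ∈ T.carrier) (hx : x ≠ x₀) :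
    ∃ i, 0 < inner ℝ (T.normal i) (x - x₀) := by
  by_contra! hcon
  obtain ⟨R, hR⟩ := T.isBounded_carrier.subset_closedBall x₀
  have hpos : 0 < ‖x - x₀‖ := norm_pos_iff.2 (sub_ne_zero.2 hx)
  have hmem : x₀ + ((|R| + 1) / ‖x - x₀‖) • (x - x₀) ∈ T.carrier := by
    rw [mem_carrier] at hx₀ ⊢
    intro i
    have h1 := hx₀ i
    have h2 : (|R| + 1) / ‖x - x₀‖ * inner ℝ (T.normal i) (x - x₀) ≤ 0 :=
      mul_nonpos_of_nonneg_of_nonpos (by positivity) (hcon i)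
    simp only [lam, inner_add_right, inner_smul_right] at h1 ⊢
    linarith
  have := hR hmem
  rw [Metric.mem_closedBall, dist_eq_norm, add_sub_cancel_left, norm_smul, Real.norm_eq_abs,
    abs_of_pos (by positivity), div_mul_cancel₀ _ hpos.ne'] at this
  linarith [le_abs_self R]

/-- The ray from `x₀` through `x` leaves the polytope through the face `i` for which the ratio of
`⟨n_i, x - x₀⟩` to the distance of `x₀` from that face is largest. -/
lemma carrier_subset_iUnion_faceCone {x₀ : E d} (hx₀ : x₀ ∈ T.carrier) :
    T.carrier ⊆ insert x₀ (⋃ i, T.faceCone x₀ i) := by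
  intro x hx
  by_cases hxx : x = x₀
  · exact Or.inl hxx
  right
  obtain ⟨i₀, hi₀⟩ := exists_inner_pos hx₀ hxx
  have hl := mem_carrier.1 hx₀
  obtain ⟨i, -, hi⟩ := Finset.exists_max_image Finset.univ
    (fun i => inner ℝ (T.normal i) (x - x₀) / T.lam i x₀) ⟨i₀, Finset.mem_univ _⟩
  have hpos : 0 < inner ℝ (T.normal i) (x - x₀) / T.lam i x₀ :=
    (div_pos hi₀ (hl i₀)).trans_le (hi i₀ (Finset.mem_univ _))
  have hpos' : 0 < inner ℝ (T.normal i) (x - x₀) := by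
    have := mul_pos hpos (hl i)
    rwa [div_mul_cancel₀ _ (hl i).ne'] at this
  refine Set.mem_iUnion.2 ⟨i, ⟨hpos', ?_⟩, ?_⟩
  · have h1 := mem_carrier.1 hx i
    have h2 := lam_sub i x₀ x
    linarith
  · have hlam : ∀ l, T.lam l (x₀ + (T.lam i x₀ / inner ℝ (T.normal i) (x - x₀)) • (x - x₀))
        = T.lam l x₀ - T.lam i x₀ / inner ℝ (T.normal i) (x - x₀)
          * inner ℝ (T.normal l) (x - x₀) := by
      intro l
      simp only [lam, inner_add_right, inner_smul_right]
      ring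
    rw [mem_face]
    refine ⟨?_, fun l => ?_⟩
    · rw [hlam, div_mul_cancel₀ _ hpos'.ne', sub_self]
    · rw [hlam, sub_nonneg]
      have := hi l (Finset.mem_univ _)
      rw [div_le_div_iff₀ (hl l) (hl i)] at this
      rw [div_mul_eq_mul_div, div_le_iff₀ hpos']
      linarith

lemma faceCone_inter_subset {x₀ : E d} (hx₀ : x₀ ∈ T.carrier) (i l : Fin T.numFaces) {x : E d}
    (hx : x ∈ T.faceCone x₀ i) :
    inner ℝ (T.normal l) (x - x₀) / T.lam l x₀ ≤ inner ℝ (T.normal i) (x - x₀) / T.lam i x₀ := by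
  obtain ⟨⟨h1, h2⟩, h3⟩ := hx
  have hl := mem_carrier.1 hx₀
  have h4 := (mem_face.1 h3).2 l
  simp only [lam, inner_add_right, inner_smul_right] at h4
  rw [div_le_div_iff₀ (hl l) (hl i)]
  have h5 : T.lam i x₀ / inner ℝ (T.normal i) (x - x₀) * inner ℝ (T.normal l) (x - x₀)
      ≤ T.lam l x₀ := by simp only [lam] at *; linarith
  rw [div_mul_eq_mul_div, div_le_iff₀ h1] at h5
  linarith

/-- On the overlap of two cones the two exit ratios are equal by `faceCone_inter_subset`. This
confines the overlap to a hyperplane, nondegenerate because different faces have different normals.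
-/
lemma aedisjoint_faceCone {x₀ : E d} (hx₀ : x₀ ∈ T.carrier) :
    Pairwise fun i l => AEDisjoint volume (T.faceCone x₀ i) (T.faceCone x₀ l) := by
  intro i l hil
  have hl := mem_carrier.1 hx₀
  set w : E d := (T.lam i x₀)⁻¹ • T.normal i - (T.lam l x₀)⁻¹ • T.normal l with hw
  have hw0 : w ≠ 0 := by
    intro h
    rw [hw, sub_eq_zero] at h
    have h2 := congrArg norm h
    rw [norm_smul, norm_smul, T.norm_normal, T.norm_normal, mul_one, mul_one, Real.norm_eq_abs,
      Real.norm_eq_abs, abs_of_pos (inv_pos.2 (hl i)), abs_of_pos (inv_pos.2 (hl l))] at h2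
    rw [h2] at h
    exact hil (T.normal_injective (smul_right_injective _ (inv_pos.2 (hl l)).ne' h))
  refine measure_mono_null (fun x hx => ?_) (volume_hyperplane hw0 (inner ℝ w x₀))
  have h1 := faceCone_inter_subset hx₀ i l hx.1
  have h2 := faceCone_inter_subset hx₀ l i hx.2
  have h3 := le_antisymm h1 h2
  simp only [Set.mem_ofPred_eq, hw, inner_sub_left, inner_sub_right, inner_smul_left] at h3 ⊢
  simp only [div_eq_inv_mul] at h3
  simp
  linarith

/-- This is the divergence theorem for the radial field `g(x) (x - x₀)`: the normal component of `x
- x₀` is constant on each face, equal to the distance of `x₀`, and the cones over the faces fill the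
polytope up to a null set. -/
lemma integral_radial (hd : 1 ≤ d) {x₀ : E d} (hx₀ : x₀ ∈ T.carrier) {g : E d → ℝ}
    (hg : ContDiff ℝ 1 g) :
    ∫ x in T.carrier, (d * g x + fderiv ℝ g x (x - x₀))
      = ∑ i, T.lam i x₀ * ∫ x, g x ∂(surf (T.face i)) := by
  have hl := mem_carrier.1 hx₀
  have hsub : (⋃ i, T.faceCone x₀ i) ⊆ T.carrier := Set.iUnion_subset fun i =>
    faceCone_subset hx₀ i
  have : Nonempty (Fin d) := ⟨⟨0, hd⟩⟩
  have hae : T.carrier =ᵐ[volume] ⋃ i, T.faceCone x₀ i := by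
    refine (Filter.EventuallyLE.antisymm ?_ hsub.eventuallyLE)
    have h0 : ∀ᵐ x : E d, x ≠ x₀ := by
      rw [ae_iff]; simp
    filter_upwards [h0] with x hx h
    exact (carrier_subset_iUnion_faceCone hx₀ h).resolve_left hx
  have hcont : Continuous fun x => (d * g x + fderiv ℝ g x (x - x₀)) := by
    have h1 := hg.continuous
    have h2 := hg.continuous_fderiv one_ne_zero
    fun_prop
  rw [setIntegral_congr_set hae, integral_iUnion_ae (s := T.faceCone x₀)
    (fun i => (measurableSet_cone _ _ _ (T.measurableSet_face i)).nullMeasurableSet)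
    (aedisjoint_faceCone hx₀)
    (integrableOn_of_continuous (T.isBounded_carrier.subset hsub) hcont), tsum_fintype]
  refine Finset.sum_congr rfl fun i _ => ?_
  exact integral_cone hd (T.norm_normal i) x₀ (hl i) (fun x hx => inner_eq_of_mem_face hx x₀)
    (T.measurableSet_face i) (isBounded_face i) hg

/-- The divergence theorem on a convex polytope. -/
theorem integral_fderiv (hd : 1 ≤ d) {g : E d → ℝ} (hg : ContDiff ℝ 1 g) (v : E d) :
    ∫ x in T.carrier, fderiv ℝ g x v
      = ∑ i, inner ℝ (T.normal i) v * ∫ x, g x ∂(surf (T.face i)) := by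
  obtain ⟨x₀, hx₀⟩ := T.carrier_nonempty
  obtain ⟨ε, hε, hball⟩ := Metric.isOpen_iff.1 T.isOpen_carrier x₀ hx₀
  obtain ⟨s, hs, hsv⟩ : ∃ s : ℝ, 0 < s ∧ ‖s • v‖ < ε := by
    refine ⟨ε / (‖v‖ + 1), by positivity, ?_⟩
    rw [norm_smul, Real.norm_eq_abs, abs_of_pos (by positivity), div_mul_eq_mul_div,
      div_lt_iff₀ (by positivity)]
    nlinarith [norm_nonneg v]
  have hx₁ : x₀ - s • v ∈ T.carrier := hball (by
    rw [Metric.mem_ball, dist_eq_norm]; simpa using hsv)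
  have h0 := integral_radial hd hx₀ hg
  have h1 := integral_radial hd hx₁ hg
  have hgc := hg.continuous
  have hgf := hg.continuous_fderiv one_ne_zero
  have hi : ∀ y, IntegrableOn (fun x => (d * g x + fderiv ℝ g x (x - y))) T.carrier := fun y =>
    integrableOn_of_continuous T.isBounded_carrier (by fun_prop)
  -- The radial identities with apexes `x₀ - s v` and `x₀` are subtracted. The two radial fields
  -- differ by the constant vector `s v`, and the distances to the faces by `s ⟨n_i, v⟩`.
  have h2 : ∫ x in T.carrier, s * fderiv ℝ g x v
      = ∑ i, (T.lam i (x₀ - s • v) - T.lam i x₀) * ∫ x, g x ∂(surf (T.face i)) := by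
    simp only [sub_mul, Finset.sum_sub_distrib]
    rw [← h0, ← h1, ← integral_sub (hi _) (hi _)]
    congr 1
    ext x
    rw [show x - (x₀ - s • v) = (x - x₀) + s • v by abel, map_add, map_smul, smul_eq_mul]
    ring
  rw [integral_const_mul] at h2
  have h3 : ∀ i, T.lam i (x₀ - s • v) - T.lam i x₀ = s * inner ℝ (T.normal i) v := by
    intro i
    rw [lam_sub, sub_sub_cancel, inner_smul_right]
  simp only [h3, mul_assoc] at h2
  rw [← Finset.mul_sum] at h2
  exact mul_left_cancel₀ hs.ne' h2

end ConvexPolytope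

end WG

namespace WG

/-! ### Geometry of shape regular elements -/

/-- Shape regularity of one element. -/
structure Regular {d : ℕ} (T : ConvexPolytope d) (n : ℕ) (ρv ρe κ δ : ℝ) : Prop where
  numFaces_le : T.numFaces ≤ n
  volume_ge : ρv * T.size ^ d ≤ (volume T.carrier).toReal
  face_ge : ∀ i, ρe * Metric.diam (T.face i) ^ (d - 1)
    ≤ ((μHE[d - 1] : Measure (E d)) (T.face i)).toReal
  diam_face_ge : ∀ i, κ * T.size ≤ Metric.diam (T.face i)
  angle : ∀ i i', i ≠ i' → inner ℝ (T.normal i) (T.normal i') ≤ 1 - δ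

lemma ShapeRegular.regular {d : ℕ} {Ω : Set (E d)} {M : Mesh d Ω} {n : ℕ} {ρv ρe κ δ : ℝ}
    (h : ShapeRegular M n ρv ρe κ δ) (t : Fin M.numElem) : Regular (M.elem t) n ρv ρe κ δ :=
  ⟨h.numFaces_le t, h.volume_ge t, h.face_ge t, h.diam_face_ge t, h.angle t⟩

namespace ConvexPolytope

variable {d : ℕ} {T : ConvexPolytope d}

lemma norm_sub_le_size {x y : E d} (hx : x ∈ closure T.carrier) (hy : y ∈ closure T.carrier) :
    ‖x - y‖ ≤ T.size := by
  rw [size, ← Metric.diam_closure, ← dist_eq_norm]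
  exact Metric.dist_le_diam_of_mem T.isBounded_carrier.closure hx hy

lemma size_pos (hd : 1 ≤ d) : 0 < T.size := by
  obtain ⟨x, hx⟩ := T.carrier_nonempty
  obtain ⟨ε, hε, hball⟩ := Metric.isOpen_iff.1 T.isOpen_carrier x hx
  have hy : x + (ε / 2) • unitVec ⟨0, hd⟩ ∈ T.carrier := hball (by
    rw [Metric.mem_ball, dist_eq_norm, add_sub_cancel_left, norm_smul, unitVec,
      PiLp.norm_single, Real.norm_eq_abs, abs_of_pos (by positivity)]
    simp; linarith)
  have h := norm_sub_le_size (subset_closure hy) (subset_closure hx)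
  rw [add_sub_cancel_left, norm_smul, unitVec,
      PiLp.norm_single, Real.norm_eq_abs, abs_of_pos (by positivity)] at h
  simp at h; linarith

lemma face_nonempty (i : Fin T.numFaces) : (T.face i).Nonempty :=
  nonempty_of_measure_ne_zero (T.face_pos i).ne'

lemma lam_le_size {x : E d} (hx : x ∈ closure T.carrier) (i : Fin T.numFaces) :
    T.lam i x ≤ T.size := by
  obtain ⟨y, hy⟩ := face_nonempty i
  have h1 := lam_sub_le i x y
  rw [(mem_face.1 hy).1] at h1
  linarith [norm_sub_le_size hx (face_subset_closure i hy)]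

end ConvexPolytope

open ConvexPolytope

/-- If every point were closer than `c h` to some face, at most `n` slabs of thickness `c h` would
cover the polytope, and their total volume is too small for the lower volume bound. -/
lemma exists_inball (d n : ℕ) (hd : 1 ≤ d) {ρv : ℝ} (hρv : 0 < ρv) :
    ∃ c : ℝ, 0 < c ∧ ∀ (T : ConvexPolytope d), T.numFaces ≤ n →
      ρv * T.size ^ d ≤ (volume T.carrier).toReal →
      ∃ x₀ ∈ T.carrier, ∀ l, c * T.size ≤ T.lam l x₀ := by
  set β : ℝ := (ballVol (d - 1)).toReal with hβ
  have hβ0 : 0 ≤ β := ENNReal.toReal_nonneg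
  -- With this `c` the slabs have total volume at most `n c β h^d`, which is less than `ρv h^d / 2`.
  refine ⟨ρv / (2 * (n + 1) * (β + 1)), by positivity, fun T hn hv => ?_⟩
  set c := ρv / (2 * (n + 1) * (β + 1)) with hc
  have hc0 : 0 < c := by positivity
  have hs := T.size_pos hd
  by_contra! hcon
  obtain ⟨p, hp⟩ := T.carrier_nonempty
  have hslab : ∀ l : Fin T.numFaces, volume {x | x ∈ T.carrier ∧ T.lam l x < c * T.size}
      ≤ ENNReal.ofReal (c * T.size ^ d * β) := by
    intro l
    refine (measure_mono (t := {x | x ∈ Metric.closedBall p T.size ∧ inner ℝ (T.normal l) x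
      ∈ Set.Icc (T.offset l - c * T.size) (T.offset l)}) ?_).trans ?_
    · rintro x ⟨hx, hx'⟩
      refine ⟨?_, ?_⟩
      · rw [Metric.mem_closedBall, dist_eq_norm]
        exact norm_sub_le_size (subset_closure hx) (subset_closure hp)
      · have := mem_carrier.1 hx l
        simp only [lam] at this hx'
        constructor <;> linarith
    · refine (volume_slab_le (T.norm_normal l) p hs.le (by nlinarith)).trans ?_
      rw [finrank_euclideanSpace_fin, sub_sub_cancel, mul_assoc c, ← pow_succ',
        Nat.sub_add_cancel hd]
  have hcover : T.carrier ⊆ ⋃ l, {x | x ∈ T.carrier ∧ T.lam l x < c * T.size} := by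
    intro x hx
    obtain ⟨l, hl⟩ := hcon x hx
    exact Set.mem_iUnion.2 ⟨l, hx, hl⟩
  have h1 : volume T.carrier ≤ ENNReal.ofReal (n * (c * T.size ^ d * β)) := by
    refine (measure_mono hcover).trans ((measure_iUnion_fintype_le _ _).trans ?_)
    refine (Finset.sum_le_sum fun l _ => hslab l).trans ?_
    rw [Finset.sum_const, Finset.card_univ, Fintype.card_fin, nsmul_eq_mul,
      ENNReal.ofReal_mul (Nat.cast_nonneg n), ENNReal.ofReal_natCast]
    gcongr
  have h2 : (volume T.carrier).toReal ≤ n * (c * T.size ^ d * β) :=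
    ENNReal.toReal_le_of_le_ofReal (by positivity) h1
  have h3 : ρv * T.size ^ d ≤ (n * c * β) * T.size ^ d := by
    calc _ ≤ _ := hv.trans h2
      _ = _ := by ring
  have h4 := le_of_mul_le_mul_right h3 (by positivity)
  have h5 : c * (2 * (n + 1) * (β + 1)) = ρv := by rw [hc]; field_simp
  nlinarith [mul_nonneg hc0.le hβ0, mul_nonneg hc0.le (Nat.cast_nonneg (α := ℝ) n),
    mul_nonneg (mul_nonneg hc0.le (Nat.cast_nonneg (α := ℝ) n)) hβ0]

lemma volume_slice_face {d : ℕ} {T : ConvexPolytope d} (i : Fin T.numFaces) (x₀ : E d) :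
    volume {z : Perp (T.normal i) | slice (T.normal i) x₀ (T.lam i x₀, z) ∈ T.face i}
      = (μHE[d - 1] : Measure (E d)) (T.face i) := by
  have h := surf_eq_map (T.norm_normal i) x₀ (T.lam i x₀)
    (fun x hx => inner_eq_of_mem_face hx x₀) (T.measurableSet_face i)
  have h2 := congrArg (fun μ : Measure (E d) => μ Set.univ) h
  rw [surf, Measure.restrict_apply_univ, Measure.map_apply
    (isometry_slice_const _ _ _).continuous.measurable MeasurableSet.univ, Set.preimage_univ,
    Measure.restrict_apply_univ] at h2
  exact h2.symm

/-- Along the `i`-th face the distance to the `l`-th one varies only through the tangential part `τ`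
of the `l`-th normal, so `‖τ‖` is its slope there. -/
lemma lam_eq_of_mem_face {d : ℕ} {T : ConvexPolytope d} {i : Fin T.numFaces} (l : Fin T.numFaces)
    {x₀ y : E d} (hy : y ∈ T.face i) {τ : E d}
    (hτ : τ = T.normal l - inner ℝ (T.normal i) (T.normal l) • T.normal i) :
    T.lam l y = T.lam l x₀ - inner ℝ (T.normal i) (T.normal l) * T.lam i x₀
      - inner ℝ τ (y - x₀) := by
  have h1 := inner_eq_of_mem_face hy x₀
  have h2 : inner ℝ τ (y - x₀) = inner ℝ (T.normal l) (y - x₀)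
      - inner ℝ (T.normal i) (T.normal l) * inner ℝ (T.normal i) (y - x₀) := by
    rw [hτ, inner_sub_left, inner_smul_left]; simp
  rw [h2, inner_sub_right (T.normal i), h1]
  simp only [lam, inner_sub_right]
  ring

/-- Slabs are counted again, now inside the face. If the slope `‖τ‖` of the distance to the face `l`
is at least `s₀`, the points close to `l` form a thin slab. If the slope is small, the two normals
are nearly parallel; the angle condition excludes nearly equal normals, and for nearly opposite ones
the inscribed point `x₀` keeps the two faces apart, so no point is close to `l`. -/
lemma exists_face_inball (d n : ℕ) (hd : 2 ≤ d) {ρv ρe κ δ : ℝ} (hρv : 0 < ρv) (hρe : 0 < ρe)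
    (hκ : 0 < κ) (hδ : 0 < δ) :
    ∃ c : ℝ, 0 < c ∧ ∀ (T : ConvexPolytope d), Regular T n ρv ρe κ δ → ∀ i,
      ∃ y₀ ∈ T.face i, ∀ l, l ≠ i → c * T.size ≤ T.lam l y₀ := by
  obtain ⟨c₀, hc₀, hball⟩ := exists_inball d n (by omega) hρv
  set β : ℝ := (ballVol (d - 1 - 1)).toReal with hβ
  have hβ0 : 0 ≤ β := ENNReal.toReal_nonneg
  -- The bound `√δ` makes a small slope force `α < 0`: for `0 ≤ α ≤ 1 - δ` the squared slope `1 -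
  -- α²` is at least `δ`. The bound `c₀ / 2` then leaves a distance of at least `c₀ h / 2`, which
  -- exceeds `c h`.
  set s₀ : ℝ := min (c₀ / 2) (min (Real.sqrt δ) 1) with hs₀
  have hs0 : 0 < s₀ := by positivity
  set c : ℝ := min (c₀ / 4) (s₀ * (ρe * κ ^ (d - 1)) / (2 * (n + 1) * (β + 1))) with hc
  have hc0 : 0 < c := by positivity
  refine ⟨c, hc0, fun T hT i => ?_⟩
  obtain ⟨x₀, hx₀, hx₀l⟩ := hball T hT.numFaces_le hT.volume_ge
  have hs := T.size_pos (by omega)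
  have hx₀' := mem_carrier.1 hx₀
  by_contra! hcon
  set ν := T.normal i with hν
  set e' := {z : Perp ν | slice ν x₀ (T.lam i x₀, z) ∈ T.face i} with he'
  have hslab : ∀ l : Fin T.numFaces,
      volume {z : Perp ν | z ∈ e' ∧ l ≠ i ∧ T.lam l (slice ν x₀ (T.lam i x₀, z)) < c * T.size}
      ≤ ENNReal.ofReal (c / s₀ * T.size ^ (d - 1) * β) := by
    intro l
    by_cases hli : l = i
    · simp [hli]
    set α : ℝ := inner ℝ ν (T.normal l) with hα
    have hnn : ‖ν‖ = 1 := T.norm_normal i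
    let τ : Perp ν := ⟨T.normal l - α • ν, by
      rw [Submodule.mem_orthogonal_singleton_iff_inner_right]
      simp [inner_sub_right, inner_smul_right, hnn, hα]⟩
    have hτn : ‖τ‖ ^ 2 = 1 - α ^ 2 := by
      have : ‖τ‖ = ‖T.normal l - α • ν‖ := rfl
      rw [this, norm_sub_sq_real, inner_smul_right, real_inner_comm, ← hα, norm_smul, hnn,
        T.norm_normal, mul_one, Real.norm_eq_abs, sq_abs]
      ring
    have hlamz : ∀ z ∈ e', T.lam l (slice ν x₀ (T.lam i x₀, z))
        = T.lam l x₀ - α * T.lam i x₀ - inner ℝ (τ : Perp ν) z := by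
      intro z hz
      rw [lam_eq_of_mem_face l (x₀ := x₀) hz (τ := τ) rfl]
      congr 1
      rw [slice, add_sub_cancel_left, inner_add_right, inner_smul_right, real_inner_comm,
        inner_perp, mul_zero, zero_add]
      rfl
    have hznorm : ∀ z ∈ e', ‖z‖ ≤ T.size := by
      intro z hz
      have h1 := norm_sub_le_size (face_subset_closure i hz) (subset_closure hx₀)
      rw [slice, add_sub_cancel_left] at h1
      have h3 : ‖(z : E d)‖ ^ 2 ≤ ‖T.lam i x₀ • ν + (z : E d)‖ ^ 2 := by
        rw [norm_add_sq_real, inner_smul_left, inner_perp]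
        simp
      exact ((sq_le_sq₀ (norm_nonneg _) (norm_nonneg _)).1 h3).trans h1
    rcases lt_or_ge ‖τ‖ s₀ with hτ | hτ
    · have hempty : {z : Perp ν | z ∈ e' ∧ l ≠ i ∧
          T.lam l (slice ν x₀ (T.lam i x₀, z)) < c * T.size} = ∅ := by
        rw [Set.eq_empty_iff_forall_notMem]
        rintro z ⟨hz, -, hlt⟩
        rw [hlamz z hz] at hlt
        have hα0 : α < 0 := by
          by_contra! h0
          have h1 : α ≤ 1 - δ := hT.angle i l (Ne.symm hli)
          have h2 : ‖τ‖ ^ 2 < s₀ ^ 2 := by gcongr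
          have h3 : s₀ ^ 2 ≤ δ := by
            rw [← Real.sq_sqrt hδ.le]
            have : s₀ ≤ Real.sqrt δ := (min_le_right _ _).trans (min_le_left _ _)
            gcongr
          nlinarith
        have h4 : inner ℝ (τ : Perp ν) z ≤ c₀ / 2 * T.size := by
          refine (real_inner_le_norm _ _).trans ?_
          have : ‖τ‖ ≤ c₀ / 2 := hτ.le.trans (min_le_left _ _)
          exact mul_le_mul this (hznorm z hz) (norm_nonneg _) (by positivity)
        have h5 := hx₀l l
        have h6 : c ≤ c₀ / 4 := min_le_left _ _
        have h7 := mul_neg_of_neg_of_pos hα0 (hx₀' i)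
        nlinarith
      rw [hempty]; simp
    · have hτ0 : 0 < ‖τ‖ := hs0.trans_le hτ
      set A := (T.lam l x₀ - α * T.lam i x₀) / ‖τ‖ with hA
      refine (measure_mono (t := {z | z ∈ Metric.closedBall (0 : Perp ν) T.size ∧
        inner ℝ (‖τ‖⁻¹ • τ) z ∈ Set.Icc (A - c * T.size / s₀) A}) ?_).trans ?_
      · rintro z ⟨hz, -, hlt⟩
        have h0 := (mem_face.1 hz).2 l
        rw [hlamz z hz] at h0 hlt
        refine ⟨by simpa using hznorm z hz, ?_⟩
        rw [inner_smul_left]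
        simp only [conj_trivial]
        rw [← div_eq_inv_mul, hA]
        constructor
        · rw [sub_le_iff_le_add, div_le_iff₀ hτ0, add_mul, div_mul_cancel₀ _ hτ0.ne']
          have : c * T.size ≤ c * T.size / s₀ * ‖τ‖ := by
            rw [div_mul_eq_mul_div, le_div_iff₀ hs0]
            gcongr
          linarith
        · gcongr
          linarith
      · have hu : ‖(‖τ‖⁻¹ • τ)‖ = 1 := by
          rw [norm_smul, norm_inv, norm_norm, inv_mul_cancel₀ hτ0.ne']
        refine (volume_slab_le hu 0 hs.le (by
          have : 0 ≤ c * T.size / s₀ := by positivity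
          linarith)).trans ?_
        rw [finrank_perp hnn, finrank_euclideanSpace_fin, sub_sub_cancel]
        have : c * T.size / s₀ * T.size ^ (d - 1 - 1) = c / s₀ * T.size ^ (d - 1) := by
          have h8 : T.size ^ (d - 1) = T.size ^ (d - 1 - 1) * T.size := by
            rw [← pow_succ]; congr 1; omega
          rw [h8]; ring
        rw [this]
  have hcover : e' ⊆ ⋃ l, {z : Perp ν | z ∈ e' ∧ l ≠ i ∧
      T.lam l (slice ν x₀ (T.lam i x₀, z)) < c * T.size} := by
    intro z hz
    obtain ⟨l, hl, hl'⟩ := hcon _ hz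
    exact Set.mem_iUnion.2 ⟨l, hz, hl, hl'⟩
  have h1 : volume e' ≤ ENNReal.ofReal (n * (c / s₀ * T.size ^ (d - 1) * β)) := by
    refine (measure_mono hcover).trans ((measure_iUnion_fintype_le _ _).trans ?_)
    refine (Finset.sum_le_sum fun l _ => hslab l).trans ?_
    rw [Finset.sum_const, Finset.card_univ, Fintype.card_fin, nsmul_eq_mul,
      ENNReal.ofReal_mul (Nat.cast_nonneg n), ENNReal.ofReal_natCast]
    gcongr
    exact hT.numFaces_le
  rw [he', hν, volume_slice_face] at h1
  have h2 := (hT.face_ge i).trans (ENNReal.toReal_le_of_le_ofReal (by positivity) h1)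
  have h3 : (κ * T.size) ^ (d - 1) ≤ Metric.diam (T.face i) ^ (d - 1) := by
    have := hT.diam_face_ge i
    gcongr
  have h4 : (ρe * κ ^ (d - 1)) * T.size ^ (d - 1) ≤ (n * (c / s₀) * β) * T.size ^ (d - 1) := by
    calc _ = ρe * (κ * T.size) ^ (d - 1) := by rw [mul_pow]; ring
      _ ≤ _ := (mul_le_mul_of_nonneg_left h3 hρe.le).trans h2
      _ = _ := by ring
  have h5 := le_of_mul_le_mul_right h4 (by positivity)
  have h6 : c / s₀ ≤ (ρe * κ ^ (d - 1)) / (2 * (n + 1) * (β + 1)) := by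
    rw [div_le_iff₀ hs0]
    refine (min_le_right _ _).trans (le_of_eq ?_)
    ring
  have h7 : 0 < ρe * κ ^ (d - 1) := by positivity
  have h8 : n * (c / s₀) * β ≤ (ρe * κ ^ (d - 1)) / 2 := by
    calc n * (c / s₀) * β ≤ (n + 1) * ((ρe * κ ^ (d - 1)) / (2 * (n + 1) * (β + 1))) * (β + 1) := by
          gcongr <;> linarith
      _ = _ := by field_simp
  linarith

end WG

namespace WG

open ConvexPolytope

/-! ### Trace and inverse inequalities on shape regular elements -/

section Trace

variable {d : ℕ}

/-- The partial derivative `∂_l g`. -/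
noncomputable def pd (l : Fin d) (g : E d → ℝ) (x : E d) : ℝ := fderiv ℝ g x (unitVec l)

lemma pd_ev (l : Fin d) (p : Poly d) : pd l (ev p) = ev (MvPolynomial.pderiv l p) :=
  funext fun x => fderiv_ev p l x

lemma continuous_pd {g : E d → ℝ} (hg : ContDiff ℝ 1 g) (l : Fin d) : Continuous (pd l g) :=
  (hg.continuous_fderiv one_ne_zero).clm_apply continuous_const

lemma sum_unitVec (v : E d) : v = ∑ l, v l • unitVec l := by
  ext j
  simp [unitVec, Pi.single_apply]

lemma fderiv_apply_eq_sum (g : E d → ℝ) (x v : E d) : fderiv ℝ g x v = ∑ l, v l * pd l g x := by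
  conv_lhs => rw [sum_unitVec v, map_sum]
  simp [pd]

lemma abs_coord_le (v : E d) (l : Fin d) : |v l| ≤ ‖v‖ := by
  simpa using PiLp.norm_apply_le v l

/-- In `integral_radial` for `g²` all face terms are nonnegative, so a single one is bounded by the
volume integral, in which `|x - x₀| ≤ h` and Cauchy–Schwarz are used. -/
lemma trace_sq_le (hd : 1 ≤ d) {T : ConvexPolytope d} {x₀ : E d} (hx₀ : x₀ ∈ T.carrier)
    (i : Fin T.numFaces) {g : E d → ℝ} (hg : ContDiff ℝ 1 g) :
    T.lam i x₀ * nrm (surf (T.face i)) g ^ 2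
      ≤ d * nrm (volume.restrict T.carrier) g ^ 2
        + 2 * T.size * nrm (volume.restrict T.carrier) g
          * ∑ l, nrm (volume.restrict T.carrier) (pd l g) := by
  have hl := mem_carrier.1 hx₀
  set μ := (volume : Measure (E d)).restrict T.carrier
  have hgm : MemLp g 2 μ := memLp_carrier hg.continuous
  have h1 := integral_radial hd hx₀ (g := fun x => g x ^ 2) (hg.pow 2)
  have h2 : T.lam i x₀ * nrm (surf (T.face i)) g ^ 2
      ≤ ∑ i, T.lam i x₀ * ∫ x, g x ^ 2 ∂(surf (T.face i)) := by
    rw [nrm_sq (memLp_surf hg.continuous i)]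
    exact Finset.single_le_sum (f := fun i => T.lam i x₀ * ∫ x, g x ^ 2 ∂(surf (T.face i)))
      (fun j _ => mul_nonneg (hl j).le (integral_nonneg fun x => sq_nonneg _))
      (Finset.mem_univ i)
  rw [← h1] at h2
  refine h2.trans ?_
  have hpdm : ∀ l, MemLp (fun x => (x - x₀) l * pd l g x) 2 μ := fun l =>
    memLp_carrier (by have := continuous_pd hg l; fun_prop)
  have h3 : ∀ x, (d * g x ^ 2 + fderiv ℝ (fun x => g x ^ 2) x (x - x₀))
      = d * g x ^ 2 + 2 * (g x * ∑ l, (x - x₀) l * pd l g x) := by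
    intro x
    rw [fderiv_fun_pow 2 (hg.differentiable one_ne_zero x), ← fderiv_apply_eq_sum]
    simp
    ring
  have hsum : MemLp (fun x => ∑ l, (x - x₀) l * pd l g x) 2 μ :=
    memLp_finsetSum _ fun l _ => hpdm l
  simp only [h3]
  rw [integral_add (hgm.integrable_sq.const_mul _)
    ((integrable_mul_of_memLp hgm hsum).const_mul 2), integral_const_mul, integral_const_mul,
    ← nrm_sq hgm]
  have h4 := (le_abs_self _).trans (abs_integral_mul_le hgm hsum)
  have h5 : nrm μ (fun x => ∑ l, (x - x₀) l * pd l g x) ≤ T.size * ∑ l, nrm μ (pd l g) := by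
    refine (nrm_sum_le _ fun l _ => hpdm l).trans ?_
    rw [Finset.mul_sum]
    refine Finset.sum_le_sum fun l _ => ?_
    have hs : 0 ≤ T.size := Metric.diam_nonneg
    rw [← abs_of_nonneg hs, ← nrm_const_mul]
    refine nrm_mono ((memLp_carrier (continuous_pd hg l)).const_mul _) ?_
    filter_upwards [ae_restrict_mem T.measurableSet_carrier] with x hx
    rw [abs_mul, abs_mul, abs_of_nonneg hs]
    gcongr
    exact (abs_coord_le _ l).trans (norm_sub_le_size (subset_closure hx) (subset_closure hx₀))
  have h6 := mul_le_mul_of_nonneg_left h5 (nrm_nonneg μ g)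
  nlinarith

lemma sqrt_mul_le_of_sq_le {m : ℕ} {c h lam A B D : ℝ} (hc : 0 < c) (hs : 0 < h)
    (hlam : c * h ≤ lam) (hA : 0 ≤ A) (hB : 0 ≤ B) (hD : 0 ≤ D)
    (h1 : lam * D ^ 2 ≤ m * A ^ 2 + 2 * h * A * B) :
    Real.sqrt h * D ≤ Real.sqrt ((m + 1) / c) * (A + h * B) := by
  have h2 : c * h * D ^ 2 ≤ (m + 1) * (A + h * B) ^ 2 := by
    have h3 : c * h * D ^ 2 ≤ lam * D ^ 2 := by gcongr
    have h4 : (m + 1) * (A + h * B) ^ 2 - (m * A ^ 2 + 2 * h * A * B)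
        = A ^ 2 + 2 * m * (A * (h * B)) + (m + 1) * (h * B) ^ 2 := by ring
    have h5 : 0 ≤ A ^ 2 + 2 * m * (A * (h * B)) + (m + 1) * (h * B) ^ 2 := by positivity
    linarith
  refine (sq_le_sq₀ (by positivity) (by positivity)).1 ?_
  rw [mul_pow, mul_pow, Real.sq_sqrt hs.le, Real.sq_sqrt (by positivity), div_mul_eq_mul_div,
    le_div_iff₀ hc]
  linarith

/-- Placing the apex of `trace_sq_le` at the inscribed point, where all distances are at least `c
h`, makes the constant uniform. -/
lemma exists_trace_le (d n : ℕ) (hd : 1 ≤ d) {ρv : ℝ} (hρv : 0 < ρv) (ρe κ δ : ℝ) :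
    ∃ K : ℝ, 0 < K ∧ ∀ (T : ConvexPolytope d), Regular T n ρv ρe κ δ → ∀ i, ∀ g : E d → ℝ,
      ContDiff ℝ 1 g → Real.sqrt T.size * nrm (surf (T.face i)) g
        ≤ K * (nrm (volume.restrict T.carrier) g
          + T.size * ∑ l, nrm (volume.restrict T.carrier) (pd l g)) := by
  obtain ⟨c, hc, hball⟩ := exists_inball d n hd hρv
  refine ⟨Real.sqrt ((d + 1) / c), by positivity, fun T hT i g hg => ?_⟩
  obtain ⟨x₀, hx₀, hx₀l⟩ := hball T hT.numFaces_le hT.volume_ge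
  have hs := T.size_pos hd
  have h1 := trace_sq_le hd hx₀ i hg
  exact sqrt_mul_le_of_sq_le hc hs (hx₀l i) (nrm_nonneg _ _)
    (Finset.sum_nonneg fun l _ => nrm_nonneg _ _) (nrm_nonneg _ _) h1

end Trace

/-! ### Bubble functions and inverse inequalities -/

section Bubble

variable {d : ℕ}

/-- `lam i / h` as a polynomial. -/
noncomputable def lamPoly (T : ConvexPolytope d) (i : Fin T.numFaces) : Poly d :=
  T.size⁻¹ • affPoly (-(T.normal i)) (T.offset i)

lemma ev_lamPoly (T : ConvexPolytope d) (i : Fin T.numFaces) (x : E d) :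
    ev (lamPoly T i) x = T.lam i x / T.size := by
  simp only [lamPoly, ev_smul, ev_affPoly, inner_neg_left, lam]
  ring

lemma totalDegree_lamPoly_le (T : ConvexPolytope d) (i : Fin T.numFaces) :
    (lamPoly T i).totalDegree ≤ 1 := totalDegree_smul_le _ (totalDegree_affPoly_le _ _)

/-- The product of the scaled distances to all faces except the `i`-th one. -/
noncomputable def bubble (T : ConvexPolytope d) (i : Fin T.numFaces) : Poly d :=
  ∏ l ∈ Finset.univ.erase i, lamPoly T l

lemma ev_bubble (T : ConvexPolytope d) (i : Fin T.numFaces) (x : E d) :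
    ev (bubble T i) x = ∏ l ∈ Finset.univ.erase i, T.lam l x / T.size := by
  simp [bubble, ev_prod, ev_lamPoly]

lemma totalDegree_bubble_le (T : ConvexPolytope d) (i : Fin T.numFaces) :
    (bubble T i).totalDegree ≤ T.numFaces - 1 := by
  refine (MvPolynomial.totalDegree_finsetProd _ _).trans ?_
  refine (Finset.sum_le_sum fun l _ => totalDegree_lamPoly_le T l).trans ?_
  simp [Finset.card_erase_of_mem]

lemma lam_div_mem {T : ConvexPolytope d} {x : E d} (hx : ∀ l, 0 ≤ T.lam l x)
    (l : Fin T.numFaces) : T.lam l x / T.size ∈ Set.Icc (0 : ℝ) 1 := by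
  have h0 : 0 ≤ T.size := Metric.diam_nonneg
  exact ⟨div_nonneg (hx l) h0, div_le_one_of_le₀ (lam_le_size (mem_closure_carrier hx) l) h0⟩

lemma ev_bubble_mem {T : ConvexPolytope d} (i : Fin T.numFaces) {x : E d}
    (hx : ∀ l, 0 ≤ T.lam l x) : ev (bubble T i) x ∈ Set.Icc (0 : ℝ) 1 := by
  rw [ev_bubble]
  exact ⟨Finset.prod_nonneg fun l _ => (lam_div_mem hx l).1,
    Finset.prod_le_one (fun l _ => (lam_div_mem hx l).1) fun l _ => (lam_div_mem hx l).2⟩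

lemma pow_le_ev_bubble {T : ConvexPolytope d} (hs : 0 < T.size) (i : Fin T.numFaces) {x : E d}
    {c : ℝ} {n : ℕ} (hn : T.numFaces ≤ n) (hc : 0 < c) (hc1 : c ≤ 1)
    (hx : ∀ l, l ≠ i → c * T.size ≤ T.lam l x) : c ^ n ≤ ev (bubble T i) x := by
  rw [ev_bubble]
  calc c ^ n ≤ c ^ (Finset.univ.erase i).card := by
        refine pow_le_pow_of_le_one hc.le hc1 ?_
        simp [Finset.card_erase_of_mem]; omega
    _ = ∏ l ∈ Finset.univ.erase i, c := by simp
    _ ≤ _ := Finset.prod_le_prod (fun _ _ => hc.le) fun l hl => by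
        rw [le_div_iff₀ hs]; exact hx l (Finset.ne_of_mem_erase hl)

/-- Inverse inequality and coercivity of the bubble weighted product. -/
lemma exists_inverse (d n N : ℕ) (hd : 1 ≤ d) {ρv : ℝ} (hρv : 0 < ρv) (ρe κ δ : ℝ) :
    ∃ K : ℝ, 0 < K ∧ ∀ (T : ConvexPolytope d), Regular T n ρv ρe κ δ →
      ∀ p : Poly d, p.totalDegree ≤ N →
        (∀ l, T.size * nrm (volume.restrict T.carrier) (ev (MvPolynomial.pderiv l p))
          ≤ K * nrm (volume.restrict T.carrier) (ev p)) ∧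
        ∀ i, nrm (volume.restrict T.carrier) (ev p) ^ 2
          ≤ K * ∫ x in T.carrier, ev (bubble T i * lamPoly T i) x * ev p x * ev p x := by
  obtain ⟨c', hc', hball⟩ := exists_inball d n hd hρv
  set c := min c' 1 with hcdef
  have hc : 0 < c := lt_min hc' one_pos
  have hc1 : c ≤ 1 := min_le_right _ _
  -- The ball of radius `c h / 2` about the inscribed point stays at distance `c h / 2` from all
  -- faces, and the ball of radius `2 h` contains `T`. On the small ball the weight is at least `(c
  -- / 2) ^ (n + 1)`, one power being due to the factor `lamPoly T i`.
  obtain ⟨K, hK, hKball⟩ := exists_nrm_ball_le d N (c := c / 2) (C := 2) (by positivity)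
  refine ⟨K + K ^ 2 / (c / 2) ^ (n + 1), by positivity, fun T hT p hp => ?_⟩
  have hs := T.size_pos hd
  obtain ⟨x₀, hx₀, hx₀l'⟩ := hball T hT.numFaces_le hT.volume_ge
  have hx₀l : ∀ l, c * T.size ≤ T.lam l x₀ := fun l =>
    le_trans (by gcongr; exact min_le_left _ _) (hx₀l' l)
  obtain ⟨hK1, hK2⟩ := hKball x₀ T.size hs p hp
  have hlam : ∀ x ∈ Metric.ball x₀ (c / 2 * T.size), ∀ l, c / 2 * T.size ≤ T.lam l x := by
    intro x hx l
    rw [Metric.mem_ball, dist_comm, dist_eq_norm] at hx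
    have := lam_sub_le l x₀ x
    have := hx₀l l
    linarith
  have hsub1 : Metric.ball x₀ (c / 2 * T.size) ⊆ T.carrier := fun x hx =>
    mem_carrier.2 fun l => lt_of_lt_of_le (by positivity) (hlam x hx l)
  have hsub2 : T.carrier ⊆ Metric.ball x₀ (2 * T.size) := fun x hx => by
    rw [Metric.mem_ball, dist_eq_norm]
    have := norm_sub_le_size (subset_closure hx) (subset_closure hx₀)
    linarith
  have hb := fun r : ℝ => polyMem_volume (Metric.isBounded_ball (x := x₀) (r := r))
    measurableSet_ball
  have hT1 := nrm_mono_measure (Measure.restrict_mono_set volume hsub1) (polyMem_carrier p)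
  have hT2 := nrm_mono_measure (Measure.restrict_mono_set volume hsub2) (hb _ p)
  refine ⟨fun l => ?_, fun i => ?_⟩
  · have h3 := nrm_mono_measure (Measure.restrict_mono_set volume hsub2)
      (hb _ (MvPolynomial.pderiv l p))
    calc _ ≤ T.size * nrm (volume.restrict (Metric.ball x₀ (2 * T.size)))
            (ev (MvPolynomial.pderiv l p)) := by gcongr
      _ ≤ K * nrm (volume.restrict T.carrier) (ev p) := (hK2 l).trans (by gcongr)
      _ ≤ _ := by
        refine mul_le_mul_of_nonneg_right ?_ (nrm_nonneg _ _)
        have : 0 ≤ K ^ 2 / (c / 2) ^ (n + 1) := by positivity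
        linarith
  · have hbub0 : ∀ x ∈ T.carrier, 0 ≤ ev (bubble T i * lamPoly T i) x := by
      intro x hx
      have hx' := fun l => (mem_carrier.1 hx l).le
      rw [ev_mul, ev_lamPoly]
      exact mul_nonneg (ev_bubble_mem i hx').1 (lam_div_mem hx' i).1
    set I := ∫ x in T.carrier, ev (bubble T i * lamPoly T i) x * ev p x * ev p x with hI
    have hint : IntegrableOn (fun x => ev (bubble T i * lamPoly T i) x * ev p x * ev p x)
        T.carrier := by
      have := integrable_mul_of_memLp (polyMem_carrier (T := T) (bubble T i * lamPoly T i * p))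
        (polyMem_carrier p)
      simp only [ev_mul] at this ⊢
      exact this
    have hI0 : 0 ≤ I := setIntegral_nonneg T.measurableSet_carrier fun x hx => by
      rw [mul_assoc]; exact mul_nonneg (hbub0 x hx) (mul_self_nonneg _)
    have h4 : (c / 2) ^ (n + 1) * nrm (volume.restrict (Metric.ball x₀ (c / 2 * T.size))) (ev p) ^ 2
        ≤ I := by
      rw [nrm_sq (hb _ p), ← integral_const_mul]
      refine le_trans (setIntegral_mono_on (((hb _ p).integrable_sq).const_mul _)
        (hint.mono_set hsub1) measurableSet_ball fun x hx => ?_) (setIntegral_mono_set hint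
          ((ae_restrict_mem T.measurableSet_carrier).mono fun x hx => ?_) hsub1.eventuallyLE)
      · rw [mul_assoc, ← sq]
        refine mul_le_mul_of_nonneg_right ?_ (sq_nonneg _)
        rw [ev_mul, pow_succ, ev_lamPoly]
        refine mul_le_mul (pow_le_ev_bubble hs i hT.numFaces_le (by positivity) (by linarith)
          fun l _ => hlam x hx l) ?_ (by positivity)
          (ev_bubble_mem i fun l => (mem_carrier.1 (hsub1 hx) l).le).1
        rw [le_div_iff₀ hs]; exact hlam x hx i
      · show 0 ≤ ev (bubble T i * lamPoly T i) x * ev p x * ev p x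
        rw [mul_assoc]; exact mul_nonneg (hbub0 x hx) (mul_self_nonneg _)
    have h5 : nrm (volume.restrict T.carrier) (ev p) ^ 2
        ≤ K ^ 2 * nrm (volume.restrict (Metric.ball x₀ (c / 2 * T.size))) (ev p) ^ 2 := by
      rw [← mul_pow]
      have := hT2.trans hK1
      have := nrm_nonneg (volume.restrict T.carrier) (ev p)
      gcongr
    have h6 : K ^ 2 * nrm (volume.restrict (Metric.ball x₀ (c / 2 * T.size))) (ev p) ^ 2
        ≤ K ^ 2 / (c / 2) ^ (n + 1) * I := by
      rw [show K ^ 2 / (c / 2) ^ (n + 1) * I = K ^ 2 * I / (c / 2) ^ (n + 1) by ring,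
        le_div_iff₀ (by positivity), mul_assoc]
      refine mul_le_mul_of_nonneg_left ?_ (sq_nonneg K)
      linarith
    nlinarith

lemma exists_poly_trace_le (d n N : ℕ) (hd : 1 ≤ d) {ρv : ℝ} (hρv : 0 < ρv) (ρe κ δ : ℝ) :
    ∃ K : ℝ, 0 < K ∧ ∀ (T : ConvexPolytope d), Regular T n ρv ρe κ δ → ∀ i,
      ∀ p : Poly d, p.totalDegree ≤ N → Real.sqrt T.size * nrm (surf (T.face i)) (ev p)
        ≤ K * nrm (volume.restrict T.carrier) (ev p) := by
  obtain ⟨K₁, hK₁, h₁⟩ := exists_trace_le d n hd hρv ρe κ δ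
  obtain ⟨K₂, hK₂, h₂⟩ := exists_inverse d n N hd hρv ρe κ δ
  refine ⟨K₁ * (1 + d * K₂), by positivity, fun T hT i p hp => ?_⟩
  refine (h₁ T hT i (ev p) ((contDiff_ev p).of_le (by simp))).trans ?_
  rw [mul_assoc, Finset.mul_sum]
  gcongr
  have : ∑ l, T.size * nrm (volume.restrict T.carrier) (pd l (ev p))
      ≤ ∑ _l : Fin d, K₂ * nrm (volume.restrict T.carrier) (ev p) :=
    Finset.sum_le_sum fun l _ => by rw [pd_ev]; exact (h₂ T hT p hp).1 l
  rw [Finset.sum_const, Finset.card_univ, Fintype.card_fin, nsmul_eq_mul] at this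
  linarith

end Bubble

end WG

namespace WG

open ConvexPolytope

/-! ### Polynomials on a face and their liftings -/

section Face

variable {d : ℕ}

lemma slice_zero_eq {ν : E d} (x₀ : E d) (z : Perp ν) : slice ν x₀ (0, z) = x₀ + z := by
  simp [slice]

lemma norm_sq_slice_sub {ν : E d} (hν : ‖ν‖ = 1) (x₀ : E d) (p : ℝ × Perp ν) :
    ‖slice ν x₀ p - x₀‖ ^ 2 = p.1 ^ 2 + ‖p.2‖ ^ 2 := by
  rw [slice, add_sub_cancel_left, norm_add_sq_real, inner_smul_left, inner_perp, norm_smul, hν]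
  simp

lemma setIntegral_prod_snd {ν : E d} {s : Set ℝ} {t : Set (Perp ν)} (g : Perp ν → ℝ) :
    ∫ p in s ×ˢ t, g p.2 ∂((volume : Measure ℝ).prod volume)
      = (volume s).toReal * ∫ z in t, g z := by
  have := setIntegral_prod_mul (μ := (volume : Measure ℝ)) (ν := (volume : Measure (Perp ν)))
    (fun _ => (1 : ℝ)) g s t
  simpa [Measure.real] using this

/-- The polynomial `φ` composed with the orthogonal projection onto the hyperplane of a face. -/
noncomputable def faceLift (T : ConvexPolytope d) (i : Fin T.numFaces) (φ : Poly d) : Poly d :=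
  subst (fun l => affPoly (unitVec l - T.normal i l • T.normal i) (T.offset i * T.normal i l)) φ

lemma ev_faceLift (T : ConvexPolytope d) (i : Fin T.numFaces) (φ : Poly d) (x : E d) :
    ev (faceLift T i φ) x = ev φ (x + T.lam i x • T.normal i) := by
  refine ev_subst _ _ _ _ fun l => ?_
  simp [unitVec, inner_sub_left, inner_smul_left, EuclideanSpace.inner_single_left, lam]
  ring

lemma totalDegree_faceLift_le (T : ConvexPolytope d) (i : Fin T.numFaces) (φ : Poly d) :
    (faceLift T i φ).totalDegree ≤ φ.totalDegree :=
  totalDegree_subst_le (fun _ => totalDegree_affPoly_le _ _) φ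

lemma ev_faceLift_of_mem {T : ConvexPolytope d} {i : Fin T.numFaces} (φ : Poly d) {x : E d}
    (hx : x ∈ T.face i) : ev (faceLift T i φ) x = ev φ x := by
  rw [ev_faceLift, (mem_face.1 hx).1, zero_smul, add_zero]

lemma ev_faceLift_slice {T : ConvexPolytope d} {i : Fin T.numFaces} (φ : Poly d) {y₀ : E d}
    (hy₀ : y₀ ∈ T.face i) (p : ℝ × Perp (T.normal i)) :
    ev (faceLift T i φ) (slice (T.normal i) y₀ p) = ev φ (y₀ + p.2) := by
  rw [ev_faceLift]
  congr 1
  have h1 : T.lam i (slice (T.normal i) y₀ p) = - p.1 := by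
    have h2 := (mem_face.1 hy₀).1
    simp only [lam, inner_slice (T.norm_normal i)] at *
    linarith
  rw [h1, slice]
  module

/-- The integral over a ball of a function which is constant in the direction `ν`. -/
lemma integral_ball_cylinder {ν : E d} (hν : ‖ν‖ = 1) (y₀ : E d) {F : E d → ℝ} {g : Perp ν → ℝ}
    (hF0 : ∀ x, 0 ≤ F x) (hg : Continuous g)
    (hFg : ∀ p, F (slice ν y₀ p) = g p.2) {R : ℝ} (hR : 0 < R) :
    ∫ x in Metric.ball y₀ R, F x ≤ 2 * R * ∫ z in Metric.ball (0 : Perp ν) R, g z ∧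
      R * ∫ z in Metric.ball (0 : Perp ν) (R / 2), g z ≤ ∫ x in Metric.ball y₀ R, F x := by
  have hmp := measurePreserving_slice hν y₀
  have h1 := hmp.setIntegral_preimage_emb (measurableEmbedding_slice hν y₀) F (Metric.ball y₀ R)
  simp only [hFg] at h1
  rw [← h1]
  have hg0 : ∀ z, 0 ≤ g z := fun z => by
    have := hF0 (slice ν y₀ (0, z)); rwa [hFg] at this
  have hmem : ∀ p : ℝ × Perp ν, slice ν y₀ p ∈ Metric.ball y₀ R ↔ p.1 ^ 2 + ‖p.2‖ ^ 2 < R ^ 2 := by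
    intro p
    rw [Metric.mem_ball, dist_eq_norm, ← norm_sq_slice_sub hν y₀, sq_lt_sq₀ (norm_nonneg _) hR.le]
  -- The ball is enclosed between two cylinders of radii `R / 2` and `R`, over which a function
  -- constant along `ν` integrates to a product.
  have hsub1 : slice ν y₀ ⁻¹' Metric.ball y₀ R ⊆ Set.Ioo (-R) R ×ˢ Metric.ball (0 : Perp ν) R := by
    intro p hp
    have hp' := (hmem p).1 hp
    refine ⟨abs_lt.1 (abs_lt_of_sq_lt_sq ?_ hR.le), ?_⟩
    · nlinarith [norm_nonneg p.2]
    · rw [mem_ball_zero_iff]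
      refine lt_of_pow_lt_pow_left₀ 2 hR.le ?_
      nlinarith [sq_nonneg p.1]
  have hsub2 : Set.Ioo (-(R / 2)) (R / 2) ×ˢ Metric.ball (0 : Perp ν) (R / 2)
      ⊆ slice ν y₀ ⁻¹' Metric.ball y₀ R := by
    rintro p ⟨h2, h3⟩
    refine (hmem p).2 ?_
    rw [mem_ball_zero_iff] at h3
    have h4 : p.1 ^ 2 < (R / 2) ^ 2 := sq_lt_sq' h2.1 h2.2
    have h5 : ‖p.2‖ ^ 2 < (R / 2) ^ 2 := by gcongr
    nlinarith
  have hint : IntegrableOn (fun p : ℝ × Perp ν => g p.2)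
      (Set.Ioo (-R) R ×ˢ Metric.ball (0 : Perp ν) R) (volume.prod volume) :=
    integrableOn_of_continuous ((Metric.isBounded_Ioo _ _).prod Metric.isBounded_ball)
      (by fun_prop)
  constructor
  · refine (setIntegral_mono_set hint (ae_of_all _ fun p => hg0 p.2) hsub1.eventuallyLE).trans ?_
    rw [setIntegral_prod_snd, Real.volume_Ioo, ENNReal.toReal_ofReal (by linarith)]
    exact le_of_eq (by ring)
  · refine le_trans ?_ (setIntegral_mono_set (hint.mono_set hsub1) (ae_of_all _ fun p => hg0 p.2)
      hsub2.eventuallyLE)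
    rw [setIntegral_prod_snd, Real.volume_Ioo, ENNReal.toReal_ofReal (by linarith)]
    exact le_of_eq (by ring)

/-- The lift is constant in the normal direction, so integrals over balls centred on the face are
comparable to the radius times integrals over the face. The bubble is bounded below on a ball around
an inner point `y₀` of the face, and the comparison of polynomial norms on concentric balls extends
control from there to all of `T` and of the face. -/
lemma exists_faceLift_le (d n N : ℕ) (hd : 2 ≤ d) {ρv ρe κ δ : ℝ} (hρv : 0 < ρv) (hρe : 0 < ρe)
    (hκ : 0 < κ) (hδ : 0 < δ) :
    ∃ K : ℝ, 0 < K ∧ ∀ (T : ConvexPolytope d), Regular T n ρv ρe κ δ → ∀ i,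
      ∀ φ : Poly d, φ.totalDegree ≤ N →
        nrm (volume.restrict T.carrier) (ev (faceLift T i φ)) ^ 2
          ≤ K * T.size * ∫ x, ev (bubble T i) x * ev φ x * ev φ x ∂(surf (T.face i)) ∧
        nrm (surf (T.face i)) (ev φ) ^ 2
          ≤ K * ∫ x, ev (bubble T i) x * ev φ x * ev φ x ∂(surf (T.face i)) := by
  obtain ⟨c', hc', hball⟩ := exists_face_inball d n hd hρv hρe hκ hδ
  set c := min c' 1 with hcdef
  have hc : 0 < c := lt_min hc' one_pos
  have hc1 : c ≤ 1 := min_le_right _ _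
  -- The ball of radius `4 h` contains `T`, and the cylinder of half that radius, used for the lower
  -- bound, still covers the face.
  obtain ⟨K, hK, hKball⟩ := exists_nrm_ball_le d N (c := c / 2) (C := 4) (by positivity)
  refine ⟨K ^ 2 * c / (c / 2) ^ n, by positivity, fun T hT i φ hφ => ?_⟩
  have hs := T.size_pos (by omega)
  obtain ⟨y₀, hy₀, hy₀l'⟩ := hball T hT i
  have hy₀l : ∀ l, l ≠ i → c * T.size ≤ T.lam l y₀ := fun l hl =>
    le_trans (by gcongr; exact min_le_left _ _) (hy₀l' l hl)
  set h := T.size with hh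
  set ν := T.normal i with hν
  have hnn : ‖ν‖ = 1 := T.norm_normal i
  set ψ := faceLift T i φ with hψ
  set g : Perp ν → ℝ := fun z => ev φ (y₀ + z) ^ 2 with hg
  have hgc : Continuous g := by have := continuous_ev φ; fun_prop
  have hg0 : ∀ z, 0 ≤ g z := fun z => sq_nonneg _
  set e' : Set (Perp ν) := {z | slice ν y₀ (0, z) ∈ T.face i} with he'
  have heq : ∀ x ∈ T.face i, inner ℝ ν x = inner ℝ ν y₀ + 0 := by
    intro x hx
    rw [inner_eq_of_mem_face hx y₀, (mem_face.1 hy₀).1]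
  have hes : ∀ f : E d → ℝ, ∫ x, f x ∂(surf (T.face i)) = ∫ z in e', f (y₀ + z) := by
    intro f
    rw [integral_surf hnn y₀ 0 heq (T.measurableSet_face i)]
    simp only [he', slice_zero_eq]
  have hcyl := fun (R : ℝ) (hR : 0 < R) => integral_ball_cylinder hnn y₀
    (F := fun x => ev ψ x ^ 2) (g := g) (fun x => sq_nonneg _) hgc
    (fun p => by simp only [hψ, hg]; rw [ev_faceLift_slice φ hy₀]) hR
  set I := ∫ x, ev (bubble T i) x * ev φ x * ev φ x ∂(surf (T.face i)) with hI
  have hgW : ∀ r, IntegrableOn g (Metric.ball (0 : Perp ν) r) := fun r =>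
    integrableOn_of_continuous Metric.isBounded_ball hgc
  have hlam : ∀ z ∈ Metric.ball (0 : Perp ν) (c / 2 * h), ∀ l, l ≠ i →
      c / 2 * h ≤ T.lam l (y₀ + z) := by
    intro z hz l hl
    rw [mem_ball_zero_iff] at hz
    have h1 := lam_sub_le l y₀ (y₀ + z)
    rw [sub_add_cancel_left, norm_neg] at h1
    have h2 := hy₀l l hl
    have h3 : ‖(z : E d)‖ = ‖z‖ := rfl
    linarith
  have hface : Metric.ball (0 : Perp ν) (c / 2 * h) ⊆ e' := by
    intro z hz
    show slice ν y₀ (0, z) ∈ T.face i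
    rw [slice_zero_eq, mem_face]
    have h0 : T.lam i (y₀ + z) = 0 := by
      have h2 := (mem_face.1 hy₀).1
      simp only [lam, inner_add_right] at *
      rw [inner_perp (ν := T.normal i) z]
      linarith
    refine ⟨h0, fun l => ?_⟩
    by_cases hl : l = i
    · rw [hl, h0]
    · exact le_trans (by positivity) (hlam z hz l hl)
  have hface0 : ∀ z ∈ e', ∀ l, 0 ≤ T.lam l (y₀ + z) := by
    intro z hz
    have hz' : slice ν y₀ (0, z) ∈ T.face i := hz
    rw [slice_zero_eq] at hz'
    exact (mem_face.1 hz').2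
  have he'm : MeasurableSet e' := measurableSet_slice_preimage y₀ 0 (T.measurableSet_face i)
  have he'b : Bornology.IsBounded e' := isBounded_slice_preimage y₀ 0 (isBounded_face i)
  have hwI : (c / 2) ^ n * ∫ z in Metric.ball (0 : Perp ν) (c / 2 * h), g z ≤ I := by
    rw [hI, hes, ← integral_const_mul]
    have hcont : Continuous fun z : Perp ν =>
        ev (bubble T i) (y₀ + z) * ev φ (y₀ + z) * ev φ (y₀ + z) := by
      have := continuous_ev φ
      have := continuous_ev (bubble T i)
      fun_prop
    have hint := integrableOn_of_continuous (μ := volume) he'b hcont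
    refine le_trans (setIntegral_mono_on ((hgW _).const_mul _) (hint.mono_set hface)
      measurableSet_ball fun z hz => ?_) (setIntegral_mono_set hint
        ((ae_restrict_mem he'm).mono fun z hz => ?_) hface.eventuallyLE)
    · rw [mul_assoc, ← sq]
      exact mul_le_mul_of_nonneg_right (pow_le_ev_bubble hs i hT.numFaces_le (by positivity)
        (by linarith) (hlam z hz)) (sq_nonneg _)
    · show 0 ≤ ev (bubble T i) (y₀ + z) * ev φ (y₀ + z) * ev φ (y₀ + z)
      rw [mul_assoc]
      exact mul_nonneg (ev_bubble_mem i (hface0 z hz)).1 (mul_self_nonneg _)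
  have hb := fun r : ℝ => polyMem_volume (Metric.isBounded_ball (x := y₀) (r := r))
    measurableSet_ball
  have hmain : ∫ x in Metric.ball y₀ (4 * h), ev ψ x ^ 2 ≤ K ^ 2 * c / (c / 2) ^ n * h * I := by
    have h1 := (hKball y₀ h hs ψ ((totalDegree_faceLift_le T i φ).trans hφ)).1
    have h2 : nrm (volume.restrict (Metric.ball y₀ (4 * h))) (ev ψ) ^ 2
        ≤ K ^ 2 * nrm (volume.restrict (Metric.ball y₀ (c / 2 * h))) (ev ψ) ^ 2 := by
      rw [← mul_pow]
      have := nrm_nonneg (volume.restrict (Metric.ball y₀ (4 * h))) (ev ψ)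
      gcongr
    rw [nrm_sq (hb _ ψ), nrm_sq (hb _ ψ)] at h2
    have h3 := (hcyl (c / 2 * h) (by positivity)).1
    have h4 : ∫ z in Metric.ball (0 : Perp ν) (c / 2 * h), g z ≤ I / (c / 2) ^ n := by
      rw [le_div_iff₀ (by positivity)]; linarith
    calc _ ≤ _ := h2
      _ ≤ K ^ 2 * (2 * (c / 2 * h) * (I / (c / 2) ^ n)) := by
        gcongr
        exact h3.trans (by gcongr)
      _ = _ := by ring
  constructor
  · refine le_trans ?_ hmain
    rw [← nrm_sq (hb _ ψ)]
    have hsub : T.carrier ⊆ Metric.ball y₀ (4 * h) := fun x hx => by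
      rw [Metric.mem_ball, dist_eq_norm]
      have := norm_sub_le_size (subset_closure hx) (face_subset_closure i hy₀)
      linarith
    have := nrm_mono_measure (Measure.restrict_mono_set volume hsub) (hb _ ψ)
    have := nrm_nonneg (volume.restrict T.carrier) (ev ψ)
    gcongr
  · have h1 := (hcyl (4 * h) (by positivity)).2
    have hsub : e' ⊆ Metric.ball 0 (4 * h / 2) := by
      intro z hz
      have hz' : slice ν y₀ (0, z) ∈ T.face i := hz
      have h2 := norm_sub_le_size (face_subset_closure i hz') (face_subset_closure i hy₀)
      rw [slice_zero_eq, add_sub_cancel_left] at h2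
      rw [mem_ball_zero_iff]
      have h3 : ‖(z : E d)‖ = ‖z‖ := rfl
      linarith
    rw [nrm_sq (polyMem_surf i φ), hes]
    have h4 : ∫ z in e', g z ≤ ∫ z in Metric.ball (0 : Perp ν) (4 * h / 2), g z :=
      setIntegral_mono_set (hgW _) (ae_of_all _ hg0) hsub.eventuallyLE
    have h5 : (4 * h) * ∫ z in e', g z ≤ h * (K ^ 2 * c / (c / 2) ^ n * I) := by
      calc _ ≤ (4 * h) * ∫ z in Metric.ball (0 : Perp ν) (4 * h / 2), g z := by gcongr
        _ ≤ _ := h1.trans hmain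
        _ = _ := by ring
    have h6 : 0 ≤ ∫ z in e', g z := integral_nonneg hg0
    have h7 : h * ∫ z in e', g z ≤ h * (K ^ 2 * c / (c / 2) ^ n * I) := by nlinarith
    exact le_of_mul_le_mul_left h7 hs

/-- A polynomial supported, as far as the boundary is concerned, on one face, which is orthogonal
to lower order polynomials and tests a given polynomial on the face. -/
lemma exists_face_test (d n m : ℕ) (hd : 2 ≤ d) {ρv ρe κ δ : ℝ} (hρv : 0 < ρv) (hρe : 0 < ρe)
    (hκ : 0 < κ) (hδ : 0 < δ) :
    ∃ K : ℝ, 0 < K ∧ ∀ (T : ConvexPolytope d), Regular T n ρv ρe κ δ → ∀ i,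
      ∀ φ : Poly d, φ.totalDegree ≤ m → ∃ s : Poly d, s.totalDegree ≤ n + m ∧
        (∀ l, l ≠ i → ∀ x ∈ T.face l, ev s x = 0) ∧
        (∀ r : Poly d, r.totalDegree ≤ m → ∫ x in T.carrier, ev s x * ev r x = 0) ∧
        nrm (surf (T.face i)) (ev φ) ^ 2 ≤ K * ∫ x, ev φ x * ev s x ∂(surf (T.face i)) ∧
        nrm (volume.restrict T.carrier) (ev s)
          ≤ K * (Real.sqrt T.size * nrm (surf (T.face i)) (ev φ)) := by
  obtain ⟨K₁, hK₁, h₁⟩ := exists_faceLift_le d n m hd hρv hρe hκ hδ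
  obtain ⟨K₂, hK₂, h₂⟩ := exists_inverse d n m (by omega) hρv ρe κ δ
  refine ⟨K₁ + (1 + K₂) * Real.sqrt K₁, by positivity, fun T hT i φ hφ => ?_⟩
  have hs := T.size_pos (by omega)
  set w := bubble T i with hw
  set ψ := faceLift T i φ with hψ
  have hψd : ψ.totalDegree ≤ m := (totalDegree_faceLift_le T i φ).trans hφ
  set μ := (volume : Measure (E d)).restrict T.carrier with hμ
  have hpos : ∀ᵐ x ∂μ, ∀ l, 0 < T.lam l x :=
    (ae_restrict_mem T.measurableSet_carrier).mono fun x hx => mem_carrier.1 hx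
  have hwpos : ∀ᵐ x ∂μ, 0 < ev (w * lamPoly T i) x := by
    filter_upwards [hpos] with x hx
    rw [ev_mul, ev_lamPoly, ev_bubble]
    exact mul_pos (Finset.prod_pos fun l _ => div_pos (hx l) hs) (div_pos (hx i) hs)
  -- The candidate `w ψ` has the right boundary values but is not orthogonal to low degrees. The
  -- correction `w · lamPoly T i · p` vanishes on every face, and `p` is chosen so that it cancels
  -- the moments of `w ψ`.
  obtain ⟨p, hpd, hp⟩ := exists_weighted_proj (polyMem_carrier (T := T)) m (w * lamPoly T i)
    (hwpos.mono fun x hx => hx.le) (f := ev (-(w * ψ))) (polyMem_carrier _)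
    (hwpos.mono fun x hx h => absurd h hx.ne')
  have hwle : ∀ᵐ x ∂μ, |ev w x| ≤ 1 := by
    filter_upwards [hpos] with x hx
    have := ev_bubble_mem i (fun l => (hx l).le)
    rw [abs_of_nonneg this.1]; exact this.2
  have hwψ : nrm μ (ev (w * ψ)) ≤ nrm μ (ev ψ) := by
    refine nrm_mono (polyMem_carrier _) ?_
    filter_upwards [hwle] with x hx
    rw [ev_mul, abs_mul]
    exact mul_le_of_le_one_left (abs_nonneg _) hx
  have hwp : nrm μ (ev (w * lamPoly T i * p)) ≤ nrm μ (ev p) := by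
    refine nrm_mono (polyMem_carrier _) ?_
    filter_upwards [hwle, hpos] with x hx hx'
    have := lam_div_mem (fun l => (hx' l).le) i
    rw [ev_mul, ev_mul, abs_mul, abs_mul, ev_lamPoly, abs_of_nonneg this.1]
    exact mul_le_of_le_one_left (abs_nonneg _) (mul_le_one₀ hx this.1 this.2)
  -- Coercivity of the weighted product, tested with `p` itself, bounds the correction by the lift.
  have hpψ : nrm μ (ev p) ≤ K₂ * nrm μ (ev ψ) := by
    have h3 := (h₂ T hT p hpd).2 i
    rw [hp p hpd] at h3
    have h4 : ∫ x, ev (-(w * ψ)) x * ev p x ∂μ ≤ nrm μ (ev ψ) * nrm μ (ev p) := by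
      refine (le_abs_self _).trans ((abs_integral_mul_le (polyMem_carrier _)
        (polyMem_carrier p)).trans ?_)
      refine mul_le_mul_of_nonneg_right ?_ (nrm_nonneg _ _)
      refine le_trans (le_of_eq ?_) hwψ
      rw [funext (ev_neg (w * ψ)), nrm_neg]
    have h5 : nrm μ (ev p) ^ 2 ≤ K₂ * nrm μ (ev ψ) * nrm μ (ev p) := by
      refine h3.trans ?_
      rw [mul_assoc]
      exact mul_le_mul_of_nonneg_left h4 hK₂.le
    by_contra! hlt
    have := nrm_nonneg μ (ev ψ)
    have : 0 ≤ K₂ * nrm μ (ev ψ) := by positivity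
    nlinarith
  obtain ⟨hl1, hl2⟩ := h₁ T hT i φ hφ
  set I := ∫ x, ev w x * ev φ x * ev φ x ∂(surf (T.face i)) with hI
  have hI_le : I ≤ nrm (surf (T.face i)) (ev φ) ^ 2 := by
    rw [nrm_sq (polyMem_surf i φ), hI]
    refine integral_mono_ae (by
      have := integrable_mul_of_memLp (polyMem_surf i (w * φ)) (polyMem_surf i φ)
      simpa only [ev_mul] using this) (polyMem_surf i φ).integrable_sq ?_
    filter_upwards [ae_surf_mem i] with x hx
    have h3 := (ev_bubble_mem i (mem_face.1 hx).2).2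
    show ev w x * ev φ x * ev φ x ≤ ev φ x ^ 2
    rw [mul_assoc, ← sq]
    exact mul_le_of_le_one_left (sq_nonneg _) h3
  have hψle : nrm μ (ev ψ) ≤ Real.sqrt K₁ * (Real.sqrt T.size * nrm (surf (T.face i)) (ev φ)) := by
    refine (sq_le_sq₀ (nrm_nonneg _ _) (mul_nonneg (Real.sqrt_nonneg _)
      (mul_nonneg (Real.sqrt_nonneg _) (nrm_nonneg _ _)))).1 ?_
    rw [mul_pow, mul_pow, Real.sq_sqrt hK₁.le, Real.sq_sqrt hs.le, ← mul_assoc]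
    exact hl1.trans (by gcongr)
  -- The bubble has at most `n - 1` linear factors, the correction carries one more, and `ψ` and `p`
  -- have degree at most `m`. The resulting `n + m`, with `m = k - 1` in the notation of the
  -- theorem, is the reason for the degree `j = n + k - 1`.
  refine ⟨w * ψ + w * lamPoly T i * p, ?_, ?_, ?_, ?_, ?_⟩
  · have hw' := totalDegree_bubble_le T i
    have hn := hT.numFaces_le
    have hi := i.2
    have hlp := totalDegree_lamPoly_le T i
    refine totalDegree_add_le ?_ ?_
    · exact (MvPolynomial.totalDegree_mul _ _).trans
        ((Nat.add_le_add hw' hψd).trans (by omega))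
    · exact (MvPolynomial.totalDegree_mul _ _).trans ((Nat.add_le_add
        ((MvPolynomial.totalDegree_mul _ _).trans (Nat.add_le_add hw' hlp)) hpd).trans (by omega))
  · intro l hl x hx
    have : ev w x = 0 := by
      rw [hw, ev_bubble]
      refine Finset.prod_eq_zero (i := l) (by simp [hl]) ?_
      rw [(mem_face.1 hx).1, zero_div]
    simp [this]
  · intro r hr
    have h3 := hp r hr
    have h4 : ∀ x, ev (w * ψ + w * lamPoly T i * p) x * ev r x
        = ev (w * lamPoly T i) x * ev p x * ev r x - ev (-(w * ψ)) x * ev r x := by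
      intro x; simp; ring
    simp only [h4]
    rw [integral_sub, sub_eq_zero]
    · exact h3
    · have := integrable_mul_of_memLp (polyMem_carrier (T := T) (w * lamPoly T i * p))
        (polyMem_carrier r)
      simpa only [ev_mul] using this
    · exact integrable_mul_of_memLp (polyMem_carrier _) (polyMem_carrier r)
  · have h3 : ∫ x, ev φ x * ev (w * ψ + w * lamPoly T i * p) x ∂(surf (T.face i)) = I := by
      refine integral_congr_ae ?_
      filter_upwards [ae_surf_mem i] with x hx
      simp only [ev_add, ev_mul, ev_lamPoly, (mem_face.1 hx).1, hψ, ev_faceLift_of_mem φ hx]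
      ring
    rw [h3]
    have hI0 : 0 ≤ I := by
      have := sq_nonneg (nrm (surf (T.face i)) (ev φ))
      by_contra! hneg
      nlinarith
    have : 0 ≤ (1 + K₂) * Real.sqrt K₁ := by positivity
    nlinarith
  · have h3 : nrm μ (ev (w * ψ + w * lamPoly T i * p))
        ≤ nrm μ (ev (w * ψ)) + nrm μ (ev (w * lamPoly T i * p)) := by
      rw [funext (ev_add (w * ψ) (w * lamPoly T i * p))]
      exact nrm_add_le (polyMem_carrier _) (polyMem_carrier _)
    have h4 : 0 ≤ Real.sqrt T.size * nrm (surf (T.face i)) (ev φ) :=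
      mul_nonneg (Real.sqrt_nonneg _) (nrm_nonneg _ _)
    calc _ ≤ (1 + K₂) * nrm μ (ev ψ) := by linarith
      _ ≤ (1 + K₂) * (Real.sqrt K₁ * (Real.sqrt T.size * nrm (surf (T.face i)) (ev φ))) := by
        gcongr
      _ ≤ _ := by nlinarith

end Face

end WG

namespace WG

/-! ### Iterated derivatives indexed by lists -/

section Derivatives

variable {d : ℕ}

/-- The iterated partial derivative `∂_{l₁} ⋯ ∂_{l_m} φ` for `L = [l₁, …, l_m]`. -/
noncomputable def dL : List (Fin d) → (E d → ℝ) → E d → ℝ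
  | [], φ => φ
  | l :: L, φ => pd l (dL L φ)

lemma contDiff_pd {φ : E d → ℝ} (hφ : ContDiff ℝ ∞ φ) (l : Fin d) : ContDiff ℝ ∞ (pd l φ) :=
  (hφ.fderiv_right (m := ∞) (by simp)).clm_apply contDiff_const

lemma contDiff_dL {φ : E d → ℝ} (hφ : ContDiff ℝ ∞ φ) : ∀ L : List (Fin d), ContDiff ℝ ∞ (dL L φ)
  | [] => hφ
  | l :: L => contDiff_pd (contDiff_dL hφ L) l

lemma pd_comm {φ : E d → ℝ} (hφ : ContDiff ℝ ∞ φ) (l m : Fin d) :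
    pd l (pd m φ) = pd m (pd l φ) := by
  funext x
  have h : ∀ a b : Fin d, pd a (pd b φ) x = fderiv ℝ (fderiv ℝ φ) x (unitVec a) (unitVec b) := by
    intro a b
    have hd : DifferentiableAt ℝ (fderiv ℝ φ) x :=
      ((hφ.fderiv_right (m := ∞) (by simp)).differentiable (by simp)) x
    have h1 : pd b φ = fun y => fderiv ℝ φ y (unitVec b) := rfl
    rw [h1, pd, fderiv_clm_apply hd (differentiableAt_const _)]
    simp
  have hs : IsSymmSndFDerivAt ℝ φ x := hφ.contDiffAt.isSymmSndFDerivAt (by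
    simp only [minSmoothness_of_isRCLikeNormedField]
    exact WithTop.coe_le_coe.2 le_top)
  rw [h, h, hs.eq]

lemma dL_pd {φ : E d → ℝ} (hφ : ContDiff ℝ ∞ φ) (l : Fin d) :
    ∀ L : List (Fin d), dL L (pd l φ) = pd l (dL L φ)
  | [] => rfl
  | m :: L => by rw [dL, dL, dL_pd hφ l L, pd_comm (contDiff_dL hφ L)]

lemma dL_perm {φ : E d → ℝ} (hφ : ContDiff ℝ ∞ φ) {L L' : List (Fin d)} (h : L.Perm L') :
    dL L φ = dL L' φ := by
  induction h with
  | nil => rfl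
  | cons l _ ih => rw [dL, dL, ih]
  | swap a b L => exact pd_comm (contDiff_dL hφ L) _ _
  | trans _ _ h1 h2 => rw [h1, h2]

lemma iteratedFDeriv_unitVec {φ : E d → ℝ} (hφ : ContDiff ℝ ∞ φ) {m : ℕ} (s : Fin m → Fin d)
    (x : E d) :
    iteratedFDeriv ℝ m φ x (fun r => unitVec (s r)) = dL (List.ofFn s) φ x := by
  induction m generalizing x with
  | zero => simp [dL]
  | succ m ih =>
    rw [iteratedFDeriv_succ_apply_left, List.ofFn_succ, dL, pd]
    have hdiff : DifferentiableAt ℝ (iteratedFDeriv ℝ m φ) x :=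
      (hφ.differentiable_iteratedFDeriv (m := m) (by exact_mod_cast WithTop.coe_lt_top _)) x
    rw [← fderiv_continuousMultilinear_apply_const_apply hdiff]
    congr 2
    funext y
    exact ih (fun r => s r.succ) y

lemma IsTest.pd {U : Set (E d)} {φ : E d → ℝ} (h : IsTest U φ) (l : Fin d) :
    IsTest U (WG.pd l φ) :=
  ⟨contDiff_pd h.1 l, h.2.1.fderiv_apply (𝕜 := ℝ) (unitVec l),
    (tsupport_fderiv_apply_subset ℝ (unitVec l)).trans h.2.2⟩

lemma IsTest.mono {U V : Set (E d)} {φ : E d → ℝ} (h : IsTest U φ) (hUV : U ⊆ V) : IsTest V φ :=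
  ⟨h.1, h.2.1, h.2.2.trans hUV⟩

lemma IsTest.memLp {U : Set (E d)} {φ : E d → ℝ} (h : IsTest U φ) (μ : Measure (E d))
    [IsLocallyFiniteMeasure μ] : MemLp φ 2 μ :=
  h.1.continuous.memLp_of_hasCompactSupport h.2.1

/-- `w'` is the weak partial derivative `∂_l w` in `U`. -/
def WeakD1 (U : Set (E d)) (l : Fin d) (w w' : E d → ℝ) : Prop :=
  ∀ φ, IsTest U φ → ∫ x in U, w x * pd l φ x = - ∫ x in U, w' x * φ x

lemma setIntegral_mul_test {U : Set (E d)} {φ : E d → ℝ} (h : tsupport φ ⊆ U) (w : E d → ℝ) :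
    ∫ x in U, w x * φ x = ∫ x, w x * φ x :=
  setIntegral_eq_integral_of_forall_compl_eq_zero fun x hx => by
    rw [image_eq_zero_of_notMem_tsupport fun hx' => hx (h hx'), mul_zero]

lemma WeakD1.mono {U V : Set (E d)} (hUV : U ⊆ V) {l : Fin d} {w w' : E d → ℝ}
    (h : WeakD1 V l w w') : WeakD1 U l w w' := by
  intro φ hφ
  have h1 := h φ (hφ.mono hUV)
  rw [setIntegral_mul_test (hφ.pd l).2.2, setIntegral_mul_test hφ.2.2]
  rwa [setIntegral_mul_test ((hφ.pd l).2.2.trans hUV), setIntegral_mul_test (hφ.2.2.trans hUV)] at h1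

lemma WeakD1.congr {U : Set (E d)} {l : Fin d} {w w' v v' : E d → ℝ} (h : WeakD1 U l w w')
    (hw : w =ᵐ[volume.restrict U] v) (hw' : w' =ᵐ[volume.restrict U] v') : WeakD1 U l v v' := by
  intro φ hφ
  have h1 : ∫ x in U, w x * pd l φ x = ∫ x in U, v x * pd l φ x :=
    integral_congr_ae (hw.mono fun x hx => by simp only [hx])
  have h2 : ∫ x in U, w' x * φ x = ∫ x in U, v' x * φ x :=
    integral_congr_ae (hw'.mono fun x hx => by simp only [hx])
  rw [← h1, ← h2]
  exact h φ hφ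

/-- The weak derivative of `u` indexed by a list. -/
noncomputable def wD (Ω : Set (E d)) (u : E d → ℝ) (L : List (Fin d)) : E d → ℝ :=
  weakDeriv Ω L.get u

/-- The index types `Fin m` and `Fin (List.ofFn s).length` are only propositionally equal;
generalizing the length removes the cast. Lists make prepending one derivative a constructor. -/
lemma ofFn_eq_wD {Ω : Set (E d)} (u : E d → ℝ) {m : ℕ} (s : Fin m → Fin d) :
    wD Ω u (List.ofFn s) = weakDeriv Ω s u := by
  have key : ∀ {m' : ℕ} (s' : Fin m' → Fin d) (h : m' = m), (∀ r, s' r = s (Fin.cast h r)) →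
      weakDeriv Ω s' u = weakDeriv Ω s u := by
    intro m' s' h hs
    subst h
    congr 1
    funext r
    exact hs r
  refine key _ (by simp) fun r => ?_
  simp only [List.get_eq_getElem, List.getElem_ofFn]
  rfl

lemma grad_eq_wD (Ω : Set (E d)) (u : E d → ℝ) (x : E d) (l : Fin d) :
    grad Ω u x l = wD Ω u [l] x := by
  rw [grad, ← ofFn_eq_wD u ![l]]
  simp

lemma wD_spec {Ω : Set (E d)} {N : ℕ} {u : E d → ℝ} (hu : MemSobolev Ω N u) {L : List (Fin d)}
    (hL : L.length ≤ N) :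
    MemLp (wD Ω u L) 2 (volume.restrict Ω) ∧ ∀ φ, IsTest Ω φ →
      ∫ x in Ω, u x * dL L φ x = (-1) ^ L.length * ∫ x in Ω, wD Ω u L x * φ x := by
  have h := Classical.epsilon_spec (hu.2 L.length hL L.get)
  refine ⟨h.1, fun φ hφ => ?_⟩
  have h2 := h.2 φ hφ
  simp only [iteratedFDeriv_unitVec hφ.1, List.ofFn_get] at h2
  exact h2

/-- The weak derivatives of different orders are chosen independently of each other. Testing the one
for `L` with `∂_l φ` links it to the one for `l :: L`, after the signs `(-1)^{|L|}` cancel. -/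
lemma weakD1_wD {Ω : Set (E d)} {N : ℕ} {u : E d → ℝ} (hu : MemSobolev Ω N u) {L : List (Fin d)}
    (hL : L.length + 1 ≤ N) (l : Fin d) : WeakD1 Ω l (wD Ω u L) (wD Ω u (l :: L)) := by
  intro φ hφ
  have h1 := (wD_spec hu (by omega : L.length ≤ N)).2 _ (hφ.pd l)
  have h2 := (wD_spec hu (by simpa using hL : (l :: L).length ≤ N)).2 _ hφ
  rw [dL_pd hφ.1, ← dL, h2, List.length_cons, pow_succ] at h1
  have h3 : ((-1 : ℝ) ^ L.length) * (-1) ^ L.length = 1 := by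
    rw [← mul_pow]; simp
  have h4 := congrArg (fun z => (-1 : ℝ) ^ L.length * z) h1
  simp only [← mul_assoc, h3] at h4
  linarith

lemma ae_eq_of_integral_test {U : Set (E d)} (hU : IsOpen U) {w w' : E d → ℝ}
    (hw : MemLp w 2 (volume.restrict U)) (hw' : MemLp w' 2 (volume.restrict U))
    (h : ∀ φ, IsTest U φ → ∫ x in U, w x * φ x = ∫ x in U, w' x * φ x) :
    w =ᵐ[volume.restrict U] w' := by
  have hloc : LocallyIntegrableOn (fun x => w x - w' x) U := by
    have h1 : MemLp (fun x => w x - w' x) 2 (volume.restrict U) := hw.sub hw'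
    have h2 : LocallyIntegrable (fun x => w x - w' x) (volume.restrict U) :=
      h1.locallyIntegrable (by norm_num)
    exact (locallyIntegrableOn_of_locallyIntegrable_restrict h2)
  have h0 := hU.ae_eq_zero_of_integral_contDiff_smul_eq_zero hloc (fun φ h1 h2 h3 => by
    have ht : IsTest U φ := ⟨h1, h2, h3⟩
    have h4 := setIntegral_mul_test h3 (fun x => w x - w' x)
    simp only [smul_eq_mul, mul_comm (φ _)]
    rw [← h4]
    simp only [sub_mul]
    rw [integral_sub (integrable_mul_of_memLp hw (ht.memLp _))
      (integrable_mul_of_memLp hw' (ht.memLp _)), h φ ht, sub_self])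
  rw [Filter.EventuallyEq, ae_restrict_iff' hU.measurableSet]
  filter_upwards [h0] with x hx hxU
  linarith [hx hxU]

lemma wD_nil {Ω : Set (E d)} (hΩ : IsOpen Ω) {N : ℕ} {u : E d → ℝ} (hu : MemSobolev Ω N u) :
    wD Ω u [] =ᵐ[volume.restrict Ω] u := by
  have h := wD_spec hu (L := []) (by simp)
  refine ae_eq_of_integral_test hΩ h.1 hu.1 fun φ hφ => ?_
  have := h.2 φ hφ
  simpa [dL] using this.symm

end Derivatives

end WG

namespace WG

/-! ### Density of smooth functions in Sobolev spaces on convex sets -/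

section Mollify

variable {d : ℕ}

/-- Smooth averaging kernels. -/
structure IsKernel (k : E d → ℝ) : Prop where
  smooth : ContDiff ℝ ∞ k
  compact : HasCompactSupport k
  nonneg : ∀ x, 0 ≤ k x
  integral_eq : ∫ x, k x = 1

/-- The convolution `W ⋆ k` at the contracted point `τ x`. -/
noncomputable def mollify (τ : ℝ) (k W : E d → ℝ) (x : E d) : ℝ := ∫ z, W z * k (τ • x - z)

lemma convolution_apply (W k : E d → ℝ) (y : E d) :
    convolution W k (ContinuousLinearMap.mul ℝ ℝ) volume y = ∫ z, W z * k (y - z) := by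
  simp [convolution_def]

lemma mollify_eq_convolution (τ : ℝ) (W k : E d → ℝ) :
    mollify τ k W = fun x => convolution W k (ContinuousLinearMap.mul ℝ ℝ) volume (τ • x) :=
  funext fun _ => (convolution_apply W k _).symm

lemma integrable_mul_kernel {W k : E d → ℝ} (hW : LocallyIntegrable W) (hk : HasCompactSupport k)
    (hk' : Continuous k) (y : E d) : Integrable fun z => W z * k (y - z) := by
  have := hk.convolutionExists_right (ContinuousLinearMap.mul ℝ ℝ) hW hk' y
  simpa [ConvolutionExistsAt] using this

lemma contDiff_mollify (τ : ℝ) {W k : E d → ℝ} (hW : LocallyIntegrable W) (hk : IsKernel k) :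
    ContDiff ℝ ∞ (mollify τ k W) := by
  rw [mollify_eq_convolution]
  exact (hk.compact.contDiff_convolution_right _ hW hk.smooth).comp (contDiff_const_smul τ)

lemma pd_mollify (τ : ℝ) {W k : E d → ℝ} (hW : LocallyIntegrable W) (hk : IsKernel k) (l : Fin d)
    (x : E d) : pd l (mollify τ k W) x = τ * ∫ z, W z * pd l k (τ • x - z) := by
  have hk1 : ContDiff ℝ 1 k := hk.smooth.of_le (by exact_mod_cast le_top)
  have h1 := hk.compact.hasFDerivAt_convolution_right (ContinuousLinearMap.mul ℝ ℝ) hW hk1 (τ • x)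
  have h2 : HasFDerivAt (fun x : E d => τ • x) (τ • ContinuousLinearMap.id ℝ (E d)) x :=
    (hasFDerivAt_id x).const_smul τ
  have h3 := h1.comp x h2
  rw [mollify_eq_convolution, pd]
  have h4 : fderiv ℝ (fun x => convolution W k (ContinuousLinearMap.mul ℝ ℝ) volume (τ • x)) x
    = _ := h3.fderiv
  rw [h4]
  simp only [ContinuousLinearMap.comp_apply, smul_apply,
    ContinuousLinearMap.id_apply, map_smul, smul_eq_mul]
  rw [convolution_precompR_apply _ hW (hk.compact.fderiv (𝕜 := ℝ))
    (hk1.continuous_fderiv one_ne_zero), convolution_apply]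
  rfl

lemma indicator_mul_integral {U : Set (E d)} (hU : MeasurableSet U) (w g : E d → ℝ) :
    ∫ z, U.indicator w z * g z = ∫ z in U, w z * g z := by
  rw [← integral_indicator hU]
  congr 1
  funext z
  by_cases hz : z ∈ U <;> simp [hz]

/-- When its support stays in `U`, the shifted kernel `z ↦ k (τ x - z)` is a test function, and the
weak derivative moves the differentiation from the kernel to `w`. -/
lemma pd_mollify_of_weakD1 {U : Set (E d)} (hU : MeasurableSet U) {l : Fin d} {w w' : E d → ℝ}
    (h : WeakD1 U l w w') (hw : LocallyIntegrable (U.indicator w)) {k : E d → ℝ} (hk : IsKernel k)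
    {τ : ℝ} {x : E d} (hx : ∀ z, τ • x - z ∈ tsupport k → z ∈ U) :
    pd l (mollify τ k (U.indicator w)) x = τ * mollify τ k (U.indicator w') x := by
  rw [pd_mollify τ hw hk, mollify, indicator_mul_integral hU, indicator_mul_integral hU]
  congr 1
  have ht : IsTest U (fun z => k (τ • x - z)) := by
    refine ⟨hk.smooth.comp (contDiff_const.sub contDiff_id), ?_, ?_⟩
    · exact hk.compact.comp_homeomorph (Homeomorph.subLeft (τ • x))
    · refine fun z hz => hx z ?_
      have : tsupport (fun z => k (τ • x - z)) ⊆ (fun z => τ • x - z) ⁻¹' tsupport k :=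
        closure_minimal (fun z hz => subset_closure hz)
          ((isClosed_tsupport k).preimage (by fun_prop))
      exact this hz
  have h1 := h _ ht
  have h2 : ∀ z, pd l (fun z => k (τ • x - z)) z = - pd l k (τ • x - z) := by
    intro z
    have hd : HasFDerivAt k (fderiv ℝ k (τ • x - z)) (τ • x - z) :=
      ((hk.smooth.differentiable (by simp)) _).hasFDerivAt
    have h3 := (hd.comp z ((hasFDerivAt_id z).const_sub (τ • x))).fderiv
    have h4 : fderiv ℝ (fun z => k (τ • x - z)) z = _ := h3
    rw [pd, h4]
    simp [pd]
  simp only [h2, mul_neg, integral_neg] at h1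
  linarith

/-- Jensen's inequality, obtained by expanding the nonnegative average of `(W - c)²`, where `c` is
the mollified value. -/
lemma mollify_sq_le {W k : E d → ℝ} (hW : LocallyIntegrable W)
    (hW2 : LocallyIntegrable fun x => W x ^ 2) (hk : IsKernel k) (τ : ℝ) (x : E d) :
    mollify τ k W x ^ 2 ≤ mollify τ k (fun x => W x ^ 2) x := by
  set c := mollify τ k W x with hc
  have hkc := hk.smooth.continuous
  have i1 := integrable_mul_kernel hW hk.compact hkc (τ • x)
  have i2 := integrable_mul_kernel hW2 hk.compact hkc (τ • x)
  have i3 : Integrable fun z => k (τ • x - z) := by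
    simpa using integrable_mul_kernel (W := fun _ => (1 : ℝ)) (locallyIntegrable_const 1)
      hk.compact hkc (τ • x)
  have h0 : 0 ≤ ∫ z, (W z - c) ^ 2 * k (τ • x - z) :=
    integral_nonneg fun z => mul_nonneg (sq_nonneg _) (hk.nonneg _)
  have h1 : ∀ z, (W z - c) ^ 2 * k (τ • x - z)
      = W z ^ 2 * k (τ • x - z) - 2 * c * (W z * k (τ • x - z)) + c ^ 2 * k (τ • x - z) := by
    intro z; ring
  have h2 : ∫ z, k (τ • x - z) = 1 := by
    rw [integral_sub_left_eq_self k volume (τ • x), hk.integral_eq]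
  simp only [h1] at h0
  have i4 : Integrable fun z => W z ^ 2 * k (τ • x - z) - 2 * c * (W z * k (τ • x - z)) :=
    i2.sub (i1.const_mul _)
  rw [integral_add i4 (i3.const_mul _), integral_sub i2 (i1.const_mul _),
    integral_const_mul, integral_const_mul, h2] at h0
  change 0 ≤ mollify τ k (fun x => W x ^ 2) x - 2 * c * c + c ^ 2 * 1 at h0
  nlinarith

/-- Integrating `mollify_sq_le` gives the bound, because kernels have mass one; the factor `τ^{-d}`
is the Jacobian of the contraction `x ↦ τ x`. -/
lemma memLp_mollify {W k : E d → ℝ} (hW : MemLp W 2 volume) (hk : IsKernel k) {τ : ℝ}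
    (hτ : 0 < τ) : MemLp (mollify τ k W) 2 volume ∧
      nrm volume (mollify τ k W) ^ 2 ≤ (τ ^ d)⁻¹ * nrm volume W ^ 2 := by
  have hl : LocallyIntegrable W := hW.locallyIntegrable (by norm_num)
  have hi : Integrable fun x => W x ^ 2 := hW.integrable_sq
  have hki : Integrable k := hk.smooth.continuous.integrable_of_hasCompactSupport hk.compact
  have hci : Integrable (convolution (fun x => W x ^ 2) k (ContinuousLinearMap.mul ℝ ℝ) volume) :=
    hi.integrable_convolution _ hki
  have hmi : Integrable (mollify τ k fun x => W x ^ 2) := by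
    rw [mollify_eq_convolution]
    exact hci.comp_smul hτ.ne'
  have hcont : Continuous (mollify τ k W) := (contDiff_mollify τ hl hk).continuous
  have hle := mollify_sq_le hl hi.locallyIntegrable hk τ
  have hm : MemLp (mollify τ k W) 2 volume := by
    rw [memLp_two_iff_integrable_sq hcont.aestronglyMeasurable]
    refine hmi.mono' (hcont.pow 2).aestronglyMeasurable (Filter.Eventually.of_forall fun x => ?_)
    rw [Real.norm_eq_abs, abs_of_nonneg (sq_nonneg _)]
    exact hle x
  refine ⟨hm, ?_⟩
  rw [nrm_sq hm, nrm_sq hW]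
  refine (integral_mono hm.integrable_sq hmi hle).trans (le_of_eq ?_)
  rw [mollify_eq_convolution, Measure.integral_comp_smul volume
    (convolution (fun x => W x ^ 2) k (ContinuousLinearMap.mul ℝ ℝ) volume) τ,
    integral_convolution _ hi hki]
  simp [hk.integral_eq, abs_of_pos hτ]

lemma mollify_sub {W W' k : E d → ℝ} (hW : LocallyIntegrable W) (hW' : LocallyIntegrable W')
    (hk : IsKernel k) (τ : ℝ) (x : E d) :
    mollify τ k (fun x => W x - W' x) x = mollify τ k W x - mollify τ k W' x := by
  have hkc := hk.smooth.continuous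
  simp only [mollify, sub_mul]
  exact integral_sub (integrable_mul_kernel hW hk.compact hkc _)
    (integrable_mul_kernel hW' hk.compact hkc _)

lemma abs_mollify_sub_le {ψ k : E d → ℝ} (hψ : Continuous ψ) (hk : IsKernel k) {τ ε : ℝ}
    {x : E d} (h : ∀ z, τ • x - z ∈ tsupport k → |ψ z - ψ x| ≤ ε) :
    |mollify τ k ψ x - ψ x| ≤ ε := by
  have hkc := hk.smooth.continuous
  have i3 : Integrable fun z => k (τ • x - z) := by
    simpa using integrable_mul_kernel (W := fun _ => (1 : ℝ)) (locallyIntegrable_const 1)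
      hk.compact hkc (τ • x)
  have h2 : ∫ z, k (τ • x - z) = 1 := by
    rw [integral_sub_left_eq_self k volume (τ • x), hk.integral_eq]
  have h1 : mollify τ k ψ x - ψ x = ∫ z, (ψ z - ψ x) * k (τ • x - z) := by
    simp only [sub_mul]
    rw [integral_sub (integrable_mul_kernel hψ.locallyIntegrable hk.compact hkc _)
      (i3.const_mul _), integral_const_mul, h2, mul_one, mollify]
  rw [h1]
  have h3 : ‖∫ z, (ψ z - ψ x) * k (τ • x - z)‖ ≤ ∫ z, ε * k (τ • x - z) := by
    refine norm_integral_le_of_norm_le (i3.const_mul ε) (Filter.Eventually.of_forall fun z => ?_)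
    rw [Real.norm_eq_abs, abs_mul, abs_of_nonneg (hk.nonneg _)]
    by_cases hz : τ • x - z ∈ tsupport k
    · exact mul_le_mul_of_nonneg_right (h z hz) (hk.nonneg _)
    · simp [image_eq_zero_of_notMem_tsupport hz]
  rwa [integral_const_mul, h2, mul_one] at h3

/-- The bump function used to smoothen with parameter `σ`. -/
noncomputable def kernelBump (x₀ : E d) {r σ : ℝ} (hr : 0 < r) (hσ : 0 < σ) :
    ContDiffBump (-(σ • x₀)) :=
  ⟨σ * r / 2, σ * r, by positivity, by linarith [mul_pos hσ hr]⟩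

lemma exists_kernel (x₀ : E d) {r σ : ℝ} (hr : 0 < r) (hσ : 0 < σ) :
    ∃ k : E d → ℝ, IsKernel k ∧ tsupport k = Metric.closedBall (-(σ • x₀)) (σ * r) := by
  refine ⟨(kernelBump x₀ hr hσ).normed volume, ⟨(kernelBump x₀ hr hσ).contDiff_normed,
    (kernelBump x₀ hr hσ).hasCompactSupport_normed, (kernelBump x₀ hr hσ).nonneg_normed,
    (kernelBump x₀ hr hσ).integral_normed⟩, (kernelBump x₀ hr hσ).tsupport_normed_eq⟩

/-- The point `z` equals `(1 - σ) x + σ y` with `y` in the ball about `x₀`, so convexity applies.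
Contracting towards an interior ball lets averages at points near the boundary use only values
inside `U`. -/
lemma mem_of_sub_mem_closedBall {U : Set (E d)} (hU : Convex ℝ U) {x₀ : E d} {r σ : ℝ}
    (hb : Metric.closedBall x₀ r ⊆ U) (hσ : 0 < σ) (hσ1 : σ ≤ 1) {x z : E d} (hx : x ∈ U)
    (hz : (1 - σ) • x - z ∈ Metric.closedBall (-(σ • x₀)) (σ * r)) : z ∈ U := by
  have hy : σ⁻¹ • (z - (1 - σ) • x) ∈ U := by
    apply hb
    rw [mem_closedBall_iff_norm] at hz ⊢
    have h1 : σ⁻¹ • (z - (1 - σ) • x) - x₀ = -(σ⁻¹ • ((1 - σ) • x - z - -(σ • x₀))) := by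
      have : x₀ = σ⁻¹ • (σ • x₀) := by rw [smul_smul, inv_mul_cancel₀ hσ.ne', one_smul]
      nth_rewrite 1 [this]
      module
    rw [h1, norm_neg, norm_smul, norm_inv, Real.norm_of_nonneg hσ.le]
    calc σ⁻¹ * _ ≤ σ⁻¹ * (σ * r) := by gcongr
      _ = r := by field_simp
  have := hU hx hy (sub_nonneg.2 hσ1) hσ.le (by ring)
  rwa [smul_smul, mul_inv_cancel₀ hσ.ne', one_smul, add_sub_cancel] at this

/-- Mollification is uniformly bounded in `L²`, since `1 - σ ≥ 1/2`, so `W` may be replaced by a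
continuous function of compact support; for that one, uniform continuity on the bounded set `U`
suffices. -/
lemma tendsto_nrm_mollify {U : Set (E d)} (hUm : MeasurableSet U) (hUb : Bornology.IsBounded U)
    {x₀ : E d} {r : ℝ} {σ : ℕ → ℝ} (hσ : ∀ m, 0 < σ m ∧ σ m ≤ 1 / 2)
    (hσ0 : Filter.Tendsto σ Filter.atTop (𝓝 0)) {k : ℕ → E d → ℝ} (hk : ∀ m, IsKernel (k m))
    (hks : ∀ m, tsupport (k m) = Metric.closedBall (-(σ m • x₀)) (σ m * r)) {W : E d → ℝ}
    (hW : MemLp W 2 volume) :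
    Filter.Tendsto (fun m => nrm (volume.restrict U)
      (fun x => mollify (1 - σ m) (k m) W x - W x)) Filter.atTop (𝓝 0) := by
  have : IsFiniteMeasure (volume.restrict U : Measure (E d)) :=
    ⟨by rw [Measure.restrict_apply_univ]; exact hUb.measure_lt_top⟩
  have hvm : ∀ {F : E d → ℝ}, MemLp F 2 volume → MemLp F 2 (volume.restrict U) :=
    fun h => h.restrict U
  set V : ℝ := nrm (volume.restrict U : Measure (E d)) (fun _ => (1 : ℝ)) with hV
  have hV0 : 0 ≤ V := nrm_nonneg _ _
  obtain ⟨R, hR⟩ := hUb.subset_closedBall (0 : E d)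
  rw [Metric.tendsto_atTop]
  intro ε' hε'
  -- The three errors are `2^d ε` for the mollified difference `W - ψ`, `V ε` for the uniform error
  -- of `ψ`, and `ε` for `W - ψ` itself.
  obtain ⟨ε, hε, hεε⟩ : ∃ ε : ℝ, 0 < ε ∧ (2 ^ d + V + 1) * ε < ε' := by
    refine ⟨ε' / (2 * (2 ^ d + V + 1)), by positivity, ?_⟩
    rw [mul_div_assoc', div_lt_iff₀ (by positivity)]
    nlinarith [show (0 : ℝ) < 2 ^ d + V + 1 by positivity]
  obtain ⟨ψ, hψc, hψ, hψcont, hψm⟩ := hW.exists_hasCompactSupport_eLpNorm_sub_le (by norm_num)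
    (ε := ENNReal.ofReal ε) (by simpa using hε)
  have hψn : nrm volume (fun x => W x - ψ x) ≤ ε := ENNReal.toReal_le_of_le_ofReal hε.le hψ
  obtain ⟨η, hη, hψη⟩ := Metric.uniformContinuous_iff.1
    (hψc.uniformContinuous_of_continuous hψcont) ε hε
  have hlim : Filter.Tendsto (fun m => σ m * (|R| + ‖x₀‖ + |r|)) Filter.atTop (𝓝 0) := by
    simpa using hσ0.mul_const (|R| + ‖x₀‖ + |r|)
  obtain ⟨N, hN⟩ := Filter.eventually_atTop.1 (hlim.eventually (gt_mem_nhds hη))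
  refine ⟨N, fun m hm => ?_⟩
  rw [Real.dist_eq, sub_zero, abs_of_nonneg (nrm_nonneg _ _)]
  refine lt_of_le_of_lt ?_ hεε
  have hτ : (0 : ℝ) < 1 - σ m := by linarith [(hσ m).2]
  have hDm : MemLp (fun x => W x - ψ x) 2 volume := hW.sub hψm
  obtain ⟨hM, hMn⟩ := memLp_mollify hDm (hk m) hτ
  obtain ⟨hMψ, -⟩ := memLp_mollify hψm (hk m) hτ
  have h1 : nrm volume (mollify (1 - σ m) (k m) fun x => W x - ψ x) ≤ 2 ^ d * ε := by
    refine (sq_le_sq₀ (nrm_nonneg _ _) (by positivity)).1 (hMn.trans ?_)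
    have h3 : ((1 - σ m) ^ d)⁻¹ ≤ 2 ^ d := by
      rw [← inv_pow]
      refine pow_le_pow_left₀ (by positivity) ?_ _
      rw [inv_le_comm₀ hτ two_pos]
      linarith [(hσ m).2]
    have h4 : (2 : ℝ) ^ d ≤ (2 ^ d) ^ 2 := by
      rw [sq]
      exact le_mul_of_one_le_left (by positivity) (one_le_pow₀ (by norm_num))
    rw [mul_pow]
    exact mul_le_mul (h3.trans h4) (pow_le_pow_left₀ (nrm_nonneg _ _) hψn 2) (sq_nonneg _)
      (by positivity)
  have h2 : nrm (volume.restrict U) (fun x => mollify (1 - σ m) (k m) ψ x - ψ x) ≤ ε * V := by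
    rw [hV, ← abs_of_pos hε, ← nrm_const_mul]
    refine nrm_mono (memLp_const _) ?_
    filter_upwards [ae_restrict_mem hUm] with x hx
    rw [mul_one, abs_of_pos hε]
    refine abs_mollify_sub_le hψcont (hk m) fun z hz => ?_
    rw [hks, mem_closedBall_iff_norm] at hz
    refine (le_of_lt ?_)
    have := hψη (a := z) (b := x) ?_
    · rwa [Real.dist_eq] at this
    refine lt_of_le_of_lt ?_ (hN m hm)
    have hxR : ‖x‖ ≤ |R| := (mem_closedBall_zero_iff.1 (hR hx)).trans (le_abs_self R)
    have e1 : z - x = -((1 - σ m) • x - z - -(σ m • x₀)) - σ m • x + σ m • x₀ := by module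
    rw [dist_eq_norm, e1]
    refine (norm_add_le _ _).trans ?_
    refine (add_le_add_left (norm_sub_le _ _) _).trans ?_
    rw [norm_neg, norm_smul, norm_smul, Real.norm_of_nonneg (hσ m).1.le]
    have h5 : σ m * r ≤ σ m * |r| := mul_le_mul_of_nonneg_left (le_abs_self r) (hσ m).1.le
    have h6 : σ m * ‖x‖ ≤ σ m * |R| := mul_le_mul_of_nonneg_left hxR (hσ m).1.le
    linarith
  have h3 : nrm (volume.restrict U) (mollify (1 - σ m) (k m) fun x => W x - ψ x) ≤ 2 ^ d * ε :=
    (nrm_mono_measure Measure.restrict_le_self hM).trans h1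
  have h4 : nrm (volume.restrict U) (fun x => W x - ψ x) ≤ ε :=
    (nrm_mono_measure Measure.restrict_le_self hDm).trans hψn
  have hWl : LocallyIntegrable W := hW.locallyIntegrable (by norm_num)
  have e : (fun x => mollify (1 - σ m) (k m) W x - W x)
      = fun x => (mollify (1 - σ m) (k m) (fun x => W x - ψ x) x
        + (mollify (1 - σ m) (k m) ψ x - ψ x)) - (W x - ψ x) := by
    funext x
    rw [mollify_sub hWl hψcont.locallyIntegrable (hk m)]
    ring
  rw [e]
  have hA := hvm hM
  have hB : MemLp (fun x => mollify (1 - σ m) (k m) ψ x - ψ x) 2 (volume.restrict U) :=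
    hvm (hMψ.sub hψm)
  have h7 := nrm_sub_le (hA.add hB) (hvm hDm)
  have h8 := nrm_add_le hA hB
  simp only [Pi.add_apply] at h7
  change _ ≤ nrm _ (fun x => _ + _) + _ at h7
  linarith

/-- Functions with square integrable weak derivatives of order at most `N` on a bounded convex
open set are limits of smooth functions, with all these derivatives. -/
theorem exists_smooth_approx {U : Set (E d)} (hUo : IsOpen U) (hUc : Convex ℝ U)
    (hUb : Bornology.IsBounded U) (hUn : U.Nonempty) {N : ℕ} {D : List (Fin d) → E d → ℝ}
    (hD : ∀ L : List (Fin d), L.length ≤ N → MemLp (D L) 2 (volume.restrict U))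
    (hD1 : ∀ (L : List (Fin d)) (l : Fin d), L.length + 1 ≤ N → WeakD1 U l (D L) (D (l :: L))) :
    ∃ φ : ℕ → E d → ℝ, (∀ m, ContDiff ℝ ∞ (φ m)) ∧ ∀ L : List (Fin d), L.length ≤ N →
      Filter.Tendsto (fun m => eLpNorm (fun x => dL L (φ m) x - D L x) 2 (volume.restrict U))
        Filter.atTop (𝓝 0) := by
  obtain ⟨x₀, hx₀⟩ := hUn
  obtain ⟨r, hr, hb⟩ := Metric.nhds_basis_closedBall.mem_iff.1 (hUo.mem_nhds hx₀)
  -- The shift by two keeps `σ ≤ 1/2`, so the contraction factors stay at least `1/2`.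
  set σ : ℕ → ℝ := fun m => 1 / (m + 2) with hσd
  have hσ : ∀ m, 0 < σ m ∧ σ m ≤ 1 / 2 := fun m =>
    ⟨by positivity, one_div_le_one_div_of_le two_pos (by linarith [Nat.cast_nonneg (α := ℝ) m])⟩
  have hσ0 : Filter.Tendsto σ Filter.atTop (𝓝 0) := by
    have := (tendsto_one_div_add_atTop_nhds_zero_nat (𝕜 := ℝ)).comp (Filter.tendsto_add_atTop_nat 1)
    refine this.congr fun m => ?_
    simp only [Function.comp, hσd]
    push_cast
    ring_nf
  choose k hk hks using fun m => exists_kernel x₀ hr (hσ m).1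
  have hUm := hUo.measurableSet
  have hI : ∀ L : List (Fin d), L.length ≤ N → MemLp (U.indicator (D L)) 2 volume := fun L hL =>
    (memLp_indicator_iff_restrict hUm).2 (hD L hL)
  have hIl : ∀ L : List (Fin d), L.length ≤ N → LocallyIntegrable (U.indicator (D L)) :=
    fun L hL => (hI L hL).locallyIntegrable (by norm_num)
  set φ : ℕ → E d → ℝ := fun m => mollify (1 - σ m) (k m) (U.indicator (D [])) with hφ
  have hsm : ∀ m, ContDiff ℝ ∞ (φ m) := fun m => contDiff_mollify _ (hIl [] (by simp)) (hk m)
  -- Each differentiation produces one factor `1 - σ`, which tends to one. The identity holds only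
  -- inside `U`; openness turns it into a local identity that can be differentiated again.
  have hder : ∀ m, ∀ L : List (Fin d), L.length ≤ N → ∀ x ∈ U, dL L (φ m) x
      = (1 - σ m) ^ L.length * mollify (1 - σ m) (k m) (U.indicator (D L)) x := by
    intro m L
    induction L with
    | nil => intro _ x _; simp [dL, hφ]
    | cons l L ih =>
      intro hL x hx
      have hL' : L.length + 1 ≤ N := by simpa using hL
      have h1 : dL L (φ m) =ᶠ[𝓝 x]
          fun x => (1 - σ m) ^ L.length * mollify (1 - σ m) (k m) (U.indicator (D L)) x :=
        Filter.eventually_of_mem (hUo.mem_nhds hx) (ih (by omega))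
      have h2 := pd_mollify_of_weakD1 hUm (hD1 L l hL') (hIl L (by omega)) (hk m)
        (τ := 1 - σ m) (x := x) (fun z hz => by
          rw [hks] at hz
          exact mem_of_sub_mem_closedBall hUc hb (hσ m).1 (by linarith [(hσ m).2]) hx hz)
      have hdiff : DifferentiableAt ℝ (mollify (1 - σ m) (k m) (U.indicator (D L))) x :=
        (contDiff_mollify _ (hIl L (by omega)) (hk m)).differentiable (by simp) x
      rw [dL, pd, h1.fderiv_eq, fderiv_const_mul hdiff]
      simp only [smul_apply, smul_eq_mul]
      rw [← pd, h2, List.length_cons, pow_succ]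
      ring
  refine ⟨φ, hsm, fun L hL => ?_⟩
  set τ : ℕ → ℝ := fun m => 1 - σ m
  have hτ1 : Filter.Tendsto (fun m => τ m ^ L.length) Filter.atTop (𝓝 1) := by
    simpa [τ] using (hσ0.const_sub 1).pow L.length
  have hconv := tendsto_nrm_mollify (r := r) hUm hUb hσ hσ0 hk hks (hI L hL)
  have hIm : MemLp (U.indicator (D L)) 2 (volume.restrict U) := (hI L hL).restrict U
  have hMm : ∀ m, MemLp (mollify (τ m) (k m) (U.indicator (D L))) 2 (volume.restrict U) :=
    fun m => (memLp_mollify (hI L hL) (hk m) (by simp only [τ]; linarith [(hσ m).2])).1.restrict U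
  have heq : ∀ m, (fun x => dL L (φ m) x - D L x) =ᵐ[volume.restrict U]
      fun x => τ m ^ L.length * (mollify (τ m) (k m) (U.indicator (D L)) x - U.indicator (D L) x)
        + (τ m ^ L.length - 1) * U.indicator (D L) x := by
    intro m
    filter_upwards [ae_restrict_mem hUm] with x hx
    rw [hder m L hL x hx, Set.indicator_of_mem hx]
    ring
  have hm1 : ∀ m, MemLp (fun x => τ m ^ L.length
      * (mollify (τ m) (k m) (U.indicator (D L)) x - U.indicator (D L) x)) 2 (volume.restrict U) :=
    fun m => ((hMm m).sub hIm).const_mul _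
  have hm2 : ∀ m, MemLp (fun x => (τ m ^ L.length - 1) * U.indicator (D L) x) 2
      (volume.restrict U) := fun m => hIm.const_mul _
  have hbound : ∀ m, nrm (volume.restrict U) (fun x => dL L (φ m) x - D L x)
      ≤ |τ m ^ L.length| * nrm (volume.restrict U)
          (fun x => mollify (τ m) (k m) (U.indicator (D L)) x - U.indicator (D L) x)
        + |τ m ^ L.length - 1| * nrm (volume.restrict U) (U.indicator (D L)) := by
    intro m
    rw [nrm_congr_ae (heq m), ← nrm_const_mul, ← nrm_const_mul]
    exact nrm_add_le (hm1 m) (hm2 m)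
  have hz : Filter.Tendsto (fun m => nrm (volume.restrict U) (fun x => dL L (φ m) x - D L x))
      Filter.atTop (𝓝 0) := by
    refine squeeze_zero (fun m => nrm_nonneg _ _) hbound ?_
    have h1 := (hτ1.abs.mul hconv)
    have h2 := ((hτ1.sub_const 1).abs.mul_const (nrm (volume.restrict U) (U.indicator (D L))))
    simpa using h1.add h2
  have hfin : ∀ m, eLpNorm (fun x => dL L (φ m) x - D L x) 2 (volume.restrict U)
      = ENNReal.ofReal (nrm (volume.restrict U) (fun x => dL L (φ m) x - D L x)) := by
    intro m
    rw [nrm, ENNReal.ofReal_toReal]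
    rw [eLpNorm_congr_ae (heq m)]
    exact ((hm1 m).add (hm2 m)).2.ne
  simp only [hfin]
  simpa using ENNReal.tendsto_ofReal hz

end Mollify

end WG

namespace WG

open ConvexPolytope

/-! ### The Poincaré inequality on convex polytopes -/

section Poincare

variable {d : ℕ}

/-- The squared length of the gradient. -/
noncomputable def gradSq (v : E d → ℝ) (x : E d) : ℝ := ∑ l, pd l v x ^ 2

lemma gradSq_nonneg (v : E d → ℝ) (x : E d) : 0 ≤ gradSq v x :=
  Finset.sum_nonneg fun _ _ => sq_nonneg _

lemma continuous_gradSq {v : E d → ℝ} (hv : ContDiff ℝ 1 v) : Continuous (gradSq v) :=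
  continuous_finsetSum _ fun l _ => (continuous_pd hv l).pow 2

lemma sq_sub_le_segment {v : E d → ℝ} (hv : ContDiff ℝ 1 v) (x y : E d) :
    (v x - v y) ^ 2 ≤ ‖x - y‖ ^ 2 * ∫ t in Set.Icc (0 : ℝ) 1, gradSq v (y + t • (x - y)) := by
  set μ : Measure ℝ := volume.restrict (Set.Icc (0 : ℝ) 1) with hμ
  have hpath : Continuous fun t : ℝ => y + t • (x - y) := by fun_prop
  set s' : ℝ → ℝ := fun t => fderiv ℝ v (y + t • (x - y)) (x - y) with hs'
  have hs'c : Continuous s' :=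
    ((hv.continuous_fderiv one_ne_zero).comp hpath).clm_apply continuous_const
  have hder : ∀ t, HasDerivAt (fun t : ℝ => v (y + t • (x - y))) (s' t) t := by
    intro t
    have h1 : HasFDerivAt v (fderiv ℝ v (y + t • (x - y))) (y + t • (x - y)) :=
      (hv.differentiable one_ne_zero _).hasFDerivAt
    have h2 : HasDerivAt (fun t : ℝ => y + t • (x - y)) (x - y) t := by
      simpa using ((hasDerivAt_id t).smul_const (x - y)).const_add y
    exact h1.comp_hasDerivAt t h2
  have hint : v x - v y = ∫ t, s' t * 1 ∂μ := by
    have h := intervalIntegral.integral_eq_sub_of_hasDerivAt (a := 0) (b := 1)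
      (fun t _ => hder t) (hs'c.intervalIntegrable _ _)
    rw [intervalIntegral.integral_of_le zero_le_one, ← integral_Icc_eq_integral_Ioc] at h
    simp only [mul_one]
    rw [h]
    simp
  have hfin : IsFiniteMeasure μ := ⟨by simp [hμ]⟩
  have hI : ∀ {F : ℝ → ℝ}, Continuous F → Integrable F μ := fun hF =>
    hF.integrableOn_Icc
  have hm : MemLp s' 2 μ := by
    rw [memLp_two_iff_integrable_sq hs'c.aestronglyMeasurable]
    exact hI (hs'c.pow 2)
  have hone : nrm μ (fun _ => (1 : ℝ)) ^ 2 = 1 := by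
    rw [nrm_sq (memLp_const _)]; simp [hμ]
  have hcs := abs_integral_mul_le hm (memLp_const (1 : ℝ))
  have h3 : (v x - v y) ^ 2 ≤ ∫ t, s' t ^ 2 ∂μ := by
    rw [hint, ← sq_abs]
    refine (pow_le_pow_left₀ (abs_nonneg _) hcs 2).trans (le_of_eq ?_)
    rw [mul_pow, hone, mul_one, nrm_sq hm]
  refine h3.trans ?_
  rw [← integral_const_mul]
  refine integral_mono (hI (hs'c.pow 2))
    (hI (continuous_const.mul ((continuous_gradSq hv).comp hpath))) fun t => ?_
  simp only [hs']
  rw [fderiv_apply_eq_sum]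
  refine (Finset.sum_mul_sq_le_sq_mul_sq _ _ _).trans (le_of_eq ?_)
  rw [EuclideanSpace.norm_sq_eq]
  simp [gradSq]

lemma lintegral_comp_smul_add {F : E d → ENNReal} (hF : Measurable F) {t : ℝ} (ht : 0 < t)
    (c : E d) : ∫⁻ x, F (t • x + c) = ENNReal.ofReal ((t ^ d)⁻¹) * ∫⁻ x, F x := by
  have h1 : ∫⁻ x, F (t • x + c) = ∫⁻ y, F (y + c) ∂(Measure.map (fun x : E d => t • x) volume) := by
    rw [lintegral_map (f := fun y => F (y + c)) (hF.comp (measurable_add_const c))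
      (measurable_const_smul t)]
  rw [h1, Measure.map_addHaar_smul volume ht.ne', lintegral_smul_measure,
    lintegral_add_right_eq_self F c]
  simp [abs_of_pos ht]

/-- The contraction towards `y` maps the convex set into itself, and its inverse Jacobian `t^{-d}`
is at most `2^d` when `t ≥ 1/2`. -/
lemma lintegral_contract_le {U : Set (E d)} (hU : MeasurableSet U) (hc : Convex ℝ U)
    {G : E d → ENNReal} (hG : Measurable G) {t : ℝ} (ht : 1 / 2 ≤ t) (ht1 : t ≤ 1) {y : E d}
    (hy : y ∈ U) : ∫⁻ x in U, G (t • x + (1 - t) • y) ≤ 2 ^ d * ∫⁻ x in U, G x := by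
  have ht0 : 0 < t := by linarith
  calc ∫⁻ x in U, G (t • x + (1 - t) • y)
      ≤ ∫⁻ x in U, U.indicator G (t • x + (1 - t) • y) := by
        refine setLIntegral_mono' hU fun x hx => ?_
        rw [Set.indicator_of_mem (hc hx hy ht0.le (by linarith) (by ring))]
    _ ≤ ∫⁻ x, U.indicator G (t • x + (1 - t) • y) := setLIntegral_le_lintegral _ _
    _ = ENNReal.ofReal ((t ^ d)⁻¹) * ∫⁻ x in U, G x := by
        rw [lintegral_comp_smul_add (hG.indicator hU) ht0, lintegral_indicator hU]
    _ ≤ 2 ^ d * ∫⁻ x in U, G x := by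
        gcongr
        rw [← ENNReal.ofReal_ofNat 2, ← ENNReal.ofReal_pow (by norm_num)]
        refine ENNReal.ofReal_le_ofReal ?_
        rw [← inv_pow]
        refine pow_le_pow_left₀ (by positivity) ?_ _
        rw [inv_le_comm₀ ht0 two_pos]
        linarith

/-- One of `t` and `1 - t` is at least `1/2`, and the variable carrying it is integrated first. This
keeps the Poincaré constant independent of the shape of the convex set. -/
lemma lintegral_segment_le {U : Set (E d)} (hU : MeasurableSet U) (hc : Convex ℝ U)
    {G : E d → ENNReal} (hG : Measurable G) {t : ℝ} (ht : t ∈ Set.Icc (0 : ℝ) 1) :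
    ∫⁻ x in U, ∫⁻ y in U, G (y + t • (x - y)) ≤ 2 ^ d * volume U * ∫⁻ x in U, G x := by
  have hmeas : Measurable fun p : E d × E d => G (p.2 + t • (p.1 - p.2)) :=
    hG.comp (by fun_prop)
  have hconst : ∫⁻ _ in U, (2 ^ d * ∫⁻ x in U, G x) = 2 ^ d * volume U * ∫⁻ x in U, G x := by
    rw [setLIntegral_const]; ring
  rw [← hconst]
  rcases le_total (1 / 2) t with h | h
  · rw [lintegral_lintegral_swap hmeas.aemeasurable]
    refine setLIntegral_mono' hU fun y hy => ?_
    refine le_trans (le_of_eq ?_) (lintegral_contract_le hU hc hG h ht.2 hy)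
    congr 1; funext x; congr 1; module
  · refine setLIntegral_mono' hU fun x hx => ?_
    refine le_trans (le_of_eq ?_) (lintegral_contract_le hU hc hG (t := 1 - t) (by linarith)
      (by linarith [ht.1]) hx)
    congr 1; funext y; congr 1; module

lemma lintegral_lintegral_segment_le {U : Set (E d)} (hU : MeasurableSet U) (hc : Convex ℝ U)
    {G : E d → ENNReal} (hG : Measurable G) :
    ∫⁻ x in U, ∫⁻ y in U, ∫⁻ t in Set.Icc (0 : ℝ) 1, G (y + t • (x - y))
      ≤ 2 ^ d * volume U * ∫⁻ x in U, G x := by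
  have e1 : ∀ x, ∫⁻ y in U, ∫⁻ t in Set.Icc (0 : ℝ) 1, G (y + t • (x - y))
      = ∫⁻ t in Set.Icc (0 : ℝ) 1, ∫⁻ y in U, G (y + t • (x - y)) := fun x =>
    lintegral_lintegral_swap (f := fun y t => G (y + t • (x - y)))
      (hG.comp (by fun_prop)).aemeasurable
  simp only [e1]
  have hm : Measurable fun p : (E d × ℝ) × E d => G (p.2 + p.1.2 • (p.1.1 - p.2)) :=
    hG.comp (by fun_prop)
  rw [lintegral_lintegral_swap (f := fun x t => ∫⁻ y in U, G (y + t • (x - y)))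
    hm.lintegral_prod_right'.aemeasurable]
  refine (setLIntegral_mono' measurableSet_Icc fun t ht =>
    lintegral_segment_le hU hc hG ht).trans ?_
  rw [setLIntegral_const]
  simp

lemma sq_integral_le_mul {X : Type*} [MeasurableSpace X] {μ : Measure X} [IsFiniteMeasure μ]
    {f : X → ℝ} (hf : MemLp f 2 μ) : (∫ x, f x ∂μ) ^ 2 ≤ μ.real Set.univ * ∫ x, f x ^ 2 ∂μ := by
  have h := abs_integral_mul_le hf (memLp_const (1 : ℝ))
  have hone : nrm μ (fun _ => (1 : ℝ)) ^ 2 = μ.real Set.univ := by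
    rw [nrm_sq (memLp_const _)]; simp
  simp only [mul_one] at h
  rw [← sq_abs]
  refine (pow_le_pow_left₀ (abs_nonneg _) h 2).trans (le_of_eq ?_)
  rw [mul_pow, hone, nrm_sq hf, mul_comm]

lemma carrier_volume_pos (T : ConvexPolytope d) : 0 < (volume T.carrier).toReal :=
  ENNReal.toReal_pos (T.isOpen_carrier.measure_pos volume T.carrier_nonempty).ne'
    T.isBounded_carrier.measure_lt_top.ne

/-- The Poincaré inequality. -/
theorem nrm_le_of_integral_eq_zero (T : ConvexPolytope d) {v : E d → ℝ} (hv : ContDiff ℝ 1 v)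
    (h0 : ∫ x in T.carrier, v x = 0) :
    nrm (volume.restrict T.carrier) v
      ≤ 2 ^ d * T.size * ∑ l, nrm (volume.restrict T.carrier) (pd l v) := by
  have hs0 : 0 ≤ T.size := Metric.diam_nonneg
  set μ := (volume : Measure (E d)).restrict T.carrier with hμ
  set V : ℝ := (volume T.carrier).toReal with hVdef
  have hV : 0 < V := carrier_volume_pos T
  have hVe : volume T.carrier = ENNReal.ofReal V :=
    (ENNReal.ofReal_toReal T.isBounded_carrier.measure_lt_top.ne).symm
  set G : E d → ENNReal := fun x => ENNReal.ofReal (gradSq v x) with hG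
  have hGm : Measurable G := (continuous_gradSq hv).measurable.ennreal_ofReal
  have hvm : MemLp v 2 μ := memLp_carrier hv.continuous
  have hvi : Integrable v μ := hvm.integrable (by norm_num)
  have hμV : μ.real Set.univ = V := by simp [hμ, hVdef, Measure.real]
  -- As `v` has mean zero, `V v(x)` is the integral over `y` of `v(x) - v(y)`, and Cauchy–Schwarz
  -- applies. Extended nonnegative integrals allow the orders of integration to be exchanged freely.
  have h1 : ∀ x, ENNReal.ofReal V * ENNReal.ofReal (v x ^ 2)
      ≤ ∫⁻ y in T.carrier, ENNReal.ofReal ((v x - v y) ^ 2) := by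
    intro x
    have hm : MemLp (fun y => v x - v y) 2 μ := (memLp_const _).sub hvm
    rw [← ofReal_integral_eq_lintegral_ofReal hm.integrable_sq
      (Filter.Eventually.of_forall fun _ => sq_nonneg _), ← ENNReal.ofReal_mul hV.le]
    refine ENNReal.ofReal_le_ofReal ?_
    have h2 := sq_integral_le_mul hm
    rw [integral_sub (integrable_const _) hvi, h0, integral_const, hμV, sub_zero, smul_eq_mul,
      mul_pow] at h2
    nlinarith
  have h2 : ∀ x ∈ T.carrier, ∀ y ∈ T.carrier, ENNReal.ofReal ((v x - v y) ^ 2)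
      ≤ ENNReal.ofReal (T.size ^ 2) * ∫⁻ t in Set.Icc (0 : ℝ) 1, G (y + t • (x - y)) := by
    intro x hx y hy
    have hc : Continuous fun t : ℝ => gradSq v (y + t • (x - y)) :=
      (continuous_gradSq hv).comp (by fun_prop)
    rw [hG]
    rw [← ofReal_integral_eq_lintegral_ofReal hc.integrableOn_Icc
      (Filter.Eventually.of_forall fun _ => gradSq_nonneg _ _), ← ENNReal.ofReal_mul (sq_nonneg _)]
    refine ENNReal.ofReal_le_ofReal ((sq_sub_le_segment hv x y).trans ?_)
    refine mul_le_mul_of_nonneg_right (pow_le_pow_left₀ (norm_nonneg _)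
      (norm_sub_le_size (subset_closure hx) (subset_closure hy)) 2)
      (integral_nonneg fun _ => gradSq_nonneg _ _)
  have h4 : ENNReal.ofReal V * ∫⁻ x in T.carrier, ENNReal.ofReal (v x ^ 2)
      ≤ ENNReal.ofReal (T.size ^ 2) * (2 ^ d * ENNReal.ofReal V * ∫⁻ x in T.carrier, G x) := by
    rw [← lintegral_const_mul' _ _ ENNReal.ofReal_ne_top, ← hVe]
    refine le_trans ?_ (mul_le_mul_right
      (lintegral_lintegral_segment_le T.measurableSet_carrier T.convex_carrier hGm) _)
    rw [← lintegral_const_mul' _ _ ENNReal.ofReal_ne_top]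
    refine setLIntegral_mono' T.measurableSet_carrier fun x hx => ?_
    rw [hVe, ← lintegral_const_mul' _ _ ENNReal.ofReal_ne_top]
    exact (h1 x).trans (setLIntegral_mono' T.measurableSet_carrier fun y hy => h2 x hx y hy)
  have hGi : Integrable (gradSq v) μ :=
    integrableOn_of_continuous T.isBounded_carrier (continuous_gradSq hv)
  have h2d : (2 : ENNReal) ^ d = ENNReal.ofReal (2 ^ d) := by
    rw [ENNReal.ofReal_pow (by norm_num), ENNReal.ofReal_ofNat]
  rw [hG, ← ofReal_integral_eq_lintegral_ofReal hvm.integrable_sq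
      (Filter.Eventually.of_forall fun _ => sq_nonneg _),
    ← ofReal_integral_eq_lintegral_ofReal hGi
      (Filter.Eventually.of_forall fun _ => gradSq_nonneg _ _),
    h2d, ← ENNReal.ofReal_mul (by positivity),
    ← ENNReal.ofReal_mul (by positivity), ← ENNReal.ofReal_mul (by positivity),
    ← ENNReal.ofReal_mul (by positivity), ENNReal.ofReal_le_ofReal_iff
      (by have := integral_nonneg (μ := μ) (f := gradSq v) (gradSq_nonneg v); positivity)] at h4
  have h5 : ∫ x, gradSq v x ∂μ = ∑ l, nrm μ (pd l v) ^ 2 := by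
    simp only [gradSq]
    rw [integral_finsetSum _ fun l _ => (memLp_carrier (continuous_pd hv l)).integrable_sq]
    exact Finset.sum_congr rfl fun l _ => (nrm_sq (memLp_carrier (continuous_pd hv l))).symm
  have h6 : ∑ l, nrm μ (pd l v) ^ 2 ≤ (∑ l, nrm μ (pd l v)) ^ 2 :=
    Finset.sum_sq_le_sq_sum_of_nonneg fun l _ => nrm_nonneg _ _
  have hS : 0 ≤ ∑ l, nrm μ (pd l v) := Finset.sum_nonneg fun l _ => nrm_nonneg _ _
  refine nrm_le_of_sq_le (by positivity) hvm ?_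
  have h7 : ∫ x, v x ^ 2 ∂μ ≤ T.size ^ 2 * (2 ^ d * ∑ l, nrm μ (pd l v) ^ 2) := by
    rw [h5] at h4
    refine le_of_mul_le_mul_left (h4.trans (le_of_eq (by ring))) hV
  refine h7.trans ?_
  have h8 : (2 : ℝ) ^ d ≤ (2 ^ d) ^ 2 := by
    rw [sq]
    exact le_mul_of_one_le_left (by positivity) (one_le_pow₀ (by norm_num))
  calc T.size ^ 2 * (2 ^ d * ∑ l, nrm μ (pd l v) ^ 2)
      ≤ T.size ^ 2 * ((2 ^ d) ^ 2 * (∑ l, nrm μ (pd l v)) ^ 2) := by gcongr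
    _ = (2 ^ d * T.size * ∑ l, nrm μ (pd l v)) ^ 2 := by ring

end Poincare

end WG

namespace WG

open ConvexPolytope

/-! ### Polynomial approximation -/

section Jets

variable {d : ℕ}

/-- Iterated partial derivatives of polynomials. -/
noncomputable def pderivL : List (Fin d) → Poly d → Poly d
  | [], p => p
  | l :: L, p => pderivL L (MvPolynomial.pderiv l p)

lemma dL_ev (L : List (Fin d)) (p : Poly d) : dL L (ev p) = ev (pderivL L p) := by
  induction L generalizing p with
  | nil => rfl
  | cons l L ih => rw [dL, ← dL_pd (contDiff_ev p), pd_ev, ih, pderivL]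

lemma pd_sub {f g : E d → ℝ} (hf : ContDiff ℝ ∞ f) (hg : ContDiff ℝ ∞ g) (l : Fin d) :
    pd l (fun x => f x - g x) = fun x => pd l f x - pd l g x := by
  funext x
  simp only [pd]
  rw [fderiv_fun_sub (hf.differentiable (by simp) x) (hg.differentiable (by simp) x)]
  simp

lemma dL_sub {f g : E d → ℝ} (hf : ContDiff ℝ ∞ f) (hg : ContDiff ℝ ∞ g) (L : List (Fin d)) :
    dL L (fun x => f x - g x) = fun x => dL L f x - dL L g x := by
  induction L with
  | nil => rfl
  | cons l L ih => rw [dL, ih, pd_sub (contDiff_dL hf L) (contDiff_dL hg L)]; rfl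

lemma pderivL_sub (L : List (Fin d)) (p q : Poly d) :
    pderivL L (p - q) = pderivL L p - pderivL L q := by
  induction L generalizing p q with
  | nil => rfl
  | cons l L ih => simp only [pderivL, map_sub, ih]

lemma pderivL_smul (L : List (Fin d)) (c : ℝ) (p : Poly d) :
    pderivL L (c • p) = c • pderivL L p := by
  induction L generalizing p with
  | nil => rfl
  | cons l L ih => rw [pderivL, Derivation.map_smul, ih, pderivL]

lemma pderiv_eq_zero_of_totalDegree {p : Poly d} (hp : p.totalDegree ≤ 0) (l : Fin d) :
    MvPolynomial.pderiv l p = 0 := by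
  rw [MvPolynomial.totalDegree_eq_zero_iff_eq_C.1 (Nat.le_zero.1 hp), MvPolynomial.pderiv_C]

lemma pderivL_zero (L : List (Fin d)) : pderivL L (0 : Poly d) = 0 := by
  induction L with
  | nil => rfl
  | cons l L ih => simp only [pderivL, map_zero, ih]

lemma pderivL_eq_zero (L : List (Fin d)) {p : Poly d} {N : ℕ} (hp : p.totalDegree ≤ N)
    (hL : N < L.length) : pderivL L p = 0 := by
  induction L generalizing p N with
  | nil => simp at hL
  | cons l L ih =>
    rw [pderivL]
    rcases Nat.eq_zero_or_pos N with h0 | h0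
    · rw [pderiv_eq_zero_of_totalDegree (h0 ▸ hp), pderivL_zero]
    · refine ih (N := N - 1) ((totalDegree_pderiv_le p l).trans (by omega)) ?_
      simp only [List.length_cons] at hL
      omega

/-- The polynomial `∑ c [l₁, …, l_m] X_{l₁} ⋯ X_{l_m}`. -/
noncomputable def leadPoly : ℕ → (List (Fin d) → ℝ) → Poly d
  | 0, c => MvPolynomial.C (c [])
  | m + 1, c => ∑ l, MvPolynomial.X l * leadPoly m fun L => c (l :: L)

lemma totalDegree_leadPoly_le (m : ℕ) (c : List (Fin d) → ℝ) :
    (leadPoly m c).totalDegree ≤ m := by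
  induction m generalizing c with
  | zero => simp [leadPoly]
  | succ m ih =>
    refine totalDegree_sum_le _ fun l _ => ?_
    refine (MvPolynomial.totalDegree_mul _ _).trans ?_
    rw [MvPolynomial.totalDegree_X, add_comm]
    exact Nat.add_le_add_right (ih _) 1

/-- By the product rule each of the `m + 1` positions contributes once, and the symmetry of `c`
makes all contributions equal. -/
lemma pderiv_leadPoly (m : ℕ) {c : List (Fin d) → ℝ}
    (hc : ∀ L L' : List (Fin d), L.Perm L' → c L = c L') (l : Fin d) :
    MvPolynomial.pderiv l (leadPoly (m + 1) c)
      = ((m : ℝ) + 1) • leadPoly m fun L => c (l :: L) := by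
  induction m generalizing c with
  | zero =>
    simp only [leadPoly, map_sum, Derivation.leibniz, MvPolynomial.pderiv_C, MvPolynomial.pderiv_X,
      smul_eq_mul, mul_zero, zero_add]
    rw [Finset.sum_eq_single l]
    · simp
    · intro b _ hb; simp [hb]
    · simp
  | succ m ih =>
    rw [leadPoly, map_sum]
    have h1 : ∀ l', MvPolynomial.pderiv l (MvPolynomial.X l' * leadPoly (m + 1) fun L => c (l' :: L))
        = MvPolynomial.X l' * (((m : ℝ) + 1) • leadPoly m fun L => c (l :: l' :: L))
          + (if l' = l then leadPoly (m + 1) fun L => c (l' :: L) else 0) := by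
      intro l'
      rw [Derivation.leibniz, ih (c := fun L => c (l' :: L)) fun L L' h => hc _ _ (h.cons l')]
      have h2 : ∀ L, c (l' :: l :: L) = c (l :: l' :: L) := fun L => hc _ _ (List.Perm.swap _ _ _)
      simp only [h2, smul_eq_mul, MvPolynomial.pderiv_X]
      by_cases h : l' = l
      · simp [h]
      · simp [h]
    simp only [h1]
    rw [Finset.sum_add_distrib, Finset.sum_ite_eq' Finset.univ l]
    simp only [Finset.mem_univ, if_true, mul_smul_comm]
    rw [← Finset.smul_sum]
    have h3 : ∑ l', MvPolynomial.X l' * (leadPoly m fun L => c (l :: l' :: L))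
        = leadPoly (m + 1) fun L => c (l :: L) := rfl
    rw [h3]
    push_cast
    module

lemma pderivL_leadPoly (L : List (Fin d)) {c : List (Fin d) → ℝ}
    (hc : ∀ L L' : List (Fin d), L.Perm L' → c L = c L') :
    pderivL L (leadPoly L.length c) = MvPolynomial.C (L.length.factorial * c L) := by
  induction L generalizing c with
  | nil => simp [pderivL, leadPoly]
  | cons l L ih =>
    rw [List.length_cons, pderivL, pderiv_leadPoly _ hc, pderivL_smul,
      ih (c := fun L => c (l :: L)) fun L L' h => hc _ _ (h.cons l), MvPolynomial.smul_eq_C_mul,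
      ← MvPolynomial.C_mul, Nat.factorial_succ]
    push_cast
    ring_nf

/-- An averaged Taylor polynomial, matched from the highest order down. The top part has the mean
derivatives over `m!` as coefficients, symmetric because derivatives commute; the corrections of
lower degree leave the higher derivatives unchanged. -/
lemma exists_poly_integral_eq_zero (T : ConvexPolytope d) (m : ℕ) {φ : E d → ℝ}
    (hφ : ContDiff ℝ ∞ φ) : ∃ p : Poly d, p.totalDegree ≤ m ∧ ∀ L : List (Fin d), L.length ≤ m →
      ∫ x in T.carrier, dL L (fun x => φ x - ev p x) x = 0 := by
  have hV := carrier_volume_pos T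
  have hI : ∀ {ψ : E d → ℝ}, ContDiff ℝ ∞ ψ → ∀ L,
      Integrable (dL L ψ) (volume.restrict T.carrier) := fun hψ L =>
    integrableOn_of_continuous T.isBounded_carrier (contDiff_dL hψ L).continuous
  have key : ∀ (m : ℕ) {φ : E d → ℝ}, ContDiff ℝ ∞ φ → ∃ q : Poly d, q.totalDegree ≤ m ∧
      ∀ L : List (Fin d), L.length = m →
        ∫ x in T.carrier, dL L (fun x => φ x - ev q x) x = 0 := by
    intro m φ hφ
    set c : List (Fin d) → ℝ := fun L =>
      (volume T.carrier).toReal⁻¹ * ∫ x in T.carrier, dL L φ x with hcdef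
    have hc : ∀ L L' : List (Fin d), L.Perm L' → c L = c L' := fun L L' h => by
      simp only [hcdef, dL_perm hφ h]
    refine ⟨((m.factorial : ℝ)⁻¹) • leadPoly m c,
      totalDegree_smul_le _ (totalDegree_leadPoly_le m c), ?_⟩
    rintro L rfl
    rw [dL_sub hφ (contDiff_ev _), dL_ev, pderivL_smul, pderivL_leadPoly L hc]
    have hf : (L.length.factorial : ℝ) ≠ 0 := by positivity
    simp only [ev_smul, ev_C]
    rw [inv_mul_cancel_left₀ hf, integral_sub (hI hφ L) (integrable_const _)]
    simp only [integral_const, smul_eq_mul, hcdef, Measure.real, Measure.restrict_apply_univ]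
    rw [mul_inv_cancel_left₀ hV.ne', sub_self]
  induction m generalizing φ with
  | zero =>
    obtain ⟨q, hq, h⟩ := key 0 hφ
    exact ⟨q, hq, fun L hL => h L (Nat.le_zero.1 hL)⟩
  | succ m ih =>
    obtain ⟨q, hq, hq0⟩ := key (m + 1) hφ
    have hψ : ContDiff ℝ ∞ (fun x => φ x - ev q x) := hφ.sub (contDiff_ev q)
    obtain ⟨p, hp, hp0⟩ := ih hψ
    have e : (fun x => φ x - ev (q + p) x) = fun x => (φ x - ev q x) - ev p x := by
      funext x; simp only [ev_add]; ring
    refine ⟨q + p, totalDegree_add_le hq (hp.trans (Nat.le_succ m)), fun L hL => ?_⟩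
    rw [e]
    rcases Nat.lt_or_ge m L.length with h | h
    · rw [dL_sub hψ (contDiff_ev p), dL_ev, pderivL_eq_zero L hp h]
      simpa using hq0 L (by omega)
    · exact hp0 L h

/-- The sum of the norms of all derivatives of order `r`. -/
noncomputable def jetSum (μ : Measure (E d)) (r : ℕ) (D : List (Fin d) → E d → ℝ) : ℝ :=
  ∑ s : Fin r → Fin d, nrm μ (D (List.ofFn s))

lemma jetSum_nonneg (μ : Measure (E d)) (r : ℕ) (D : List (Fin d) → E d → ℝ) :
    0 ≤ jetSum μ r D := Finset.sum_nonneg fun _ _ => nrm_nonneg _ _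

lemma nrm_le_jetSum (μ : Measure (E d)) (D : List (Fin d) → E d → ℝ) (L : List (Fin d)) :
    nrm μ (D L) ≤ jetSum μ L.length D := by
  have h := Finset.single_le_sum (f := fun s : Fin L.length → Fin d => nrm μ (D (List.ofFn s)))
    (fun s _ => nrm_nonneg _ _) (Finset.mem_univ L.get)
  rwa [List.ofFn_get] at h

lemma jetSum_succ (μ : Measure (E d)) (r : ℕ) (D : List (Fin d) → E d → ℝ) :
    jetSum μ (r + 1) D = ∑ s : Fin r → Fin d, ∑ l, nrm μ (D (l :: List.ofFn s)) := by
  rw [Finset.sum_comm, ← Finset.sum_product', Finset.univ_product_univ, jetSum]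
  symm
  refine Fintype.sum_equiv (Fin.consEquiv fun _ : Fin (r + 1) => Fin d) _ _ fun p => ?_
  simp [Fin.consEquiv, List.ofFn_succ]

/-- All derivatives up to order `m` have mean zero, so the Poincaré inequality can be iterated; each
use trades one order of differentiation for a factor `2^d h`. -/
lemma jetSum_le_of_integral_eq_zero (T : ConvexPolytope d) (m : ℕ) {g : E d → ℝ}
    (hg : ContDiff ℝ ∞ g) (h0 : ∀ L : List (Fin d), L.length ≤ m →
      ∫ x in T.carrier, dL L g x = 0) (j : ℕ) (hj : j ≤ m + 1) :
    jetSum (volume.restrict T.carrier) (m + 1 - j) (fun L => dL L g)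
      ≤ (2 ^ d * T.size) ^ j * jetSum (volume.restrict T.carrier) (m + 1) (fun L => dL L g) := by
  have hs0 : 0 ≤ T.size := Metric.diam_nonneg
  induction j with
  | zero => simp
  | succ j ih =>
    have h1 := ih (by omega)
    obtain ⟨r, hr⟩ : ∃ r, r = m + 1 - (j + 1) := ⟨_, rfl⟩
    have hr' : m + 1 - j = r + 1 := by omega
    rw [← hr]
    rw [hr', jetSum_succ] at h1
    have h2 : jetSum (volume.restrict T.carrier) r (fun L => dL L g)
        ≤ 2 ^ d * T.size * ∑ s : Fin r → Fin d, ∑ l,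
          nrm (volume.restrict T.carrier) (dL (l :: List.ofFn s) g) := by
      rw [jetSum, Finset.mul_sum]
      refine Finset.sum_le_sum fun s _ => ?_
      exact nrm_le_of_integral_eq_zero T ((contDiff_dL hg _).of_le (by exact_mod_cast le_top))
        (h0 _ (by simp; omega))
    refine h2.trans ((mul_le_mul_of_nonneg_left h1 (by positivity)).trans (le_of_eq ?_))
    rw [pow_succ]
    ring

/-- The Bramble–Hilbert lemma for smooth functions. -/
lemma exists_poly_approx (T : ConvexPolytope d) (m : ℕ) {φ : E d → ℝ} (hφ : ContDiff ℝ ∞ φ) :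
    ∃ p : Poly d, p.totalDegree ≤ m ∧ ∀ L : List (Fin d), L.length ≤ m + 1 →
      nrm (volume.restrict T.carrier) (fun x => dL L φ x - ev (pderivL L p) x)
        ≤ (2 ^ d * T.size) ^ (m + 1 - L.length)
          * jetSum (volume.restrict T.carrier) (m + 1) (fun L => dL L φ) := by
  obtain ⟨p, hp, h0⟩ := exists_poly_integral_eq_zero T m hφ
  refine ⟨p, hp, fun L hL => ?_⟩
  have hψ : ContDiff ℝ ∞ (fun x => φ x - ev p x) := hφ.sub (contDiff_ev p)
  have hd : ∀ L, dL L (fun x => φ x - ev p x) = fun x => dL L φ x - ev (pderivL L p) x :=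
    fun L => by rw [dL_sub hφ (contDiff_ev p), dL_ev]
  have h1 := jetSum_le_of_integral_eq_zero T m hψ h0 (m + 1 - L.length) (by omega)
  have h2 := nrm_le_jetSum (volume.restrict T.carrier) (fun L => dL L (fun x => φ x - ev p x)) L
  have h3 : jetSum (volume.restrict T.carrier) (m + 1) (fun L => dL L (fun x => φ x - ev p x))
      = jetSum (volume.restrict T.carrier) (m + 1) (fun L => dL L φ) := by
    refine Finset.sum_congr rfl fun s _ => ?_
    simp only [hd]
    rw [pderivL_eq_zero (List.ofFn s) hp (by simp)]
    simp
  rw [h3, Nat.sub_sub_self hL] at h1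
  rw [← hd]
  exact h2.trans h1

lemma exists_inverse_list (d n N : ℕ) (hd : 1 ≤ d) {ρv : ℝ} (hρv : 0 < ρv) (ρe κ δ : ℝ) :
    ∃ K : ℝ, 1 ≤ K ∧ ∀ (T : ConvexPolytope d), Regular T n ρv ρe κ δ →
      ∀ p : Poly d, p.totalDegree ≤ N → ∀ L : List (Fin d),
        T.size ^ L.length * nrm (volume.restrict T.carrier) (ev (pderivL L p))
          ≤ K ^ L.length * nrm (volume.restrict T.carrier) (ev p) := by
  obtain ⟨K, hK, h⟩ := exists_inverse d n N hd hρv ρe κ δ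
  refine ⟨K + 1, by linarith, fun T hT p hp L => ?_⟩
  have hs := T.size_pos hd
  induction L generalizing p with
  | nil => simp [pderivL]
  | cons l L ih =>
    have h1 := (h T hT p hp).1 l
    have h2 := ih (MvPolynomial.pderiv l p) ((totalDegree_pderiv_le p l).trans (by omega))
    rw [pderivL, List.length_cons, pow_succ', mul_assoc, pow_succ, mul_assoc]
    refine (mul_le_mul_of_nonneg_left h2 hs.le).trans ?_
    rw [mul_left_comm]
    refine mul_le_mul_of_nonneg_left (h1.trans ?_) (by positivity)
    exact mul_le_mul_of_nonneg_right (by linarith) (nrm_nonneg _ _)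

lemma approx_arith {d k r : ℕ} (hr : r ≤ k + 1) {h K S N : ℝ} (hh : 0 < h) (hK : 1 ≤ K)
    (hS : 0 ≤ S)
    (H : h ^ r * N ≤ h ^ r * ((2 ^ d * h) ^ (k + 1 - r) * S)
      + K ^ r * (2 * ((2 ^ d * h) ^ (k + 1) * S))) :
    N ≤ (2 ^ d) ^ (k + 1) * (1 + 2 * K ^ (k + 1)) * h ^ (k + 1 - r) * S := by
  have hA : (1 : ℝ) ≤ 2 ^ d := one_le_pow₀ (by norm_num)
  have h1 : ((2 : ℝ) ^ d) ^ (k + 1 - r) ≤ (2 ^ d) ^ (k + 1) := pow_le_pow_right₀ hA (by omega)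
  have h2 : K ^ r ≤ K ^ (k + 1) := pow_le_pow_right₀ hK hr
  have h3 : h ^ (k + 1) = h ^ r * h ^ (k + 1 - r) := by rw [← pow_add]; congr 1; omega
  have hhr : 0 < h ^ r := by positivity
  refine le_of_mul_le_mul_left (H.trans ?_) hhr
  rw [mul_pow, mul_pow, h3]
  set q := h ^ (k + 1 - r)
  have hq : 0 < q := by positivity
  set B := ((2 : ℝ) ^ d) ^ (k + 1)
  have hB : 0 < B := by positivity
  calc h ^ r * ((2 ^ d) ^ (k + 1 - r) * q * S) + K ^ r * (2 * (B * (h ^ r * q) * S))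
      ≤ h ^ r * (B * q * S) + K ^ (k + 1) * (2 * (B * (h ^ r * q) * S)) := by gcongr
    _ = h ^ r * (B * (1 + 2 * K ^ (k + 1)) * q * S) := by ring

/-- Approximation by the `L²` projection, including derivatives. -/
theorem exists_l2Proj_approx (d n k : ℕ) (hd : 1 ≤ d) {ρv : ℝ} (hρv : 0 < ρv) (ρe κ δ : ℝ) :
    ∃ K : ℝ, 0 < K ∧ ∀ (T : ConvexPolytope d), Regular T n ρv ρe κ δ →
      ∀ (u : E d → ℝ) (D : List (Fin d) → E d → ℝ) (φ : ℕ → E d → ℝ),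
      u =ᵐ[volume.restrict T.carrier] D [] →
      (∀ L : List (Fin d), L.length ≤ k + 1 → MemLp (D L) 2 (volume.restrict T.carrier)) →
      (∀ m, ContDiff ℝ ∞ (φ m)) → (∀ L : List (Fin d), L.length ≤ k + 1 →
        Filter.Tendsto (fun m => eLpNorm (fun x => dL L (φ m) x - D L x) 2
          (volume.restrict T.carrier)) Filter.atTop (𝓝 0)) →
      ∀ L : List (Fin d), L.length ≤ k + 1 →
        nrm (volume.restrict T.carrier)
          (fun x => D L x - ev (pderivL L (l2Proj (volume.restrict T.carrier) k u).1) x)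
        ≤ K * T.size ^ (k + 1 - L.length) * jetSum (volume.restrict T.carrier) (k + 1) D := by
  obtain ⟨K, hK, hinv⟩ := exists_inverse_list d n k hd hρv ρe κ δ
  refine ⟨(2 ^ d) ^ (k + 1) * (1 + 2 * K ^ (k + 1)), by positivity, ?_⟩
  intro T hT u D φ hu hD hφ hconv L hL
  have hs := T.size_pos hd
  set μ := (volume : Measure (E d)).restrict T.carrier with hμ
  have hum : MemLp u 2 μ := (hD [] (by simp)).ae_eq hu.symm
  set Q := l2Proj μ k u with hQ
  have hPM : PolyMem μ := T.polyMem_carrier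
  choose p hp hpa using fun m => exists_poly_approx T k (hφ m)
  have hdm : ∀ m L, MemLp (dL L (φ m)) 2 μ := fun m L =>
    memLp_carrier (contDiff_dL (hφ m) L).continuous
  set a : ℕ → ℝ := fun m => jetSum μ (k + 1) (fun L => dL L (φ m)) with ha
  set e : List (Fin d) → ℕ → ℝ := fun L m => nrm μ (fun x => dL L (φ m) x - D L x) with he
  -- The comparison passes through `φ m` and its approximating polynomial `p m`. The remaining
  -- difference `p m - Q` is a polynomial, so the inverse inequality and the best approximation
  -- property of `Q` bound its derivatives; afterwards `m` tends to infinity.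
  have hb : ∀ m, T.size ^ L.length * nrm μ (fun x => D L x - ev (pderivL L Q.1) x)
      ≤ T.size ^ L.length * (e L m + (2 ^ d * T.size) ^ (k + 1 - L.length) * a m)
        + K ^ L.length * (2 * (e [] m + (2 ^ d * T.size) ^ (k + 1) * a m)) := by
    intro m
    have h1 : nrm μ (fun x => u x - ev (p m) x) ≤ e [] m + (2 ^ d * T.size) ^ (k + 1) * a m := by
      have h2 := hpa m [] (by simp)
      have h3 : MemLp (fun x => dL [] (φ m) x - D [] x) 2 μ := (hdm m []).sub (hD [] (by simp))
      have h4 : MemLp (fun x => dL [] (φ m) x - ev (pderivL [] (p m)) x) 2 μ :=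
        (hdm m []).sub (hPM _)
      have h5 := nrm_sub_le h4 h3
      refine le_trans (le_of_eq (nrm_congr_ae ?_)) (h5.trans ?_)
      · filter_upwards [hu] with x hx
        rw [hx, pderivL]
        ring
      · simp only [List.length_nil, Nat.sub_zero] at h2
        rw [add_comm]
        exact add_le_add le_rfl h2
    have h2 : nrm μ (ev (p m - Q.1)) ≤ 2 * (e [] m + (2 ^ d * T.size) ^ (k + 1) * a m) := by
      have h3 := nrm_sub_l2Proj_le hPM k hum (p m) (hp m)
      have h4 : MemLp (fun x => u x - ev Q.1 x) 2 μ := hum.sub (hPM _)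
      have h5 : MemLp (fun x => u x - ev (p m) x) 2 μ := hum.sub (hPM _)
      have h6 := nrm_sub_le h4 h5
      have h7 : ev (p m - Q.1) = fun x => (u x - ev Q.1 x) - (u x - ev (p m) x) := by
        funext x; rw [ev_sub]; ring
      rw [h7]
      linarith
    have h3 := hinv T hT (p m - Q.1) (totalDegree_sub_le (hp m) Q.2) L
    have h4 : nrm μ (fun x => D L x - ev (pderivL L Q.1) x)
        ≤ e L m + (2 ^ d * T.size) ^ (k + 1 - L.length) * a m
          + nrm μ (ev (pderivL L (p m - Q.1))) := by
      have m1 : MemLp (fun x => dL L (φ m) x - D L x) 2 μ := (hdm m L).sub (hD L hL)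
      have m2 : MemLp (fun x => dL L (φ m) x - ev (pderivL L (p m)) x) 2 μ :=
        (hdm m L).sub (hPM _)
      have m3 : MemLp (fun x => (dL L (φ m) x - ev (pderivL L (p m)) x) - (dL L (φ m) x - D L x))
        2 μ := m2.sub m1
      have h5 := nrm_sub_le m2 m1
      have h6 := nrm_add_le m3 (hPM (pderivL L (p m - Q.1)))
      have h7 : (fun x => D L x - ev (pderivL L Q.1) x)
          = fun x => ((dL L (φ m) x - ev (pderivL L (p m)) x) - (dL L (φ m) x - D L x))
            + ev (pderivL L (p m - Q.1)) x := by
        funext x; rw [pderivL_sub, ev_sub]; ring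
      rw [h7]
      have h8 := hpa m L hL
      refine h6.trans ?_
      refine add_le_add ((h5.trans ?_)) le_rfl
      rw [add_comm]
      exact add_le_add le_rfl h8
    calc _ ≤ T.size ^ L.length * (e L m + (2 ^ d * T.size) ^ (k + 1 - L.length) * a m
          + nrm μ (ev (pderivL L (p m - Q.1)))) := mul_le_mul_of_nonneg_left h4 (by positivity)
      _ ≤ _ := by
        rw [mul_add]
        refine add_le_add le_rfl (h3.trans ?_)
        exact mul_le_mul_of_nonneg_left h2 (by positivity)
  have hS : Filter.Tendsto a Filter.atTop (𝓝 (jetSum μ (k + 1) D)) :=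
    tendsto_finsetSum _ fun s _ =>
      tendsto_nrm (fun m => hdm m _) (hD _ (by simp)) (hconv _ (by simp))
  have he0 : ∀ L : List (Fin d), L.length ≤ k + 1 → Filter.Tendsto (e L) Filter.atTop (𝓝 0) :=
    fun L hL => tendsto_nrm_zero (hconv L hL)
  have hlim := ((((he0 L hL).add (hS.const_mul ((2 ^ d * T.size) ^ (k + 1 - L.length)))).const_mul
    (T.size ^ L.length)).add ((((he0 [] (by simp)).add
      (hS.const_mul ((2 ^ d * T.size) ^ (k + 1)))).const_mul 2).const_mul (K ^ L.length)))
  have hfin := ge_of_tendsto' hlim hb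
  simp only [zero_add] at hfin
  exact approx_arith hL hs hK (jetSum_nonneg _ _ _) hfin

end Jets

end WG

namespace WG

open ConvexPolytope

/-! ### Traces on the faces of a convex polytope -/

section Traces

variable {d : ℕ} {T : ConvexPolytope d}

/-- Only convergence on one fixed polytope matters here, so `trace_sq_le` with an arbitrary interior
apex suffices. -/
lemma tendsto_nrm_surf_zero (hd : 1 ≤ d) {ι : Type*} {f : Filter ι} {ψ : ι → E d → ℝ}
    (hψ : ∀ m, ContDiff ℝ ∞ (ψ m))
    (h0 : Filter.Tendsto (fun m => nrm (volume.restrict T.carrier) (ψ m)) f (𝓝 0))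
    (h1 : ∀ l, Filter.Tendsto (fun m => nrm (volume.restrict T.carrier) (pd l (ψ m))) f (𝓝 0))
    (i : Fin T.numFaces) :
    Filter.Tendsto (fun m => nrm (surf (T.face i)) (ψ m)) f (𝓝 0) := by
  obtain ⟨x₀, hx₀⟩ := T.carrier_nonempty
  have hl : 0 < T.lam i x₀ := mem_carrier.1 hx₀ i
  have hb : ∀ m, nrm (surf (T.face i)) (ψ m) ^ 2
      ≤ (T.lam i x₀)⁻¹ * (d * nrm (volume.restrict T.carrier) (ψ m) ^ 2
        + 2 * T.size * nrm (volume.restrict T.carrier) (ψ m)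
          * ∑ l, nrm (volume.restrict T.carrier) (pd l (ψ m))) := by
    intro m
    rw [← div_eq_inv_mul, le_div_iff₀ hl, mul_comm]
    exact trace_sq_le hd hx₀ i ((hψ m).of_le (by exact_mod_cast le_top))
  have hlim : Filter.Tendsto (fun m => (T.lam i x₀)⁻¹ *
      (d * nrm (volume.restrict T.carrier) (ψ m) ^ 2
        + 2 * T.size * nrm (volume.restrict T.carrier) (ψ m)
          * ∑ l, nrm (volume.restrict T.carrier) (pd l (ψ m)))) f (𝓝 0) := by
    have := (((h0.pow 2).const_mul (d : ℝ)).add ((h0.const_mul (2 * T.size)).mul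
      (tendsto_finsetSum Finset.univ fun l _ => h1 l))).const_mul (T.lam i x₀)⁻¹
    simpa using this
  have hsq := squeeze_zero (fun m => sq_nonneg _) hb hlim
  have := hsq.sqrt
  simpa [Real.sqrt_sq (nrm_nonneg _ _)] using this

/-- `w ∈ H¹(T)` with gradient `w'` has the traces `W i` on the faces of `T`. -/
structure HasTraces (T : ConvexPolytope d) (w : E d → ℝ) (w' : Fin d → E d → ℝ)
    (W : Fin T.numFaces → E d → ℝ) : Prop where
  memLp : MemLp w 2 (volume.restrict T.carrier)
  memLp_deriv : ∀ l, MemLp (w' l) 2 (volume.restrict T.carrier)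
  memLp_trace : ∀ i, MemLp (W i) 2 (surf (T.face i))
  approx : ∃ φ : ℕ → E d → ℝ, (∀ m, ContDiff ℝ ∞ (φ m)) ∧
    Filter.Tendsto (fun m => eLpNorm (fun x => φ m x - w x) 2 (volume.restrict T.carrier))
      Filter.atTop (𝓝 0) ∧
    (∀ l, Filter.Tendsto (fun m => eLpNorm (fun x => pd l (φ m) x - w' l x) 2
      (volume.restrict T.carrier)) Filter.atTop (𝓝 0)) ∧
    ∀ i, Filter.Tendsto (fun m => eLpNorm (fun x => φ m x - W i x) 2 (surf (T.face i)))
      Filter.atTop (𝓝 0)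

lemma tendsto_nrm_sub {X ι κ : Type*} [MeasurableSpace X] {μ : Measure X} {f : Filter ι}
    {a : Filter κ} {F G : κ → X → ℝ} {w : X → ℝ} {p q : ι → κ}
    (hF : ∀ m, MemLp (F m) 2 μ) (hG : ∀ m, MemLp (G m) 2 μ) (hw : MemLp w 2 μ)
    (hp : Filter.Tendsto p f a) (hq : Filter.Tendsto q f a)
    (h1 : Filter.Tendsto (fun m => nrm μ (fun x => F m x - w x)) a (𝓝 0))
    (h2 : Filter.Tendsto (fun m => nrm μ (fun x => G m x - w x)) a (𝓝 0)) :
    Filter.Tendsto (fun m => nrm μ (fun x => F (p m) x - G (q m) x)) f (𝓝 0) := by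
  have h3 := (h1.comp hp).add (h2.comp hq)
  rw [add_zero] at h3
  refine squeeze_zero (fun m => nrm_nonneg _ _) (fun m => ?_) h3
  have h4 := nrm_sub_le (f := fun x => F (p m) x - w x) (g := fun x => G (q m) x - w x)
    ((hF _).sub hw) ((hG _).sub hw)
  simpa only [sub_sub_sub_cancel_right, Function.comp] using h4

/-- Trace theorem. -/
lemma exists_hasTraces (hd : 1 ≤ d) {w : E d → ℝ} {w' : Fin d → E d → ℝ}
    (hw : MemLp w 2 (volume.restrict T.carrier))
    (hw' : ∀ l, MemLp (w' l) 2 (volume.restrict T.carrier))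
    {φ : ℕ → E d → ℝ} (hφ : ∀ m, ContDiff ℝ ∞ (φ m))
    (h0 : Filter.Tendsto (fun m => eLpNorm (fun x => φ m x - w x) 2 (volume.restrict T.carrier))
      Filter.atTop (𝓝 0))
    (h1 : ∀ l, Filter.Tendsto (fun m => eLpNorm (fun x => pd l (φ m) x - w' l x) 2
      (volume.restrict T.carrier)) Filter.atTop (𝓝 0)) :
    ∃ W, HasTraces T w w' W := by
  have hm : ∀ i m, MemLp (φ m) 2 (surf (T.face i)) := fun i m => memLp_surf (hφ m).continuous i
  have hm0 : ∀ m, MemLp (φ m) 2 (volume.restrict T.carrier) :=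
    fun m => memLp_carrier (hφ m).continuous
  have hm1 : ∀ l m, MemLp (pd l (φ m)) 2 (volume.restrict T.carrier) :=
    fun l m => memLp_carrier (contDiff_pd (hφ m) l).continuous
  have key : ∀ i, ∃ W, MemLp W 2 (surf (T.face i)) ∧
      Filter.Tendsto (fun m => eLpNorm (fun x => φ m x - W x) 2 (surf (T.face i)))
        Filter.atTop (𝓝 0) := by
    intro i
    have hfst : Filter.Tendsto (Prod.fst : ℕ × ℕ → ℕ) Filter.atTop Filter.atTop := by
      rw [← Filter.prod_atTop_atTop_eq]; exact Filter.tendsto_fst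
    have hsnd : Filter.Tendsto (Prod.snd : ℕ × ℕ → ℕ) Filter.atTop Filter.atTop := by
      rw [← Filter.prod_atTop_atTop_eq]; exact Filter.tendsto_snd
    -- The trace estimate applied to differences of the approximants makes their boundary values a
    -- Cauchy sequence; the trace is its limit in `L²` of the face.
    have hc : Filter.Tendsto (fun p : ℕ × ℕ => nrm (surf (T.face i))
        (fun x => φ p.1 x - φ p.2 x)) Filter.atTop (𝓝 0) := by
      refine tendsto_nrm_surf_zero hd (ψ := fun p : ℕ × ℕ => fun x => φ p.1 x - φ p.2 x)
        (fun p => (hφ p.1).sub (hφ p.2)) ?_ (fun l => ?_) i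
      · exact tendsto_nrm_sub hm0 hm0 hw hfst hsnd (tendsto_nrm_zero h0) (tendsto_nrm_zero h0)
      · have := tendsto_nrm_sub (hm1 l) (hm1 l) (hw' l) hfst hsnd (tendsto_nrm_zero (h1 l))
          (tendsto_nrm_zero (h1 l))
        simpa only [pd_sub (hφ _) (hφ _)] using this
    have hcau : CauchySeq fun m => (hm i m).toLp (φ m) := by
      rw [Lp.cauchySeq_Lp_iff_cauchySeq_eLpNorm]
      have h2 := ENNReal.tendsto_ofReal hc
      rw [ENNReal.ofReal_zero] at h2
      refine h2.congr fun p => ?_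
      have hf : eLpNorm (fun x => φ p.1 x - φ p.2 x) 2 (surf (T.face i)) ≠ ⊤ :=
        ((hm i p.1).sub (hm i p.2)).2.ne
      rw [nrm, ENNReal.ofReal_toReal hf]
      refine eLpNorm_congr_ae ?_
      filter_upwards [(hm i p.1).coeFn_toLp, (hm i p.2).coeFn_toLp] with x hx1 hx2
      rw [Pi.sub_apply, hx1, hx2]
    obtain ⟨W, hW⟩ := cauchySeq_tendsto_of_complete hcau
    refine ⟨W, Lp.memLp W, ?_⟩
    have h3 := (Lp.tendsto_Lp_iff_tendsto_eLpNorm' _ _).1 hW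
    refine h3.congr fun m => eLpNorm_congr_ae ?_
    filter_upwards [(hm i m).coeFn_toLp] with x hx
    rw [Pi.sub_apply, hx]
  choose W hWm hW using key
  exact ⟨W, hw, hw', hWm, φ, hφ, h0, h1, hW⟩

/-- Green's formula. -/
lemma HasTraces.green (hd : 1 ≤ d) {w : E d → ℝ} {w' : Fin d → E d → ℝ}
    {W : Fin T.numFaces → E d → ℝ} (h : HasTraces T w w' W) {v : E d → ℝ} (hv : ContDiff ℝ ∞ v)
    (l : Fin d) :
    (∫ x in T.carrier, w' l x * v x) + ∫ x in T.carrier, w x * pd l v x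
      = ∑ i, T.normal i l * ∫ x, W i x * v x ∂(surf (T.face i)) := by
  obtain ⟨φ, hφ, h0, h1, h2⟩ := h.approx
  have hvm : MemLp v 2 (volume.restrict T.carrier) := memLp_carrier hv.continuous
  have hpm : MemLp (pd l v) 2 (volume.restrict T.carrier) :=
    memLp_carrier (contDiff_pd hv l).continuous
  have l1 := tendsto_integral_mul (fun m => memLp_carrier (contDiff_pd (hφ m) l).continuous)
    (h.memLp_deriv l) hvm (h1 l)
  have l2 := tendsto_integral_mul (fun m => memLp_carrier (hφ m).continuous) h.memLp hpm h0
  have l3 := tendsto_finsetSum Finset.univ fun i (_ : i ∈ Finset.univ) =>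
    (tendsto_integral_mul (fun m => memLp_surf (hφ m).continuous i) (h.memLp_trace i)
      (memLp_surf hv.continuous i) (h2 i)).const_mul (T.normal i l)
  refine tendsto_nhds_unique (l1.add l2) (l3.congr fun m => ?_)
  have hg : ContDiff ℝ 1 (fun x => φ m x * v x) :=
    ((hφ m).mul hv).of_le (by exact_mod_cast le_top)
  have h3 := integral_fderiv hd hg (T := T) (unitVec l)
  have h4 : ∀ x, fderiv ℝ (fun x => φ m x * v x) x (unitVec l)
      = pd l (φ m) x * v x + φ m x * pd l v x := by
    intro x
    rw [fderiv_fun_mul ((hφ m).differentiable (by simp) x) (hv.differentiable (by simp) x)]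
    simp [pd]
    ring
  simp only [h4] at h3
  rw [integral_add (integrable_mul_of_memLp (memLp_carrier (contDiff_pd (hφ m) l).continuous) hvm)
    (integrable_mul_of_memLp (memLp_carrier (hφ m).continuous) hpm)] at h3
  rw [h3]
  refine Finset.sum_congr rfl fun i _ => ?_
  simp [unitVec, EuclideanSpace.inner_single_right]

lemma HasTraces.green_of_zero (hd : 1 ≤ d) {w : E d → ℝ} {w' : Fin d → E d → ℝ}
    {W : Fin T.numFaces → E d → ℝ} (h : HasTraces T w w' W) {v : E d → ℝ} (hv : ContDiff ℝ ∞ v)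
    {i : Fin T.numFaces} (hz : ∀ j, j ≠ i → ∀ x ∈ T.face j, v x = 0) (l : Fin d) :
    (∫ x in T.carrier, w' l x * v x) + ∫ x in T.carrier, w x * pd l v x
      = T.normal i l * ∫ x, W i x * v x ∂(surf (T.face i)) := by
  rw [h.green hd hv l, Finset.sum_eq_single i]
  · intro j _ hj
    rw [integral_eq_zero_of_ae, mul_zero]
    filter_upwards [T.ae_surf_mem j] with x hx
    simp [hz j hj x hx]
  · simp

/-- Traces are unique. -/
lemma HasTraces.ae_eq (hd : 1 ≤ d) {w : E d → ℝ} {w' : Fin d → E d → ℝ}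
    {W : Fin T.numFaces → E d → ℝ} (h : HasTraces T w w' W) {i : Fin T.numFaces} {V : E d → ℝ}
    (hV : MemLp V 2 (surf (T.face i))) {φ : ℕ → E d → ℝ} (hφ : ∀ m, ContDiff ℝ ∞ (φ m))
    (h0 : Filter.Tendsto (fun m => eLpNorm (fun x => φ m x - w x) 2 (volume.restrict T.carrier))
      Filter.atTop (𝓝 0))
    (h1 : ∀ l, Filter.Tendsto (fun m => eLpNorm (fun x => pd l (φ m) x - w' l x) 2
      (volume.restrict T.carrier)) Filter.atTop (𝓝 0))
    (h2 : Filter.Tendsto (fun m => eLpNorm (fun x => φ m x - V x) 2 (surf (T.face i)))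
      Filter.atTop (𝓝 0)) : W i =ᵐ[surf (T.face i)] V := by
  obtain ⟨ψ, hψ, g0, g1, g2⟩ := h.approx
  have hm0 : ∀ {χ : ℕ → E d → ℝ}, (∀ m, ContDiff ℝ ∞ (χ m)) →
      ∀ m, MemLp (χ m) 2 (volume.restrict T.carrier) := fun hχ m =>
    memLp_carrier (hχ m).continuous
  have hdiff : Filter.Tendsto (fun m => nrm (surf (T.face i)) (fun x => ψ m x - φ m x))
      Filter.atTop (𝓝 0) := by
    refine tendsto_nrm_surf_zero hd (ψ := fun m => fun x => ψ m x - φ m x)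
      (fun m => (hψ m).sub (hφ m)) ?_ (fun l => ?_) i
    · exact tendsto_nrm_sub (hm0 hψ) (hm0 hφ) h.memLp Filter.tendsto_id Filter.tendsto_id
        (tendsto_nrm_zero g0) (tendsto_nrm_zero h0)
    · have := tendsto_nrm_sub (hm0 fun m => contDiff_pd (hψ m) l) (hm0 fun m => contDiff_pd (hφ m) l)
        (h.memLp_deriv l) Filter.tendsto_id Filter.tendsto_id (tendsto_nrm_zero (g1 l))
        (tendsto_nrm_zero (h1 l))
      simpa only [id, pd_sub (hψ _) (hφ _)] using this
  have hWm := h.memLp_trace i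
  have hs : ∀ {χ : ℕ → E d → ℝ}, (∀ m, ContDiff ℝ ∞ (χ m)) →
      ∀ m, MemLp (χ m) 2 (surf (T.face i)) := fun hχ m => memLp_surf (hχ m).continuous i
  have hz : nrm (surf (T.face i)) (fun x => W i x - V x) = 0 := by
    refine le_antisymm ?_ (nrm_nonneg _ _)
    have hlim := (hdiff.add (tendsto_nrm_zero h2)).add (tendsto_nrm_zero (g2 i))
    simp only [add_zero] at hlim
    refine ge_of_tendsto' hlim fun m => ?_
    have m1 : MemLp (fun x => ψ m x - φ m x) 2 (surf (T.face i)) := (hs hψ m).sub (hs hφ m)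
    have m2 : MemLp (fun x => φ m x - V x) 2 (surf (T.face i)) := (hs hφ m).sub hV
    have m3 : MemLp (fun x => ψ m x - W i x) 2 (surf (T.face i)) := (hs hψ m).sub hWm
    have m4 : MemLp (fun x => (ψ m x - φ m x) + (φ m x - V x)) 2 (surf (T.face i)) := m1.add m2
    have a1 := nrm_add_le m1 m2
    have a2 := nrm_sub_le m4 m3
    have e : (fun x => W i x - V x)
        = fun x => ((ψ m x - φ m x) + (φ m x - V x)) - (ψ m x - W i x) := by
      funext x; ring
    rw [e]
    linarith
  have hsub : MemLp (fun x => W i x - V x) 2 (surf (T.face i)) := hWm.sub hV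
  have h3 : eLpNorm (fun x => W i x - V x) 2 (surf (T.face i)) = 0 := by
    rcases (ENNReal.toReal_eq_zero_iff _).1 hz with h | h
    · exact h
    · exact absurd h hsub.2.ne
  rw [eLpNorm_eq_zero_iff hsub.1 (by norm_num)] at h3
  filter_upwards [h3] with x hx
  have hx' : W i x - V x = 0 := hx
  linarith

/-- The trace inequality. -/
lemma exists_hasTraces_le (d n : ℕ) (hd : 1 ≤ d) {ρv : ℝ} (hρv : 0 < ρv) (ρe κ δ : ℝ) :
    ∃ K : ℝ, 0 < K ∧ ∀ (T : ConvexPolytope d), Regular T n ρv ρe κ δ → ∀ (w : E d → ℝ)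
      (w' : Fin d → E d → ℝ) (W : Fin T.numFaces → E d → ℝ), HasTraces T w w' W →
      ∀ i, ∀ p : Poly d, Real.sqrt T.size * nrm (surf (T.face i)) (fun x => W i x - ev p x)
        ≤ K * (nrm (volume.restrict T.carrier) (fun x => w x - ev p x) + T.size *
          ∑ l, nrm (volume.restrict T.carrier)
            (fun x => w' l x - ev (MvPolynomial.pderiv l p) x)) := by
  obtain ⟨K, hK, htr⟩ := exists_trace_le d n hd hρv ρe κ δ
  refine ⟨K, hK, fun T hT w w' W h i p => ?_⟩
  obtain ⟨φ, hφ, h0, h1, h2⟩ := h.approx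
  have hsm : ∀ m, ContDiff ℝ ∞ (fun x => φ m x - ev p x) := fun m => (hφ m).sub (contDiff_ev p)
  have conv : ∀ {μ : Measure (E d)} {F : ℕ → E d → ℝ} {f : E d → ℝ} {q : Poly d},
      (∀ m, MemLp (F m) 2 μ) → MemLp f 2 μ → MemLp (ev q) 2 μ →
      Filter.Tendsto (fun m => eLpNorm (fun x => F m x - f x) 2 μ) Filter.atTop (𝓝 0) →
      Filter.Tendsto (fun m => nrm μ (fun x => F m x - ev q x)) Filter.atTop
        (𝓝 (nrm μ (fun x => f x - ev q x))) := by
    intro μ F f q hF hf hq hlim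
    refine tendsto_nrm (F := fun m x => F m x - ev q x) (fun m => (hF m).sub hq) (hf.sub hq) ?_
    simpa only [sub_sub_sub_cancel_right] using hlim
  have l1 := (conv (fun m => memLp_surf (hφ m).continuous i) (h.memLp_trace i)
    (T.polyMem_surf i p) (h2 i)).const_mul (Real.sqrt T.size)
  have l2 := conv (fun m => memLp_carrier (hφ m).continuous) h.memLp (T.polyMem_carrier p) h0
  have l3 := tendsto_finsetSum Finset.univ fun l (_ : l ∈ Finset.univ) =>
    conv (fun m => memLp_carrier (contDiff_pd (hφ m) l).continuous) (h.memLp_deriv l)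
      (T.polyMem_carrier (MvPolynomial.pderiv l p)) (h1 l)
  refine le_of_tendsto_of_tendsto' l1 ((l2.add (l3.const_mul T.size)).const_mul K) fun m => ?_
  have h3 := htr T hT i (fun x => φ m x - ev p x) ((hsm m).of_le (by exact_mod_cast le_top))
  simpa only [pd_sub (hφ m) (contDiff_ev p), pd_ev] using h3

end Traces

end WG

namespace WG

open ConvexPolytope

/-! ### Faces shared by two elements -/

section Interface

variable {d : ℕ}

/-- A hyperplane which is not the one of the face meets the face in a null set. -/
lemma surf_hyperplane_eq_zero {T : ConvexPolytope d} (i : Fin T.numFaces) {w : E d} {c : ℝ}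
    (hw : ‖w‖ = 1) (h1 : ¬ (w = T.normal i ∧ c = T.offset i))
    (h2 : ¬ (w = - T.normal i ∧ c = - T.offset i)) :
    surf (T.face i) {x | inner ℝ w x = c} = 0 := by
  set ν := T.normal i with hν
  have hν1 : ‖ν‖ = 1 := T.norm_normal i
  obtain ⟨x₀, hx₀⟩ := T.face_nonempty i
  have hx0' : inner ℝ ν x₀ = T.offset i := hx₀.1
  have hmeas : MeasurableSet {x : E d | inner ℝ w x = c} :=
    (isClosed_eq (continuous_const.inner continuous_id) continuous_const).measurableSet
  rw [surf_eq_map hν1 x₀ 0 (fun x hx => by rw [add_zero, hx0']; exact hx.1)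
    (T.measurableSet_face i), Measure.map_apply
    (isometry_slice_const _ _ _).continuous.measurable hmeas]
  refine le_antisymm ((Measure.restrict_apply_le _ _).trans ?_) zero_le
  set w₁ : E d := w - (inner ℝ ν w : ℝ) • ν with hw₁
  have hperp : w₁ ∈ Perp ν := by
    rw [Submodule.mem_orthogonal_singleton_iff_inner_right, hw₁, inner_sub_right,
      real_inner_smul_right, real_inner_self_eq_norm_sq, hν1]
    ring
  have hinner : ∀ z : Perp ν, inner ℝ w (slice ν x₀ (0, z))
      = inner ℝ w x₀ + inner ℝ (⟨w₁, hperp⟩ : Perp ν) z := by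
    intro z
    simp only [slice, zero_smul, zero_add, inner_add_right, Submodule.coe_inner]
    rw [hw₁, inner_sub_left, real_inner_smul_left, inner_perp, mul_zero, sub_zero]
  -- If the tangential part of `w` vanishes, the two hyperplanes are parallel and, being different,
  -- disjoint. Otherwise the intersection is a proper hyperplane of `Perp ν`.
  by_cases hz : w₁ = 0
  · have hwν : w = (inner ℝ ν w : ℝ) • ν := sub_eq_zero.1 hz
    have habs : |(inner ℝ ν w : ℝ)| = 1 := by
      have := congrArg norm hwν
      rwa [norm_smul, hν1, hw, mul_one, Real.norm_eq_abs, eq_comm] at this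
    have hempty : (fun z : Perp ν => slice ν x₀ (0, z)) ⁻¹' {x | inner ℝ w x = c} = ∅ := by
      rw [Set.eq_empty_iff_forall_notMem]
      intro z hzc
      have hzc' : inner ℝ w (slice ν x₀ (0, z)) = c := hzc
      have h0 : (⟨w₁, hperp⟩ : Perp ν) = 0 := Subtype.ext hz
      rw [hinner, h0, inner_zero_left, add_zero] at hzc'
      rcases (abs_eq zero_le_one).1 habs with h | h
      · rw [h, one_smul] at hwν
        exact h1 ⟨hwν, by rw [← hzc', hwν, hx0']⟩
      · rw [h, neg_one_smul] at hwν
        exact h2 ⟨hwν, by rw [← hzc', hwν, inner_neg_left, hx0']⟩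
    rw [hempty, measure_empty]
  · have h0 : (⟨w₁, hperp⟩ : Perp ν) ≠ 0 := fun h => hz (congrArg Subtype.val h)
    refine le_of_eq ?_
    rw [← volume_hyperplane h0 (c - inner ℝ w x₀)]
    congr 1
    ext z
    simp only [Set.mem_preimage, Set.mem_ofPred_eq, hinner]
    constructor <;> intro h <;> linarith

/-- Other faces lie in other hyperplanes, which meet this face in null sets. The only exception, the
same hyperplane with the opposite normal, would leave no interior. -/
lemma ae_surf_lam_pos {T : ConvexPolytope d} (i : Fin T.numFaces) :
    ∀ᵐ x ∂(surf (T.face i)), ∀ l, l ≠ i → 0 < T.lam l x := by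
  rw [ae_all_iff]
  intro l
  by_cases hl : l = i
  · simp [hl]
  have hnull : surf (T.face i) {x | inner ℝ (T.normal l) x = T.offset l} = 0 := by
    by_cases hneg : T.normal l = - T.normal i ∧ T.offset l = - T.offset i
    · exfalso
      obtain ⟨x, hx⟩ := T.carrier_nonempty
      have a1 := mem_carrier.1 hx l
      have a2 := mem_carrier.1 hx i
      simp only [lam, hneg.1, hneg.2, inner_neg_left] at a1 a2
      linarith
    · exact surf_hyperplane_eq_zero i (T.norm_normal l)
        (fun h => hl (T.normal_injective h.1)) hneg
  filter_upwards [T.ae_surf_mem i, measure_eq_zero_iff_ae_notMem.1 hnull] with x hx hx' _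
  refine lt_of_le_of_ne ((mem_face.1 hx).2 l) fun h => hx' ?_
  simp only [lam] at h
  linarith

lemma surf_face_ne_zero {T : ConvexPolytope d} (i : Fin T.numFaces) : surf (T.face i) ≠ 0 := by
  intro h
  have := congrArg (fun μ : Measure (E d) => μ Set.univ) h
  simp only [surf, Measure.restrict_apply_univ, Measure.coe_zero, Pi.zero_apply] at this
  exact (T.face_pos i).ne' this

/-- Otherwise the face would lie in a hyperplane which meets it in a null set, contradicting
`face_pos`. -/
lemma normal_of_face_eq {T T' : ConvexPolytope d} {i : Fin T.numFaces} {i' : Fin T'.numFaces}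
    (h : T'.face i' = T.face i) :
    (T'.normal i' = T.normal i ∧ T'.offset i' = T.offset i) ∨
      (T'.normal i' = - T.normal i ∧ T'.offset i' = - T.offset i) := by
  by_contra hcon
  rw [not_or] at hcon
  have h0 := surf_hyperplane_eq_zero i (T'.norm_normal i') hcon.1 hcon.2
  have hall : ∀ᵐ x ∂(surf (T.face i)), False := by
    filter_upwards [T.ae_surf_mem i, measure_eq_zero_iff_ae_notMem.1 h0] with x hx hx'
    rw [← h] at hx
    exact hx' hx.1
  rw [Filter.eventually_false_iff_eq_bot, ae_eq_bot] at hall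
  exact surf_face_ne_zero i hall

lemma face_injective {T : ConvexPolytope d} {i i' : Fin T.numFaces} (h : T.face i' = T.face i) :
    i' = i := by
  rcases normal_of_face_eq h with h1 | h1
  · exact T.normal_injective h1.1
  · exfalso
    obtain ⟨x, hx⟩ := T.carrier_nonempty
    have a1 := mem_carrier.1 hx i'
    have a2 := mem_carrier.1 hx i
    simp only [lam, h1.1, h1.2, inner_neg_left] at a1 a2
    linarith

/-- Disjoint polytopes lie on different sides of a common face. -/
lemma normal_eq_neg {T T' : ConvexPolytope d} (hdisj : Disjoint T.carrier T'.carrier)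
    {i : Fin T.numFaces} {i' : Fin T'.numFaces} (h : T'.face i' = T.face i) :
    T'.normal i' = - T.normal i ∧ T'.offset i' = - T.offset i := by
  rcases normal_of_face_eq h with h1 | h1
  · exfalso
    have hae : ∀ᵐ x ∂(surf (T.face i)), x ∈ T.face i ∧ (∀ l, l ≠ i → 0 < T.lam l x) ∧
        ∀ l, l ≠ i' → 0 < T'.lam l x := by
      have h2 := ae_surf_lam_pos i'
      rw [h] at h2
      filter_upwards [T.ae_surf_mem i, ae_surf_lam_pos i, h2] with x a b c using ⟨a, b, c⟩
    have hne : (ae (surf (T.face i))).NeBot := ae_neBot.2 (surf_face_ne_zero i)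
    obtain ⟨x, hx, hxl, hxl'⟩ := hae.exists
    -- With equal normals, a short inward step from a point of the face that lies on no other face
    -- of either polytope ends in both open polytopes.
    set y : ℝ → E d := fun s => x - s • T.normal i with hy
    have hyc : Continuous y := by fun_prop
    have hev : ∀ᶠ s in 𝓝[>] (0 : ℝ), (∀ l, l ≠ i → 0 < T.lam l (y s)) ∧
        ∀ l, l ≠ i' → 0 < T'.lam l (y s) := by
      have hy0 : y 0 = x := by simp [hy]
      refine Filter.Eventually.filter_mono nhdsWithin_le_nhds (Filter.Eventually.and ?_ ?_)
      · refine Filter.eventually_all.2 fun l => ?_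
        by_cases hl : l = i
        · simp [hl]
        have := ((T.continuous_lam l).comp hyc).continuousAt (x := 0) |>.eventually
          (lt_mem_nhds (a := 0) (by simpa [hy0] using hxl l hl))
        filter_upwards [this] with s hs _ using hs
      · refine Filter.eventually_all.2 fun l => ?_
        by_cases hl : l = i'
        · simp [hl]
        have := ((T'.continuous_lam l).comp hyc).continuousAt (x := 0) |>.eventually
          (lt_mem_nhds (a := 0) (by simpa [hy0] using hxl' l hl))
        filter_upwards [this] with s hs _ using hs
    obtain ⟨s, ⟨hs1, hs2⟩, hs0⟩ := (hev.and self_mem_nhdsWithin).exists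
    have hs0' : (0 : ℝ) < s := hs0
    have hi : T.lam i (y s) = s := by
      have := hx.1
      simp only [lam, hy, inner_sub_right, real_inner_smul_right, real_inner_self_eq_norm_sq,
        T.norm_normal i, this]
      ring
    have hi' : T'.lam i' (y s) = s := by
      refine Eq.trans ?_ hi
      simp only [lam, h1.1, h1.2]
    refine Set.disjoint_left.1 hdisj (mem_carrier.2 fun l => ?_ : y s ∈ T.carrier)
      (mem_carrier.2 fun l => ?_)
    · by_cases hl : l = i
      · rw [hl, hi]; exact hs0'
      · exact hs1 l hl
    · by_cases hl : l = i'
      · rw [hl, hi']; exact hs0'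
      · exact hs2 l hl
  · exact h1

/-- The open neighbourhood of the relative interior of a common face which is covered by the two
elements. -/
def patch (T T' : ConvexPolytope d) (i : Fin T.numFaces) (i' : Fin T'.numFaces) : Set (E d) :=
  {x | (∀ l, l ≠ i → 0 < T.lam l x) ∧ ∀ l, l ≠ i' → 0 < T'.lam l x}

lemma isOpen_patch (T T' : ConvexPolytope d) (i : Fin T.numFaces) (i' : Fin T'.numFaces) :
    IsOpen (patch T T' i i') := by
  have h : patch T T' i i' = (⋂ l, {x | l ≠ i → 0 < T.lam l x}) ∩ ⋂ l, {x | l ≠ i' → 0 < T'.lam l x} := by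
    ext x; simp [patch]
  have key : ∀ {S : ConvexPolytope d} (a l : Fin S.numFaces), IsOpen {x | l ≠ a → 0 < S.lam l x} := by
    intro S a l
    by_cases hl : l = a
    · simp [hl]
    · simpa [hl] using isOpen_lt continuous_const (S.continuous_lam l)
  rw [h]
  exact (isOpen_iInter_of_finite fun l => key i l).inter (isOpen_iInter_of_finite fun l => key i' l)

lemma ae_mem_patch {T T' : ConvexPolytope d} {i : Fin T.numFaces} {i' : Fin T'.numFaces}
    (h : T'.face i' = T.face i) : ∀ᵐ x ∂(surf (T.face i)), x ∈ patch T T' i i' := by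
  have h2 := ae_surf_lam_pos i'
  rw [h] at h2
  filter_upwards [ae_surf_lam_pos i, h2] with x a b using ⟨a, b⟩

lemma patch_subset {T T' : ConvexPolytope d} (hdisj : Disjoint T.carrier T'.carrier)
    {i : Fin T.numFaces} {i' : Fin T'.numFaces} (h : T'.face i' = T.face i) :
    patch T T' i i' ⊆ T.carrier ∪ T'.carrier ∪ T.face i := by
  intro x hx
  obtain ⟨h1, h2⟩ := normal_eq_neg hdisj h
  have hlam : T'.lam i' x = - T.lam i x := by
    simp only [lam, h1, h2, inner_neg_left]; ring
  rcases lt_trichotomy (T.lam i x) 0 with h0 | h0 | h0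
  · refine Or.inl (Or.inr (mem_carrier.2 fun l => ?_))
    by_cases hl : l = i'
    · rw [hl, hlam]; linarith
    · exact hx.2 l hl
  · refine Or.inr (mem_face.2 ⟨h0, fun l => ?_⟩)
    by_cases hl : l = i
    · rw [hl, h0]
    · exact (hx.1 l hl).le
  · refine Or.inl (Or.inl (mem_carrier.2 fun l => ?_))
    by_cases hl : l = i
    · rw [hl]; exact h0
    · exact hx.1 l hl

lemma patch_swap (T T' : ConvexPolytope d) (i : Fin T.numFaces) (i' : Fin T'.numFaces) :
    patch T' T i' i = patch T T' i i' := by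
  ext x; exact and_comm

lemma eq_zero_on_face_of_patch {T T' : ConvexPolytope d} {i : Fin T.numFaces}
    {i' : Fin T'.numFaces} {φ : E d → ℝ} (hφ : IsTest (patch T T' i i') φ) {j : Fin T.numFaces}
    (hj : j ≠ i) {x : E d} (hx : x ∈ T.face j) : φ x = 0 := by
  refine image_eq_zero_of_notMem_tsupport fun hx' => ?_
  have := (hφ.2.2 hx').1 j hj
  rw [(mem_face.1 hx).1] at this
  exact lt_irrefl _ this

lemma volume_face {T : ConvexPolytope d} (i : Fin T.numFaces) : volume (T.face i) = 0 := by
  refine measure_mono_null (t := {x | inner ℝ (T.normal i) x = T.offset i}) (fun x hx => hx.1) ?_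
  refine volume_hyperplane ?_ _
  rw [← norm_pos_iff, T.norm_normal i]
  exact one_pos

/-! ### Test functions across the faces of a partition -/

variable {Ω : Set (E d)} (M : Mesh d Ω)

lemma Mesh.carrier_subset (t : Fin M.numElem) : (M.elem t).carrier ⊆ Ω := by
  refine Set.Subset.trans ?_ M.domain_eq.symm.subset
  exact interior_maximal (subset_closure.trans (Set.subset_iUnion (fun t =>
    closure (M.elem t).carrier) t)) (M.elem t).isOpen_carrier

lemma Mesh.isOpen_domain {Ω : Set (E d)} (M : Mesh d Ω) : IsOpen Ω :=
  M.domain_eq ▸ isOpen_interior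

/-- The patch is open and covered by the closures of the two elements, so it lies in the interior of
their union. Test functions on it are therefore admissible in the weak equations on `Ω`. -/
lemma Mesh.patch_subset_domain {t t' : Fin M.numElem} (htt : t ≠ t')
    {i : Fin (M.elem t).numFaces} {i' : Fin (M.elem t').numFaces}
    (h : (M.elem t').face i' = (M.elem t).face i) :
    patch (M.elem t) (M.elem t') i i' ⊆ Ω := by
  refine Set.Subset.trans ?_ M.domain_eq.symm.subset
  refine interior_maximal ((patch_subset (M.disjoint t t' htt) h).trans ?_) (isOpen_patch _ _ _ _)
  have hc : ∀ s, closure (M.elem s).carrier ⊆ ⋃ t, closure (M.elem t).carrier :=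
    Set.subset_iUnion fun t => closure (M.elem t).carrier
  exact Set.union_subset (Set.union_subset (subset_closure.trans (hc t))
    (subset_closure.trans (hc t'))) (((M.elem t).face_subset_closure i).trans (hc t))

lemma Mesh.integral_patch {t t' : Fin M.numElem} (htt : t ≠ t')
    {i : Fin (M.elem t).numFaces} {i' : Fin (M.elem t').numFaces}
    (h : (M.elem t').face i' = (M.elem t).face i) {G : E d → ℝ}
    (hG : ∀ x, x ∉ patch (M.elem t) (M.elem t') i i' → G x = 0)
    (hi : IntegrableOn G (M.elem t).carrier) (hi' : IntegrableOn G (M.elem t').carrier) :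
    ∫ x in Ω, G x = (∫ x in (M.elem t).carrier, G x) + ∫ x in (M.elem t').carrier, G x := by
  rw [← setIntegral_union (M.disjoint t t' htt) (M.elem t').measurableSet_carrier hi hi']
  refine setIntegral_eq_of_subset_of_ae_sdiff_eq_zero M.isOpen_domain.nullMeasurableSet
    (Set.union_subset (M.carrier_subset t) (M.carrier_subset t')) ?_
  filter_upwards [measure_eq_zero_iff_ae_notMem.1 (volume_face (T := M.elem t) i)] with x hx hx'
  refine hG x fun hxp => ?_
  rcases patch_subset (M.disjoint t t' htt) h hxp with h1 | h1
  · exact hx'.2 h1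
  · exact hx h1

/-- The fundamental lemma of the calculus of variations for the surface measure: the patch contains
almost every point of the face. Identities of traces and of fluxes both reduce to it. -/
lemma ae_eq_zero_of_patch {T T' : ConvexPolytope d} {i : Fin T.numFaces}
    {i' : Fin T'.numFaces} (h : T'.face i' = T.face i) {F : E d → ℝ}
    (hF : MemLp F 2 (surf (T.face i)))
    (h0 : ∀ φ, IsTest (patch T T' i i') φ → ∫ x, F x * φ x ∂(surf (T.face i)) = 0) :
    F =ᵐ[surf (T.face i)] 0 := by
  have h1 := (isOpen_patch T T' i i').ae_eq_zero_of_integral_contDiff_smul_eq_zero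
    (μ := surf (T.face i)) (f := F)
    ((hF.integrable (by norm_num)).locallyIntegrable.locallyIntegrableOn _)
    (fun φ a b c => by
      have := h0 φ ⟨a, b, c⟩
      simpa only [smul_eq_mul, mul_comm] using this)
  filter_upwards [h1, ae_mem_patch h] with x hx hx' using hx hx'

end Interface

end WG

namespace WG

open ConvexPolytope

/-! ### Traces and fluxes of the exact solution -/

section Exact

variable {d : ℕ} {Ω : Set (E d)} (M : Mesh d Ω) {k : ℕ} {u : E d → ℝ}

lemma memLp_wD_elem (hu : MemSobolev Ω (k + 1) u) (t : Fin M.numElem) {L : List (Fin d)}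
    (hL : L.length ≤ k + 1) : MemLp (wD Ω u L) 2 (volume.restrict (M.elem t).carrier) :=
  (wD_spec hu hL).1.mono_measure (Measure.restrict_mono (M.carrier_subset t) le_rfl)

lemma memLp_elem {f : E d → ℝ} (hf : MemLp f 2 (volume.restrict Ω)) (t : Fin M.numElem) :
    MemLp f 2 (volume.restrict (M.elem t).carrier) :=
  hf.mono_measure (Measure.restrict_mono (M.carrier_subset t) le_rfl)

lemma wD_nil_elem (hu : MemSobolev Ω (k + 1) u) (t : Fin M.numElem) :
    u =ᵐ[volume.restrict (M.elem t).carrier] wD Ω u [] :=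
  ((wD_nil M.isOpen_domain hu).filter_mono
    (ae_mono (Measure.restrict_mono (M.carrier_subset t) le_rfl))).symm

lemma exists_smooth_approx_elem (hu : MemSobolev Ω (k + 1) u) (t : Fin M.numElem) :
    ∃ φ : ℕ → E d → ℝ, (∀ m, ContDiff ℝ ∞ (φ m)) ∧ ∀ L : List (Fin d), L.length ≤ k + 1 →
      Filter.Tendsto (fun m => eLpNorm (fun x => dL L (φ m) x - wD Ω u L x) 2
        (volume.restrict (M.elem t).carrier)) Filter.atTop (𝓝 0) :=
  exists_smooth_approx (M.elem t).isOpen_carrier (M.elem t).convex_carrier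
    (M.elem t).isBounded_carrier (M.elem t).carrier_nonempty
    (fun _ hL => memLp_wD_elem M hu t hL)
    (fun _ l hL => (weakD1_wD hu hL l).mono (M.carrier_subset t))

lemma exists_traces (hd : 1 ≤ d) (hu : MemSobolev Ω (k + 1) u) (t : Fin M.numElem) :
    ∃ W, HasTraces (M.elem t) u (fun l => wD Ω u [l]) W := by
  obtain ⟨φ, hφ, h⟩ := exists_smooth_approx_elem M hu t
  refine exists_hasTraces hd (memLp_elem M hu.1 t) (fun l => memLp_wD_elem M hu t (by simp)) hφ ?_
    fun l => h [l] (by simp)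
  refine (h [] (by simp)).congr fun m => eLpNorm_congr_ae ?_
  filter_upwards [wD_nil_elem M hu t] with x hx
  rw [hx]
  rfl

lemma exists_traces_deriv (hd : 1 ≤ d) (hk : 1 ≤ k) (hu : MemSobolev Ω (k + 1) u)
    (t : Fin M.numElem) (m : Fin d) :
    ∃ W, HasTraces (M.elem t) (wD Ω u [m]) (fun l => wD Ω u [l, m]) W := by
  obtain ⟨φ, hφ, h⟩ := exists_smooth_approx_elem M hu t
  exact exists_hasTraces hd (memLp_wD_elem M hu t (by simp))
    (fun l => memLp_wD_elem M hu t (by simpa using hk)) (fun m' => contDiff_pd (hφ m') m)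
    (h [m] (by simp)) fun l => h [l, m] (by simpa using hk)

lemma HasTraces.isTrace {T : ConvexPolytope d} {W : Fin T.numFaces → E d → ℝ}
    (h : HasTraces T u (fun l => wD Ω u [l]) W) (i : Fin T.numFaces) :
    IsTrace Ω T.carrier (T.face i) u (W i) := by
  obtain ⟨φ, hφ, h0, h1, h2⟩ := h.approx
  refine ⟨h.memLp_trace i, φ, hφ, h0, fun l => ?_, h2 i⟩
  simp only [grad_eq_wD]
  exact h1 l

lemma HasTraces.ae_eq_of_isTrace (hd : 1 ≤ d) {T : ConvexPolytope d}
    {W : Fin T.numFaces → E d → ℝ} (h : HasTraces T u (fun l => wD Ω u [l]) W)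
    {i : Fin T.numFaces} {V : E d → ℝ} (hV : IsTrace Ω T.carrier (T.face i) u V) :
    W i =ᵐ[surf (T.face i)] V := by
  obtain ⟨hm, φ, hφ, h0, h1, h2⟩ := hV
  simp only [grad_eq_wD] at h1
  exact h.ae_eq hd hm hφ h0 h1 h2

lemma isTrace_congr {T e : Set (E d)} {W V : E d → ℝ} (h : W =ᵐ[surf e] V)
    (hW : IsTrace Ω T e u W) : IsTrace Ω T e u V := by
  obtain ⟨hm, φ, hφ, h0, h1, h2⟩ := hW
  refine ⟨hm.ae_eq h, φ, hφ, h0, h1, h2.congr fun m => eLpNorm_congr_ae ?_⟩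
  filter_upwards [h] with x hx
  rw [hx]

lemma exists_normal_ne_zero (T : ConvexPolytope d) (i : Fin T.numFaces) :
    ∃ l, T.normal i l ≠ 0 := by
  by_contra! h
  have : T.normal i = 0 := by ext l; simpa using h l
  have h1 := T.norm_normal i
  rw [this, norm_zero] at h1
  exact zero_ne_one h1

/-- The traces from both sides of a face agree. -/
lemma traces_ae_eq (hd : 1 ≤ d) (hu : MemSobolev Ω (k + 1) u) {t t' : Fin M.numElem}
    (htt : t ≠ t') {i : Fin (M.elem t).numFaces} {i' : Fin (M.elem t').numFaces}
    (h : (M.elem t').face i' = (M.elem t).face i)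
    {W : Fin (M.elem t).numFaces → E d → ℝ} {W' : Fin (M.elem t').numFaces → E d → ℝ}
    (hW : HasTraces (M.elem t) u (fun l => wD Ω u [l]) W)
    (hW' : HasTraces (M.elem t') u (fun l => wD Ω u [l]) W') :
    W i =ᵐ[surf ((M.elem t).face i)] W' i' := by
  obtain ⟨hν, -⟩ := normal_eq_neg (M.disjoint t t' htt) h
  have hm' : MemLp (W' i') 2 (surf ((M.elem t).face i)) := h ▸ hW'.memLp_trace i'
  have key := ae_eq_zero_of_patch h (F := fun x => W i x - W' i' x)
    ((hW.memLp_trace i).sub hm') (fun φ hφ => ?_)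
  · filter_upwards [key] with x hx
    have : W i x - W' i' x = 0 := hx
    linarith
  -- A direction with nonzero normal component is differentiated. Green's formula on both elements
  -- is compared with the weak derivative on `Ω`: the volume terms cancel, and as the normals are
  -- opposite the difference of the two traces remains.
  obtain ⟨l, hl⟩ := exists_normal_ne_zero (M.elem t) i
  have hwd : WeakD1 Ω l u (wD Ω u [l]) :=
    (weakD1_wD hu (L := []) (by simp) l).congr (wD_nil M.isOpen_domain hu) Filter.EventuallyEq.rfl
  have h1 := hwd φ (hφ.mono (M.patch_subset_domain htt h))
  have i1 : ∀ s, IntegrableOn (fun x => u x * pd l φ x) (M.elem s).carrier := fun s =>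
    integrable_mul_of_memLp (memLp_elem M hu.1 s) ((hφ.pd l).memLp _)
  have i2 : ∀ s, IntegrableOn (fun x => wD Ω u [l] x * φ x) (M.elem s).carrier := fun s =>
    integrable_mul_of_memLp (memLp_wD_elem M hu s (by simp)) (hφ.memLp _)
  have hz : ∀ {χ : E d → ℝ}, IsTest (patch (M.elem t) (M.elem t') i i') χ →
      ∀ x, x ∉ patch (M.elem t) (M.elem t') i i' → χ x = 0 := fun hχ x hx =>
    image_eq_zero_of_notMem_tsupport fun hx' => hx (hχ.2.2 hx')
  rw [M.integral_patch htt h (fun x hx => by rw [hz (hφ.pd l) x hx, mul_zero]) (i1 t) (i1 t'),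
    M.integral_patch htt h (fun x hx => by rw [hz hφ x hx, mul_zero]) (i2 t) (i2 t')] at h1
  have g1 := hW.green_of_zero hd hφ.1
    (fun j hj x hx => eq_zero_on_face_of_patch hφ hj hx) l
  have g2 := hW'.green_of_zero hd hφ.1 (i := i')
    (fun j hj x hx => eq_zero_on_face_of_patch
      (by rw [patch_swap]; exact hφ : IsTest (patch (M.elem t') (M.elem t) i' i) φ) hj hx) l
  rw [h, hν, PiLp.neg_apply] at g2
  have h2 : (M.elem t).normal i l * ((∫ x, W i x * φ x ∂(surf ((M.elem t).face i)))
      - ∫ x, W' i' x * φ x ∂(surf ((M.elem t).face i))) = 0 := by linarith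
  simp only [sub_mul]
  rw [integral_sub (integrable_mul_of_memLp (hW.memLp_trace i) (memLp_surf hφ.1.continuous i))
    (integrable_mul_of_memLp hm' (memLp_surf hφ.1.continuous i))]
  exact (mul_eq_zero.1 h2).resolve_left hl

/-- The trace on a face is the one from each element with that face. -/
lemma faceTrace_ae_eq (hd : 1 ≤ d) (hu : MemSobolev Ω (k + 1) u) {t : Fin M.numElem}
    {W : Fin (M.elem t).numFaces → E d → ℝ}
    (hW : HasTraces (M.elem t) u (fun l => wD Ω u [l]) W) (i : Fin (M.elem t).numFaces) :
    M.faceTrace u (M.faceOf t i) =ᵐ[surf ((M.elem t).face i)] W i := by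
  -- The chosen `faceTrace` is meaningful only because one function is a trace from all elements
  -- with this face, which is the agreement of traces from both sides.
  have hex : ∃ w, ∀ t' i', (M.elem t').face i' = (M.faceOf t i).1 →
      IsTrace Ω (M.elem t').carrier (M.faceOf t i).1 u w := by
    refine ⟨W i, fun t' i' h => ?_⟩
    by_cases htt : t = t'
    · subst htt
      exact hW.isTrace i
    · obtain ⟨W', hW'⟩ := exists_traces M hd hu t'
      have h' : (M.elem t').face i' = (M.elem t).face i := h
      have h1 := hW'.isTrace i'
      rw [h'] at h1
      exact isTrace_congr (traces_ae_eq M hd hu htt h' hW hW').symm h1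
  have hs := Classical.epsilon_spec hex t i rfl
  exact (hW.ae_eq_of_isTrace hd hs).symm

/-! ### The equation on single elements and the flux across faces -/

lemma integral_mulVec_dotProduct {T : Set (E d)} (hT : MeasurableSet T)
    {a : E d → Matrix (Fin d) (Fin d) ℝ}
    {A : Matrix (Fin d) (Fin d) ℝ} (hA : ∀ x ∈ T, a x = A) {g h : E d → Fin d → ℝ}
    (hg : ∀ m, MemLp (fun x => g x m) 2 (volume.restrict T))
    (hh : ∀ l, MemLp (fun x => h x l) 2 (volume.restrict T)) :
    IntegrableOn (fun x => (a x).mulVec (g x) ⬝ᵥ h x) T ∧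
    ∫ x in T, (a x).mulVec (g x) ⬝ᵥ h x = ∑ l, ∑ m, A l m * ∫ x in T, g x m * h x l := by
  have hi : ∀ l m, Integrable (fun x => A l m * (g x m * h x l)) (volume.restrict T) :=
    fun l m => (integrable_mul_of_memLp (hg m) (hh l)).const_mul _
  have e : (fun x => (a x).mulVec (g x) ⬝ᵥ h x) =ᵐ[volume.restrict T]
      fun x => ∑ l, ∑ m, A l m * (g x m * h x l) := by
    filter_upwards [ae_restrict_mem hT] with x hx
    rw [hA x hx]
    simp only [dotProduct, Matrix.mulVec, Finset.sum_mul, mul_assoc]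
  refine ⟨Integrable.congr (integrable_finsetSum _ fun l _ => integrable_finsetSum _ fun m _ =>
    hi l m) e.symm, ?_⟩
  rw [integral_congr_ae e, integral_finsetSum _ fun l _ => integrable_finsetSum _ fun m _ => hi l m]
  refine Finset.sum_congr rfl fun l _ => ?_
  rw [integral_finsetSum _ fun m _ => hi l m]
  exact Finset.sum_congr rfl fun m _ => integral_const_mul _ _

lemma integral_exact_elem {a : E d → Matrix (Fin d) (Fin d) ℝ} (hu : MemSobolev Ω (k + 1) u)
    (t : Fin M.numElem) {A : Matrix (Fin d) (Fin d) ℝ} (hA : ∀ x ∈ (M.elem t).carrier, a x = A)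
    {v : E d → ℝ} (hv : ContDiff ℝ ∞ v) :
    IntegrableOn (fun x => (a x).mulVec (grad Ω u x) ⬝ᵥ fun l => fderiv ℝ v x (unitVec l))
      (M.elem t).carrier ∧
    ∫ x in (M.elem t).carrier, (a x).mulVec (grad Ω u x) ⬝ᵥ (fun l => fderiv ℝ v x (unitVec l))
      = ∑ l, ∑ m, A l m * ∫ x in (M.elem t).carrier, wD Ω u [m] x * pd l v x := by
  have := integral_mulVec_dotProduct (M.elem t).measurableSet_carrier hA (g := fun x => grad Ω u x)
    (h := fun x l => pd l v x)
    (fun m => by simpa only [grad_eq_wD] using memLp_wD_elem M hu t (by simp))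
    (fun l => memLp_carrier (contDiff_pd hv l).continuous)
  refine ⟨this.1, this.2.trans ?_⟩
  simp only [grad_eq_wD]

/-- The flux `a ∇u · n` through the `i`-th face of an element, given the traces of `∇u`. -/
noncomputable def flux (T : ConvexPolytope d) (A : Matrix (Fin d) (Fin d) ℝ)
    (Z : Fin d → Fin T.numFaces → E d → ℝ) (i : Fin T.numFaces) (x : E d) : ℝ :=
  ∑ l, ∑ m, T.normal i l * A l m * Z m i x

lemma memLp_flux {T : ConvexPolytope d} (A : Matrix (Fin d) (Fin d) ℝ)
    {Z : Fin d → Fin T.numFaces → E d → ℝ} {i : Fin T.numFaces}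
    (hZ : ∀ m, MemLp (Z m i) 2 (surf (T.face i))) :
    MemLp (flux T A Z i) 2 (surf (T.face i)) :=
  memLp_finsetSum _ fun _ _ => memLp_finsetSum _ fun m _ => (hZ m).const_mul _

lemma integral_flux_mul {T : ConvexPolytope d} (A : Matrix (Fin d) (Fin d) ℝ)
    {Z : Fin d → Fin T.numFaces → E d → ℝ} {i : Fin T.numFaces}
    (hZ : ∀ m, MemLp (Z m i) 2 (surf (T.face i))) {v : E d → ℝ}
    (hv : MemLp v 2 (surf (T.face i))) :
    ∫ x, flux T A Z i x * v x ∂(surf (T.face i))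
      = ∑ l, ∑ m, A l m * (T.normal i l * ∫ x, Z m i x * v x ∂(surf (T.face i))) := by
  have hi : ∀ l m, Integrable (fun x => A l m * (T.normal i l * (Z m i x * v x)))
      (surf (T.face i)) :=
    fun l m => ((integrable_mul_of_memLp (hZ m) hv).const_mul _).const_mul _
  have e : ∀ x, flux T A Z i x * v x = ∑ l, ∑ m, A l m * (T.normal i l * (Z m i x * v x)) := by
    intro x
    simp only [flux, Finset.sum_mul]
    exact Finset.sum_congr rfl fun l _ => Finset.sum_congr rfl fun m _ => by ring
  simp only [e]
  rw [integral_finsetSum _ fun l _ => integrable_finsetSum _ fun m _ => hi l m]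
  refine Finset.sum_congr rfl fun l _ => ?_
  rw [integral_finsetSum _ fun m _ => hi l m]
  refine Finset.sum_congr rfl fun m _ => ?_
  rw [integral_const_mul, integral_const_mul]

variable {a : E d → Matrix (Fin d) (Fin d) ℝ} {f g : E d → ℝ}

/-- Inside an element the coefficient is constant and `u` has second weak derivatives, as `k ≥ 1`.
The weak form tested with functions supported there is thus the equation in strong form. -/
lemma pde_elem (hk : 1 ≤ k) (hu : MemSobolev Ω (k + 1) u) (hf : MemLp f 2 (volume.restrict Ω))
    (hex : ∀ φ : E d → ℝ, IsTest Ω φ →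
      ∫ x in Ω, (a x).mulVec (grad Ω u x) ⬝ᵥ (fun l => fderiv ℝ φ x (unitVec l))
        = ∫ x in Ω, f x * φ x)
    (t : Fin M.numElem) {A : Matrix (Fin d) (Fin d) ℝ} (hA : ∀ x ∈ (M.elem t).carrier, a x = A) :
    f =ᵐ[volume.restrict (M.elem t).carrier] fun x => - ∑ l, ∑ m, A l m * wD Ω u [l, m] x := by
  have hmem : ∀ l m, MemLp (fun x => A l m * wD Ω u [l, m] x) 2
      (volume.restrict (M.elem t).carrier) := fun l m =>
    (memLp_wD_elem M hu t (by simpa using hk)).const_mul _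
  refine ae_eq_of_integral_test (M.elem t).isOpen_carrier (memLp_elem M hf t)
    (memLp_finsetSum _ fun l _ => memLp_finsetSum _ fun m _ => hmem l m).neg fun φ hφ => ?_
  have h1 := hex φ (hφ.mono (M.carrier_subset t))
  have hz : ∀ x, x ∉ (M.elem t).carrier → ∀ l, pd l φ x = 0 := fun x hx l =>
    image_eq_zero_of_notMem_tsupport fun hx' => hx ((hφ.pd l).2.2 hx')
  rw [← setIntegral_eq_of_subset_of_forall_sdiff_eq_zero M.isOpen_domain.measurableSet
      (M.carrier_subset t) (fun x hx => by
        rw [image_eq_zero_of_notMem_tsupport fun hx' => hx.2 (hφ.2.2 hx'), mul_zero]), ← h1,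
    setIntegral_eq_of_subset_of_forall_sdiff_eq_zero M.isOpen_domain.measurableSet
      (M.carrier_subset t) (fun x hx => by
        have : (fun l => fderiv ℝ φ x (unitVec l)) = 0 := funext fun l => hz x hx.2 l
        rw [this, dotProduct_zero]),
    (integral_exact_elem M hu t hA hφ.1).2]
  have hφm : MemLp φ 2 (volume.restrict (M.elem t).carrier) := hφ.memLp _
  have hi : ∀ l m, Integrable (fun x => A l m * wD Ω u [l, m] x * φ x)
      (volume.restrict (M.elem t).carrier) := fun l m => integrable_mul_of_memLp (hmem l m) hφm
  simp only [neg_mul, Finset.sum_mul]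
  rw [integral_neg, integral_finsetSum _ fun l _ => integrable_finsetSum _ fun m _ => hi l m,
    ← Finset.sum_neg_distrib]
  refine Finset.sum_congr rfl fun l _ => ?_
  rw [integral_finsetSum _ fun m _ => hi l m, ← Finset.sum_neg_distrib]
  refine Finset.sum_congr rfl fun m _ => ?_
  simp only [mul_assoc]
  rw [((weakD1_wD hu (L := [m]) (by simpa using hk) l).mono (M.carrier_subset t)) φ hφ,
    integral_const_mul, mul_neg]

/-- Integration by parts in the equation on one element. -/
lemma green_flux (hd : 1 ≤ d) (hk : 1 ≤ k) (hu : MemSobolev Ω (k + 1) u)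
    (hf : MemLp f 2 (volume.restrict Ω))
    (hex : ∀ φ : E d → ℝ, IsTest Ω φ →
      ∫ x in Ω, (a x).mulVec (grad Ω u x) ⬝ᵥ (fun l => fderiv ℝ φ x (unitVec l))
        = ∫ x in Ω, f x * φ x)
    (t : Fin M.numElem) {A : Matrix (Fin d) (Fin d) ℝ} (hA : ∀ x ∈ (M.elem t).carrier, a x = A)
    {Z : Fin d → Fin (M.elem t).numFaces → E d → ℝ}
    (hZ : ∀ m, HasTraces (M.elem t) (wD Ω u [m]) (fun l => wD Ω u [l, m]) (Z m))
    {v : E d → ℝ} (hv : ContDiff ℝ ∞ v) :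
    (∑ l, ∑ m, A l m * ∫ x in (M.elem t).carrier, wD Ω u [m] x * pd l v x)
        - ∫ x in (M.elem t).carrier, f x * v x
      = ∑ i, ∫ x, flux (M.elem t) A Z i x * v x ∂(surf ((M.elem t).face i)) := by
  have hvm : MemLp v 2 (volume.restrict (M.elem t).carrier) := memLp_carrier hv.continuous
  have h1 : ∫ x in (M.elem t).carrier, f x * v x
      = - ∑ l, ∑ m, A l m * ∫ x in (M.elem t).carrier, wD Ω u [l, m] x * v x := by
    have hi : ∀ l m, Integrable (fun x => A l m * (wD Ω u [l, m] x * v x))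
        (volume.restrict (M.elem t).carrier) := fun l m =>
      (integrable_mul_of_memLp (memLp_wD_elem M hu t (by simpa using hk)) hvm).const_mul _
    have e : (fun x => f x * v x) =ᵐ[volume.restrict (M.elem t).carrier]
        fun x => - ∑ l, ∑ m, A l m * (wD Ω u [l, m] x * v x) := by
      filter_upwards [pde_elem M hk hu hf hex t hA] with x hx
      rw [hx]
      simp only [neg_mul, Finset.sum_mul, mul_assoc]
    rw [integral_congr_ae e, integral_neg,
      integral_finsetSum _ fun l _ => integrable_finsetSum _ fun m _ => hi l m]
    congr 1
    refine Finset.sum_congr rfl fun l _ => ?_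
    rw [integral_finsetSum _ fun m _ => hi l m]
    exact Finset.sum_congr rfl fun m _ => integral_const_mul _ _
  have h2 : ∀ i, ∫ x, flux (M.elem t) A Z i x * v x ∂(surf ((M.elem t).face i))
      = ∑ l, ∑ m, A l m * ((M.elem t).normal i l
        * ∫ x, Z m i x * v x ∂(surf ((M.elem t).face i))) := fun i =>
    integral_flux_mul A (fun m => (hZ m).memLp_trace i) (memLp_surf hv.continuous i)
  have h3 : ∑ i, ∑ l, ∑ m, A l m * ((M.elem t).normal i l
        * ∫ x, Z m i x * v x ∂(surf ((M.elem t).face i)))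
      = ∑ l, ∑ m, ∑ i, A l m * ((M.elem t).normal i l
        * ∫ x, Z m i x * v x ∂(surf ((M.elem t).face i))) := by
    rw [Finset.sum_comm]
    exact Finset.sum_congr rfl fun l _ => Finset.sum_comm
  simp only [h2]
  rw [h1, sub_neg_eq_add, h3, ← Finset.sum_add_distrib]
  refine Finset.sum_congr rfl fun l _ => ?_
  rw [← Finset.sum_add_distrib]
  refine Finset.sum_congr rfl fun m _ => ?_
  rw [← Finset.mul_sum, ← (hZ m).green hd hv l]
  ring

/-- The flux is continuous across faces. -/
lemma flux_ae_eq (hd : 1 ≤ d) (hk : 1 ≤ k) (hu : MemSobolev Ω (k + 1) u)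
    (hf : MemLp f 2 (volume.restrict Ω))
    (hex : ∀ φ : E d → ℝ, IsTest Ω φ →
      ∫ x in Ω, (a x).mulVec (grad Ω u x) ⬝ᵥ (fun l => fderiv ℝ φ x (unitVec l))
        = ∫ x in Ω, f x * φ x)
    {A : Fin M.numElem → Matrix (Fin d) (Fin d) ℝ}
    (hA : ∀ t, ∀ x ∈ (M.elem t).carrier, a x = A t)
    {Z : (t : Fin M.numElem) → Fin d → Fin (M.elem t).numFaces → E d → ℝ}
    (hZ : ∀ t m, HasTraces (M.elem t) (wD Ω u [m]) (fun l => wD Ω u [l, m]) (Z t m))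
    {t t' : Fin M.numElem} (htt : t ≠ t') {i : Fin (M.elem t).numFaces}
    {i' : Fin (M.elem t').numFaces} (h : (M.elem t').face i' = (M.elem t).face i) :
    (fun x => flux (M.elem t) (A t) (Z t) i x + flux (M.elem t') (A t') (Z t') i' x)
      =ᵐ[surf ((M.elem t).face i)] 0 := by
  have hm := memLp_flux (A t) (fun m => (hZ t m).memLp_trace i)
  have hm' : MemLp (flux (M.elem t') (A t') (Z t') i') 2 (surf ((M.elem t).face i)) :=
    h ▸ memLp_flux (A t') (fun m => (hZ t' m).memLp_trace i')
  refine ae_eq_zero_of_patch h (hm.add hm') fun φ hφ => ?_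
  have hz : ∀ {χ : E d → ℝ}, IsTest (patch (M.elem t) (M.elem t') i i') χ →
      ∀ x, x ∉ patch (M.elem t) (M.elem t') i i' → χ x = 0 := fun hχ x hx =>
    image_eq_zero_of_notMem_tsupport fun hx' => hx (hχ.2.2 hx')
  have h1 := hex φ (hφ.mono (M.patch_subset_domain htt h))
  have i2 : ∀ s, IntegrableOn (fun x => f x * φ x) (M.elem s).carrier := fun s =>
    integrable_mul_of_memLp (memLp_elem M hf s) (hφ.memLp _)
  have e1 := integral_exact_elem M hu t (hA t) hφ.1
  have e2 := integral_exact_elem M hu t' (hA t') hφ.1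
  rw [M.integral_patch htt h (fun x hx => by
      have : (fun l => fderiv ℝ φ x (unitVec l)) = 0 := funext fun l => hz (hφ.pd l) x hx
      rw [this, dotProduct_zero]) e1.1 e2.1,
    M.integral_patch htt h (fun x hx => by rw [hz hφ x hx, mul_zero]) (i2 t) (i2 t'),
    e1.2, e2.2] at h1
  -- The elementwise Green formulas add up to the weak equation on the patch plus the two fluxes
  -- through the common face, so the sum of the fluxes is orthogonal to all test functions.
  have g1 := green_flux M hd hk hu hf hex t (hA t) (hZ t) hφ.1
  have g2 := green_flux M hd hk hu hf hex t' (hA t') (hZ t') hφ.1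
  have hφ' : IsTest (patch (M.elem t') (M.elem t) i' i) φ := by rw [patch_swap]; exact hφ
  have z1 : ∀ {s s' : Fin M.numElem} {j : Fin (M.elem s).numFaces} {j' : Fin (M.elem s').numFaces},
      IsTest (patch (M.elem s) (M.elem s') j j') φ →
      ∑ r, ∫ x, flux (M.elem s) (A s) (Z s) r x * φ x ∂(surf ((M.elem s).face r))
        = ∫ x, flux (M.elem s) (A s) (Z s) j x * φ x ∂(surf ((M.elem s).face j)) := by
    intro s s' j j' hχ
    refine Finset.sum_eq_single j (fun r _ hr => integral_eq_zero_of_ae ?_) (by simp)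
    filter_upwards [(M.elem s).ae_surf_mem r] with x hx
    simp [eq_zero_on_face_of_patch hχ hr hx]
  rw [z1 hφ] at g1
  rw [z1 hφ', h] at g2
  have hs := memLp_surf hφ.1.continuous i
  simp only [add_mul]
  rw [integral_add (integrable_mul_of_memLp hm hs) (integrable_mul_of_memLp hm' hs)]
  linarith

/-- A face belongs to at most two elements: the normals of three would be pairwise opposite, hence
zero. -/
lemma eq_of_face_eq {p q q' : Σ t, Fin (M.elem t).numFaces} (hq : q ≠ p) (hq' : q' ≠ p)
    (h : (M.elem q.1).face q.2 = (M.elem p.1).face p.2)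
    (h' : (M.elem q'.1).face q'.2 = (M.elem p.1).face p.2) : q = q' := by
  have key : ∀ {p q : Σ t, Fin (M.elem t).numFaces},
      (M.elem q.1).face q.2 = (M.elem p.1).face p.2 → q ≠ p → q.1 ≠ p.1 := by
    rintro ⟨t, i⟩ ⟨t', i'⟩ h hne (rfl : t' = t)
    have hii : i' = i := face_injective h
    exact hne (by rw [hii])
  by_contra hne
  have n1 := (normal_eq_neg (M.disjoint _ _ (key h hq).symm) h).1
  have n2 := (normal_eq_neg (M.disjoint _ _ (key h' hq').symm) h').1
  have n3 := (normal_eq_neg (M.disjoint _ _ (key (h.trans h'.symm) hne).symm) (h.trans h'.symm)).1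
  rw [n1, n2, neg_neg] at n3
  have h0 : (M.elem p.1).normal p.2 = 0 := by
    ext l
    have := congrArg (fun z : E d => z l) n3
    simp only [PiLp.neg_apply] at this
    rw [PiLp.zero_apply]
    linarith
  have h1 := (M.elem p.1).norm_normal p.2
  rw [h0, norm_zero] at h1
  exact zero_ne_one h1

/-- The fluxes tested with single valued functions vanishing on the boundary cancel. -/
lemma sum_flux_eq_zero {F : (t : Fin M.numElem) → Fin (M.elem t).numFaces → E d → ℝ}
    (hFm : ∀ t i, MemLp (F t i) 2 (surf ((M.elem t).face i)))
    (hF : ∀ {t t' : Fin M.numElem}, t ≠ t' → ∀ {i : Fin (M.elem t).numFaces}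
      {i' : Fin (M.elem t').numFaces}, (M.elem t').face i' = (M.elem t).face i →
      (fun x => F t i x + F t' i' x) =ᵐ[surf ((M.elem t).face i)] 0)
    (v : M.Vh k) (hv : M.MemVh0 v) :
    ∑ t, ∑ i, ∫ x, F t i x * ev (v.bdry (M.faceOf t i)) x ∂(surf ((M.elem t).face i)) = 0 := by
  classical
  set J : (Σ t, Fin (M.elem t).numFaces) → ℝ := fun p =>
    ∫ x, F p.1 p.2 x * ev (v.bdry (M.faceOf p.1 p.2)) x ∂(surf ((M.elem p.1).face p.2)) with hJ
  refine (Fintype.sum_sigma J).symm.trans ?_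
  let P : (Σ t, Fin (M.elem t).numFaces) → (Σ t, Fin (M.elem t).numFaces) → Prop := fun p q =>
    q ≠ p ∧ (M.elem q.1).face q.2 = (M.elem p.1).face p.2
  -- The involution exchanges the two sides of a face, whose contributions cancel. A face without a
  -- partner lies on `∂Ω` by conformity, where `v_b` vanishes.
  let π : (Σ t, Fin (M.elem t).numFaces) → (Σ t, Fin (M.elem t).numFaces) := fun p =>
    if h : ∃ q, P p q then h.choose else p
  have hπ : ∀ p q, P p q → π p = q := by
    intro p q hpq
    have hex : ∃ q, P p q := ⟨q, hpq⟩
    have : π p = hex.choose := dif_pos hex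
    rw [this]
    exact eq_of_face_eq M hex.choose_spec.1 hpq.1 hex.choose_spec.2 hpq.2
  have hπ' : ∀ p, (¬ ∃ q, P p q) → π p = p := fun p h => dif_neg h
  have hJ0 : ∀ p, (¬ ∃ q, P p q) → J p = 0 := by
    intro p hp
    have hb : M.IsBoundaryFace (M.faceOf p.1 p.2) := by
      by_contra hb
      obtain ⟨t', ht', i', hi'⟩ := M.conforming p.1 p.2 hb
      exact hp ⟨⟨t', i'⟩, fun h => ht' (congrArg Sigma.fst h), hi'⟩
    refine integral_eq_zero_of_ae ?_
    filter_upwards [(M.elem p.1).ae_surf_mem p.2] with x hx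
    simp [hv _ hb x hx]
  refine Finset.sum_involution (fun p _ => π p) (fun p _ => ?_) (fun p _ hp => ?_)
    (fun p _ => by simp) (fun p _ => ?_)
  · by_cases h : ∃ q, P p q
    · obtain ⟨q, hq⟩ := h
      rw [hπ p q hq]
      obtain ⟨t, i⟩ := p
      obtain ⟨t', i'⟩ := q
      have hf : (M.elem t').face i' = (M.elem t).face i := hq.2
      have htt : t ≠ t' := by
        rintro rfl
        have hii : i' = i := face_injective hf
        exact hq.1 (by rw [hii])
      have hface : M.faceOf t' i' = M.faceOf t i := Subtype.ext hf
      simp only [hJ]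
      rw [hface, hf]
      have hm' : MemLp (F t' i') 2 (surf ((M.elem t).face i)) := hf ▸ hFm t' i'
      have hpm := (M.elem t).polyMem_surf i (v.bdry (M.faceOf t i))
      rw [← integral_add (integrable_mul_of_memLp (hFm t i) hpm) (integrable_mul_of_memLp hm' hpm)]
      refine integral_eq_zero_of_ae ?_
      filter_upwards [hF htt hf] with x hx
      have hx' : F t i x + F t' i' x = 0 := hx
      simp only [← add_mul, hx', zero_mul, Pi.zero_apply]
    · have := hJ0 p h
      rw [hπ' p h, this, add_zero]
  · by_cases h : ∃ q, P p q
    · obtain ⟨q, hq⟩ := h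
      rw [hπ p q hq]
      exact hq.1
    · exact absurd (hJ0 p h) hp
  · by_cases h : ∃ q, P p q
    · obtain ⟨q, hq⟩ := h
      have h1 : P q p := ⟨hq.1.symm, hq.2.symm⟩
      simp only [hπ p q hq, hπ q p h1]
    · simp only [hπ' p h]

end Exact

end WG

namespace WG

open ConvexPolytope

/-! ### The weak gradient on one element -/

section ElemGrad

variable {d : ℕ} {T : ConvexPolytope d}

/-- The components `G l` of the weak gradient on `T` with interior gradient `g` and
(projected) jumps `φ i` on the faces. -/
def IsElemGrad (T : ConvexPolytope d) (j : ℕ) (g : Fin d → E d → ℝ) (φ : Fin T.numFaces → Poly d)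
    (G : Fin d → Poly d) : Prop :=
  (∀ l, (G l).totalDegree ≤ j) ∧ ∀ l, ∀ r : Poly d, r.totalDegree ≤ j →
    ∫ x in T.carrier, ev (G l) x * ev r x
      = (∫ x in T.carrier, g l x * ev r x)
        + ∑ i, T.normal i l * ∫ x, ev (φ i) x * ev r x ∂(surf (T.face i))

lemma integrable_ev_mul_carrier {f : E d → ℝ} (hf : MemLp f 2 (volume.restrict T.carrier))
    (p : Poly d) : Integrable (fun x => f x * ev p x) (volume.restrict T.carrier) :=
  integrable_mul_of_memLp hf (T.polyMem_carrier p)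

lemma integrable_ev_mul_surf (i : Fin T.numFaces) {f : E d → ℝ}
    (hf : MemLp f 2 (surf (T.face i))) (p : Poly d) :
    Integrable (fun x => f x * ev p x) (surf (T.face i)) :=
  integrable_mul_of_memLp hf (T.polyMem_surf i p)

lemma poly_eq_zero_of_integral {p : Poly d} (h : ∫ x in T.carrier, ev p x * ev p x = 0) : p = 0 := by
  have h1 := ae_eq_zero_of_integral_sq (T.polyMem_carrier p) h
  exact poly_eq_zero_of_ae T.isOpen_carrier T.carrier_nonempty h1

lemma exists_isElemGrad (j : ℕ) {g : Fin d → E d → ℝ}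
    (hg : ∀ l, MemLp (g l) 2 (volume.restrict T.carrier)) (φ : Fin T.numFaces → Poly d) :
    ∃ G, IsElemGrad T j g φ G := by
  have key : ∀ l, ∃ p : Poly d, p.totalDegree ≤ j ∧ ∀ r : Poly d, r.totalDegree ≤ j →
      ∫ x in T.carrier, ev p x * ev r x = (∫ x in T.carrier, g l x * ev r x)
        + ∑ i, T.normal i l * ∫ x, ev (φ i) x * ev r x ∂(surf (T.face i)) := by
    intro l
    let B : PN d j →ₗ[ℝ] PN d j →ₗ[ℝ] ℝ := LinearMap.mk₂ ℝ
      (fun p q => ∫ x in T.carrier, ev p.1 x * ev q.1 x)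
      (fun p p' q => by
        simp only [Submodule.coe_add, ev_add, add_mul]
        exact integral_add (integrable_ev_mul_carrier (T.polyMem_carrier _) _)
          (integrable_ev_mul_carrier (T.polyMem_carrier _) _))
      (fun c p q => by
        simp only [Submodule.coe_smul, ev_smul, mul_assoc, integral_const_mul, smul_eq_mul])
      (fun p q q' => by
        simp only [Submodule.coe_add, ev_add, mul_add]
        exact integral_add (integrable_ev_mul_carrier (T.polyMem_carrier _) _)
          (integrable_ev_mul_carrier (T.polyMem_carrier _) _))
      (fun c p q => by
        simp only [Submodule.coe_smul, ev_smul, mul_left_comm _ c, integral_const_mul,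
          smul_eq_mul])
    let ℓ : PN d j →ₗ[ℝ] ℝ :=
      { toFun := fun r => (∫ x in T.carrier, g l x * ev r.1 x)
          + ∑ i, T.normal i l * ∫ x, ev (φ i) x * ev r.1 x ∂(surf (T.face i))
        map_add' := fun r r' => by
          simp only [Submodule.coe_add, ev_add, mul_add]
          rw [integral_add (integrable_ev_mul_carrier (hg l) _) (integrable_ev_mul_carrier (hg l) _)]
          have : ∀ i, ∫ x, ev (φ i) x * ev r.1 x + ev (φ i) x * ev r'.1 x ∂(surf (T.face i))
              = (∫ x, ev (φ i) x * ev r.1 x ∂(surf (T.face i)))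
                + ∫ x, ev (φ i) x * ev r'.1 x ∂(surf (T.face i)) := fun i =>
            integral_add (integrable_ev_mul_surf i (T.polyMem_surf i _) _)
              (integrable_ev_mul_surf i (T.polyMem_surf i _) _)
          simp only [this, mul_add, Finset.sum_add_distrib]
          ring
        map_smul' := fun c r => by
          simp only [Submodule.coe_smul, ev_smul, mul_left_comm _ c, integral_const_mul,
            smul_eq_mul, RingHom.id_apply, mul_add, Finset.mul_sum] }
    obtain ⟨p, hp⟩ := exists_bilin_eq B
      (fun v w => by
        change ∫ x in T.carrier, _ = ∫ x in T.carrier, _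
        congr 1; ext x; ring) ℓ
      (fun v hv => by
        have : v = 0 := Subtype.ext (poly_eq_zero_of_integral hv)
        rw [this, map_zero])
    exact ⟨p.1, mem_PN.1 p.2, fun r hr => hp ⟨r, mem_PN.2 hr⟩⟩
  choose G hG hG' using key
  exact ⟨G, hG, hG'⟩

lemma IsElemGrad.unique {j : ℕ} {g g' : Fin d → E d → ℝ} {φ φ' : Fin T.numFaces → Poly d}
    {G G' : Fin d → Poly d} (h : IsElemGrad T j g φ G) (h' : IsElemGrad T j g' φ' G')
    (hg : ∀ l, ∀ r : Poly d, r.totalDegree ≤ j →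
      ∫ x in T.carrier, g l x * ev r x = ∫ x in T.carrier, g' l x * ev r x)
    (hφ : ∀ i, ev (φ i) =ᵐ[surf (T.face i)] ev (φ' i)) : G = G' := by
  funext l
  have hd := totalDegree_sub_le (h.1 l) (h'.1 l)
  have h1 := h.2 l (G l - G' l) hd
  have h2 := h'.2 l (G l - G' l) hd
  have h3 : ∀ i, ∫ x, ev (φ i) x * ev (G l - G' l) x ∂(surf (T.face i))
      = ∫ x, ev (φ' i) x * ev (G l - G' l) x ∂(surf (T.face i)) := fun i =>
    integral_congr_ae ((hφ i).mono fun x hx => by simp only [hx])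
  rw [hg l _ hd] at h1
  simp only [h3] at h1
  rw [← h2] at h1
  refine sub_eq_zero.1 (poly_eq_zero_of_integral (T := T) ?_)
  have e : ∀ x, ev (G l - G' l) x * ev (G l - G' l) x
      = ev (G l) x * ev (G l - G' l) x - ev (G' l) x * ev (G l - G' l) x := by
    intro x; rw [← sub_mul, ← ev_sub]
  simp only [e]
  rw [integral_sub (integrable_ev_mul_carrier (T.polyMem_carrier _) _)
    (integrable_ev_mul_carrier (T.polyMem_carrier _) _), h1, sub_self]

lemma IsElemGrad.sub {j : ℕ} {g g' : Fin d → E d → ℝ} {φ φ' ψ : Fin T.numFaces → Poly d}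
    {G G' : Fin d → Poly d} (h : IsElemGrad T j g φ G) (h' : IsElemGrad T j g' φ' G')
    (hg : ∀ l, MemLp (g l) 2 (volume.restrict T.carrier))
    (hg' : ∀ l, MemLp (g' l) 2 (volume.restrict T.carrier))
    (hψ : ∀ i, ev (ψ i) =ᵐ[surf (T.face i)] fun x => ev (φ i) x - ev (φ' i) x) :
    IsElemGrad T j (fun l x => g l x - g' l x) ψ (fun l => G l - G' l) := by
  refine ⟨fun l => totalDegree_sub_le (h.1 l) (h'.1 l), fun l r hr => ?_⟩
  have e : ∀ i, ∫ x, ev (ψ i) x * ev r x ∂(surf (T.face i))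
      = (∫ x, ev (φ i) x * ev r x ∂(surf (T.face i)))
        - ∫ x, ev (φ' i) x * ev r x ∂(surf (T.face i)) := by
    intro i
    rw [← integral_sub (integrable_ev_mul_surf i (T.polyMem_surf i _) _)
      (integrable_ev_mul_surf i (T.polyMem_surf i _) _)]
    exact integral_congr_ae ((hψ i).mono fun x hx => by simp only [hx, sub_mul])
  simp only [e, ev_sub, sub_mul, mul_sub, Finset.sum_sub_distrib]
  rw [integral_sub (integrable_ev_mul_carrier (T.polyMem_carrier _) _)
    (integrable_ev_mul_carrier (T.polyMem_carrier _) _), h.2 l r hr, h'.2 l r hr,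
    integral_sub (integrable_ev_mul_carrier (hg l) _) (integrable_ev_mul_carrier (hg' l) _)]
  ring

/-- Linearity holds only almost everywhere: on a face, the polynomial chosen by `l2Proj` is
arbitrary away from the face. The difference is orthogonal to itself. -/
lemma l2Proj_sub_ae {μ : Measure (E d)} (hμ : PolyMem μ) (m : ℕ) {f g : E d → ℝ}
    (hf : MemLp f 2 μ) (hg : MemLp g 2 μ) :
    ev (l2Proj μ m (fun x => f x - g x)).1
      =ᵐ[μ] fun x => ev (l2Proj μ m f).1 x - ev (l2Proj μ m g).1 x := by
  set p := l2Proj μ m (fun x => f x - g x)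
  set q := l2Proj μ m f
  set r := l2Proj μ m g
  have hd : (p.1 - (q.1 - r.1)).totalDegree ≤ m :=
    totalDegree_sub_le p.2 (totalDegree_sub_le q.2 r.2)
  have h1 := l2Proj_spec hμ m (hf.sub hg) _ hd
  have h2 := l2Proj_spec hμ m hf _ hd
  have h3 := l2Proj_spec hμ m hg _ hd
  have hz : ∫ x, ev (p.1 - (q.1 - r.1)) x * ev (p.1 - (q.1 - r.1)) x ∂μ = 0 := by
    set z := p.1 - (q.1 - r.1) with hzdef
    have e : ∀ x, ev z x * ev z x
        = ev p.1 x * ev z x - (ev q.1 x * ev z x - ev r.1 x * ev z x) := by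
      intro x
      have hzx : ev z x = ev p.1 x - (ev q.1 x - ev r.1 x) := by rw [hzdef, ev_sub, ev_sub]
      rw [← sub_mul, ← sub_mul, ← hzx]
    have i1 := fun s : Poly d => integrable_mul_of_memLp (hμ s) (hμ z)
    have i2 : Integrable (fun x => ev q.1 x * ev z x - ev r.1 x * ev z x) μ := (i1 _).sub (i1 _)
    simp only [e]
    rw [integral_sub (i1 _) i2, integral_sub (i1 _) (i1 _), h2, h3]
    have h4 : ∫ x, ev p.1 x * ev z x ∂μ = ∫ x, (f x - g x) * ev z x ∂μ := h1
    rw [h4]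
    simp only [sub_mul]
    rw [integral_sub (integrable_mul_of_memLp hf (hμ z)) (integrable_mul_of_memLp hg (hμ z)),
      sub_self]
  filter_upwards [ae_eq_zero_of_integral_sq (hμ _) hz] with x hx
  have hx' : ev (p.1 - (q.1 - r.1)) x = 0 := hx
  rw [ev_sub, ev_sub] at hx'
  linarith

lemma abs_normal_le (i : Fin T.numFaces) (l : Fin d) : |T.normal i l| ≤ 1 :=
  (abs_coord_le _ l).trans (T.norm_normal i).le

lemma sum_normal_sq (i : Fin T.numFaces) : ∑ l, T.normal i l * T.normal i l = 1 := by
  have h := EuclideanSpace.norm_sq_eq (T.normal i)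
  rw [T.norm_normal i] at h
  simp only [Real.norm_eq_abs, sq_abs, one_pow] at h
  rw [h]
  exact Finset.sum_congr rfl fun l _ => (sq _).symm

lemma abs_sum_normal_mul_le {N : ℕ} (hN : T.numFaces ≤ N) (l : Fin d) {b : Fin T.numFaces → ℝ}
    {B : ℝ} (hB : 0 ≤ B) (hb : ∀ i, |b i| ≤ B) : |∑ i, T.normal i l * b i| ≤ N * B := by
  refine (Finset.abs_sum_le_sum_abs _ _).trans ?_
  have : ∀ i ∈ Finset.univ, |T.normal i l * b i| ≤ B := fun i _ => by
    rw [abs_mul]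
    calc _ ≤ 1 * B := mul_le_mul (abs_normal_le i l) (hb i) (abs_nonneg _) zero_le_one
      _ = B := one_mul B
  refine (Finset.sum_le_card_nsmul _ _ _ this).trans ?_
  rw [Finset.card_univ, Fintype.card_fin, nsmul_eq_mul]
  exact mul_le_mul_of_nonneg_right (by exact_mod_cast hN) hB

lemma le_of_sq_le_mul {x y : ℝ} (hx : 0 ≤ x) (hy : 0 ≤ y) (h : x ^ 2 ≤ y * x) : x ≤ y := by
  rcases hx.eq_or_lt with h0 | h0
  · rw [← h0]; exact hy
  · exact le_of_mul_le_mul_right (by rwa [← sq]) h0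

/-- The weak gradient controls the jumps and the gradient of the interior part. -/
lemma exists_norm_equiv (d n k : ℕ) (hd : 2 ≤ d) {ρv ρe κ δ : ℝ} (hρv : 0 < ρv) (hρe : 0 < ρe)
    (hκ : 0 < κ) (hδ : 0 < δ) :
    ∃ K : ℝ, 0 < K ∧ ∀ (T : ConvexPolytope d), Regular T n ρv ρe κ δ →
      ∀ (v : Poly d) (φ : Fin T.numFaces → Poly d) (G : Fin d → Poly d),
        v.totalDegree ≤ k + 1 → (∀ i, (φ i).totalDegree ≤ k) →
        IsElemGrad T (n + k) (fun l => ev (MvPolynomial.pderiv l v)) φ G →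
        (∀ i, nrm (surf (T.face i)) (ev (φ i))
          ≤ K * Real.sqrt T.size * ∑ l, nrm (volume.restrict T.carrier) (ev (G l))) ∧
        ∀ l, nrm (volume.restrict T.carrier) (ev (MvPolynomial.pderiv l v))
          ≤ K * ∑ l, nrm (volume.restrict T.carrier) (ev (G l)) := by
  obtain ⟨K₁, hK₁, htest⟩ := exists_face_test d n k hd hρv hρe hκ hδ
  obtain ⟨K₂, hK₂, htr⟩ := exists_poly_trace_le d n k (by omega) hρv ρe κ δ
  refine ⟨K₁ * K₁ + (1 + n * (K₁ * K₁ * K₂)), by positivity, fun T hT v φ G hv hφ hG => ?_⟩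
  have hs := T.size_pos (by omega)
  obtain ⟨μ, hμ⟩ : ∃ μ, μ = (volume : Measure (E d)).restrict T.carrier := ⟨_, rfl⟩
  obtain ⟨N, hN⟩ : ∃ N, N = ∑ l, nrm μ (ev (G l)) := ⟨_, rfl⟩
  rw [← hμ, ← hN]
  simp only [IsElemGrad, ← hμ] at hG
  have htr' : ∀ i, ∀ p : Poly d, p.totalDegree ≤ k →
      Real.sqrt T.size * nrm (surf (T.face i)) (ev p) ≤ K₂ * nrm μ (ev p) :=
    fun i p hp => hμ ▸ htr T hT i p hp
  have hN0 : 0 ≤ N := hN ▸ Finset.sum_nonneg fun l _ => nrm_nonneg _ _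
  have hGN : ∀ l, nrm μ (ev (G l)) ≤ N := fun l => hN ▸
    Finset.single_le_sum (f := fun l => nrm μ (ev (G l))) (fun l _ => nrm_nonneg _ _)
      (Finset.mem_univ l)
  have hdv : ∀ l, (MvPolynomial.pderiv l v).totalDegree ≤ k := fun l =>
    (totalDegree_pderiv_le v l).trans (by omega)
  have hPM : PolyMem μ := hμ ▸ T.polyMem_carrier
  have h1 : ∀ i, nrm (surf (T.face i)) (ev (φ i)) ≤ K₁ * K₁ * Real.sqrt T.size * N := by
    intro i
    obtain ⟨s, hsd, hs0, hsr, hsφ, hsn⟩ := htest T hT i (φ i) (hφ i)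
    rw [← hμ] at hsn
    rw [← hμ] at hsr
    -- The partial derivatives of `v` have degree at most `k`, so `s` is orthogonal to them, and `s`
    -- vanishes on all other faces; a single face term survives. Multiplying by the normal
    -- components and summing recovers it, as the normal has length one.
    have e1 : ∀ l, ∫ x, ev (G l) x * ev s x ∂μ
        = T.normal i l * ∫ x, ev (φ i) x * ev s x ∂(surf (T.face i)) := by
      intro l
      have h2 := hsr _ (hdv l)
      rw [hG.2 l s hsd]
      simp only [mul_comm (ev (MvPolynomial.pderiv l v) _)]
      rw [h2, zero_add, Finset.sum_eq_single i]
      · intro j _ hj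
        rw [integral_eq_zero_of_ae, mul_zero]
        filter_upwards [T.ae_surf_mem j] with x hx
        simp [hs0 j hj x hx]
      · simp
    have e2 : ∫ x, ev (φ i) x * ev s x ∂(surf (T.face i))
        = ∑ l, T.normal i l * ∫ x, ev (G l) x * ev s x ∂μ := by
      simp only [e1, ← mul_assoc]
      rw [← Finset.sum_mul, sum_normal_sq, one_mul]
    have e3 : ∫ x, ev (φ i) x * ev s x ∂(surf (T.face i)) ≤ N * nrm μ (ev s) := by
      rw [e2, hN, Finset.sum_mul]
      refine Finset.sum_le_sum fun l _ => (le_abs_self _).trans ?_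
      rw [abs_mul]
      calc _ ≤ 1 * (nrm μ (ev (G l)) * nrm μ (ev s)) :=
            mul_le_mul (abs_normal_le i l) (abs_integral_mul_le (hPM _) (hPM _)) (abs_nonneg _)
              zero_le_one
        _ = _ := one_mul _
    refine le_of_sq_le_mul (nrm_nonneg _ _) (by positivity) ?_
    calc nrm (surf (T.face i)) (ev (φ i)) ^ 2
        ≤ K₁ * (N * nrm μ (ev s)) := hsφ.trans (mul_le_mul_of_nonneg_left e3 hK₁.le)
      _ ≤ K₁ * (N * (K₁ * (Real.sqrt T.size * nrm (surf (T.face i)) (ev (φ i))))) := by gcongr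
      _ = _ := by ring
  refine ⟨fun i => (h1 i).trans ?_, fun l => ?_⟩
  · have : K₁ * K₁ ≤ K₁ * K₁ + (1 + n * (K₁ * K₁ * K₂)) := by
      have : 0 ≤ 1 + n * (K₁ * K₁ * K₂) := by positivity
      linarith
    gcongr
  -- The weak gradient is now tested with `∂_l v` itself. The factor `√h` in the jump bound is
  -- absorbed by the trace inequality for polynomials.
  · set p := MvPolynomial.pderiv l v with hp
    have h2 := hG.2 l p ((hdv l).trans (by omega))
    have h3 : nrm μ (ev p) ^ 2 ≤ (1 + n * (K₁ * K₁ * K₂)) * N * nrm μ (ev p) := by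
      have h4 : nrm μ (ev p) ^ 2 = ∫ x, ev p x * ev p x ∂μ := by
        rw [nrm_sq (hPM p)]; simp only [sq]
      have h5 : |∫ x, ev (G l) x * ev p x ∂μ| ≤ N * nrm μ (ev p) :=
        (abs_integral_mul_le (hPM _) (hPM _)).trans
          (mul_le_mul_of_nonneg_right (hGN l) (nrm_nonneg _ _))
      have h6 := abs_sum_normal_mul_le hT.numFaces_le l
        (b := fun i => ∫ x, ev (φ i) x * ev p x ∂(surf (T.face i)))
        (B := K₁ * K₁ * K₂ * N * nrm μ (ev p))
        (mul_nonneg (by positivity) (nrm_nonneg _ _)) (fun i => by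
          refine (abs_integral_mul_le (T.polyMem_surf i _) (T.polyMem_surf i _)).trans ?_
          calc _ ≤ (K₁ * K₁ * Real.sqrt T.size * N) * nrm (surf (T.face i)) (ev p) :=
                mul_le_mul_of_nonneg_right (h1 i) (nrm_nonneg _ _)
            _ = K₁ * K₁ * N * (Real.sqrt T.size * nrm (surf (T.face i)) (ev p)) := by ring
            _ ≤ K₁ * K₁ * N * (K₂ * nrm μ (ev p)) :=
                mul_le_mul_of_nonneg_left (htr' i p (hdv l)) (by positivity)
            _ = _ := by ring)
      have h7 := (abs_le.1 h5).2
      have h8 := (abs_le.1 h6).1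
      rw [h4]
      have h9 : (1 + n * (K₁ * K₁ * K₂)) * N * nrm μ (ev p)
          = N * nrm μ (ev p) + n * (K₁ * K₁ * K₂ * N * nrm μ (ev p)) := by ring
      rw [h9]
      linarith
    refine (le_of_sq_le_mul (nrm_nonneg _ _) (by positivity) h3).trans ?_
    have : 1 + n * (K₁ * K₁ * K₂) ≤ K₁ * K₁ + (1 + n * (K₁ * K₁ * K₂)) := by
      have : 0 ≤ K₁ * K₁ := by positivity
      linarith
    gcongr

end ElemGrad

end WG

namespace WG

open ConvexPolytope

/-! ### Consistency error on one element -/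

section Consistency

variable {d : ℕ}

lemma mul_le_mul_of_scaled {s x y a b : ℝ} (hx : 0 ≤ x) (hb : 0 ≤ b) (h1 : s * x ≤ a)
    (h2 : y ≤ s * b) : x * y ≤ a * b :=
  calc x * y ≤ x * (s * b) := mul_le_mul_of_nonneg_left h2 hx
    _ = s * x * b := by ring
    _ ≤ a * b := mul_le_mul_of_nonneg_right h1 hb

/-- The polynomial `Q` approximates `u` together with its first and second derivatives, with the
scaled error `H`. -/
structure IsApprox (T : ConvexPolytope d) (u : E d → ℝ) (D1 : Fin d → E d → ℝ)
    (D2 : Fin d → Fin d → E d → ℝ) (Q : Poly d) (H : ℝ) : Prop where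
  nonneg : 0 ≤ H
  zero : nrm (volume.restrict T.carrier) (fun x => u x - ev Q x) ≤ T.size ^ 2 * H
  one : ∀ m, nrm (volume.restrict T.carrier)
    (fun x => D1 m x - ev (MvPolynomial.pderiv m Q) x) ≤ T.size * H
  two : ∀ l m, nrm (volume.restrict T.carrier)
    (fun x => D2 l m x - ev (MvPolynomial.pderiv l (MvPolynomial.pderiv m Q)) x) ≤ H

lemma exists_trace_approx (d n : ℕ) (hd : 1 ≤ d) {ρv : ℝ} (hρv : 0 < ρv) (ρe κ δ : ℝ) :
    ∃ K : ℝ, 0 < K ∧ ∀ (T : ConvexPolytope d), Regular T n ρv ρe κ δ →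
      ∀ (u : E d → ℝ) (D1 : Fin d → E d → ℝ) (D2 : Fin d → Fin d → E d → ℝ) (Q : Poly d) (H : ℝ)
        (W : Fin T.numFaces → E d → ℝ) (Z : Fin d → Fin T.numFaces → E d → ℝ),
      IsApprox T u D1 D2 Q H → HasTraces T u D1 W →
      (∀ m, HasTraces T (D1 m) (fun l => D2 l m) (Z m)) →
      (∀ i, Real.sqrt T.size * nrm (surf (T.face i)) (fun x => W i x - ev Q x)
        ≤ K * (T.size * (T.size * H))) ∧
      ∀ m i, Real.sqrt T.size * nrm (surf (T.face i))
        (fun x => Z m i x - ev (MvPolynomial.pderiv m Q) x) ≤ K * (T.size * H) := by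
  obtain ⟨K, hK, htr⟩ := exists_hasTraces_le d n hd hρv ρe κ δ
  refine ⟨K * (1 + d), by positivity, fun T hT u D1 D2 Q H W Z hQ hW hZ => ?_⟩
  have hs := T.size_pos hd
  have hH := hQ.nonneg
  refine ⟨fun i => (htr T hT u D1 W hW i Q).trans ?_, fun m i =>
    (htr T hT (D1 m) _ (Z m) (hZ m) i _).trans ?_⟩
  · have h1 := Finset.sum_le_card_nsmul Finset.univ _ _ fun l (_ : l ∈ Finset.univ) => hQ.one l
    rw [Finset.card_univ, Fintype.card_fin, nsmul_eq_mul] at h1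
    have h2 := mul_le_mul_of_nonneg_left h1 hs.le
    rw [mul_assoc]
    refine mul_le_mul_of_nonneg_left ?_ hK.le
    have h3 := hQ.zero
    calc _ ≤ T.size ^ 2 * H + T.size * (d * (T.size * H)) := add_le_add h3 h2
      _ = _ := by ring
  · have h1 := Finset.sum_le_card_nsmul Finset.univ _ _ fun l (_ : l ∈ Finset.univ) => hQ.two l m
    rw [Finset.card_univ, Fintype.card_fin, nsmul_eq_mul] at h1
    have h2 := mul_le_mul_of_nonneg_left h1 hs.le
    rw [mul_assoc]
    refine mul_le_mul_of_nonneg_left ?_ hK.le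
    calc _ ≤ T.size * H + T.size * (d * H) := add_le_add (hQ.one m) h2
      _ = _ := by ring

/-- The weak gradient of the projection approximates the projection of the gradient. -/
lemma exists_weakGradient_proj_le (d n N : ℕ) (hd : 1 ≤ d) {ρv : ℝ} (hρv : 0 < ρv) (ρe κ δ : ℝ) :
    ∃ K : ℝ, 0 < K ∧ ∀ (T : ConvexPolytope d), Regular T n ρv ρe κ δ →
      ∀ (D1 : Fin d → E d → ℝ) (Q : Poly d) (B : ℝ) (φ : Fin T.numFaces → Poly d)
        (G P : Fin d → Poly d), 0 ≤ B →
      (∀ l, MemLp (D1 l) 2 (volume.restrict T.carrier)) →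
      (∀ l, nrm (volume.restrict T.carrier)
        (fun x => D1 l x - ev (MvPolynomial.pderiv l Q) x) ≤ B) →
      (∀ i, nrm (surf (T.face i)) (ev (φ i)) * Real.sqrt T.size ≤ T.size * B) →
      IsElemGrad T N (fun l => ev (MvPolynomial.pderiv l Q)) φ G →
      IsElemGrad T N D1 0 P →
      ∀ l, nrm (volume.restrict T.carrier) (ev (G l - P l)) ≤ K * B := by
  obtain ⟨K, hK, htr⟩ := exists_poly_trace_le d n N hd hρv ρe κ δ
  refine ⟨1 + n * K, by positivity, fun T hT D1 Q B φ G P hB hD hQ hφ hG hP l => ?_⟩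
  have hs := T.size_pos hd
  have hsq : 0 < Real.sqrt T.size := Real.sqrt_pos.2 hs
  obtain ⟨μ, hμ⟩ : ∃ μ, μ = (volume : Measure (E d)).restrict T.carrier := ⟨_, rfl⟩
  have hPM : PolyMem μ := hμ ▸ T.polyMem_carrier
  rw [← hμ] at hD
  have hr : (G l - P l).totalDegree ≤ N := totalDegree_sub_le (hG.1 l) (hP.1 l)
  have h1 := hG.2 l _ hr
  have h2 := hP.2 l _ hr
  have h3 := hQ l
  have h4 : ∀ i, Real.sqrt T.size * nrm (surf (T.face i)) (ev (G l - P l))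
      ≤ K * nrm μ (ev (G l - P l)) := fun i => hμ ▸ htr T hT i _ hr
  rw [← hμ] at h1 h2 h3 ⊢
  obtain ⟨r, hrdef⟩ : ∃ r, r = G l - P l := ⟨_, rfl⟩
  rw [← hrdef] at h1 h2 h4 ⊢
  have hφ' : ∀ i, nrm (surf (T.face i)) (ev (φ i)) ≤ Real.sqrt T.size * B := fun i => by
    refine le_of_mul_le_mul_right ((hφ i).trans (le_of_eq ?_)) hsq
    rw [mul_right_comm, Real.mul_self_sqrt hs.le]
  -- The difference `r = G l - P l` is itself an admissible test polynomial, which leaves the error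
  -- of `∇Q` and the projected jumps.
  have e : nrm μ (ev r) ^ 2 = (∫ x, (ev (MvPolynomial.pderiv l Q) x - D1 l x) * ev r x ∂μ)
      + ∑ i, T.normal i l * ∫ x, ev (φ i) x * ev r x ∂(surf (T.face i)) := by
    have e1 : ∀ x, ev r x ^ 2 = ev (G l) x * ev r x - ev (P l) x * ev r x := by
      intro x; rw [← sub_mul, ← ev_sub, ← hrdef, sq]
    rw [nrm_sq (hPM r)]
    simp only [e1, sub_mul]
    rw [integral_sub (integrable_mul_of_memLp (hPM _) (hPM _))
      (integrable_mul_of_memLp (hPM _) (hPM _)), h1, h2,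
      integral_sub (integrable_mul_of_memLp (hPM _) (hPM _))
      (integrable_mul_of_memLp (hD l) (hPM _))]
    simp
    ring
  have h5 : |∫ x, (ev (MvPolynomial.pderiv l Q) x - D1 l x) * ev r x ∂μ| ≤ B * nrm μ (ev r) := by
    refine (abs_integral_mul_le ((hPM _).sub (hD l)) (hPM r)).trans ?_
    rw [nrm_sub_comm] at h3
    exact mul_le_mul_of_nonneg_right h3 (nrm_nonneg _ _)
  have h6 := abs_sum_normal_mul_le hT.numFaces_le l
    (b := fun i => ∫ x, ev (φ i) x * ev r x ∂(surf (T.face i)))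
    (B := K * nrm μ (ev r) * B) (mul_nonneg (mul_nonneg hK.le (nrm_nonneg _ _)) hB)
    (fun i => by
      refine (abs_integral_mul_le (T.polyMem_surf i _) (T.polyMem_surf i _)).trans ?_
      rw [mul_comm]
      exact mul_le_mul_of_scaled (nrm_nonneg _ _) hB (h4 i) (hφ' i))
  refine le_of_sq_le_mul (nrm_nonneg _ _) (by positivity) ?_
  rw [e]
  have h7 := (abs_le.1 h5).2
  have h8 := (abs_le.1 h6).2
  calc _ ≤ B * nrm μ (ev r) + n * (K * nrm μ (ev r) * B) := add_le_add h7 h8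
    _ = _ := by ring

lemma abs_integral_flux_mul_le {T : ConvexPolytope d} {A : Matrix (Fin d) (Fin d) ℝ} {lam : ℝ}
    (hA : ∀ l m, |A l m| ≤ lam) {Z : Fin d → Fin T.numFaces → E d → ℝ} {i : Fin T.numFaces}
    (hZ : ∀ m, MemLp (Z m i) 2 (surf (T.face i))) {v : E d → ℝ}
    (hv : MemLp v 2 (surf (T.face i))) {B : ℝ}
    (h : ∀ m, nrm (surf (T.face i)) (Z m i) * nrm (surf (T.face i)) v ≤ B) :
    |∫ x, flux T A Z i x * v x ∂(surf (T.face i))| ≤ d * (d * (lam * B)) := by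
  rw [integral_flux_mul A hZ hv]
  have h1 : ∀ l m, |A l m * (T.normal i l * ∫ x, Z m i x * v x ∂(surf (T.face i)))| ≤ lam * B := by
    intro l m
    rw [abs_mul, abs_mul]
    refine mul_le_mul (hA l m) ?_ (by positivity) ((abs_nonneg _).trans (hA l m))
    calc _ ≤ 1 * B := mul_le_mul (abs_normal_le i l) ((abs_integral_mul_le (hZ m) hv).trans (h m))
          (abs_nonneg _) zero_le_one
      _ = B := one_mul B
  refine (Finset.abs_sum_le_sum_abs _ _).trans ?_
  have h2 : ∀ l ∈ Finset.univ, |∑ m, A l m * (T.normal i l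
      * ∫ x, Z m i x * v x ∂(surf (T.face i)))| ≤ d * (lam * B) := fun l _ => by
    refine (Finset.abs_sum_le_sum_abs _ _).trans ?_
    have := Finset.sum_le_card_nsmul Finset.univ _ _ fun m (_ : m ∈ Finset.univ) => h1 l m
    rwa [Finset.card_univ, Fintype.card_fin, nsmul_eq_mul] at this
  have := Finset.sum_le_card_nsmul Finset.univ _ _ h2
  rwa [Finset.card_univ, Fintype.card_fin, nsmul_eq_mul] at this

lemma flux_sub (T : ConvexPolytope d) (A : Matrix (Fin d) (Fin d) ℝ)
    (Z Z' : Fin d → Fin T.numFaces → E d → ℝ) (i : Fin T.numFaces) (x : E d) :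
    flux T A (fun m i x => Z m i x - Z' m i x) i x = flux T A Z i x - flux T A Z' i x := by
  simp only [flux, mul_sub, Finset.sum_sub_distrib]

/-- The jump of a discrete function is controlled by its weak gradient. -/
lemma exists_jump_le (d n k : ℕ) (hd : 2 ≤ d) {ρv ρe κ δ : ℝ} (hρv : 0 < ρv) (hρe : 0 < ρe)
    (hκ : 0 < κ) (hδ : 0 < δ) :
    ∃ K : ℝ, 0 < K ∧ ∀ (T : ConvexPolytope d), Regular T n ρv ρe κ δ →
      ∀ (v : Poly d) (b : Fin T.numFaces → Poly d) (G : Fin d → Poly d),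
        v.totalDegree ≤ k + 1 → (∀ i, (b i).totalDegree ≤ k) →
        IsElemGrad T (n + k) (fun l => ev (MvPolynomial.pderiv l v))
          (fun i => (l2Proj (surf (T.face i)) k (fun y => ev (b i) y - ev v y)).1) G →
        ∀ i, nrm (surf (T.face i))
            (ev (l2Proj (surf (T.face i)) k (fun y => ev (b i) y - ev v y)).1)
              ≤ Real.sqrt T.size * (K * ∑ l, nrm (volume.restrict T.carrier) (ev (G l))) ∧
          nrm (surf (T.face i)) (fun y => ev (b i) y - ev v y)
            ≤ Real.sqrt T.size * (K * ∑ l, nrm (volume.restrict T.carrier) (ev (G l))) := by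
  obtain ⟨K₁, hK₁, heq⟩ := exists_norm_equiv d n k hd hρv hρe hκ hδ
  obtain ⟨K₂, hK₂, htr⟩ := exists_poly_trace_le d n (k + 1) (by omega) hρv ρe κ δ
  refine ⟨K₁ + K₂ * (2 ^ d * (d * K₁)), by positivity, fun T hT v b G hv hb hG i => ?_⟩
  have hs := T.size_pos (by omega)
  have hsq : 0 < Real.sqrt T.size := Real.sqrt_pos.2 hs
  obtain ⟨h1, h2⟩ := heq T hT v _ G hv (fun i => (l2Proj _ _ _).2) hG
  obtain ⟨N, hN⟩ : ∃ N, N = ∑ l, nrm (volume.restrict T.carrier) (ev (G l)) := ⟨_, rfl⟩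
  have hN0 : 0 ≤ N := hN ▸ Finset.sum_nonneg fun l _ => nrm_nonneg _ _
  rw [← hN] at h1 h2 ⊢
  have h1i : nrm (surf (T.face i)) (ev (l2Proj (surf (T.face i)) k
      (fun y => ev (b i) y - ev v y)).1) ≤ Real.sqrt T.size * (K₁ * N) :=
    (h1 i).trans (le_of_eq (by ring))
  have hPM := T.polyMem_surf i
  -- With `c` the mean of `v`, the competitor `b - c` in the best approximation of `b - v` leaves
  -- the residual `-(v - c)`. Its trace is bounded by the Poincaré inequality and the bound for
  -- `∇v`.
  obtain ⟨c, hc⟩ : ∃ c : ℝ, c = (volume T.carrier).toReal⁻¹ * ∫ x in T.carrier, ev v x := ⟨_, rfl⟩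
  set w : Poly d := v - MvPolynomial.C c with hw
  have hwd : w.totalDegree ≤ k + 1 := totalDegree_sub_le hv (by simp)
  have hw0 : ∫ x in T.carrier, ev w x = 0 := by
    have hV := carrier_volume_pos T
    simp only [hw, ev_sub, ev_C]
    rw [integral_sub ((T.polyMem_carrier v).integrable (by norm_num)) (integrable_const _)]
    simp only [integral_const, smul_eq_mul, Measure.real, Measure.restrict_apply_univ]
    rw [hc, mul_inv_cancel_left₀ hV.ne', sub_self]
  have hp := nrm_le_of_integral_eq_zero T ((contDiff_ev w).of_le (by simp)) hw0
  have hpd : ∀ l, pd l (ev w) = ev (MvPolynomial.pderiv l v) := by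
    intro l; rw [pd_ev, hw, map_sub, MvPolynomial.pderiv_C, sub_zero]
  simp only [hpd] at hp
  have h3 := Finset.sum_le_card_nsmul Finset.univ _ _ fun l (_ : l ∈ Finset.univ) => h2 l
  rw [Finset.card_univ, Fintype.card_fin, nsmul_eq_mul] at h3
  have h4 := htr T hT i w hwd
  have h5 : nrm (surf (T.face i)) (ev w) ≤ Real.sqrt T.size * (K₂ * (2 ^ d * (d * K₁)) * N) := by
    refine le_of_mul_le_mul_left (h4.trans ?_) hsq
    calc _ ≤ K₂ * (2 ^ d * T.size * (d * (K₁ * N))) :=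
          mul_le_mul_of_nonneg_left (hp.trans (mul_le_mul_of_nonneg_left h3 (by positivity))) hK₂.le
      _ = T.size * (K₂ * (2 ^ d * (d * K₁)) * N) := by ring
      _ = _ := by rw [← mul_assoc (Real.sqrt T.size), Real.mul_self_sqrt hs.le]
  have hf : MemLp (fun y => ev (b i) y - ev v y) 2 (surf (T.face i)) := (hPM _).sub (hPM _)
  have h6 := nrm_sub_l2Proj_le hPM k hf (b i - MvPolynomial.C c)
    (totalDegree_sub_le (hb i) (by simp))
  have h7 : nrm (surf (T.face i))
      (fun x => ev (b i) x - ev v x - ev (b i - MvPolynomial.C c) x)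
      = nrm (surf (T.face i)) (ev w) := by
    rw [← nrm_neg (ev w)]
    congr 1
    funext x
    simp only [hw, ev_sub, ev_C]
    ring
  rw [h7] at h6
  have h8 := nrm_le_add_sub hf (hPM (l2Proj (surf (T.face i)) k (fun y => ev (b i) y - ev v y)).1)
  have h9 : Real.sqrt T.size * ((K₁ + K₂ * (2 ^ d * (d * K₁))) * N)
      = Real.sqrt T.size * (K₂ * (2 ^ d * (d * K₁)) * N) + Real.sqrt T.size * (K₁ * N) := by ring
  have h10 : 0 ≤ Real.sqrt T.size * (K₂ * (2 ^ d * (d * K₁)) * N) := by positivity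
  rw [h9]
  exact ⟨by linarith, by linarith⟩

/-- The part of the error functional which belongs to the faces of one element. -/
lemma exists_face_error_le (d n k : ℕ) (hd : 2 ≤ d) {ρv ρe κ δ : ℝ} (hρv : 0 < ρv) (hρe : 0 < ρe)
    (hκ : 0 < κ) (hδ : 0 < δ) :
    ∃ K : ℝ, 0 < K ∧ ∀ (T : ConvexPolytope d), Regular T n ρv ρe κ δ →
      ∀ (u : E d → ℝ) (D1 : Fin d → E d → ℝ) (D2 : Fin d → Fin d → E d → ℝ) (Q : Poly d) (H : ℝ)
        (W : Fin T.numFaces → E d → ℝ) (Z : Fin d → Fin T.numFaces → E d → ℝ)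
        (A : Matrix (Fin d) (Fin d) ℝ) (lam : ℝ) (P : Fin d → Poly d)
        (v : Poly d) (b : Fin T.numFaces → Poly d) (G : Fin d → Poly d),
        IsApprox T u D1 D2 Q H → HasTraces T u D1 W →
        (∀ m, HasTraces T (D1 m) (fun l => D2 l m) (Z m)) → Q.totalDegree ≤ k + 1 →
        (∀ l m, |A l m| ≤ lam) → IsElemGrad T (n + k) D1 0 P →
        v.totalDegree ≤ k + 1 → (∀ i, (b i).totalDegree ≤ k) →
        IsElemGrad T (n + k) (fun l => ev (MvPolynomial.pderiv l v))
          (fun i => (l2Proj (surf (T.face i)) k (fun y => ev (b i) y - ev v y)).1) G →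
        ∀ i, |(∫ x, flux T A (fun m _ => ev (P m)) i x
              * ev (l2Proj (surf (T.face i)) k (fun y => ev (b i) y - ev v y)).1 x
                ∂(surf (T.face i)))
            - ∫ x, flux T A Z i x * (ev (b i) x - ev v x) ∂(surf (T.face i))|
          ≤ K * lam * (T.size * H) * ∑ l, nrm (volume.restrict T.carrier) (ev (G l)) := by
  obtain ⟨K₁, hK₁, hjump⟩ := exists_jump_le d n k hd hρv hρe hκ hδ
  obtain ⟨K₂, hK₂, htra⟩ := exists_trace_approx d n (by omega) hρv ρe κ δ
  obtain ⟨K₃, hK₃, htr⟩ := exists_poly_trace_le d n (n + k) (by omega) hρv ρe κ δ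
  have hdR : (0 : ℝ) < d := by exact_mod_cast (by omega : 0 < d)
  refine ⟨d * (d * ((K₃ + K₂) * K₁)), by positivity, ?_⟩
  intro T hT u D1 D2 Q H W Z A lam P v b G hQ hW hZ hQd hA hP hv hb hG i
  have hs := T.size_pos (by omega)
  have hH := hQ.nonneg
  obtain ⟨N, hN⟩ : ∃ N, N = ∑ l, nrm (volume.restrict T.carrier) (ev (G l)) := ⟨_, rfl⟩
  have hN0 : 0 ≤ N := hN ▸ Finset.sum_nonneg fun l _ => nrm_nonneg _ _
  obtain ⟨hj1, hj2⟩ := hjump T hT v b G hv hb hG i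
  obtain ⟨-, htZ⟩ := htra T hT u D1 D2 Q H W Z hQ hW hZ
  rw [← hN] at hj1 hj2 ⊢
  have hPM := T.polyMem_surf i
  have hlam : 0 ≤ lam := (abs_nonneg _).trans (hA ⟨0, by omega⟩ ⟨0, by omega⟩)
  have hf : MemLp (fun y => ev (b i) y - ev v y) 2 (surf (T.face i)) := (hPM _).sub (hPM _)
  set φ := (l2Proj (surf (T.face i)) k (fun y => ev (b i) y - ev v y)).1 with hφ
  have hdq : ∀ m, (MvPolynomial.pderiv m Q).totalDegree ≤ k := fun m =>
    (totalDegree_pderiv_le Q m).trans (by omega)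
  set q : Fin d → Fin T.numFaces → E d → ℝ := fun m _ => ev (MvPolynomial.pderiv m Q) with hq
  have hqm : ∀ m, MemLp (q m i) 2 (surf (T.face i)) := fun m => hPM _
  -- The flux of `∇Q` has degree at most `k`, so it does not distinguish the jump from its
  -- projection. It can be subtracted from both terms, leaving only approximation errors.
  have hswap : ∫ x, flux T A q i x * ev φ x ∂(surf (T.face i))
      = ∫ x, flux T A q i x * (ev (b i) x - ev v x) ∂(surf (T.face i)) := by
    rw [integral_flux_mul A hqm (hPM φ), integral_flux_mul A hqm hf]
    refine Finset.sum_congr rfl fun l _ => Finset.sum_congr rfl fun m _ => ?_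
    have := l2Proj_spec hPM k hf _ (hdq m)
    simp only [hq, mul_comm (ev (MvPolynomial.pderiv m Q) _)]
    rw [this]
  have hPm : ∀ m, MemLp (ev (P m)) 2 (surf (T.face i)) := fun m => hPM _
  have e1 : (∫ x, flux T A (fun m _ => ev (P m)) i x * ev φ x ∂(surf (T.face i)))
      - ∫ x, flux T A q i x * ev φ x ∂(surf (T.face i))
      = ∫ x, flux T A (fun m j x => ev (P m) x - q m j x) i x * ev φ x ∂(surf (T.face i)) := by
    simp only [flux_sub T A (fun m _ => ev (P m)) q, sub_mul]
    rw [integral_sub (integrable_mul_of_memLp (memLp_flux A hPm) (hPM φ))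
      (integrable_mul_of_memLp (memLp_flux A hqm) (hPM φ))]
  have hZm : ∀ m, MemLp (Z m i) 2 (surf (T.face i)) := fun m => (hZ m).memLp_trace i
  have e2 : (∫ x, flux T A Z i x * (ev (b i) x - ev v x) ∂(surf (T.face i)))
      - ∫ x, flux T A q i x * (ev (b i) x - ev v x) ∂(surf (T.face i))
      = ∫ x, flux T A (fun m j x => Z m j x - q m j x) i x * (ev (b i) x - ev v x)
          ∂(surf (T.face i)) := by
    simp only [flux_sub T A Z q]
    rw [← integral_sub (integrable_mul_of_memLp (memLp_flux A hZm) hf)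
      (integrable_mul_of_memLp (memLp_flux A hqm) hf)]
    simp only [sub_mul]
  have hPq : ∀ m, Real.sqrt T.size * nrm (surf (T.face i))
      (fun x => ev (P m) x - ev (MvPolynomial.pderiv m Q) x) ≤ K₃ * (T.size * H) := by
    intro m
    have hdeg : (P m - MvPolynomial.pderiv m Q).totalDegree ≤ n + k :=
      totalDegree_sub_le (hP.1 m) ((hdq m).trans (by omega))
    have h1 := htr T hT i _ hdeg
    -- `P m` is the projection of `D1 m` and `∂_m Q` is left fixed by it, so the projection can only
    -- decrease the error.
    have h2 : nrm (volume.restrict T.carrier) (ev (P m - MvPolynomial.pderiv m Q))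
        ≤ T.size * H := by
      refine le_trans ?_ (hQ.one m)
      have hD := (hZ m).memLp
      have hPM' := T.polyMem_carrier
      have h3 := hP.2 m _ hdeg
      simp only [Pi.zero_apply, ev_zero, zero_mul, integral_zero, mul_zero, Finset.sum_const_zero,
        add_zero] at h3
      refine le_of_sq_le_mul (nrm_nonneg _ _) (nrm_nonneg _ _) ?_
      have h4 := (le_abs_self _).trans (abs_integral_mul_le (hD.sub (hPM' (MvPolynomial.pderiv m Q)))
        (hPM' (P m - MvPolynomial.pderiv m Q)))
      refine le_trans (le_of_eq ?_) h4
      have e3 : ∀ x, ev (P m - MvPolynomial.pderiv m Q) x ^ 2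
          = ev (P m) x * ev (P m - MvPolynomial.pderiv m Q) x
            - ev (MvPolynomial.pderiv m Q) x * ev (P m - MvPolynomial.pderiv m Q) x := by
        intro x; rw [← sub_mul, ← ev_sub, sq]
      rw [nrm_sq (hPM' _)]
      simp only [e3, Pi.sub_apply, sub_mul]
      rw [integral_sub (integrable_mul_of_memLp (hPM' _) (hPM' _))
        (integrable_mul_of_memLp (hPM' _) (hPM' _)), h3,
        integral_sub (integrable_mul_of_memLp hD (hPM' _))
        (integrable_mul_of_memLp (hPM' _) (hPM' _))]
    refine le_trans ?_ (h1.trans (mul_le_mul_of_nonneg_left h2 hK₃.le))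
    refine le_of_eq ?_
    congr 2
    funext x
    rw [ev_sub]
  have b1 := abs_integral_flux_mul_le hA (T := T) (i := i)
    (Z := fun m j x => ev (P m) x - q m j x) (fun m => (hPm m).sub (hqm m)) (hPM φ)
    (B := K₃ * (T.size * H) * (K₁ * N))
    (fun m => mul_le_mul_of_scaled (nrm_nonneg _ _) (by positivity) (hPq m) hj1)
  have b2 := abs_integral_flux_mul_le hA (T := T) (i := i)
    (Z := fun m j x => Z m j x - q m j x) (fun m => (hZm m).sub (hqm m)) hf
    (B := K₂ * (T.size * H) * (K₁ * N))
    (fun m => mul_le_mul_of_scaled (nrm_nonneg _ _) (by positivity) (htZ m i) hj2)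
  have e4 : (∫ x, flux T A (fun m _ => ev (P m)) i x * ev φ x ∂(surf (T.face i)))
      - ∫ x, flux T A Z i x * (ev (b i) x - ev v x) ∂(surf (T.face i))
      = (∫ x, flux T A (fun m j x => ev (P m) x - q m j x) i x * ev φ x ∂(surf (T.face i)))
        - ∫ x, flux T A (fun m j x => Z m j x - q m j x) i x * (ev (b i) x - ev v x)
          ∂(surf (T.face i)) := by
    rw [← e1, ← e2, hswap]
    ring
  rw [e4]
  refine (abs_sub _ _).trans ((add_le_add b1 b2).trans (le_of_eq ?_))
  ring

end Consistency

end WG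

namespace WG

open ConvexPolytope

/-! ### Weak gradients of weak functions -/

section WeakGradient

variable {d : ℕ} {Ω : Set (E d)} {M : Mesh d Ω}

lemma integral_dotProduct {μ : Measure (E d)} {g h : E d → Fin d → ℝ}
    (hg : ∀ l, MemLp (fun x => g x l) 2 μ) (hh : ∀ l, MemLp (fun x => h x l) 2 μ) :
    ∫ x, g x ⬝ᵥ h x ∂μ = ∑ l, ∫ x, g x l * h x l ∂μ := by
  simp only [dotProduct]
  exact integral_finsetSum _ fun l _ => integrable_mul_of_memLp (hg l) (hh l)

/-- The data entering the weak gradient are square integrable. -/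
structure IsAdmissible (v : M.WeakFn) : Prop where
  grad : ∀ t l, MemLp (fun x => v.gradInt t x l) 2 (volume.restrict (M.elem t).carrier)
  jump : ∀ t i, MemLp (fun y => v.bdry (M.faceOf t i) y - v.traceInt t i y) 2
    (surf ((M.elem t).face i))

/-- The projected jumps of a weak function on the faces of an element. -/
noncomputable def jumpProj (m : ℕ) (v : M.WeakFn) (t : Fin M.numElem)
    (i : Fin (M.elem t).numFaces) : Poly d :=
  (l2Proj (surf ((M.elem t).face i)) m (fun y => v.bdry (M.faceOf t i) y - v.traceInt t i y)).1

/-- Vector test fields decouple into components: fields with one nonzero component give one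
direction, summation the other. -/
lemma isWeakGradient_iff {v : M.WeakFn} (hv : IsAdmissible v) (k j : ℕ) (t : Fin M.numElem)
    (G : Fin d → Poly d) :
    M.IsWeakGradient k j v t G ↔
      IsElemGrad (M.elem t) j (fun l x => v.gradInt t x l) (jumpProj (k - 1) v t) G := by
  have hPC := (M.elem t).polyMem_carrier
  have e1 : ∀ q : Fin d → Poly d, ∫ x in (M.elem t).carrier, evVec G x ⬝ᵥ evVec q x
      = ∑ l, ∫ x in (M.elem t).carrier, ev (G l) x * ev (q l) x := fun q =>
    integral_dotProduct (fun l => hPC (G l)) (fun l => hPC (q l))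
  have e2 : ∀ q : Fin d → Poly d, ∫ x in (M.elem t).carrier, v.gradInt t x ⬝ᵥ evVec q x
      = ∑ l, ∫ x in (M.elem t).carrier, v.gradInt t x l * ev (q l) x := fun q =>
    integral_dotProduct (hv.grad t) (fun l => hPC (q l))
  have e3 : ∀ (q : Fin d → Poly d) (i : Fin (M.elem t).numFaces),
      ∫ x, ev (jumpProj (k - 1) v t i) x * (evVec q x ⬝ᵥ fun l => (M.elem t).normal i l)
          ∂(surf ((M.elem t).face i))
      = ∑ l, (M.elem t).normal i l * ∫ x, ev (jumpProj (k - 1) v t i) x * ev (q l) x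
          ∂(surf ((M.elem t).face i)) := by
    intro q i
    have hPS := (M.elem t).polyMem_surf i
    simp only [dotProduct, Finset.mul_sum, evVec]
    rw [integral_finsetSum _ fun l _ => ?_]
    · refine Finset.sum_congr rfl fun l _ => ?_
      rw [← integral_const_mul]
      congr 1
      funext x
      ring
    · have h := (integrable_mul_of_memLp (hPS (jumpProj (k - 1) v t i)) (hPS (q l))).const_mul
        ((M.elem t).normal i l)
      refine h.congr (Filter.Eventually.of_forall fun x => ?_)
      simp only
      ring
  have e4 : ∀ q : Fin d → Poly d,
      (∑ l, ∫ x in (M.elem t).carrier, v.gradInt t x l * ev (q l) x)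
        + ∑ i, ∫ x, ev (jumpProj (k - 1) v t i) x * (evVec q x ⬝ᵥ fun l => (M.elem t).normal i l)
          ∂(surf ((M.elem t).face i))
      = ∑ l, ((∫ x in (M.elem t).carrier, v.gradInt t x l * ev (q l) x)
        + ∑ i, (M.elem t).normal i l * ∫ x, ev (jumpProj (k - 1) v t i) x * ev (q l) x
          ∂(surf ((M.elem t).face i))) := by
    intro q
    simp only [e3]
    rw [Finset.sum_comm, Finset.sum_add_distrib]
  unfold Mesh.IsWeakGradient
  constructor
  · rintro ⟨hd, h⟩
    refine ⟨hd, fun l r hr => ?_⟩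
    have h1 := h (Pi.single l r) (fun l' => by
      by_cases hl : l' = l
      · subst hl; simpa using hr
      · simp [hl])
    rw [e1, e2] at h1
    have h2 := h1.trans (e4 _)
    rw [Finset.sum_eq_single l, Finset.sum_eq_single l] at h2
    · simpa using h2
    · intro l' _ hl; simp [hl]
    · simp
    · intro l' _ hl; simp [hl]
    · simp
  · rintro ⟨hd, h⟩
    refine ⟨hd, fun q hq => ?_⟩
    rw [e1, e2]
    refine Eq.trans ?_ (e4 q).symm
    exact Finset.sum_congr rfl fun l _ => h l _ (hq l)

/-- Solvability of the componentwise problem justifies the choice in the definition of the weak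
gradient. -/
lemma isElemGrad_weakGradient {v : M.WeakFn} (hv : IsAdmissible v) (k j : ℕ)
    (t : Fin M.numElem) :
    IsElemGrad (M.elem t) j (fun l x => v.gradInt t x l) (jumpProj (k - 1) v t)
      (M.weakGradient k j v t) := by
  rw [← isWeakGradient_iff hv]
  obtain ⟨G, hG⟩ := exists_isElemGrad j (hv.grad t) (jumpProj (k - 1) v t)
  exact Classical.epsilon_spec (p := fun G => M.IsWeakGradient k j v t G)
    ⟨G, (isWeakGradient_iff hv k j t G).2 hG⟩

lemma IsAdmissible.sub {v w : M.WeakFn} (hv : IsAdmissible v) (hw : IsAdmissible w) :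
    IsAdmissible (v - w) := by
  refine ⟨fun t l => (hv.grad t l).sub (hw.grad t l), fun t i => ?_⟩
  refine ((hv.jump t i).sub (hw.jump t i)).ae_eq (Filter.Eventually.of_forall fun x => ?_)
  change _ - _ - (_ - _) = v.bdry _ x - w.bdry _ x - (v.traceInt t i x - w.traceInt t i x)
  ring

/-- The projected jumps are linear only almost everywhere, yet the polynomials agree exactly,
because a weak gradient is unique on the open element. -/
lemma weakGradient_sub {v w : M.WeakFn} (hv : IsAdmissible v) (hw : IsAdmissible w) (k j : ℕ)
    (t : Fin M.numElem) :
    M.weakGradient k j (v - w) t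
      = fun l => M.weakGradient k j v t l - M.weakGradient k j w t l := by
  refine (isElemGrad_weakGradient (hv.sub hw) k j t).unique
    ((isElemGrad_weakGradient hv k j t).sub (ψ := jumpProj (k - 1) (v - w) t)
      (isElemGrad_weakGradient hw k j t) (hv.grad t)
      (hw.grad t) fun i => ?_) (fun l r _ => rfl) fun i => Filter.EventuallyEq.rfl
  have h := l2Proj_sub_ae ((M.elem t).polyMem_surf i) (k - 1) (hv.jump t i) (hw.jump t i)
  have e : jumpProj (k - 1) (v - w) t i = (l2Proj (surf ((M.elem t).face i)) (k - 1)
      (fun x => v.bdry (M.faceOf t i) x - v.traceInt t i x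
        - (w.bdry (M.faceOf t i) x - w.traceInt t i x))).1 := by
    unfold jumpProj
    congr 2
    funext x
    change v.bdry _ x - w.bdry _ x - (v.traceInt t i x - w.traceInt t i x) = _
    ring
  rw [e]
  exact h

lemma isAdmissible_toWeakFn {k : ℕ} (v : M.Vh k) : IsAdmissible v.toWeakFn :=
  ⟨fun t _ => (M.elem t).polyMem_carrier _,
    fun t i => ((M.elem t).polyMem_surf i _).sub ((M.elem t).polyMem_surf i _)⟩

/-- The difference of two discrete functions. -/
noncomputable def Vh.diff {k : ℕ} (v w : M.Vh k) : M.Vh k where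
  int t := v.int t - w.int t
  bdry e := v.bdry e - w.bdry e
  int_degree t := totalDegree_sub_le (v.int_degree t) (w.int_degree t)
  bdry_degree e := totalDegree_sub_le (v.bdry_degree e) (w.bdry_degree e)

lemma toWeakFn_diff {k : ℕ} (v w : M.Vh k) :
    (Vh.diff v w).toWeakFn = v.toWeakFn - w.toWeakFn := by
  change Mesh.WeakFn.mk _ _ _ = Mesh.WeakFn.mk _ _ _
  congr 1
  · funext t x l
    simp [Vh.diff, Mesh.Vh.toWeakFn]
  · funext t i x
    simp [Vh.diff, Mesh.Vh.toWeakFn]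
  · funext e x
    simp [Vh.diff, Mesh.Vh.toWeakFn]

variable {k : ℕ} {u : E d → ℝ}

lemma isAdmissible_ofSobolev (hu : MemSobolev Ω (k + 1) u) : IsAdmissible (M.ofSobolev u) := by
  refine ⟨fun t l => ?_, fun t i => ?_⟩
  · simp only [Mesh.ofSobolev, grad_eq_wD]
    exact memLp_wD_elem M hu t (by simp)
  · simp only [Mesh.ofSobolev, sub_self]
    exact MemLp.zero'

/-- The weak gradient of a Sobolev function is the projection of its gradient. -/
lemma isElemGrad_ofSobolev (hu : MemSobolev Ω (k + 1) u) (k' j : ℕ) (t : Fin M.numElem) :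
    IsElemGrad (M.elem t) j (fun l => wD Ω u [l]) 0 (M.weakGradient k' j (M.ofSobolev u) t) := by
  obtain ⟨h1, h2⟩ := isElemGrad_weakGradient (isAdmissible_ofSobolev (M := M) hu) k' j t
  refine ⟨h1, fun l r hr => (h2 l r hr).trans ?_⟩
  congr 1
  · simp only [Mesh.ofSobolev, grad_eq_wD]
  · refine Finset.sum_congr rfl fun i _ => ?_
    congr 1
    refine integral_congr_ae ?_
    have hPS := (M.elem t).polyMem_surf i
    have e : ev (jumpProj (k' - 1) (M.ofSobolev u) t i) =ᵐ[surf ((M.elem t).face i)] fun _ => 0 := by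
      have h := l2Proj_sub_ae hPS (k' - 1) (MemLp.zero' (ε := ℝ) (p := 2)) (MemLp.zero' (ε := ℝ) (p := 2))
      have e : jumpProj (k' - 1) (M.ofSobolev u) t i
          = (l2Proj (surf ((M.elem t).face i)) (k' - 1) (fun _ => (0 : ℝ) - 0)).1 := by
        unfold jumpProj
        congr 2
        funext x
        simp [Mesh.ofSobolev]
      rw [e]
      refine h.trans (Filter.Eventually.of_forall fun x => sub_self _)
    filter_upwards [e] with x hx
    rw [hx]
    simp

end WeakGradient

end WG

namespace WG

open ConvexPolytope

/-! ### The error on one element of a partition -/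

section LocalError

variable {d : ℕ} {Ω : Set (E d)} {M : Mesh d Ω} {k : ℕ} {u : E d → ℝ}

/-- Since `Q_b` is a projection, `Q_b (Q_b u - Q_0 u) = Q_b (u - Q_0 u)`, and projections do not
increase the norm. -/
lemma nrm_jumpProj_Qh_le (hd : 1 ≤ d) (hu : MemSobolev Ω (k + 1 + 1) u) (t : Fin M.numElem)
    {W : Fin (M.elem t).numFaces → E d → ℝ}
    (hW : HasTraces (M.elem t) u (fun l => wD Ω u [l]) W) (i : Fin (M.elem t).numFaces) :
    nrm (surf ((M.elem t).face i)) (ev (jumpProj k (M.Qh (k + 1) u).toWeakFn t i))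
      ≤ nrm (surf ((M.elem t).face i)) (fun x => W i x - ev ((M.Qh (k + 1) u).int t) x) := by
  have hPS := (M.elem t).polyMem_surf i
  have hm := hW.memLp_trace i
  have hae := faceTrace_ae_eq M hd hu hW i
  have hb : l2Proj (surf ((M.elem t).face i)) k (M.faceTrace u (M.faceOf t i))
      = l2Proj (surf ((M.elem t).face i)) k (W i) :=
    l2Proj_congr fun q _ => integral_congr_ae (hae.mono fun x hx => by simp only [hx])
  have e : jumpProj k (M.Qh (k + 1) u).toWeakFn t i = (l2Proj (surf ((M.elem t).face i)) k
      (fun x => W i x - ev ((M.Qh (k + 1) u).int t) x)).1 := by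
    change (l2Proj (surf ((M.elem t).face i)) k (fun x =>
      ev (l2Proj (surf ((M.elem t).face i)) k (M.faceTrace u (M.faceOf t i))).1 x
        - ev ((M.Qh (k + 1) u).int t) x)).1 = _
    rw [hb]
    congr 1
    refine l2Proj_congr fun q hq => ?_
    simp only [sub_mul]
    rw [integral_sub (integrable_mul_of_memLp (hPS _) (hPS q))
      (integrable_mul_of_memLp (hPS _) (hPS q)), l2Proj_spec hPS k hm q hq,
      integral_sub (integrable_mul_of_memLp hm (hPS q))
      (integrable_mul_of_memLp (hPS _) (hPS q))]
  rw [e]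
  exact nrm_l2Proj_le hPS k (hm.sub (hPS _))

/-- The projection approximates `u` and its derivatives on every element. -/
lemma exists_isApprox (d n k : ℕ) (hd : 1 ≤ d) {ρv : ℝ} (hρv : 0 < ρv) (ρe κ δ : ℝ) :
    ∃ K : ℝ, 0 < K ∧ ∀ (Ω : Set (E d)) (M : Mesh d Ω), ShapeRegular M n ρv ρe κ δ →
      ∀ u, MemSobolev Ω (k + 1 + 1) u → ∀ t,
      IsApprox (M.elem t) u (fun l => wD Ω u [l]) (fun l m => wD Ω u [l, m])
        ((M.Qh (k + 1) u).int t) (K * (M.elem t).size ^ k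
          * jetSum (volume.restrict (M.elem t).carrier) (k + 1 + 1) (wD Ω u)) := by
  obtain ⟨K, hK, h⟩ := exists_l2Proj_approx d n (k + 1) hd hρv ρe κ δ
  refine ⟨K, hK, fun Ω M hM u hu t => ?_⟩
  obtain ⟨φ, hφ, hφ'⟩ := exists_smooth_approx_elem M hu t
  have key := h (M.elem t) (hM.regular t) u (wD Ω u) φ (wD_nil_elem M hu t)
    (fun L hL => memLp_wD_elem M hu t hL) hφ hφ'
  have hs := (M.elem t).size_pos hd
  have hS := jetSum_nonneg (volume.restrict (M.elem t).carrier) (k + 1 + 1) (wD Ω u)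
  refine ⟨by positivity, ?_, fun m => ?_, fun l m => ?_⟩
  · have h0 := key [] (by simp)
    have e : nrm (volume.restrict (M.elem t).carrier)
        (fun x => u x - ev ((M.Qh (k + 1) u).int t) x)
        = nrm (volume.restrict (M.elem t).carrier) (fun x => wD Ω u [] x - ev (pderivL []
          (l2Proj (volume.restrict (M.elem t).carrier) (k + 1) u).1) x) :=
      nrm_congr_ae ((wD_nil_elem M hu t).mono fun x hx => by
        simp only [hx]
        rfl)
    rw [e]
    refine h0.trans (le_of_eq ?_)
    simp only [List.length_nil, Nat.sub_zero]
    ring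
  · have h1 := key [m] (by simp)
    refine h1.trans (le_of_eq ?_)
    simp only [List.length_singleton, Nat.add_sub_cancel]
    ring
  · have h2 := key [l, m] (by simp)
    have e : ev (pderivL [l, m] (l2Proj (volume.restrict (M.elem t).carrier) (k + 1) u).1)
        = ev (MvPolynomial.pderiv l (MvPolynomial.pderiv m ((M.Qh (k + 1) u).int t))) := by
      rw [← dL_ev, ← pd_ev, ← pd_ev]
      rfl
    rw [e] at h2
    refine h2.trans (le_of_eq ?_)
    simp only [List.length_cons, List.length_nil, zero_add, Nat.reduceAdd, Nat.add_sub_cancel,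
      Nat.add_assoc]

lemma abs_sum_mul_integral_le {μ : Measure (E d)} {A : Matrix (Fin d) (Fin d) ℝ} {lam B : ℝ}
    (hA : ∀ l m, |A l m| ≤ lam) {R G : Fin d → E d → ℝ} (hR : ∀ m, MemLp (R m) 2 μ)
    (hG : ∀ l, MemLp (G l) 2 μ) (hB : ∀ m, nrm μ (R m) ≤ B) :
    |∑ l, ∑ m, A l m * ∫ x, R m x * G l x ∂μ| ≤ d * (lam * B) * ∑ l, nrm μ (G l) := by
  rw [Finset.mul_sum]
  refine (Finset.abs_sum_le_sum_abs _ _).trans (Finset.sum_le_sum fun l _ => ?_)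
  refine (Finset.abs_sum_le_sum_abs _ _).trans ?_
  have h : ∀ m ∈ Finset.univ, |A l m * ∫ x, R m x * G l x ∂μ| ≤ lam * B * nrm μ (G l) := by
    intro m _
    rw [abs_mul, mul_assoc]
    refine mul_le_mul (hA l m) ((abs_integral_mul_le (hR m) (hG l)).trans
      (mul_le_mul_of_nonneg_right (hB m) (nrm_nonneg _ _))) (abs_nonneg _)
      ((abs_nonneg _).trans (hA l m))
  refine (Finset.sum_le_card_nsmul _ _ _ h).trans (le_of_eq ?_)
  rw [Finset.card_univ, Fintype.card_fin, nsmul_eq_mul]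
  ring

/-- The error functional restricted to one element. -/
noncomputable def elemError (n k : ℕ) {Ω : Set (E d)} (M : Mesh d Ω) (u : E d → ℝ)
    (v : M.Vh (k + 1)) (t : Fin M.numElem) (A : Matrix (Fin d) (Fin d) ℝ)
    (Z : Fin d → Fin (M.elem t).numFaces → E d → ℝ) : ℝ :=
  (∑ l, ∑ m, A l m * ∫ x in (M.elem t).carrier,
      ev (M.weakGradient (k + 1) (n + k) (M.Qh (k + 1) u).toWeakFn t m
        - M.weakGradient (k + 1) (n + k) (M.ofSobolev u) t m) x
      * ev (M.weakGradient (k + 1) (n + k) v.toWeakFn t l) x)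
    + ∑ i, ((∫ x, flux (M.elem t) A
          (fun m _ => ev (M.weakGradient (k + 1) (n + k) (M.ofSobolev u) t m)) i x
          * ev (jumpProj k v.toWeakFn t i) x ∂(surf ((M.elem t).face i)))
        - ∫ x, flux (M.elem t) A Z i x * (ev (v.bdry (M.faceOf t i)) x - ev (v.int t) x)
          ∂(surf ((M.elem t).face i)))

/-- The volume part of the error functional is Cauchy–Schwarz with the bound for the weak gradient
of `Q_h u - u`, the face part is `exists_face_error_le`. The former bound is also recorded
separately because the estimate for `u - u_h` needs it. -/
lemma exists_elemError_le (d n k : ℕ) (hd : 2 ≤ d) {ρv ρe κ δ : ℝ} (hρv : 0 < ρv) (hρe : 0 < ρe)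
    (hκ : 0 < κ) (hδ : 0 < δ) :
    ∃ K : ℝ, 0 < K ∧ ∀ (Ω : Set (E d)) (M : Mesh d Ω), ShapeRegular M n ρv ρe κ δ →
      ∀ u, MemSobolev Ω (k + 1 + 1) u → ∀ t,
      (∀ l, nrm (volume.restrict (M.elem t).carrier)
        (ev (M.weakGradient (k + 1) (n + k) (M.Qh (k + 1) u).toWeakFn t l
          - M.weakGradient (k + 1) (n + k) (M.ofSobolev u) t l))
        ≤ K * ((M.elem t).size ^ (k + 1)
          * jetSum (volume.restrict (M.elem t).carrier) (k + 1 + 1) (wD Ω u))) ∧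
      ∀ (A : Matrix (Fin d) (Fin d) ℝ) (lam : ℝ) (Z : Fin d → Fin (M.elem t).numFaces → E d → ℝ),
        (∀ l m, |A l m| ≤ lam) →
        (∀ m, HasTraces (M.elem t) (wD Ω u [m]) (fun l => wD Ω u [l, m]) (Z m)) →
        ∀ v : M.Vh (k + 1), |elemError n k M u v t A Z|
          ≤ K * lam * ((M.elem t).size ^ (k + 1)
            * jetSum (volume.restrict (M.elem t).carrier) (k + 1 + 1) (wD Ω u))
            * ∑ l, nrm (volume.restrict (M.elem t).carrier)
              (ev (M.weakGradient (k + 1) (n + k) v.toWeakFn t l)) := by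
  obtain ⟨K₀, hK₀, happ⟩ := exists_isApprox d n k (by omega) hρv ρe κ δ
  obtain ⟨K₁, hK₁, htr⟩ := exists_trace_approx d n (by omega) hρv ρe κ δ
  obtain ⟨K₂, hK₂, hproj⟩ := exists_weakGradient_proj_le d n (n + k) (by omega) hρv ρe κ δ
  obtain ⟨K₃, hK₃, hface⟩ := exists_face_error_le d n k hd hρv hρe hκ hδ
  have hdR : (0 : ℝ) < d := by exact_mod_cast (by omega : 0 < d)
  have hC : K₂ * ((1 + K₁) * K₀) ≤ K₂ * ((1 + K₁) * K₀) + d * (K₂ * ((1 + K₁) * K₀))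
      + n * (K₃ * K₀) := by
    have : 0 ≤ d * (K₂ * ((1 + K₁) * K₀)) + n * (K₃ * K₀) := by positivity
    linarith
  -- The summands serve the gradient bound, the volume part of the functional, and at most `n`
  -- faces, in this order.
  refine ⟨K₂ * ((1 + K₁) * K₀) + d * (K₂ * ((1 + K₁) * K₀)) + n * (K₃ * K₀), by positivity,
    fun Ω M hM u hu t => ?_⟩
  have hT := hM.regular t
  have hs := (M.elem t).size_pos (by omega)
  obtain ⟨W, hW⟩ := exists_traces M (by omega) hu t
  have hA := happ Ω M hM u hu t
  obtain ⟨S, hSdef⟩ : ∃ S, S = jetSum (volume.restrict (M.elem t).carrier) (k + 1 + 1) (wD Ω u) :=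
    ⟨_, rfl⟩
  have hS : 0 ≤ S := hSdef ▸ jetSum_nonneg _ _ _
  rw [← hSdef] at hA ⊢
  obtain ⟨Z₀, hZ₀⟩ : ∃ Z : Fin d → Fin (M.elem t).numFaces → E d → ℝ,
      ∀ m, HasTraces (M.elem t) (wD Ω u [m]) (fun l => wD Ω u [l, m]) (Z m) := by
    choose Z hZ using fun m => exists_traces_deriv M (by omega) (by omega) hu t m
    exact ⟨Z, hZ⟩
  set Q := (M.Qh (k + 1) u).int t with hQ
  have hQd : Q.totalDegree ≤ k + 1 := (M.Qh (k + 1) u).int_degree t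
  have hP := isElemGrad_ofSobolev (M := M) hu (k + 1) (n + k) t
  have hGQ : IsElemGrad (M.elem t) (n + k) (fun l => ev (MvPolynomial.pderiv l Q))
      (jumpProj k (M.Qh (k + 1) u).toWeakFn t)
      (M.weakGradient (k + 1) (n + k) (M.Qh (k + 1) u).toWeakFn t) :=
    isElemGrad_weakGradient (isAdmissible_toWeakFn (M.Qh (k + 1) u)) (k + 1) (n + k) t
  have hsz : (M.elem t).size * (K₀ * (M.elem t).size ^ k * S)
      = K₀ * ((M.elem t).size ^ (k + 1) * S) := by ring
  have hB0 : 0 ≤ (M.elem t).size ^ (k + 1) * S := by positivity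
  have hR : ∀ l, nrm (volume.restrict (M.elem t).carrier)
        (ev (M.weakGradient (k + 1) (n + k) (M.Qh (k + 1) u).toWeakFn t l
          - M.weakGradient (k + 1) (n + k) (M.ofSobolev u) t l))
        ≤ K₂ * ((1 + K₁) * K₀) * ((M.elem t).size ^ (k + 1) * S) := by
    intro l
    have h1 := hproj (M.elem t) hT (fun l => wD Ω u [l]) Q
      ((1 + K₁) * (K₀ * ((M.elem t).size ^ (k + 1) * S))) _ _ _ (by positivity)
      (fun l => memLp_wD_elem M hu t (by simp))
      (fun l => (hA.one l).trans (by
        rw [hsz]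
        refine le_mul_of_one_le_left (by positivity) (by linarith)))
      (fun i => ?_) hGQ hP l
    · exact h1.trans (le_of_eq (by ring))
    · have h2 := (htr (M.elem t) hT _ _ _ Q _ W Z₀ hA hW hZ₀).1 i
      rw [hsz] at h2
      have h3 := nrm_jumpProj_Qh_le (by omega) hu t hW i
      calc _ ≤ nrm (surf ((M.elem t).face i)) (fun x => W i x - ev Q x)
              * Real.sqrt (M.elem t).size :=
            mul_le_mul_of_nonneg_right h3 (Real.sqrt_nonneg _)
        _ = Real.sqrt (M.elem t).size
              * nrm (surf ((M.elem t).face i)) (fun x => W i x - ev Q x) := mul_comm _ _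
        _ ≤ K₁ * ((M.elem t).size * (K₀ * ((M.elem t).size ^ (k + 1) * S))) := h2
        _ = (M.elem t).size * (K₁ * (K₀ * ((M.elem t).size ^ (k + 1) * S))) := by ring
        _ ≤ _ := by
          refine mul_le_mul_of_nonneg_left (mul_le_mul_of_nonneg_right (by linarith) ?_) hs.le
          positivity
  refine ⟨fun l => (hR l).trans (mul_le_mul_of_nonneg_right hC hB0), ?_⟩
  intro A lam Z hAl hZ v
  have hG := isElemGrad_weakGradient (isAdmissible_toWeakFn v) (k + 1) (n + k) t
  have hlam : 0 ≤ lam := (abs_nonneg _).trans (hAl ⟨0, by omega⟩ ⟨0, by omega⟩)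
  have hPC := (M.elem t).polyMem_carrier
  have b1 := abs_sum_mul_integral_le hAl (μ := volume.restrict (M.elem t).carrier)
    (G := fun l => ev (M.weakGradient (k + 1) (n + k) v.toWeakFn t l))
    (fun m => hPC _) (fun l => hPC _) hR
  have b2 := hface (M.elem t) hT u _ _ Q _ W Z A lam _ (v.int t)
    (fun i => v.bdry (M.faceOf t i)) _ hA hW hZ hQd hAl hP (v.int_degree t)
    (fun i => v.bdry_degree _) hG
  rw [hsz] at b2
  obtain ⟨N, hN⟩ : ∃ N, N = ∑ l, nrm (volume.restrict (M.elem t).carrier)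
      (ev (M.weakGradient (k + 1) (n + k) v.toWeakFn t l)) := ⟨_, rfl⟩
  have hN0 : 0 ≤ N := hN ▸ Finset.sum_nonneg fun l _ => nrm_nonneg _ _
  rw [← hN] at b1 b2 ⊢
  have b3 := (Finset.abs_sum_le_sum_abs _ _).trans
    (Finset.sum_le_card_nsmul Finset.univ _ _ fun i (_ : i ∈ Finset.univ) => b2 i)
  rw [Finset.card_univ, Fintype.card_fin, nsmul_eq_mul] at b3
  have hnf : ((M.elem t).numFaces : ℝ) ≤ n := by exact_mod_cast hM.numFaces_le t
  have hX : 0 ≤ K₃ * lam * (K₀ * ((M.elem t).size ^ (k + 1) * S)) * N := by positivity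
  have b4 := b3.trans (mul_le_mul_of_nonneg_right hnf hX)
  refine (abs_add_le _ _).trans ((add_le_add b1 b4).trans ?_)
  have hY : 0 ≤ K₂ * ((1 + K₁) * K₀) * lam * ((M.elem t).size ^ (k + 1) * S) * N := by positivity
  obtain ⟨X, hXd⟩ : ∃ X, X = (M.elem t).size ^ (k + 1) * S := ⟨_, rfl⟩
  rw [← hXd] at hY ⊢
  have e : (K₂ * ((1 + K₁) * K₀) + d * (K₂ * ((1 + K₁) * K₀)) + n * (K₃ * K₀)) * lam * X * N
      = K₂ * ((1 + K₁) * K₀) * lam * X * N + (d * (lam * (K₂ * ((1 + K₁) * K₀) * X)) * N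
        + n * (K₃ * lam * (K₀ * X) * N)) := by ring
  rw [e]
  linarith

end LocalError

end WG

namespace WG

open ConvexPolytope

/-! ### The energy norm of the error -/

section GlobalError

variable {d : ℕ} {Ω : Set (E d)} {M : Mesh d Ω} {k n : ℕ} {a : E d → Matrix (Fin d) (Fin d) ℝ}
  {A : Fin M.numElem → Matrix (Fin d) (Fin d) ℝ} {f g u : E d → ℝ} {lam₁ lam₂ : ℝ}

/-- Polarization: the bounds of the quadratic form at the sum and at the difference of two
coordinate vectors are combined using symmetry. -/
lemma IsElliptic.abs_le (ha : IsElliptic Ω lam₁ lam₂ a) (h₁ : 0 ≤ lam₁) {x : E d} (hx : x ∈ Ω)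
    (l m : Fin d) : |a x l m| ≤ lam₂ := by
  obtain ⟨hs, h⟩ := ha x hx
  have hsym : a x m l = a x l m := hs.apply l m
  have hp := h (Pi.single l 1 + Pi.single m 1)
  have hm := h (Pi.single l 1 - Pi.single m 1)
  have hp0 : 0 ≤ (Pi.single l 1 + Pi.single m 1 : Fin d → ℝ) ⬝ᵥ (Pi.single l 1 + Pi.single m 1) :=
    Finset.sum_nonneg fun i _ => mul_self_nonneg _
  have hm0 : 0 ≤ (Pi.single l 1 - Pi.single m 1 : Fin d → ℝ) ⬝ᵥ (Pi.single l 1 - Pi.single m 1) :=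
    Finset.sum_nonneg fun i _ => mul_self_nonneg _
  have hp1 := (mul_nonneg h₁ hp0).trans hp.1
  have hm1 := (mul_nonneg h₁ hm0).trans hm.1
  have hl2 := (h (Pi.single l 1))
  have hlam : 0 ≤ lam₂ := by
    have h3 := (mul_nonneg h₁ (Finset.sum_nonneg fun i _ => mul_self_nonneg _ :
      0 ≤ (Pi.single l 1 : Fin d → ℝ) ⬝ᵥ (Pi.single l 1))).trans (hl2.1.trans hl2.2)
    simpa using h3
  have hp2 := hp.2
  have hm2 := hm.2
  simp only [Matrix.mulVec_add, Matrix.mulVec_sub, Matrix.mulVec_single_one, add_dotProduct,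
    dotProduct_add, sub_dotProduct, dotProduct_sub, single_one_dotProduct, Matrix.col_apply,
    Pi.single_apply, hsym] at hp1 hm1 hp2 hm2
  rw [_root_.abs_le]
  by_cases hlm : l = m
  · subst hlm
    simp only [if_true] at hp1 hm1 hp2 hm2
    constructor <;> linarith
  · simp only [if_true, if_neg hlm, if_neg (Ne.symm hlm)] at hp1 hm1 hp2 hm2
    constructor <;> linarith

lemma form_eq (hA : ∀ t, ∀ x ∈ (M.elem t).carrier, a x = A t) (j : ℕ) (v w : M.WeakFn) :
    M.form a k j v w = ∑ t, ∑ l, ∑ m, A t l m * ∫ x in (M.elem t).carrier,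
      ev (M.weakGradient k j v t m) x * ev (M.weakGradient k j w t l) x :=
  Finset.sum_congr rfl fun t _ =>
    (integral_mulVec_dotProduct (M.elem t).measurableSet_carrier (hA t)
      (g := evVec (M.weakGradient k j v t)) (h := evVec (M.weakGradient k j w t))
      (fun _ => (M.elem t).polyMem_carrier _) (fun _ => (M.elem t).polyMem_carrier _)).2

lemma le_form_self (ha : IsElliptic Ω lam₁ lam₂ a) (hpc : M.IsPiecewiseConstant a) (k j : ℕ)
    (v : M.WeakFn) :
    lam₁ * (∑ t, ∑ l, nrm (volume.restrict (M.elem t).carrier) (ev (M.weakGradient k j v t l)) ^ 2)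
      ≤ M.form a k j v v ∧
    M.form a k j v v ≤ lam₂ *
      ∑ t, ∑ l, nrm (volume.restrict (M.elem t).carrier) (ev (M.weakGradient k j v t l)) ^ 2 := by
  have key : ∀ t, ∑ l, nrm (volume.restrict (M.elem t).carrier)
        (ev (M.weakGradient k j v t l)) ^ 2
      = ∫ x in (M.elem t).carrier, evVec (M.weakGradient k j v t) x
        ⬝ᵥ evVec (M.weakGradient k j v t) x := by
    intro t
    have hPC := (M.elem t).polyMem_carrier
    rw [integral_dotProduct (g := evVec (M.weakGradient k j v t))
      (h := evVec (M.weakGradient k j v t)) (fun _ => hPC _) (fun _ => hPC _)]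
    refine Finset.sum_congr rfl fun l _ => ?_
    rw [nrm_sq (hPC _)]
    simp only [sq]
    rfl
  have hi : ∀ t, Integrable (fun x => evVec (M.weakGradient k j v t) x
      ⬝ᵥ evVec (M.weakGradient k j v t) x) (volume.restrict (M.elem t).carrier) := fun t =>
    integrable_finsetSum _ fun l _ =>
      integrable_mul_of_memLp ((M.elem t).polyMem_carrier _) ((M.elem t).polyMem_carrier _)
  have hi' : ∀ t, Integrable (fun x => (a x).mulVec (evVec (M.weakGradient k j v t) x)
      ⬝ᵥ evVec (M.weakGradient k j v t) x) (volume.restrict (M.elem t).carrier) := fun t => by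
    obtain ⟨A, hA⟩ := hpc t
    exact (integral_mulVec_dotProduct (M.elem t).measurableSet_carrier hA
      (g := evVec (M.weakGradient k j v t)) (h := evVec (M.weakGradient k j v t))
      (fun _ => (M.elem t).polyMem_carrier _) (fun _ => (M.elem t).polyMem_carrier _)).1
  simp only [key]
  rw [Finset.mul_sum, Finset.mul_sum]
  constructor
  · refine Finset.sum_le_sum fun t _ => ?_
    rw [← integral_const_mul]
    refine setIntegral_mono_on ((hi t).const_mul _) (hi' t) (M.elem t).measurableSet_carrier
      fun x hx => ?_
    rw [dotProduct_comm ((a x).mulVec _)]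
    exact ((ha x (M.carrier_subset t hx)).2 _).1
  · refine Finset.sum_le_sum fun t _ => ?_
    rw [← integral_const_mul]
    refine setIntegral_mono_on (hi' t) ((hi t).const_mul _) (M.elem t).measurableSet_carrier
      fun x hx => ?_
    rw [dotProduct_comm ((a x).mulVec _)]
    exact ((ha x (M.carrier_subset t hx)).2 _).2

lemma size_le_meshSize (t : Fin M.numElem) : (M.elem t).size ≤ M.meshSize :=
  le_ciSup (f := fun t => (M.elem t).size) (Set.finite_range _).bddAbove t

lemma sum_setIntegral_elem_le {F : E d → ℝ} (hF : IntegrableOn F Ω) (h0 : ∀ x, 0 ≤ F x) :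
    ∑ t, ∫ x in (M.elem t).carrier, F x ≤ ∫ x in Ω, F x := by
  rw [← integral_iUnion_fintype (fun t => (M.elem t).measurableSet_carrier)
    (fun t t' h => M.disjoint t t' h) (fun t => hF.mono_set (M.carrier_subset t))]
  exact setIntegral_mono_set hF (Filter.Eventually.of_forall h0)
    (Set.iUnion_subset M.carrier_subset).eventuallyLE

/-- There are `d^r` derivatives of order `r`, which is the Cauchy–Schwarz constant for passing from
the sum of norms to the sum of squares; the disjoint elements lie in `Ω`. -/
lemma sum_jetSum_sq_le {r : ℕ} (hu : MemSobolev Ω r u) :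
    ∑ t, jetSum (volume.restrict (M.elem t).carrier) r (wD Ω u) ^ 2
      ≤ (d : ℝ) ^ r * sobolevSeminorm Ω r u ^ 2 := by
  have hm : ∀ s : Fin r → Fin d, MemLp (weakDeriv Ω s u) 2 (volume.restrict Ω) := fun s => by
    rw [← ofFn_eq_wD]
    exact (wD_spec hu (by simp)).1
  have h0 : 0 ≤ ∑ s : Fin r → Fin d, ∫ x in Ω, (weakDeriv Ω s u x) ^ 2 :=
    Finset.sum_nonneg fun s _ => integral_nonneg fun x => sq_nonneg _
  rw [sobolevSeminorm, Real.sq_sqrt h0]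
  have h1 : ∀ t, jetSum (volume.restrict (M.elem t).carrier) r (wD Ω u) ^ 2
      ≤ (d : ℝ) ^ r * ∑ s : Fin r → Fin d, ∫ x in (M.elem t).carrier, (weakDeriv Ω s u x) ^ 2 := by
    intro t
    have h2 := sq_sum_le_card_mul_sum_sq (s := (Finset.univ : Finset (Fin r → Fin d)))
      (f := fun s => nrm (volume.restrict (M.elem t).carrier) (wD Ω u (List.ofFn s)))
    simp only [Finset.card_univ, Fintype.card_fun, Fintype.card_fin, Nat.cast_pow] at h2
    refine h2.trans (le_of_eq ?_)
    congr 1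
    refine Finset.sum_congr rfl fun s _ => ?_
    rw [ofFn_eq_wD, nrm_sq (memLp_elem M (hm s) t)]
  refine (Finset.sum_le_sum fun t _ => h1 t).trans ?_
  rw [← Finset.mul_sum, Finset.sum_comm]
  refine mul_le_mul_of_nonneg_left (Finset.sum_le_sum fun s _ => ?_) (by positivity)
  exact sum_setIntegral_elem_le (hm s).integrable_sq fun x => sq_nonneg _

/-- `P = ∇_w u` is itself a test field for the weak gradient of `v`, which gives `(aP, ∇_w v) =
(a∇u, ∇v_0)` plus the projected face terms; `green_flux` then replaces `(a∇u, ∇v_0)` by `(f, v_0)`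
and the flux against `v_0`. Isolating the flux against `v_b` prepares its cancellation over the
whole partition. -/
lemma elemError_eq (hd : 1 ≤ d) (hu : MemSobolev Ω (k + 1 + 1) u)
    (hf : MemLp f 2 (volume.restrict Ω))
    (hex : ∀ φ : E d → ℝ, IsTest Ω φ →
      ∫ x in Ω, (a x).mulVec (grad Ω u x) ⬝ᵥ (fun l => fderiv ℝ φ x (unitVec l))
        = ∫ x in Ω, f x * φ x)
    (v : M.Vh (k + 1)) (t : Fin M.numElem) {A : Matrix (Fin d) (Fin d) ℝ}
    (hA : ∀ x ∈ (M.elem t).carrier, a x = A)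
    {Z : Fin d → Fin (M.elem t).numFaces → E d → ℝ}
    (hZ : ∀ m, HasTraces (M.elem t) (wD Ω u [m]) (fun l => wD Ω u [l, m]) (Z m)) :
    elemError n k M u v t A Z
      = (∑ l, ∑ m, A l m * ∫ x in (M.elem t).carrier,
          ev (M.weakGradient (k + 1) (n + k) (M.Qh (k + 1) u).toWeakFn t m) x
            * ev (M.weakGradient (k + 1) (n + k) v.toWeakFn t l) x)
        - (∫ x in (M.elem t).carrier, f x * ev (v.int t) x)
        - ∑ i, ∫ x, flux (M.elem t) A Z i x * ev (v.bdry (M.faceOf t i)) x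
          ∂(surf ((M.elem t).face i)) := by
  have hPC := (M.elem t).polyMem_carrier
  have hPS := fun i => (M.elem t).polyMem_surf i
  have hg := green_flux M hd (by omega) hu hf hex t hA hZ (contDiff_ev (v.int t))
  have hP := isElemGrad_ofSobolev (M := M) hu (k + 1) (n + k) t
  have hG := isElemGrad_weakGradient (isAdmissible_toWeakFn v) (k + 1) (n + k) t
  unfold elemError
  set P := M.weakGradient (k + 1) (n + k) (M.ofSobolev u) t with hPdef
  set G := M.weakGradient (k + 1) (n + k) v.toWeakFn t with hGdef
  set GQ := M.weakGradient (k + 1) (n + k) (M.Qh (k + 1) u).toWeakFn t with hGQdef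
  have e1 : ∀ l m, ∫ x in (M.elem t).carrier, ev (GQ m - P m) x * ev (G l) x
      = (∫ x in (M.elem t).carrier, ev (GQ m) x * ev (G l) x)
        - ∫ x in (M.elem t).carrier, ev (P m) x * ev (G l) x := by
    intro l m
    simp only [ev_sub, sub_mul]
    exact integral_sub (integrable_mul_of_memLp (hPC _) (hPC _))
      (integrable_mul_of_memLp (hPC _) (hPC _))
  have e2 : ∀ l m, ∫ x in (M.elem t).carrier, ev (P m) x * ev (G l) x
      = (∫ x in (M.elem t).carrier, wD Ω u [m] x * pd l (ev (v.int t)) x)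
        + ∑ i, (M.elem t).normal i l * ∫ x, ev (P m) x * ev (jumpProj k v.toWeakFn t i) x
          ∂(surf ((M.elem t).face i)) := by
    intro l m
    have h1 := hG.2 l (P m) (hP.1 m)
    have h2 := hP.2 m (MvPolynomial.pderiv l (v.int t))
      (((totalDegree_pderiv_le _ _).trans (Nat.sub_le_sub_right (v.int_degree t) 1)).trans
        (by omega))
    simp only [Pi.zero_apply, ev_zero, zero_mul, integral_zero, mul_zero, Finset.sum_const_zero,
      add_zero] at h2
    simp only [mul_comm (ev (P m) _)]
    rw [h1, pd_ev, ← h2]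
    simp only [mul_comm (ev (P m) _)]
    rfl
  have e3 : ∑ i, ∫ x, flux (M.elem t) A (fun m _ => ev (P m)) i x
        * ev (jumpProj k v.toWeakFn t i) x ∂(surf ((M.elem t).face i))
      = ∑ l, ∑ m, A l m * ∑ i, (M.elem t).normal i l * ∫ x, ev (P m) x
        * ev (jumpProj k v.toWeakFn t i) x ∂(surf ((M.elem t).face i)) := by
    simp only [Finset.mul_sum]
    rw [Finset.sum_congr rfl fun i _ => integral_flux_mul A (fun m => hPS i (P m))
      (hPS i (jumpProj k v.toWeakFn t i)), Finset.sum_comm]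
    exact Finset.sum_congr rfl fun l _ => Finset.sum_comm
  have e4 : ∀ i, ∫ x, flux (M.elem t) A Z i x * (ev (v.bdry (M.faceOf t i)) x - ev (v.int t) x)
        ∂(surf ((M.elem t).face i))
      = (∫ x, flux (M.elem t) A Z i x * ev (v.bdry (M.faceOf t i)) x ∂(surf ((M.elem t).face i)))
        - ∫ x, flux (M.elem t) A Z i x * ev (v.int t) x ∂(surf ((M.elem t).face i)) := by
    intro i
    have hF := memLp_flux A fun m => (hZ m).memLp_trace i
    simp only [mul_sub]
    exact integral_sub (integrable_mul_of_memLp hF (hPS i _))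
      (integrable_mul_of_memLp hF (hPS i _))
  rw [Finset.sum_sub_distrib, e3, Finset.sum_congr rfl fun i _ => e4 i, Finset.sum_sub_distrib,
    ← hg]
  simp only [e1, e2, mul_sub, mul_add, Finset.sum_sub_distrib, Finset.sum_add_distrib]
  ring

/-- The error equation. -/
lemma form_eq_sum_elemError (hd : 1 ≤ d) (hu : MemSobolev Ω (k + 1 + 1) u)
    (hf : MemLp f 2 (volume.restrict Ω)) (hex : M.IsExactSolution a f g u)
    (hA : ∀ t, ∀ x ∈ (M.elem t).carrier, a x = A t)
    {Z : (t : Fin M.numElem) → Fin d → Fin (M.elem t).numFaces → E d → ℝ}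
    (hZ : ∀ t m, HasTraces (M.elem t) (wD Ω u [m]) (fun l => wD Ω u [l, m]) (Z t m))
    {uh : M.Vh (k + 1)} (huh : M.IsWGSolution a f g (n + k) uh) {v : M.Vh (k + 1)}
    (hv : M.MemVh0 v) :
    M.form a (k + 1) (n + k) ((M.Qh (k + 1) u).toWeakFn - uh.toWeakFn) v.toWeakFn
      = ∑ t, elemError n k M u v t (A t) (Z t) := by
  have hsub : M.form a (k + 1) (n + k) ((M.Qh (k + 1) u).toWeakFn - uh.toWeakFn) v.toWeakFn
      = M.form a (k + 1) (n + k) (M.Qh (k + 1) u).toWeakFn v.toWeakFn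
        - M.form a (k + 1) (n + k) uh.toWeakFn v.toWeakFn := by
    simp only [form_eq hA, ← Finset.sum_sub_distrib, ← mul_sub]
    refine Finset.sum_congr rfl fun t _ => Finset.sum_congr rfl fun l _ =>
      Finset.sum_congr rfl fun m _ => ?_
    have hPC := (M.elem t).polyMem_carrier
    rw [weakGradient_sub (isAdmissible_toWeakFn _) (isAdmissible_toWeakFn _)]
    simp only [ev_sub, sub_mul]
    rw [integral_sub (integrable_mul_of_memLp (hPC _) (hPC _))
      (integrable_mul_of_memLp (hPC _) (hPC _))]
  have h0 := sum_flux_eq_zero M (F := fun t => flux (M.elem t) (A t) (Z t))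
    (fun t i => memLp_flux (A t) fun m => (hZ t m).memLp_trace i)
    (fun htt _ _ h => flux_ae_eq M hd (by omega) hu hf hex.2.1 hA hZ htt h) v hv
  rw [hsub, huh.2 v hv, form_eq hA,
    Finset.sum_congr rfl fun t _ => elemError_eq hd hu hf hex.2.1 v t (hA t) (hZ t),
    Finset.sum_sub_distrib, Finset.sum_sub_distrib, h0, sub_zero]

/-- On `∂Ω` the trace of `u` equals `g` almost everywhere, so `l2Proj_congr` yields literally the
same polynomial, and the difference vanishes at every point of the face. -/
lemma memVh0_diff (hd : 1 ≤ d) (hu : MemSobolev Ω (k + 1 + 1) u)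
    (hex : M.IsExactSolution a f g u) {j : ℕ} {uh : M.Vh (k + 1)}
    (huh : M.IsWGSolution a f g j uh) : M.MemVh0 (Vh.diff (M.Qh (k + 1) u) uh) := by
  rintro ⟨e, t, i, rfl⟩ he x hx
  obtain ⟨W, hW⟩ := exists_traces M hd hu t
  have h1 : M.faceTrace u (M.faceOf t i) =ᵐ[surf ((M.elem t).face i)] g :=
    (faceTrace_ae_eq M hd hu hW i).trans (hW.ae_eq_of_isTrace hd (hex.2.2 t i he))
  have h2 : l2Proj (surf ((M.elem t).face i)) (k + 1 - 1) (M.faceTrace u (M.faceOf t i))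
      = l2Proj (surf ((M.elem t).face i)) (k + 1 - 1) g :=
    l2Proj_congr fun q _ => integral_congr_ae (h1.mono fun x hx => by simp only [hx])
  change ev ((l2Proj (surf ((M.elem t).face i)) (k + 1 - 1) (M.faceTrace u (M.faceOf t i))).1
    - uh.bdry ⟨_, t, i, rfl⟩) x = 0
  rw [ev_sub, huh.1 _ he x hx, h2, sub_self]

end GlobalError

end WG

namespace WG

open ConvexPolytope

/-! ### The error estimates -/

section ErrorEstimate

variable {d : ℕ}

lemma sum_mul_le_sqrt_mul_sqrt_of_sq_le {ι : Type*} (s : Finset ι) {x y : ι → ℝ} {X Y : ℝ}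
    (hX : 0 ≤ X) (hY : 0 ≤ Y) (hx : ∑ i ∈ s, x i ^ 2 ≤ X ^ 2) (hy : ∑ i ∈ s, y i ^ 2 ≤ Y ^ 2) :
    ∑ i ∈ s, x i * y i ≤ X * Y := by
  refine (Real.sum_mul_le_sqrt_mul_sqrt s x y).trans ?_
  refine mul_le_mul ((Real.sqrt_le_sqrt hx).trans_eq (Real.sqrt_sq hX))
    ((Real.sqrt_le_sqrt hy).trans_eq (Real.sqrt_sq hY)) (Real.sqrt_nonneg _) hX

/-- The error equation is tested with `v = Q_h u - u_h`, so that its left side is the squared energy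
norm; the element estimates are summed by Cauchy–Schwarz over the elements. -/
theorem exists_energy_error_le (d n k : ℕ) (hd : 2 ≤ d) {ρv ρe κ δ lam₁ lam₂ : ℝ} (hρv : 0 < ρv)
    (hρe : 0 < ρe) (hκ : 0 < κ) (hδ : 0 < δ) (hlam₁ : 0 < lam₁) (hlam₂ : 0 < lam₂) :
    ∃ C : ℝ, 0 < C ∧ ∀ (Ω : Set (E d)) (M : Mesh d Ω), ShapeRegular M n ρv ρe κ δ →
      ∀ a : E d → Matrix (Fin d) (Fin d) ℝ, IsElliptic Ω lam₁ lam₂ a → M.IsPiecewiseConstant a →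
      ∀ f g u : E d → ℝ, MemLp f 2 (volume.restrict Ω) → M.IsExactSolution a f g u →
        MemSobolev Ω (k + 1 + 1) u →
      ∀ uh : M.Vh (k + 1), M.IsWGSolution a f g (n + k) uh →
        M.energyNorm a (k + 1) (n + k) (M.ofSobolev u - uh.toWeakFn)
            ≤ C * M.meshSize ^ (k + 1) * sobolevSeminorm Ω (k + 1 + 1) u ∧
        M.energyNorm a (k + 1) (n + k) ((M.Qh (k + 1) u).toWeakFn - uh.toWeakFn)
            ≤ C * M.meshSize ^ (k + 1) * sobolevSeminorm Ω (k + 1 + 1) u := by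
  obtain ⟨K, hK, hloc⟩ := exists_elemError_le d n k hd hρv hρe hκ hδ
  have hdR : (0 : ℝ) < d := by exact_mod_cast (by omega : 0 < d)
  obtain ⟨c, hc⟩ : ∃ c : ℝ, c = Real.sqrt ((d : ℝ) ^ (k + 1 + 1)) := ⟨_, rfl⟩
  obtain ⟨b, hb⟩ : ∃ b : ℝ, b = Real.sqrt (d / lam₁) := ⟨_, rfl⟩
  have hc0 : 0 < c := hc ▸ Real.sqrt_pos.2 (by positivity)
  have hb0 : 0 < b := hb ▸ Real.sqrt_pos.2 (by positivity)
  have hc2 : (d : ℝ) ^ (k + 1 + 1) = c ^ 2 := by rw [hc, Real.sq_sqrt (by positivity)]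
  have hb2 : (d : ℝ) / lam₁ = b ^ 2 := by rw [hb, Real.sq_sqrt (by positivity)]
  -- `K lam₂` comes from the element estimate, `c` from comparing jets with the Sobolev seminorm,
  -- `b` from comparing the sum of the component norms with the energy norm. `C₂` collects the
  -- parallelogram factor `2`, the upper bound `lam₂` of the form, and the two parts of `∇_w (u -
  -- u_h)`.
  set C₁ := K * lam₂ * c * b with hC₁
  set C₂ := Real.sqrt (2 * lam₂ * (C₁ ^ 2 / lam₁ + d * (K * c) ^ 2)) with hC₂
  have hC₁0 : 0 < C₁ := by positivity
  have hC₂0 : 0 < C₂ := Real.sqrt_pos.2 (by positivity)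
  refine ⟨C₁ + C₂, by positivity, ?_⟩
  intro Ω M hM a ha hpc f g u hf hex hu uh huh
  choose A hA using hpc
  have hpc : M.IsPiecewiseConstant a := fun t => ⟨A t, hA t⟩
  choose Z hZ using fun t m => exists_traces_deriv M (by omega) (by omega) hu t m
  have hAl : ∀ t l m, |A t l m| ≤ lam₂ := fun t l m => by
    obtain ⟨x, hx⟩ := (M.elem t).carrier_nonempty
    rw [← hA t x hx]
    exact ha.abs_le hlam₁.le (M.carrier_subset t hx) l m
  set v := Vh.diff (M.Qh (k + 1) u) uh with hv
  have hvw : (M.Qh (k + 1) u).toWeakFn - uh.toWeakFn = v.toWeakFn := (toWeakFn_diff _ _).symm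
  have herr := form_eq_sum_elemError (by omega) hu hf hex hA hZ huh (memVh0_diff (by omega) hu hex huh)
  rw [← hv, hvw] at herr
  set μ : Fin M.numElem → Measure (E d) := fun t => volume.restrict (M.elem t).carrier with hμ
  set G := fun t => M.weakGradient (k + 1) (n + k) v.toWeakFn t with hG
  set R : Fin M.numElem → Fin d → Poly d := fun t l =>
    M.weakGradient (k + 1) (n + k) (M.Qh (k + 1) u).toWeakFn t l
      - M.weakGradient (k + 1) (n + k) (M.ofSobolev u) t l with hR
  obtain ⟨U, hU⟩ : ∃ U, U = sobolevSeminorm Ω (k + 1 + 1) u := ⟨_, rfl⟩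
  have hU0 : 0 ≤ U := hU ▸ Real.sqrt_nonneg _
  obtain ⟨h, hh⟩ : ∃ h, h = M.meshSize := ⟨_, rfl⟩
  have hh0 : 0 ≤ h := hh ▸ Real.iSup_nonneg fun t => Metric.diam_nonneg
  obtain ⟨S, hS⟩ : ∃ S : Fin M.numElem → ℝ, ∀ t, S t
    = jetSum (volume.restrict (M.elem t).carrier) (k + 1 + 1) (wD Ω u) := ⟨_, fun _ => rfl⟩
  have hS0 : ∀ t, 0 ≤ S t := fun t => hS t ▸ jetSum_nonneg _ _ _
  have hSsum : ∑ t, S t ^ 2 ≤ (c * U) ^ 2 := by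
    have h1 := sum_jetSum_sq_le (M := M) hu
    simp only [← hS, hc2, ← hU] at h1
    rwa [mul_pow]
  have hpow : ∀ t, (M.elem t).size ^ (k + 1) * S t ≤ h ^ (k + 1) * S t := fun t =>
    mul_le_mul_of_nonneg_right (pow_le_pow_left₀ Metric.diam_nonneg (hh ▸ size_le_meshSize t) _)
      (hS0 t)
  obtain ⟨F, hF⟩ : ∃ F, F = M.form a (k + 1) (n + k) v.toWeakFn v.toWeakFn := ⟨_, rfl⟩
  obtain ⟨N, hN⟩ : ∃ N : Fin M.numElem → ℝ, ∀ t, N t = ∑ l, nrm (μ t) (ev (G t l)) :=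
    ⟨_, fun _ => rfl⟩
  have hN0 : ∀ t, 0 ≤ N t := fun t => hN t ▸ Finset.sum_nonneg fun l _ => nrm_nonneg _ _
  have hlow := (le_form_self ha hpc (k + 1) (n + k) v.toWeakFn).1
  obtain ⟨D, hD⟩ : ∃ D, D = ∑ t, ∑ l, nrm (μ t) (ev (G t l)) ^ 2 := ⟨_, rfl⟩
  have hD0 : 0 ≤ D := hD ▸ Finset.sum_nonneg fun t _ => Finset.sum_nonneg fun l _ => sq_nonneg _
  have hlow' : lam₁ * D ≤ F := by rw [hD, hF]; exact hlow
  have hF0 : 0 ≤ F := (mul_nonneg hlam₁.le hD0).trans hlow'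
  have hNsum : ∑ t, N t ^ 2 ≤ (b * Real.sqrt F) ^ 2 := by
    have h1 : ∑ t, N t ^ 2 ≤ d * D := by
      rw [hD, Finset.mul_sum]
      refine Finset.sum_le_sum fun t _ => ?_
      have h2 := sq_sum_le_card_mul_sum_sq (s := (Finset.univ : Finset (Fin d)))
        (f := fun l => nrm (μ t) (ev (G t l)))
      rw [Finset.card_univ, Fintype.card_fin] at h2
      rwa [hN]
    rw [mul_pow, Real.sq_sqrt hF0, ← hb2]
    refine h1.trans ?_
    rw [div_mul_eq_mul_div, le_div_iff₀ hlam₁, mul_assoc, mul_comm D]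
    exact mul_le_mul_of_nonneg_left hlow' hdR.le
  have hest : ∀ t, elemError n k M u v t (A t) (Z t) ≤ K * lam₂ * h ^ (k + 1) * (S t * N t) := by
    intro t
    have h1 := (le_abs_self _).trans ((hloc Ω M hM u hu t).2 (A t) lam₂ (Z t) (hAl t) (hZ t) v)
    rw [← hS] at h1
    have h2 : elemError n k M u v t (A t) (Z t)
        ≤ K * lam₂ * ((M.elem t).size ^ (k + 1) * S t) * N t := by rw [hN]; exact h1
    refine h2.trans ?_
    calc _ ≤ K * lam₂ * (h ^ (k + 1) * S t) * N t :=
          mul_le_mul_of_nonneg_right (mul_le_mul_of_nonneg_left (hpow t) (by positivity)) (hN0 t)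
      _ = _ := by ring
  -- `F` is bounded by a multiple of its own square root, one factor of which cancels.
  have hFle : Real.sqrt F ≤ C₁ * h ^ (k + 1) * U := by
    have h1 : F ≤ K * lam₂ * h ^ (k + 1) * ((c * U) * (b * Real.sqrt F)) := by
      refine (hF.trans herr).le.trans ((Finset.sum_le_sum fun t _ => hest t).trans ?_)
      rw [← Finset.mul_sum]
      exact mul_le_mul_of_nonneg_left (sum_mul_le_sqrt_mul_sqrt_of_sq_le _ (by positivity)
        (by positivity) hSsum hNsum) (by positivity)
    refine le_of_sq_le_mul (Real.sqrt_nonneg _) (by positivity) ?_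
    rw [Real.sq_sqrt hF0]
    exact h1.trans (le_of_eq (by rw [hC₁]; ring))
  have hRle : ∀ t l, nrm (μ t) (ev (R t l)) ≤ K * (h ^ (k + 1) * S t) := by
    intro t l
    have h1 := (hloc Ω M hM u hu t).1 l
    rw [← hS] at h1
    exact h1.trans (mul_le_mul_of_nonneg_left (hpow t) hK.le)
  have hRsum : ∑ t, ∑ l, nrm (μ t) (ev (R t l)) ^ 2 ≤ d * (K * c) ^ 2 * (h ^ (k + 1) * U) ^ 2 := by
    have h1 : ∀ t, ∑ l, nrm (μ t) (ev (R t l)) ^ 2 ≤ d * (K * h ^ (k + 1)) ^ 2 * S t ^ 2 := by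
      intro t
      have h2 := Finset.sum_le_card_nsmul Finset.univ _ _ fun l (_ : l ∈ Finset.univ) =>
        pow_le_pow_left₀ (nrm_nonneg _ _) (hRle t l) 2
      rw [Finset.card_univ, Fintype.card_fin, nsmul_eq_mul] at h2
      exact h2.trans (le_of_eq (by ring))
    refine (Finset.sum_le_sum fun t _ => h1 t).trans ?_
    rw [← Finset.mul_sum]
    refine (mul_le_mul_of_nonneg_left hSsum (by positivity)).trans (le_of_eq (by ring))
  -- Passing through `Q_h u` splits the weak gradient of `u - u_h` into that of `Q_h u - u_h` and
  -- the already estimated projection error.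
  have hGe : ∀ t l, M.weakGradient (k + 1) (n + k) (M.ofSobolev u - uh.toWeakFn) t l
      = G t l - R t l := by
    intro t l
    simp only [hG, hR, ← hvw]
    rw [weakGradient_sub (isAdmissible_ofSobolev hu) (isAdmissible_toWeakFn uh),
      weakGradient_sub (isAdmissible_toWeakFn _) (isAdmissible_toWeakFn uh)]
    ring
  have hle : C₁ * h ^ (k + 1) * U ≤ (C₁ + C₂) * h ^ (k + 1) * U := by
    have : 0 ≤ C₂ * h ^ (k + 1) * U := by positivity
    linarith [add_mul C₁ C₂ (h ^ (k + 1)), add_mul (C₁ * h ^ (k + 1)) (C₂ * h ^ (k + 1)) U]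
  have hle' : C₂ * h ^ (k + 1) * U ≤ (C₁ + C₂) * h ^ (k + 1) * U := by
    have : 0 ≤ C₁ * h ^ (k + 1) * U := by positivity
    linarith [add_mul C₁ C₂ (h ^ (k + 1)), add_mul (C₁ * h ^ (k + 1)) (C₂ * h ^ (k + 1)) U]
  rw [← hU, ← hh]
  refine ⟨le_trans ?_ hle', ?_⟩
  · have hup := (le_form_self ha hpc (k + 1) (n + k) (M.ofSobolev u - uh.toWeakFn)).2
    refine Real.sqrt_le_iff.2 ⟨by positivity, hup.trans ?_⟩
    simp only [hGe]
    have h1 : ∀ t l, nrm (μ t) (ev (G t l - R t l)) ^ 2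
        ≤ 2 * nrm (μ t) (ev (G t l)) ^ 2 + 2 * nrm (μ t) (ev (R t l)) ^ 2 := by
      intro t l
      have h2 := nrm_sub_le ((M.elem t).polyMem_carrier (G t l)) ((M.elem t).polyMem_carrier (R t l))
      simp only [← ev_sub] at h2
      have h3 := pow_le_pow_left₀ (nrm_nonneg _ _) h2 2
      refine h3.trans ?_
      have := sq_nonneg (nrm (μ t) (ev (G t l)) - nrm (μ t) (ev (R t l)))
      rw [add_sq]
      rw [sub_sq] at this
      simp only [hμ] at this ⊢
      linarith
    have h2 : ∑ t, ∑ l, nrm (μ t) (ev (G t l - R t l)) ^ 2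
        ≤ 2 * D + 2 * ∑ t, ∑ l, nrm (μ t) (ev (R t l)) ^ 2 := by
      refine (Finset.sum_le_sum fun t _ => Finset.sum_le_sum fun l _ => h1 t l).trans (le_of_eq ?_)
      rw [hD]
      simp only [Finset.sum_add_distrib, Finset.mul_sum]
    have h3 : D ≤ C₁ ^ 2 / lam₁ * (h ^ (k + 1) * U) ^ 2 := by
      have h4 := pow_le_pow_left₀ (Real.sqrt_nonneg _) hFle 2
      rw [Real.sq_sqrt hF0] at h4
      rw [div_mul_eq_mul_div, le_div_iff₀ hlam₁, mul_comm D]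
      exact (hlow'.trans h4).trans (le_of_eq (by ring))
    have h5 : (C₂ * h ^ (k + 1) * U) ^ 2
        = lam₂ * (2 * (C₁ ^ 2 / lam₁ * (h ^ (k + 1) * U) ^ 2)
          + 2 * (d * (K * c) ^ 2 * (h ^ (k + 1) * U) ^ 2)) := by
      rw [mul_assoc, mul_pow, hC₂, Real.sq_sqrt (by positivity)]
      ring
    rw [h5]
    exact mul_le_mul_of_nonneg_left (h2.trans (by linarith)) hlam₂.le
  · rw [hvw, Mesh.energyNorm, ← hF]
    exact hFle.trans hle

end ErrorEstimate

end WG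

theorem mainTheorem1 (d k n : ℕ) (hd : 2 ≤ d) (hk : 1 ≤ k)
    (ρv ρe κ δ lam₁ lam₂ : ℝ) (hρv : 0 < ρv) (hρe : 0 < ρe) (hκ : 0 < κ) (hδ : 0 < δ)
    (hlam₁ : 0 < lam₁) (hlam₂ : 0 < lam₂) :
    ∃ C : ℝ, 0 < C ∧
      ∀ (Ω : Set (WG.E d)) (M : WG.Mesh d Ω), WG.ShapeRegular M n ρv ρe κ δ →
      ∀ a : WG.E d → Matrix (Fin d) (Fin d) ℝ,
        WG.IsElliptic Ω lam₁ lam₂ a → M.IsPiecewiseConstant a →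
      ∀ f g u : WG.E d → ℝ, MemLp f 2 (volume.restrict Ω) →
        M.IsExactSolution a f g u → WG.MemSobolev Ω (k + 1) u →
      ∀ uh : M.Vh k, M.IsWGSolution a f g (n + k - 1) uh →
        M.energyNorm a k (n + k - 1) (M.ofSobolev u - uh.toWeakFn)
            ≤ C * M.meshSize ^ k * WG.sobolevSeminorm Ω (k + 1) u ∧
        M.energyNorm a k (n + k - 1) ((M.Qh k u).toWeakFn - uh.toWeakFn)
            ≤ C * M.meshSize ^ k * WG.sobolevSeminorm Ω (k + 1) u := by
  -- Writing `k = k' + 1` turns the truncated differences `n + k - 1` and `k - 1` into `n + k'` and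
  -- `k'`.
  obtain ⟨k, rfl⟩ : ∃ k', k = k' + 1 := ⟨k - 1, by omega⟩
  exact WG.exists_energy_error_le d n k hd hρv hρe hκ hδ hlam₁ hlam₂
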